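/- Let $\mathbb F$ be a field of characteristic $0$ and let $V=V_{\bar0}\oplus V_{\bar1}$ be a vector superspace over $\mathbb F$ with an even endomorphism $\partial$, i.e. an $\mathbb F[\partial]$-module that is the direct sum of two submodules. Let $\Pi V$ be $V$ with reversed parity $\bar p=1-p$, and let $\mathcal O_n=\mathbb F[(z_i-z_j)^{\pm1}]_{1\le i<j\le n}$ (so $\mathcal O_0=\mathcal O_1=\mathbb F$). **Notation.** Let $\widetilde P(n)=\widetilde{\mathcal P}^{\mathrm{ch}}(\Pi V)(n)$ be the space of linear maps $f_{\lambda_1,\dots,\lambda_n}:(\Pi V)^{\otimes n}\otimes\mathcal O_n\to\Pi V[\lambda_1,\dots,\lambda_n]$ with $$f(\partial_iv\otimes p)+\lambda_if(v\otimes p)=f\Big(v\otimes\tfrac{\partial p}{\partial z_i}\Big),\qquad f(v\otimes(z_i-z_j)p)=\Big(\tfrac{\partial}{\partial\lambda_j}-\tfrac{\partial}{\partial\lambda_i}\Big)f(v\otimes p),$$ where $\partial_i$ is $\partial$ applied to the $i$-th factor, and let $P(n)=\mathcal P^{\mathrm{ch}}(\Pi V)(n)$ be the space of linear maps with values in $\Pi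 V[\lambda_1,\dots,\lambda_n]/\langle\partial+\lambda_1+\dots+\lambda_n\rangle$ that satisfy the same conditions. Let $\partial$ act on $\widetilde P(n)$ as multiplication by $\partial+\lambda_1+\dots+\lambda_n$, and let $S_n$ act on the right on both spaces by permuting simultaneously the vectors (with the Koszul sign for $\bar p$), the $\lambda_i$ and the $z_i$. Put $\widetilde W_n=\widetilde P(n+1)^{S_{n+1}}$, $W_n=P(n+1)^{S_{n+1}}$, $\widetilde W=\bigoplus_{n\ge-1}\widetilde W_n$, $W=\bigoplus_{n\ge-1}W_n$, graded also by the parity $p$ of maps with respect to $\bar p$. For $f$ of arity $n+1$ and $g$ of arity $m$ in $\widetilde P$, the product $f\circ_\lambda g$ in the first position is defined, for $p=q(z_1,\dots,z_m)\,h(z_1,\dots,z_{m+n})$ with $q\in\mathcal O_m$ and $h\in\mathcal O_{m+n}$ without poles at $z_k=z_l$ for $k,l\le m$, by $$(f\circ_\lambda g)_{\mu_1,\dots,\mu_{m+n}}(v_1\otimes\dots\otimes v_{m+n}\otimes p)=f_{\lambda+\mu_1+\dots+\mu_m,\mu_{m+1},\dots,\mu_{m+n}}\big(g_{\mu_1-\partial_{z_1},\dots,\mu_m-\partial_{z_m}}(v_1\otimes\dots\otimes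 v_m\otimes q)_\to\otimes v_{m+1}\otimes\dots\otimes v_{m+n}\otimes h|_{z_1=\dots=z_m=Z}\big),$$ where the $\partial_{z_i}$ are applied to $h$ before the substitution and the slots of $f$ carry the variables $Z,z_{m+1},\dots,z_{m+n}$. The right-hand side is a polynomial in $\lambda$ for each fixed argument; substituting $\lambda=-\partial$, with $\partial$ acting on the left as $\partial+\mu_1+\dots+\mu_{m+n}$, gives $f\circ_{-\partial}g$. The formula with $\lambda=0$ also defines $f\circ_1g\in P(m+n)$ for $f\in P(n+1)$, $g\in P(m)$, and, with any representatives of the values in the quotients, $f\circ_{-\partial}g\in\widetilde P(m+n)$ for $f\in P(n+1)$, $g\in\widetilde P(m)$ and $f\circ_0g\in\widetilde P(m+n)$ for $f\in\widetilde P(n+1)$, $g\in P(m)$. Put $$f\Box g=\sum_\sigma(f\circ_1g)^{\sigma^{-1}},\qquad f\Box_0g=\sum_\sigma(f\circ_{-\partial}g)^{\sigma^{-1}},\qquad f\Box_{-\partial}g=\sum_\sigma(f\circ_0g)^{\sigma^{-1}},$$ the sums over the $(m,n)$-shuffles, and let these products be $0$ if $f$ has arity $0$. **Proposition.** (a) Composition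 with the quotient map $\Pi V[\lambda_1,\dots,\lambda_n]\to\Pi V[\lambda_1,\dots,\lambda_n]/\langle\partial+\lambda_1+\dots+\lambda_n\rangle$ induces an injective map $\widetilde P(n)/\partial\widetilde P(n)\to P(n)$ for every $n\ge0$. It is bijective for $n=0$ and, for $n\ge1$, surjective if $V$ is a free $\mathbb F[\partial]$-module. (b) $W$ is a Lie superalgebra with the bracket $[f,g]=f\Box g-(-1)^{p(f)p(g)}g\Box f$, and $\widetilde W/\partial\widetilde W$ is a Lie superalgebra with the bracket induced by $[f_\lambda g]|_{\lambda=0}=f\Box_0g-(-1)^{p(f)p(g)}g\Box_{-\partial}f$. The map in (a) induces a parity and degree preserving injective Lie superalgebra homomorphism $\varphi:\widetilde W/\partial\widetilde W\to W$. It is injective in every degree, bijective in degree $-1$ and, in degrees $n\ge0$, surjective if $V$ is a free $\mathbb F[\partial]$-module. (c) The formula $\rho(f)g=f\Box_0g-(-1)^{p(f)p(g)}g\Box_{-\partial}f$, for homogeneous $f\in W$, $g\in\widetilde W$, defines a representation $\rho$ of the $\mathbb Z_{\ge-1}$-graded Lie superalgebra $W$ on the graded superspace $\widetilde W$. It is compatible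 with $\varphi$: for $f,g\in\widetilde W$ one has $\rho(\varphi(\bar f))g=[f_\lambda g]|_{\lambda=0}$, and for $x\in W$, $g\in\widetilde W$ one has $\varphi(\overline{\rho(x)g})=[x,\varphi(\bar g)]$, where the bar denotes the class modulo $\partial\widetilde W$. In particular, if $X\in W_1$ is odd and $X\Box X=0$, then $\rho(X)^2=0$, so that $(\widetilde W,\rho(X))$ is a complex. -/

import Mathlib

open scoped Polynomial TensorProduct DirectSum

noncomputable section

namespace Chiral

universe u v w

/-! ### Functions on configuration spaces -/

section Functions

variable (F : Type u) [Field F] {ι κ : Type*}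

/-- The multiplicative set of polynomials in the variables `z_i` generated by the differences
`z_i - z_j` for the edges `i j` of the graph `G`. -/
def diffs (G : SimpleGraph ι) : Submonoid (MvPolynomial ι F) :=
  Submonoid.closure {x | ∃ i j, G.Adj i j ∧ x = MvPolynomial.X i - MvPolynomial.X j}

/-- Polynomials in the variables `z_i`, localized on the diagonals `z_i = z_j` for the edges `i j`
of `G` (and nowhere else). -/
abbrev Conf (G : SimpleGraph ι) : Type _ := Localization (diffs F G)

variable {F}

/-- The coordinate function `z_i`. -/
def coord (G : SimpleGraph ι) (i : ι) : Conf F G :=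
  algebraMap (MvPolynomial ι F) (Conf F G) (MvPolynomial.X i)

theorem isUnit_aeval {G : SimpleGraph ι} {B : Type*} [CommRing B] [Algebra F B] (b : ι → B)
    (hb : ∀ i j, G.Adj i j → IsUnit (b i - b j)) (y : diffs F G) :
    IsUnit (MvPolynomial.aeval (R := F) b (y : MvPolynomial ι F)) := by
  have h : diffs F G ≤ (IsUnit.submonoid B).comap (MvPolynomial.aeval (R := F) b) := by
    refine Submonoid.closure_le.2 ?_
    rintro _ ⟨i, j, hij, rfl⟩
    simpa [IsUnit.mem_submonoid_iff] using hb i j hij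
  exact h y.2

/-- Evaluation of a function at the point with coordinates `b i` in an `F`-algebra. -/
def evalAt {G : SimpleGraph ι} {B : Type*} [CommRing B] [Algebra F B] (b : ι → B)
    (hb : ∀ i j, G.Adj i j → IsUnit (b i - b j)) : Conf F G →ₐ[F] B :=
  IsLocalization.liftAlgHom (M := diffs F G) (f := MvPolynomial.aeval (R := F) b)
    (isUnit_aeval b hb)

@[simp] theorem evalAt_coord {G : SimpleGraph ι} {B : Type*} [CommRing B] [Algebra F B] (b : ι → B)
    (hb : ∀ i j, G.Adj i j → IsUnit (b i - b j)) (i : ι) :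
    evalAt (F := F) b hb (coord G i) = b i := by
  simp [evalAt, coord]

theorem isUnit_coord_sub (G : SimpleGraph ι) (i j : ι) (h : G.Adj i j) :
    IsUnit (coord (F := F) G i - coord G j) := by
  have := IsLocalization.map_units (Conf F G)
    (⟨_, Submonoid.subset_closure ⟨i, j, h, rfl⟩⟩ : diffs F G)
  simpa [coord] using this

theorem conf_hom_ext {G : SimpleGraph ι} {B : Type*} [CommRing B] [Algebra F B]
    {p q : Conf F G →ₐ[F] B} (h : ∀ i, p (coord G i) = q (coord G i)) : p = q := by
  refine IsLocalization.algHom_ext (diffs F G) ?_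
  refine MvPolynomial.algHom_ext fun i => ?_
  exact h i

/-- The substitution `z_i ↦ z_{φ i}` along a graph homomorphism `φ`. -/
def substZ {G : SimpleGraph ι} {H : SimpleGraph κ} (φ : G →g H) : Conf F G →ₐ[F] Conf F H :=
  evalAt (fun i => coord H (φ i)) fun _ _ h => isUnit_coord_sub H _ _ (φ.map_adj h)

open Classical in
/-- `p(z) ↦ p(z_1, …, z_i + ε, …)` with `ε ^ 2 = 0`. -/
def shiftZ (G : SimpleGraph ι) (i : ι) : Conf F G →ₐ[F] DualNumber (Conf F G) :=
  evalAt (B := DualNumber (Conf F G)) (fun j => TrivSqZeroExt.inl (coord G j) +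
      TrivSqZeroExt.inr (if j = i then (1 : Conf F G) else 0))
    fun j k h => by
      rw [TrivSqZeroExt.isUnit_iff_isUnit_fst]
      have h1 : ∀ c : Conf F G, ∀ l, TrivSqZeroExt.fst
          ((TrivSqZeroExt.inl c + TrivSqZeroExt.inr (if l = i then (1 : Conf F G) else 0) :
            DualNumber (Conf F G))) = c := fun c l => by
        rw [TrivSqZeroExt.fst_add, TrivSqZeroExt.fst_inl, TrivSqZeroExt.fst_inr, add_zero]
      rw [TrivSqZeroExt.fst_sub, h1, h1]
      exact isUnit_coord_sub (F := F) G j k h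

theorem fst_shiftZ (G : SimpleGraph ι) (i : ι) (p : Conf F G) : (shiftZ G i p).fst = p := by
  have : (TrivSqZeroExt.fstHom F (Conf F G) (Conf F G)).comp (shiftZ G i) = AlgHom.id F _ :=
    conf_hom_ext fun j => by by_cases h : j = i <;> simp [shiftZ, h]
  exact DFunLike.congr_fun this p

/-- The partial derivative `∂/∂z_i`: the coefficient of `ε` in `p(z_1, …, z_i + ε, …)`. -/
def derivZ (G : SimpleGraph ι) (i : ι) : Derivation F (Conf F G) (Conf F G) :=
  Derivation.mk' ((TrivSqZeroExt.sndHom (Conf F G) (Conf F G)).restrictScalars F ∘ₗ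
    (shiftZ G i).toLinearMap) fun a b => by
      simp [fst_shiftZ, mul_comm]

variable (F) in
/-- The algebra of translation invariant functions, generated by all the `z_i - z_j` and by the
`(z_i - z_j)⁻¹` for the edges `i j` of `G`. -/
def TInv (G : SimpleGraph ι) : Subalgebra F (Conf F G) :=
  Algebra.adjoin F {x | (∃ i j, x = coord G i - coord G j) ∨
    ∃ i j, G.Adj i j ∧ x * (coord G i - coord G j) = 1}

/-- `z_i - z_j` as a translation invariant function. -/
def zsub (G : SimpleGraph ι) (i j : ι) : TInv F G :=
  ⟨coord G i - coord G j, Algebra.subset_adjoin (Or.inl ⟨i, j, rfl⟩)⟩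

theorem substZ_mem {G : SimpleGraph ι} {H : SimpleGraph κ} (φ : G →g H) (p : TInv F G) :
    substZ φ (p : Conf F G) ∈ TInv F H := by
  have h : TInv F G ≤ (TInv F H).comap (substZ φ) := by
    refine Algebra.adjoin_le ?_
    rintro x (⟨i, j, rfl⟩ | ⟨i, j, hij, hx⟩)
    · exact Algebra.subset_adjoin (Or.inl ⟨φ i, φ j, by simp [substZ]⟩)
    · refine Algebra.subset_adjoin (Or.inr ⟨φ i, φ j, φ.map_adj hij, ?_⟩)
      have := congrArg (substZ φ) hx
      simpa [substZ] using this
  exact h p.2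

/-- `substZ` on translation invariant functions. -/
def substT {G : SimpleGraph ι} {H : SimpleGraph κ} (φ : G →g H) : TInv F G →ₐ[F] TInv F H :=
  ((substZ φ).comp (TInv F G).val).codRestrict _ (substZ_mem φ)

theorem derivZ_coord_sub (G : SimpleGraph ι) (k i j : ι) :
    derivZ (F := F) G k (coord G i - coord G j) ∈ TInv F G := by
  classical
  have : derivZ (F := F) G k (coord G i - coord G j)
      = (if i = k then 1 else 0) - (if j = k then 1 else 0) := by
    by_cases h : i = k <;> by_cases h' : j = k <;> simp [derivZ, shiftZ, h, h']
  rw [this]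
  refine sub_mem ?_ ?_ <;> split_ifs <;> first | exact one_mem _ | exact zero_mem _

theorem derivZ_mem (G : SimpleGraph ι) (k : ι) (p : TInv F G) :
    derivZ G k (p : Conf F G) ∈ TInv F G := by
  obtain ⟨p, hp⟩ := p
  change derivZ G k p ∈ TInv F G
  refine Algebra.adjoin_induction (p := fun x _ => derivZ G k x ∈ TInv F G) ?_ ?_ ?_ ?_ hp
  · rintro x (⟨i, j, rfl⟩ | ⟨i, j, hij, hx⟩)
    · exact derivZ_coord_sub G k i j
    · have hxm : x ∈ TInv F G := Algebra.subset_adjoin (Or.inr ⟨i, j, hij, hx⟩)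
      have h := congrArg (derivZ G k) hx
      rw [Derivation.leibniz, Derivation.map_one_eq_zero, smul_eq_mul, smul_eq_mul] at h
      have h2 : derivZ G k x = -(x * x * derivZ G k (coord G i - coord G j)) := by
        linear_combination x * h - derivZ G k x * hx
      rw [h2]
      exact neg_mem (mul_mem (mul_mem hxm hxm) (derivZ_coord_sub G k i j))
  · intro r
    simp
  · intro x y _ _ hx hy
    rw [map_add]
    exact add_mem hx hy
  · intro x y hx' hy' hx hy
    rw [Derivation.leibniz, smul_eq_mul, smul_eq_mul]
    exact add_mem (mul_mem hx' hy) (mul_mem hy' hx)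

/-- `∂/∂z_i` on translation invariant functions. -/
def derivT (G : SimpleGraph ι) (i : ι) : TInv F G →ₗ[F] TInv F G :=
  LinearMap.codRestrict (Subalgebra.toSubmodule (TInv F G))
    ((derivZ (F := F) G i).toLinearMap ∘ₗ (TInv F G).val.toLinearMap) (derivZ_mem G i)

/-- The iterated derivative `∏_{i < m} (∂/∂z_i) ^ (β i)`. -/
def iterDeriv {N m : ℕ} (G : SimpleGraph (Fin N)) (e : Fin m → Fin N) (β : Fin m →₀ ℕ) :
    Module.End F (TInv F G) :=
  (List.ofFn fun i => (derivT G (e i) : Module.End F (TInv F G)) ^ β i).prod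

variable (F) in
/-- The algebra `F[(z_i - z_j)^{±1}]_{1 ≤ i < j ≤ n}`. -/
abbrev O (n : ℕ) : Type _ := TInv F (⊤ : SimpleGraph (Fin n))

/-- A permutation as an endomorphism of the complete graph. -/
def permHom {n : ℕ} (σ : Equiv.Perm (Fin n)) :
    (⊤ : SimpleGraph (Fin n)) →g (⊤ : SimpleGraph (Fin n)) where
  toFun := σ
  map_rel' h := by simpa using h

/-- The map `{1, …, m + n} → {0, …, n}` that sends the first `m` indices (the block) to `0`. -/
def collapse (m n : ℕ) : Fin (m + n) → Fin (n + 1) :=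
  Fin.append (fun _ => 0) Fin.succ

/-- The pairs of indices that do not both lie in the block of the first `m` indices. -/
def regGraph (m n : ℕ) : SimpleGraph (Fin (m + n)) :=
  SimpleGraph.comap (collapse m n) ⊤

/-- Translation invariant functions of `z_1, …, z_{m+n}` without poles at `z_k = z_l` for `k, l`
both in the block of the first `m` indices. -/
abbrev ORegular (F : Type u) [Field F] (m n : ℕ) : Type _ := TInv F (regGraph m n)

/-- The substitution `z_1 = ⋯ = z_m = Z`. -/
def specialize (m n : ℕ) : ORegular F m n →ₐ[F] O F (n + 1) :=
  substT ⟨collapse m n, fun h => h⟩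

/-- A function of the first `m` variables as a function of `m + n` variables. -/
def blockIncl (m n : ℕ) : O F m →ₐ[F] O F (m + n) :=
  substT ⟨Fin.castAdd n, fun h => by simpa using h⟩

/-- A function without poles in the block as a function with arbitrary poles. -/
def regIncl (m n : ℕ) : ORegular F m n →ₐ[F] O F (m + n) :=
  substT ⟨id, fun {a b} h => by
    rintro rfl
    exact (regGraph m n).loopless.irrefl _ h⟩

end Functions

/-! ### Polynomials with values in an `F[∂]`-module -/

section Values

variable (F : Type u) (V : Type v) [Field F] [AddCommGroup V] [Module F V] [Module F[X] V]
  [IsScalarTower F F[X] V]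

/-- `F[∂][λ_i]_{i ∈ ι}`; here `∂` is the variable of `F[X]`. -/
abbrev A (ι : Type*) : Type _ := MvPolynomial ι F[X]

/-- `V[λ_i]_{i ∈ ι} = F[∂][λ_i] ⊗_{F[∂]} V`. -/
def PolV (ι : Type*) : Type _ := A F ι ⊗[F[X]] V

instance (ι : Type*) : AddCommGroup (PolV F V ι) :=
  inferInstanceAs (AddCommGroup (A F ι ⊗[F[X]] V))

instance (ι : Type*) : Module (A F ι) (PolV F V ι) :=
  inferInstanceAs (Module (A F ι) (A F ι ⊗[F[X]] V))

instance (ι : Type*) : Module F[X] (PolV F V ι) :=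
  inferInstanceAs (Module F[X] (A F ι ⊗[F[X]] V))

instance (ι : Type*) : Module F (PolV F V ι) :=
  inferInstanceAs (Module F (A F ι ⊗[F[X]] V))

instance (ι : Type*) : IsScalarTower F F[X] (PolV F V ι) :=
  inferInstanceAs (IsScalarTower F F[X] (A F ι ⊗[F[X]] V))

instance (ι : Type*) : IsScalarTower F (A F ι) (PolV F V ι) :=
  inferInstanceAs (IsScalarTower F (A F ι) (A F ι ⊗[F[X]] V))

instance (ι : Type*) : SMulCommClass (A F ι) F (PolV F V ι) :=
  inferInstanceAs (SMulCommClass (A F ι) F (A F ι ⊗[F[X]] V))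

/-- The element `p(λ) v`. -/
def pol {F : Type u} {V : Type v} [Field F] [AddCommGroup V] [Module F[X] V] {ι : Type*}
    (p : A F ι) (x : V) : PolV F V ι := p ⊗ₜ[F[X]] x

theorem pol_induction {F : Type u} {V : Type v} [Field F] [AddCommGroup V] [Module F[X] V]
    {ι : Type*} {motive : PolV F V ι → Prop} (x : PolV F V ι) (zero : motive 0)
    (pol : ∀ p v, motive (pol p v)) (add : ∀ x y, motive x → motive y → motive (x + y)) :
    motive x :=
  TensorProduct.induction_on (motive := motive) x zero pol add

theorem smul_pol {F : Type u} {V : Type v} [Field F] [AddCommGroup V] [Module F[X] V] {ι : Type*}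
    (a p : A F ι) (x : V) : a • (pol p x : PolV F V ι) = pol (a * p) x := rfl

/-- The map on values induced by an `F[∂]`-linear map of the coefficient algebras. -/
def polMap {F : Type u} (V : Type v) [Field F] [AddCommGroup V] [Module F V] [Module F[X] V]
    [IsScalarTower F F[X] V] {ι κ : Type*} (T : A F ι →ₗ[F[X]] A F κ) :
    PolV F V ι →ₗ[F] PolV F V κ :=
  (LinearMap.rTensor V T).restrictScalars F

theorem polMap_pol {F : Type u} (V : Type v) [Field F] [AddCommGroup V] [Module F V]
    [Module F[X] V] [IsScalarTower F F[X] V] {ι κ : Type*} (T : A F ι →ₗ[F[X]] A F κ) (p : A F ι)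
    (x : V) : polMap V T (pol p x) = pol (T p) x := rfl

/-- The element `∂ + ∑ i, λ_i`. -/
def total (ι : Type*) [Fintype ι] : A F ι :=
  MvPolynomial.C Polynomial.X + ∑ i, MvPolynomial.X i

/-- The submodule `⟨∂ + λ_1 + ⋯ + λ_n⟩`, the image of multiplication by `∂ + λ_1 + ⋯ + λ_n`. -/
def totalRange (n : ℕ) : Submodule (A F (Fin n)) (PolV F V (Fin n)) :=
  LinearMap.range (LinearMap.lsmul (A F (Fin n)) (PolV F V (Fin n)) (total F (Fin n)))

/-- `V[λ_1, …, λ_n] / ⟨∂ + λ_1 + ⋯ + λ_n⟩`. -/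
def QuotV (n : ℕ) : Type _ := PolV F V (Fin n) ⧸ totalRange F V n

instance (n : ℕ) : AddCommGroup (QuotV F V n) :=
  inferInstanceAs (AddCommGroup (PolV F V (Fin n) ⧸ totalRange F V n))

instance (n : ℕ) : Module (A F (Fin n)) (QuotV F V n) :=
  inferInstanceAs (Module (A F (Fin n)) (PolV F V (Fin n) ⧸ totalRange F V n))

instance (n : ℕ) : Module F (QuotV F V n) :=
  inferInstanceAs (Module F (PolV F V (Fin n) ⧸ totalRange F V n))

instance (n : ℕ) : SMulCommClass (A F (Fin n)) F (QuotV F V n) :=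
  inferInstanceAs (SMulCommClass (A F (Fin n)) F (PolV F V (Fin n) ⧸ totalRange F V n))

/-- The quotient map `V[λ_1, …, λ_n] → V[λ_1, …, λ_n] / ⟨∂ + λ_1 + ⋯ + λ_n⟩`. -/
def toQuot (n : ℕ) : PolV F V (Fin n) →ₗ[F] QuotV F V n :=
  (totalRange F V n).mkQ.restrictScalars F

theorem toQuot_total (n : ℕ) (x : PolV F V (Fin n)) : toQuot F V n (total F (Fin n) • x) = 0 :=
  (Submodule.Quotient.mk_eq_zero _).2 ⟨x, rfl⟩

variable {F V}

/-- The map induced on the quotient by a linear map that kills `(∂ + λ_1 + ⋯ + λ_n) V[λ]`. -/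
def quotLift {n : ℕ} {Y : Type*} [AddCommGroup Y] [Module F Y] (T : PolV F V (Fin n) →ₗ[F] Y)
    (hT : ∀ x, T (total F (Fin n) • x) = 0) : QuotV F V n →ₗ[F] Y :=
  ((totalRange F V n).restrictScalars F).liftQ T (by rintro _ ⟨x, rfl⟩; exact hT x) ∘ₗ
    (Submodule.Quotient.restrictScalarsEquiv F (totalRange F V n)).symm.toLinearMap

@[simp] theorem quotLift_toQuot {n : ℕ} {Y : Type*} [AddCommGroup Y] [Module F Y]
    (T : PolV F V (Fin n) →ₗ[F] Y) (hT : ∀ x, T (total F (Fin n) • x) = 0)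
    (x : PolV F V (Fin n)) : quotLift T hT (toQuot F V n x) = T x := rfl

variable (V) in
/-- The substitution of the variables along a homomorphism of `F[∂]`-algebras. -/
def substL {ι κ : Type*} (φ : A F ι →ₐ[F[X]] A F κ) : PolV F V ι →ₗ[F] PolV F V κ :=
  polMap V φ.toLinearMap

theorem substL_smul {ι κ : Type*} (φ : A F ι →ₐ[F[X]] A F κ) (a : A F ι) (x : PolV F V ι) :
    substL V φ (a • x) = φ a • substL V φ x := by
  induction x using pol_induction with
  | zero => simp
  | add x y hx hy => simp only [smul_add, map_add, hx, hy]
  | pol p v => simp [substL, polMap_pol, smul_pol]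

variable (F V) in
/-- The operator `∂/∂λ_j - ∂/∂λ_i`. -/
def diffL (n : ℕ) (i j : Fin n) : PolV F V (Fin n) →ₗ[F] PolV F V (Fin n) :=
  polMap V ((MvPolynomial.pderiv (R := F[X]) j).toLinearMap -
    (MvPolynomial.pderiv (R := F[X]) i).toLinearMap)

theorem diffL_total (n : ℕ) (i j : Fin n) (x : PolV F V (Fin n)) :
    diffL F V n i j (total F (Fin n) • x) = total F (Fin n) • diffL F V n i j x := by
  have h : ∀ k : Fin n, MvPolynomial.pderiv k (total F (Fin n)) = 1 := fun k => by
    simp [total, MvPolynomial.pderiv_X, Pi.single_apply]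
  induction x using pol_induction with
  | zero => simp
  | add x y hx hy => simp only [smul_add, map_add, hx, hy]
  | pol p v =>
    simp only [diffL, smul_pol, polMap_pol, LinearMap.sub_apply, Derivation.coeFn_coe, smul_eq_mul, Derivation.leibniz, h, mul_one]
    congr 1
    ring

variable (F V) in
/-- The operator `∂/∂λ_j - ∂/∂λ_i` on the quotient. -/
def diffQ (n : ℕ) (i j : Fin n) : QuotV F V n →ₗ[F] QuotV F V n :=
  quotLift (toQuot F V n ∘ₗ diffL F V n i j) fun x => by
    rw [LinearMap.comp_apply, diffL_total, toQuot_total]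

variable (F) in
/-- The renaming `λ_i ↦ λ_{σ⁻¹ i}`. -/
def permA {n : ℕ} (σ : Equiv.Perm (Fin n)) : A F (Fin n) →ₐ[F[X]] A F (Fin n) :=
  MvPolynomial.rename σ.symm

theorem permA_total {n : ℕ} (σ : Equiv.Perm (Fin n)) :
    permA F σ (total F (Fin n)) = total F (Fin n) := by
  simp only [permA, total, map_add, map_sum, MvPolynomial.rename_X, MvPolynomial.rename_C]
  rw [Equiv.sum_comp σ.symm (fun i => (MvPolynomial.X i : A F (Fin n)))]

variable (F V) in
/-- The renaming `λ_i ↦ λ_{σ⁻¹ i}` on `V[λ_1, …, λ_n]`. -/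
def permL {n : ℕ} (σ : Equiv.Perm (Fin n)) : PolV F V (Fin n) →ₗ[F] PolV F V (Fin n) :=
  substL V (permA F σ)

variable (F V) in
/-- The renaming `λ_i ↦ λ_{σ⁻¹ i}` on the quotient. -/
def permQ {n : ℕ} (σ : Equiv.Perm (Fin n)) : QuotV F V n →ₗ[F] QuotV F V n :=
  quotLift (toQuot F V n ∘ₗ permL F V σ) fun x => by
    rw [LinearMap.comp_apply, permL, substL_smul, permA_total, toQuot_total]

variable (F) in
/-- The substitution `λ_0 ↦ s + μ_1 + ⋯ + μ_m`, `λ_j ↦ μ_{m+j}` for `1 ≤ j ≤ n`. -/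
def insA (m n : ℕ) (s : A F (Fin (m + n))) : A F (Fin (n + 1)) →ₐ[F[X]] A F (Fin (m + n)) :=
  MvPolynomial.aeval (Fin.cons (s + ∑ i : Fin m, MvPolynomial.X (Fin.castAdd n i))
    fun j => MvPolynomial.X (Fin.natAdd m j))

theorem insA_total (m n : ℕ) (s : A F (Fin (m + n))) :
    insA F m n s (total F (Fin (n + 1))) = s + total F (Fin (m + n)) := by
  have h : insA F m n s (MvPolynomial.C Polynomial.X) = MvPolynomial.C Polynomial.X :=
    (insA F m n s).commutes _
  rw [total, map_add, h, map_sum, Fin.sum_univ_succ, total, Fin.sum_univ_add]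
  simp only [insA, MvPolynomial.aeval_X, Fin.cons_zero, Fin.cons_succ]
  ring

variable (F V) in
/-- The map of quotients induced by `λ_0 ↦ μ_1 + ⋯ + μ_m`, `λ_j ↦ μ_{m+j}`. -/
def insQ (m n : ℕ) : QuotV F V (n + 1) →ₗ[F] QuotV F V (m + n) :=
  quotLift (toQuot F V (m + n) ∘ₗ substL V (insA F m n 0)) fun x => by
    rw [LinearMap.comp_apply, substL_smul, insA_total, zero_add, toQuot_total]

variable (F V) in
/-- The map induced by `λ_0 ↦ -∂ - μ_{m+1} - ⋯ - μ_{m+n}`, `λ_j ↦ μ_{m+j}`, which vanishes on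
`⟨∂ + λ_0 + ⋯ + λ_n⟩`; the former is `s + μ_1 + ⋯ + μ_m` for `s = -(∂ + μ_1 + ⋯ + μ_{m+n})`. -/
def elimQ (m n : ℕ) : QuotV F V (n + 1) →ₗ[F] PolV F V (Fin (m + n)) :=
  quotLift (substL V (insA F m n (-total F (Fin (m + n))))) fun x => by
    rw [substL_smul, insA_total, neg_add_cancel, zero_smul]

/-- The coefficients in `V` of an element of `V[λ_i]`. -/
def coeffs {ι : Type*} : PolV F V ι ≃ₗ[F[X]] ((ι →₀ ℕ) →₀ V) := by
  classical
  exact LinearEquiv.rTensor V (MvPolynomial.basisMonomials ι F[X]).repr ≪≫ₗ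
    TensorProduct.finsuppScalarLeft F[X] V (ι →₀ ℕ)

theorem coeffs_pol {ι : Type*} (p : A F ι) (x : V) (α : ι →₀ ℕ) :
    coeffs (pol p x : PolV F V ι) α = p.coeff α • x := by
  classical
  exact TensorProduct.finsuppScalarLeft_apply_tmul_apply _ x α

end Values

/-! ### The chiral operad and its pro-conformal version -/

section Operads

variable (F : Type u) (V : Type v) [Field F] [AddCommGroup V] [Module F V] [Module F[X] V]
  [IsScalarTower F F[X] V]

/-- Linear maps `V^{⊗ n} ⊗ F[(z_i - z_j)^{±1}] → Y`. -/
def Maps (n : ℕ) (Y : Type w) [AddCommGroup Y] [Module F Y] : Type _ :=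
  MultilinearMap F (fun _ : Fin n => V) (O F n →ₗ[F] Y)

instance (n : ℕ) (Y : Type w) [AddCommGroup Y] [Module F Y] : AddCommGroup (Maps F V n Y) :=
  inferInstanceAs (AddCommGroup (MultilinearMap F (fun _ : Fin n => V) (O F n →ₗ[F] Y)))

instance (n : ℕ) (Y : Type w) [AddCommGroup Y] [Module F Y] : Module F (Maps F V n Y) :=
  inferInstanceAs (Module F (MultilinearMap F (fun _ : Fin n => V) (O F n →ₗ[F] Y)))

instance (n : ℕ) (Y : Type w) [AddCommGroup Y] [Module F Y] :
    FunLike (Maps F V n Y) (Fin n → V) (O F n →ₗ[F] Y) :=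
  inferInstanceAs (FunLike (MultilinearMap F (fun _ : Fin n => V) (O F n →ₗ[F] Y)) _ _)

@[simp] theorem Maps.add_apply {n : ℕ} {Y : Type w} [AddCommGroup Y] [Module F Y]
    (f g : Maps F V n Y) (v : Fin n → V) : (f + g) v = f v + g v := rfl

@[simp] theorem Maps.smul_apply {n : ℕ} {Y : Type w} [AddCommGroup Y] [Module F Y]
    (c : F) (f : Maps F V n Y) (v : Fin n → V) : (c • f) v = c • f v := rfl

@[simp] theorem Maps.zero_apply {n : ℕ} {Y : Type w} [AddCommGroup Y] [Module F Y]
    (v : Fin n → V) : (0 : Maps F V n Y) v = 0 := rfl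

theorem Maps.ext {n : ℕ} {Y : Type w} [AddCommGroup Y] [Module F Y] {f g : Maps F V n Y}
    (h : ∀ v p, f v p = g v p) : f = g :=
  DFunLike.ext _ _ fun v => LinearMap.ext fun p => h v p

/-- Maps with values in `V[λ_1, …, λ_n]`. -/
abbrev TMaps (n : ℕ) : Type _ := Maps F V n (PolV F V (Fin n))

/-- Maps with values in `V[λ_1, …, λ_n] / ⟨∂ + λ_1 + ⋯ + λ_n⟩`. -/
abbrev QMaps (n : ℕ) : Type _ := Maps F V n (QuotV F V n)

variable {F V}

/-- The maps satisfying the two sesquilinearity conditions, where `D i j` stands for the operator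
`∂/∂λ_j - ∂/∂λ_i` on the module `Y` of values. -/
def sesqui {n : ℕ} {Y : Type w} [AddCommGroup Y] [Module F Y] [Module (A F (Fin n)) Y]
    [SMulCommClass (A F (Fin n)) F Y] (D : Fin n → Fin n → Y →ₗ[F] Y) :
    Submodule F (Maps F V n Y) where
  carrier := {f | (∀ v i p, f (Function.update v i ((Polynomial.X : F[X]) • v i)) p +
        (MvPolynomial.X i : A F (Fin n)) • f v p = f v (derivT ⊤ i p)) ∧
      ∀ v i j p, f v (zsub ⊤ i j * p) = D i j (f v p)}
  add_mem' {f g} hf hg := by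
    refine ⟨fun v i p => ?_, fun v i j p => ?_⟩
    · have h1 := hf.1 v i p
      have h2 := hg.1 v i p
      simp only [Maps.add_apply, LinearMap.add_apply, smul_add, ← h1, ← h2]
      abel
    · simp [hf.2 v i j p, hg.2 v i j p]
  zero_mem' := by simp
  smul_mem' c f hf := by
    refine ⟨fun v i p => ?_, fun v i j p => ?_⟩
    · have h1 := hf.1 v i p
      simp only [Maps.smul_apply, LinearMap.smul_apply, ← h1, smul_add]
      rw [smul_comm]
    · simp [hf.2 v i j p]

variable (F V) in
/-- The space `P̃^ch(n)` of sesquilinear maps with values in `V[λ_1, …, λ_n]`. As a space it does not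
depend on the parity of `V`. -/
def PT (n : ℕ) : Submodule F (TMaps F V n) := sesqui (diffL F V n)

variable (F V) in
/-- The space `P^ch(n)` of sesquilinear maps with values in
`V[λ_1, …, λ_n] / ⟨∂ + λ_1 + ⋯ + λ_n⟩`. -/
def PQ (n : ℕ) : Submodule F (QMaps F V n) := sesqui (diffQ F V n)

/-- Composition with a linear map of the values. -/
def postComp {n : ℕ} {Y Y' : Type w} [AddCommGroup Y] [Module F Y] [AddCommGroup Y'] [Module F Y']
    (T : Y →ₗ[F] Y') : Maps F V n Y →ₗ[F] Maps F V n Y' where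
  toFun f := LinearMap.compMultilinearMap (LinearMap.compRight F T)
    (f : MultilinearMap F (fun _ : Fin n => V) (O F n →ₗ[F] Y))
  map_add' f g := Maps.ext F V fun v p => T.map_add (f v p) (g v p)
  map_smul' c f := Maps.ext F V fun v p => T.map_smul c (f v p)

@[simp] theorem postComp_apply {n : ℕ} {Y Y' : Type w} [AddCommGroup Y] [Module F Y]
    [AddCommGroup Y'] [Module F Y'] (T : Y →ₗ[F] Y') (f : Maps F V n Y) (v : Fin n → V)
    (p : O F n) : postComp T f v p = T (f v p) := rfl

variable (F V) in
/-- `f ↦ (∂ + λ_1 + ⋯ + λ_n) f`. -/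
def partialMaps (n : ℕ) : Module.End F (TMaps F V n) :=
  postComp (DistribSMul.toLinearMap F (PolV F V (Fin n)) (total F (Fin n)))

variable (F V) in
/-- Composition with the quotient map to `V[λ_1, …, λ_n] / ⟨∂ + λ_1 + ⋯ + λ_n⟩`. -/
def quotMaps (n : ℕ) : TMaps F V n →ₗ[F] QMaps F V n := postComp (toQuot F V n)

theorem partialMaps_mem (n : ℕ) (f : TMaps F V n) (hf : f ∈ PT F V n) :
    partialMaps F V n f ∈ PT F V n := by
  refine ⟨fun v i p => ?_, fun v i j p => ?_⟩
  · have h := hf.1 v i p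
    simp only [partialMaps, postComp_apply, DistribSMul.toLinearMap_apply, ← h, smul_add]
    rw [smul_comm]
  · have h := hf.2 v i j p
    simp only [partialMaps, postComp_apply, DistribSMul.toLinearMap_apply, h, diffL_total]

theorem quotMaps_mem (n : ℕ) (f : TMaps F V n) (hf : f ∈ PT F V n) :
    quotMaps F V n f ∈ PQ F V n := by
  refine ⟨fun v i p => ?_, fun v i j p => ?_⟩
  · have h := hf.1 v i p
    simp only [quotMaps, postComp_apply, ← h, map_add]
    rfl
  · have h := hf.2 v i j p
    simp only [quotMaps, postComp_apply, h]
    rfl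

variable (F V) in
/-- The endomorphism `∂` of `P̃^ch(n)`. -/
def partialPT (n : ℕ) : Module.End F (PT F V n) :=
  (partialMaps F V n).restrict (partialMaps_mem n)

theorem quotMaps_partialMaps (n : ℕ) (f : TMaps F V n) :
    quotMaps F V n (partialMaps F V n f) = 0 := by
  exact Maps.ext F V fun v p => toQuot_total F V n _

variable (F V) in
/-- The canonical map `P̃^ch(n) / ∂P̃^ch(n) → P^ch(n)`. -/
def canonP (n : ℕ) : (PT F V n ⧸ LinearMap.range (partialPT F V n)) →ₗ[F] PQ F V n :=
  (LinearMap.range (partialPT F V n)).liftQ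
    ((quotMaps F V n).restrict (q := PQ F V n) (quotMaps_mem n))
    (LinearMap.range_le_ker_iff.2 (LinearMap.ext fun f =>
      Subtype.ext (quotMaps_partialMaps n (f : TMaps F V n))))

/-- The Koszul sign `(-1)^{a b}`. -/
def ksign (a b : ZMod 2) : ℤ := if a = 1 ∧ b = 1 then -1 else 1

/-- The sign `ε(σ)` for the permutation `σ` of homogeneous vectors of parities `ε`. -/
def permSign {n : ℕ} (σ : Equiv.Perm (Fin n)) (ε : Fin n → ZMod 2) : ℤ :=
  ∏ i, ∏ j, if i < j ∧ σ j < σ i then ksign (ε i) (ε j) else 1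

/-- The value `f^σ(v ⊗ p)` on homogeneous vectors `v` of parities `ε`: here `ren` is the renaming
`λ_i ↦ λ_{σ⁻¹ i}` of the values. -/
def permEval {n : ℕ} {Y : Type w} [AddCommGroup Y] [Module F Y] (ren : Y →ₗ[F] Y)
    (σ : Equiv.Perm (Fin n)) (ε : Fin n → ZMod 2) (f : Maps F V n Y) (v : Fin n → V)
    (p : O F n) : Y :=
  permSign σ ε • ren (f (fun i => v (σ.symm i)) (substT (permHom σ) p))

/-- The maps `f` with `f^σ = f` for all permutations `σ`, where `E` is the grading of the
superspace by parity. -/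
def symm (E : ZMod 2 → Submodule F[X] V) {n : ℕ} {Y : Type w} [AddCommGroup Y] [Module F Y]
    (ren : Equiv.Perm (Fin n) → Y →ₗ[F] Y) : Submodule F (Maps F V n Y) where
  carrier := {f | ∀ σ ε v p, (∀ i, v i ∈ E (ε i)) → permEval (ren σ) σ ε f v p = f v p}
  add_mem' {f g} hf hg σ ε v p hv := by
    have h1 := hf σ ε v p hv
    have h2 := hg σ ε v p hv
    simp only [permEval] at h1 h2 ⊢
    simp only [Maps.add_apply, LinearMap.add_apply, map_add, smul_add, h1, h2]
  zero_mem' σ ε v p hv := by simp [permEval]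
  smul_mem' c f hf σ ε v p hv := by
    have h1 := hf σ ε v p hv
    simp only [permEval] at h1 ⊢
    simp only [Maps.smul_apply, LinearMap.smul_apply, map_smul]
    rw [smul_comm, h1]

/-- The invariants `P̃^ch(a)^{S_a}`, the component of degree `a - 1` of `W̃`. -/
def WT (E : ZMod 2 → Submodule F[X] V) (a : ℕ) : Submodule F (TMaps F V a) :=
  PT F V a ⊓ symm E (permL F V)

/-- The invariants `P^ch(a)^{S_a}`, the component of degree `a - 1` of `W`. -/
def WQ (E : ZMod 2 → Submodule F[X] V) (a : ℕ) : Submodule F (QMaps F V a) :=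
  PQ F V a ⊓ symm E (permQ F V)

theorem partialMaps_mem_WT (E : ZMod 2 → Submodule F[X] V) (a : ℕ) (f : TMaps F V a)
    (hf : f ∈ WT E a) : partialMaps F V a f ∈ WT E a := by
  refine ⟨partialMaps_mem a f hf.1, fun σ ε v p hv => ?_⟩
  have h := hf.2 σ ε v p hv
  simp only [permEval, partialMaps, postComp_apply, DistribSMul.toLinearMap_apply, ← h]
  rw [permL, substL_smul, permA_total, smul_comm]

theorem quotMaps_mem_WQ (E : ZMod 2 → Submodule F[X] V) (a : ℕ) (f : TMaps F V a)
    (hf : f ∈ WT E a) : quotMaps F V a f ∈ WQ E a := by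
  refine ⟨quotMaps_mem a f hf.1, fun σ ε v p hv => ?_⟩
  have h := hf.2 σ ε v p hv
  simp only [permEval, quotMaps, postComp_apply, permQ, quotLift_toQuot,
    LinearMap.comp_apply] at h ⊢
  rw [← map_zsmul, h]

/-- The endomorphism `∂` of `W̃`, in each degree. -/
def partialWT (E : ZMod 2 → Submodule F[X] V) (a : ℕ) : Module.End F (WT E a) :=
  (partialMaps F V a).restrict (partialMaps_mem_WT E a)

/-- The component of degree `a - 1` of `W̃ / ∂W̃`. -/
abbrev WR (E : ZMod 2 → Submodule F[X] V) (a : ℕ) : Type _ :=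
  WT E a ⧸ LinearMap.range (partialWT E a)

/-- The canonical map `W̃ / ∂W̃ → W`, in each degree. -/
def canonW (E : ZMod 2 → Submodule F[X] V) (a : ℕ) : WR E a →ₗ[F] WQ E a :=
  (LinearMap.range (partialWT E a)).liftQ
    ((quotMaps F V a).restrict (q := WQ E a) (quotMaps_mem_WQ E a))
    (LinearMap.range_le_ker_iff.2 (LinearMap.ext fun f =>
      Subtype.ext (quotMaps_partialMaps a (f : TMaps F V a))))

end Operads

/-! ### The `∘_1`-products and the `□`-products -/

section Products

variable {F : Type u} {V : Type v} [Field F] [AddCommGroup V] [Module F V] [Module F[X] V]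
  [IsScalarTower F F[X] V]

/-- If `G = ∑ α, x ^ α w_α` is a polynomial in `x_1, …, x_m` with coefficients `w_α` in `V`, this is
`∑ α, (μ - ∂_z) ^ α (Φ (w_α ⊗ h))`, where `μ_i - ∂_{z_i}` for `i = 1, …, m` replaces `x_i`, all the
`μ_i` are moved to the left, the `∂_{z_i}` are applied to `h` and afterwards
`z_1 = ⋯ = z_m = Z` is substituted. The power is expanded as
`(μ - ∂_z) ^ α = ∑_{β + γ = α} (-1) ^ |β| (α choose β) μ ^ γ ∂_z ^ β`. -/
def plug (m n : ℕ) {Y : Type w} [AddCommGroup Y] [Module (A F (Fin (m + n))) Y]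
    (Φ : V → O F (n + 1) → Y) (G : PolV F V (Fin m)) (h : ORegular F m n) : Y :=
  (coeffs G).sum fun α x => ∑ b ∈ Finset.HasAntidiagonal.antidiagonal α,
    ((-1) ^ b.1.degree * ∏ i, ((α i).choose (b.1 i) : ℤ)) •
      (MvPolynomial.monomial (b.2.mapDomain (Fin.castAdd n)) 1 : A F (Fin (m + n))) •
        Φ x (specialize m n (iterDeriv (regGraph m n) (Fin.castAdd n) b.1 h))

/-- `k` is the result of inserting `g` into the first argument of `f`: for every `q` in the
variables `z_1, …, z_m` and every `h` without poles at `z_k = z_l` for `k, l ≤ m`, the value of `k`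
at `v_1 ⊗ ⋯ ⊗ v_{m+n} ⊗ q h` is the value of `f` at
`g_{μ - ∂_z}(v_1 ⊗ ⋯ ⊗ v_m ⊗ q)_→ ⊗ v_{m+1} ⊗ ⋯ ⊗ v_{m+n} ⊗ h|_{z_1 = ⋯ = z_m = Z}`.
Here `Φ v w r` is the value of `f` at `w ⊗ v ⊗ r`, with its variables already expressed through
`μ_1, …, μ_{m+n}`, and `R v q G` says that `G` is (a representative of) the value of `g`
at `v ⊗ q`. -/
def IsInsertion (m n : ℕ) {Y : Type w} [AddCommGroup Y] [Module F Y]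
    [Module (A F (Fin (m + n))) Y] (Φ : (Fin n → V) → V → O F (n + 1) → Y)
    (R : (Fin m → V) → O F m → PolV F V (Fin m) → Prop) (k : Maps F V (m + n) Y) : Prop :=
  ∀ (v : Fin (m + n) → V) (q : O F m) (h : ORegular F m n) (G : PolV F V (Fin m)),
    R (fun i => v (Fin.castAdd n i)) q G →
      k v (blockIncl m n q * regIncl m n h) = plug m n (Φ fun j => v (Fin.natAdd m j)) G h

/-- `k = f ∘_1 g` in `P^ch`. -/
def IsCircQQ (m n : ℕ) (f : QMaps F V (n + 1)) (g : QMaps F V m) (k : QMaps F V (m + n)) : Prop :=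
  IsInsertion m n (fun v x r => insQ F V m n (f (Fin.cons x v : Fin (n + 1) → V) r))
    (fun v q G => toQuot F V m G = g v q) k

/-- `k` is the `λ`-product of `f` and `g` in the first position in `P̃^ch`, evaluated at `λ = s`.
For `s = 0` this is the value at `λ = 0`. For `s = -(∂ + μ_1 + ⋯ + μ_{m+n})` this is the value at
`λ = -∂`, because `∂` acts on `P̃^ch(m + n)` as multiplication by `∂ + μ_1 + ⋯ + μ_{m+n}`. -/
def IsCircTT (m n : ℕ) (s : A F (Fin (m + n))) (f : TMaps F V (n + 1)) (g : TMaps F V m)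
    (k : TMaps F V (m + n)) : Prop :=
  IsInsertion m n (fun v x r => substL V (insA F m n s) (f (Fin.cons x v : Fin (n + 1) → V) r))
    (fun v q G => G = g v q) k

/-- The product of `f` in `P^ch` and `g` in `P̃^ch` at `λ = -∂`. At `λ = -∂` the first variable of
`f` becomes `-∂ - μ_{m+1} - ⋯ - μ_{m+n}`, so that the product is defined for `f` modulo
`⟨∂ + λ_0 + ⋯ + λ_n⟩`. -/
def IsCircQT (m n : ℕ) (f : QMaps F V (n + 1)) (g : TMaps F V m) (k : TMaps F V (m + n)) : Prop :=
  IsInsertion m n (fun v x r => elimQ F V m n (f (Fin.cons x v : Fin (n + 1) → V) r))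
    (fun v q G => G = g v q) k

/-- The product of `f` in `P̃^ch` and `g` in `P^ch` at `λ = 0`; any representatives of the values
of `g` give the same result. -/
def IsCircTQ (m n : ℕ) (f : TMaps F V (n + 1)) (g : QMaps F V m) (k : TMaps F V (m + n)) : Prop :=
  IsInsertion m n (fun v x r => substL V (insA F m n 0) (f (Fin.cons x v : Fin (n + 1) → V) r))
    (fun v q G => toQuot F V m G = g v q) k

/-- The `(m, n)`-shuffles. -/
def IsShuffle (m n : ℕ) (σ : Equiv.Perm (Fin (m + n))) : Prop :=
  (∀ i j : Fin m, i < j → σ (Fin.castAdd n i) < σ (Fin.castAdd n j)) ∧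
    ∀ i j : Fin n, i < j → σ (Fin.natAdd m i) < σ (Fin.natAdd m j)

open Classical in
/-- `y = ∑ σ, k^{σ⁻¹}`, the sum over the `(m, n)`-shuffles. -/
def IsShuffleSum (E : ZMod 2 → Submodule F[X] V) (m n : ℕ) {Y : Type w} [AddCommGroup Y]
    [Module F Y] (ren : Equiv.Perm (Fin (m + n)) → Y →ₗ[F] Y) (k y : Maps F V (m + n) Y) : Prop :=
  ∀ ε v p, (∀ i, v i ∈ E (ε i)) →
    y v p = ∑ σ : Equiv.Perm (Fin (m + n)) with IsShuffle m n σ, permEval (ren σ⁻¹) σ⁻¹ ε k v p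

/-- `z` is the product of `f` of arity `a` and `g` of arity `b`, where `C` describes the product
in the arities `n + 1` and `m`, with values in the arity `m + n`. The product is zero for `a = 0`. -/
def IsProduct {X X' Z : ℕ → Type*} [∀ c, AddCommMonoid (Z c)]
    (C : ∀ m n, X (n + 1) → X' m → Z (m + n) → Prop) :
    ∀ a b, X a → X' b → (⨁ c, Z c) → Prop
  | 0, _, _, _, z => z = 0
  | n + 1, m, f, g, z => ∃ y, C m n f g y ∧ z = DirectSum.of Z (m + n) y

variable (E : ZMod 2 → Submodule F[X] V)

/-- `z = f □ g` in `P^ch`. -/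
def IsBoxQQ (a b : ℕ) (f : QMaps F V a) (g : QMaps F V b) (z : ⨁ c, QMaps F V c) : Prop :=
  IsProduct (X := QMaps F V) (X' := QMaps F V) (Z := QMaps F V)
    (fun m n f g y => ∃ k, IsCircQQ m n f g k ∧ IsShuffleSum E m n (permQ F V) k y) a b f g z

/-- `z = f □_λ g` at `λ = 0` in `P̃^ch`: the sum of the `(f ∘_{-∂} g)^{σ⁻¹}`. -/
def IsBoxZero (a b : ℕ) (f : TMaps F V a) (g : TMaps F V b) (z : ⨁ c, TMaps F V c) : Prop :=
  IsProduct (X := TMaps F V) (X' := TMaps F V) (Z := TMaps F V)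
    (fun m n f g y => ∃ k, IsCircTT m n (-total F (Fin (m + n))) f g k ∧
      IsShuffleSum E m n (permL F V) k y) a b f g z

/-- `z = f □_λ g` at `λ = -∂` in `P̃^ch`: the sum of the `(f ∘_0 g)^{σ⁻¹}`. -/
def IsBoxMinus (a b : ℕ) (f : TMaps F V a) (g : TMaps F V b) (z : ⨁ c, TMaps F V c) : Prop :=
  IsProduct (X := TMaps F V) (X' := TMaps F V) (Z := TMaps F V)
    (fun m n f g y => ∃ k, IsCircTT m n 0 f g k ∧ IsShuffleSum E m n (permL F V) k y) a b f g z

/-- `z = f □_λ g` at `λ = 0` for `f` in `P^ch` and `g` in `P̃^ch`. -/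
def IsBoxZeroQT (a b : ℕ) (f : QMaps F V a) (g : TMaps F V b) (z : ⨁ c, TMaps F V c) : Prop :=
  IsProduct (X := QMaps F V) (X' := TMaps F V) (Z := TMaps F V)
    (fun m n f g y => ∃ k, IsCircQT m n f g k ∧ IsShuffleSum E m n (permL F V) k y) a b f g z

/-- `z = f □_λ g` at `λ = -∂` for `f` in `P̃^ch` and `g` in `P^ch`. -/
def IsBoxMinusTQ (a b : ℕ) (f : TMaps F V a) (g : QMaps F V b) (z : ⨁ c, TMaps F V c) : Prop :=
  IsProduct (X := TMaps F V) (X' := QMaps F V) (Z := TMaps F V)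
    (fun m n f g y => ∃ k, IsCircTQ m n f g k ∧ IsShuffleSum E m n (permL F V) k y) a b f g z

end Products

/-! ### Parities, Lie superalgebras and the brackets -/

section Lie

variable {F : Type u} {V : Type v} [Field F] [AddCommGroup V] [Module F V] [Module F[X] V]
  [IsScalarTower F F[X] V]

/-- The superspace `ΠV` with reversed parity. -/
def parityRev (gr : ZMod 2 → Submodule F[X] V) : ZMod 2 → Submodule F[X] V := fun i => gr (1 - i)

/-- The elements of parity `i` of `V[λ_1, …, λ_n]`: those with all coefficients of parity `i`. -/
def polPar (E : ZMod 2 → Submodule F[X] V) (n : ℕ) (i : ZMod 2) :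
    Submodule F (PolV F V (Fin n)) where
  carrier := {x | ∀ α, coeffs x α ∈ E i}
  add_mem' {x y} hx hy α := by
    rw [map_add, Finsupp.add_apply]
    exact add_mem (hx α) (hy α)
  zero_mem' α := by simp
  smul_mem' c x hx α := by
    have h : c • x = (Polynomial.C c : F[X]) • x := by
      rw [← algebraMap_smul F[X] c x]; rfl
    rw [h, map_smul, Finsupp.smul_apply]
    exact (E i).smul_mem _ (hx α)

/-- The elements of parity `i` of the quotient. -/
def quotPar (E : ZMod 2 → Submodule F[X] V) (n : ℕ) (i : ZMod 2) : Submodule F (QuotV F V n) :=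
  (polPar E n i).map (toQuot F V n)

/-- The maps of parity `i`, for a family `G` of subspaces of the target. -/
def mapsPar (E : ZMod 2 → Submodule F[X] V) {n : ℕ} {Y : Type w} [AddCommGroup Y] [Module F Y]
    (G : ZMod 2 → Submodule F Y) (i : ZMod 2) : Submodule F (Maps F V n Y) where
  carrier := {f | ∀ (ε : Fin n → ZMod 2) v p, (∀ k, v k ∈ E (ε k)) → f v p ∈ G (i + ∑ k, ε k)}
  add_mem' {f g} hf hg ε v p hv := by
    rw [Maps.add_apply, LinearMap.add_apply]
    exact add_mem (hf ε v p hv) (hg ε v p hv)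
  zero_mem' ε v p hv := by simp
  smul_mem' c f hf ε v p hv := by
    rw [Maps.smul_apply, LinearMap.smul_apply]
    exact (G _).smul_mem c (hf ε v p hv)

/-- The elements of parity `i` of `W̃`, in each degree. -/
def parWT (E : ZMod 2 → Submodule F[X] V) (i : ZMod 2) (a : ℕ) : Submodule F (WT E a) :=
  (mapsPar E (polPar E a) i).comap (WT E a).subtype

/-- The elements of parity `i` of `W`, in each degree. -/
def parWQ (E : ZMod 2 → Submodule F[X] V) (i : ZMod 2) (a : ℕ) : Submodule F (WQ E a) :=
  (mapsPar E (quotPar E a) i).comap (WQ E a).subtype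

/-- The elements of parity `i` of `W̃ / ∂W̃`, in each degree. -/
def parWR (E : ZMod 2 → Submodule F[X] V) (i : ZMod 2) (a : ℕ) : Submodule F (WR E a) :=
  (parWT E i a).map (LinearMap.range (partialWT E a)).mkQ

/-- The elements of a direct sum all of whose components lie in given subspaces. -/
def sumPar {M : ℕ → Type*} [∀ a, AddCommGroup (M a)] [∀ a, Module F (M a)]
    (G : ∀ a, Submodule F (M a)) : Submodule F (⨁ a, M a) :=
  ⨅ a, (G a).comap (DirectSum.component F ℕ M a)

/-- `L` with the grading `par` by parity and the bilinear bracket `br` is a Lie superalgebra. -/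
structure IsLieSuperalgebra {L : Type*} [AddCommGroup L] [Module F L]
    (par : ZMod 2 → Submodule F L) (br : L →ₗ[F] L →ₗ[F] L) : Prop where
  internal : DirectSum.IsInternal par
  parity : ∀ i j x y, x ∈ par i → y ∈ par j → br x y ∈ par (i + j)
  skew : ∀ i j x y, x ∈ par i → y ∈ par j → br x y = -(ksign i j • br y x)
  jacobi : ∀ i j x y z, x ∈ par i → y ∈ par j →
    br x (br y z) = br (br x y) z + ksign i j • br y (br x z)

/-- `ρ` is a representation of the Lie superalgebra `L` on the superspace `M`. -/
structure IsRepresentation {L M : Type*} [AddCommGroup L] [Module F L] [AddCommGroup M]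
    [Module F M] (par : ZMod 2 → Submodule F L) (br : L →ₗ[F] L →ₗ[F] L)
    (parM : ZMod 2 → Submodule F M) (ρ : L →ₗ[F] M →ₗ[F] M) : Prop where
  internal : DirectSum.IsInternal parM
  parity : ∀ i j x y, x ∈ par i → y ∈ parM j → ρ x y ∈ parM (i + j)
  bracket : ∀ i j x y m, x ∈ par i → y ∈ par j →
    ρ (br x y) m = ρ x (ρ y m) - ksign i j • ρ y (ρ x m)

variable (E : ZMod 2 → Submodule F[X] V)

/-- `W̃`, the direct sum of the `WT E a`, which has degree `a - 1`. -/
abbrev WTsum : Type _ := ⨁ a, WT E a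

/-- `W`, the direct sum of the `WQ E a`, which has degree `a - 1`. -/
abbrev WQsum : Type _ := ⨁ a, WQ E a

/-- `W̃ / ∂W̃`, the direct sum of the `WR E a`, which has degree `a - 1`. -/
abbrev WRsum : Type _ := ⨁ a, WR E a

/-- The quotient map `W̃ → W̃ / ∂W̃`. -/
def projW : WTsum E →ₗ[F] WRsum E :=
  DirectSum.lmap fun a => (LinearMap.range (partialWT E a)).mkQ

/-- The canonical map `W̃ / ∂W̃ → W`. -/
def canonWsum : WRsum E →ₗ[F] WQsum E := DirectSum.lmap fun a => canonW E a

/-- The inclusion of `W̃` in the direct sum of all maps. -/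
def inclWT : WTsum E →ₗ[F] ⨁ a, TMaps F V a := DirectSum.lmap fun a => (WT E a).subtype

/-- The inclusion of `W` in the direct sum of all maps. -/
def inclWQ : WQsum E →ₗ[F] ⨁ a, QMaps F V a := DirectSum.lmap fun a => (WQ E a).subtype

/-- `z = f □ g - (-1)^{p(f) p(g)} g □ f`, for `f`, `g` in `W` of parities `i`, `j`. -/
def IsBracketW (i j : ZMod 2) {a b : ℕ} (f : WQ E a) (g : WQ E b) (z : WQsum E) : Prop :=
  ∃ x y, IsBoxQQ E a b f g x ∧ IsBoxQQ E b a g f y ∧ inclWQ E z = x - ksign i j • y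

/-- `z = [f_λ g]` at `λ = 0`, for `f`, `g` in `W̃` of parities `i`, `j`, where
`[f_λ g] = f □_λ g - (-1)^{p(f) p(g)} g □_{-λ-∂} f`. -/
def IsBracketWT (i j : ZMod 2) {a b : ℕ} (f : WT E a) (g : WT E b) (z : WTsum E) : Prop :=
  ∃ x y, IsBoxZero E a b f g x ∧ IsBoxMinus E b a g f y ∧ inclWT E z = x - ksign i j • y

/-- `z = f □_0 g - (-1)^{p(f) p(g)} g □_{-∂} f`, for `f` in `W` and `g` in `W̃` of parities
`i`, `j`. -/
def IsAction (i j : ZMod 2) {a b : ℕ} (f : WQ E a) (g : WT E b) (z : WTsum E) : Prop :=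
  ∃ x y, IsBoxZeroQT E a b f g x ∧ IsBoxMinusTQ E b a g f y ∧ inclWT E z = x - ksign i j • y

end Lie

end Chiral

end

/-!
The proof treats `P^ch(n)` and `P̃^ch(n)` at once: a boolean `b` selects the values `Val F V b n`,
which are the polynomials in `λ_1, …, λ_n` for `b = false` and their quotient modulo
`∂ + λ_1 + ⋯ + λ_n` for `b = true`. The products `f ∘_1 g`, `f ∘_{-∂} g` and `f ∘_0 g` are then one
product `comp`; they differ only in the shift `shiftT` of the first variable of `f`, which is
`-(∂ + λ_1 + ⋯ + λ_N)` for `g` in `P̃^ch` and zero for `g` in `P^ch`.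

*The product.* A function of `m + n` variables is a product of a function `q` of the first `m` variables
and of a function `h` without poles in these (`exists_blockIncl_mul_regIncl`), but not in a unique way.
The value of the defining expression does not depend on the factorization because it is balanced over
the differences `z_i - z_j` of the block, by the sesquilinearity of `f` and `g` (`exists_glue`,
`exists_isComp`). The polynomial in `λ_i - ∂_{z_i}` that occurs in the definition is the value of a
polynomial at commuting operators on maps (`plug_eq_plugL`), so that identities between products can be
proved by induction on polynomials.

*Jacobi.* The product is sequentially associative (`comp_comp_first`) and associative in parallel
(`comp_comp_second`); the latter holds if at least one of the two inserted maps lies in `P^ch`. With the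
equivariance of the product (`comp_act`), `f □ g` is `1 / (m! n!)` times the sum over all permutations,
and in the associator of `□` only those terms survive in which `g` and `k` are inserted in different
arguments of `f` (`inclWV_associator_succ`). So the associator is supersymmetric in its last two
arguments (`box_associator_symm`), and the Jacobi identity follows formally (`bracket_jacobi`). For
three elements of `W` this says that `W` is a Lie superalgebra, and for two elements of `W` and one of
`W̃` that `W` acts on `W̃`.

*The canonical map.* If `n ≥ 1`, then `∂ + λ_1 + ⋯ + λ_n` is a coordinate of the polynomial ring, and it
is killed by the operators `∂/∂λ_j - ∂/∂λ_i`. So a map in `P̃^ch(n)` all of whose values are multiples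
of it is a multiple of a map in `P̃^ch(n)` (`total_smul_injective`, `mem_PT_of_partialMaps_mem`), that is,
the canonical map is injective. The quotient map is compatible with all products (`quotSum_box`). Hence
the bracket induced on `W̃ / ∂W̃` by the action of `W` on `W̃` is mapped to the bracket of `W`, and the
axioms of a Lie superalgebra pass from `W` to `W̃ / ∂W̃` (`isLieSuperalgebra_bracketR`).

*Surjectivity.* The substitution `λ_i ↦ λ_i - (∂ + λ_1 + ⋯ + λ_n) / n` induces a section of the quotient
map on values that commutes with the operators `∂/∂λ_j - ∂/∂λ_i`. It does not respect the action of
`λ_i`, but if `V` is free, then it can be used on the elements of a basis, and the lift is extended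
to all of `V` by the first sesquilinearity condition (`exists_multilinearMap_of_basis`,
`exists_quotV_eq`). Averaging over `S_n` gives the lifts of invariants (`exists_quotV_eq_of_mem_WV`).
-/

set_option linter.unusedSectionVars false

noncomputable section

namespace Chiral

universe u v w

/-! ### Translation invariant functions: induction, derivations, substitutions -/

section Functions

variable {F : Type u} [Field F] {ι κ τ : Type*}

instance (G : SimpleGraph ι) : CommRing (TInv F G) := inferInstance
instance (G : SimpleGraph ι) : AddCommGroup (TInv F G) := inferInstance
instance (G : SimpleGraph ι) : AddCommMonoid (TInv F G) := inferInstance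
instance (G : SimpleGraph ι) : Semiring (TInv F G) := inferInstance
instance (G : SimpleGraph ι) : Algebra F (TInv F G) := inferInstance
instance (G : SimpleGraph ι) : Module F (TInv F G) := inferInstance

theorem tinv_induction {G : SimpleGraph ι} {motive : TInv F G → Prop}
    (sub : ∀ i j, motive (zsub G i j))
    (inv : ∀ i j (x : TInv F G), G.Adj i j → x * zsub G i j = 1 → motive x)
    (const : ∀ r, motive (algebraMap F _ r))
    (add : ∀ x y, motive x → motive y → motive (x + y))
    (mul : ∀ x y, motive x → motive y → motive (x * y)) (p : TInv F G) : motive p := by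
  obtain ⟨p, hp⟩ := p
  refine Algebra.adjoin_induction (p := fun x hx => motive ⟨x, hx⟩) ?_ ?_ ?_ ?_ hp
  · rintro x (⟨i, j, rfl⟩ | ⟨i, j, hij, hx⟩)
    · exact sub i j
    · exact inv i j _ hij (Subtype.ext hx)
  · exact fun r => const r
  · exact fun x y hx hy h1 h2 => add ⟨x, hx⟩ ⟨y, hy⟩ h1 h2
  · exact fun x y hx hy h1 h2 => mul ⟨x, hx⟩ ⟨y, hy⟩ h1 h2

theorem exists_inv_zsub {G : SimpleGraph ι} {i j : ι} (h : G.Adj i j) :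
    ∃ x : TInv F G, x * zsub G i j = 1 := by
  obtain ⟨u, hu⟩ := isUnit_coord_sub (F := F) G i j h
  have hx : (↑u⁻¹ : Conf F G) * (coord G i - coord G j) = 1 := by rw [← hu]; simp
  exact ⟨⟨_, Algebra.subset_adjoin (Or.inr ⟨i, j, h, hx⟩)⟩, Subtype.ext hx⟩

@[simp] theorem substT_zsub {G : SimpleGraph ι} {H : SimpleGraph κ} (φ : G →g H) (i j : ι) :
    substT (F := F) φ (zsub G i j) = zsub H (φ i) (φ j) :=
  Subtype.ext (by simp [substT, zsub, substZ])

theorem zsub_self (G : SimpleGraph ι) (i : ι) : zsub (F := F) G i i = 0 :=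
  Subtype.ext (sub_self _)

theorem tinv_algHom_ext {G : SimpleGraph ι} {B : Type*} [CommRing B] [Algebra F B]
    {f g : TInv F G →ₐ[F] B} (h : ∀ i j, f (zsub G i j) = g (zsub G i j)) : f = g := by
  ext p
  induction p using tinv_induction with
  | sub i j => exact h i j
  | inv i j x _ hx =>
    have h1 := congrArg f hx
    have h2 := congrArg g hx
    rw [map_mul, map_one] at h1 h2
    rw [← h] at h2
    linear_combination (-f x) * h2 + g x * h1
  | const r => simp
  | add x y hx hy => simp [hx, hy]
  | mul x y hx hy => simp [hx, hy]

theorem substT_substT {G : SimpleGraph ι} {H : SimpleGraph κ} {K : SimpleGraph τ} (ψ : H →g K)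
    (φ : G →g H) (p : TInv F G) : substT ψ (substT φ p) = substT (ψ.comp φ) p := by
  have : (substT (F := F) ψ).comp (substT φ) = substT (ψ.comp φ) :=
    tinv_algHom_ext (B := TInv F K) fun i j => by simp
  exact DFunLike.congr_fun this p

theorem substT_eq_self {G : SimpleGraph ι} (φ : G →g G) (hφ : ∀ i, φ i = i) (p : TInv F G) :
    substT φ p = p := by
  have : substT (F := F) φ = AlgHom.id F _ :=
    tinv_algHom_ext (B := TInv F G) fun i j => by simp [hφ]
  exact DFunLike.congr_fun this p

theorem substT_congr {G : SimpleGraph ι} {H : SimpleGraph κ} {φ ψ : G →g H}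
    (h : ∀ i, φ i = ψ i) (p : TInv F G) : substT φ p = substT ψ p := by
  have : φ = ψ := DFunLike.ext _ _ h
  rw [this]

theorem substT_injective {G : SimpleGraph ι} {H : SimpleGraph κ} (φ : G →g H)
    (hφ : Function.Injective φ) : Function.Injective (substT (F := F) φ) := by
  have hd : ∀ {ι : Type _} (G : SimpleGraph ι), diffs F G ≤ nonZeroDivisors _ := fun G => by
    refine Submonoid.closure_le.2 ?_
    rintro _ ⟨i, j, hij, rfl⟩
    refine mem_nonZeroDivisors_of_ne_zero fun h => hij.ne ?_
    exact MvPolynomial.X_injective (sub_eq_zero.1 h)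
  have key : Function.Injective (substZ (F := F) φ) := by
    rw [injective_iff_map_eq_zero]
    intro x hx
    obtain ⟨a, s, rfl⟩ := IsLocalization.exists_mk'_eq (diffs F G) x
    have h1 : algebraMap (MvPolynomial ι F) (Conf F G) a =
        IsLocalization.mk' (Conf F G) a s * algebraMap _ _ (s : MvPolynomial ι F) := by
      rw [IsLocalization.mk'_spec]
    have h2 : substZ φ (algebraMap (MvPolynomial ι F) (Conf F G) a) = 0 := by
      rw [h1, map_mul, hx, zero_mul]
    have h3 : substZ φ (algebraMap (MvPolynomial ι F) (Conf F G) a) =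
        algebraMap (MvPolynomial κ F) (Conf F H) (MvPolynomial.rename φ a) := by
      have : ((substZ (F := F) φ).comp (Algebra.algHom F _ _)) =
          (Algebra.algHom F (MvPolynomial κ F) (Conf F H)).comp (MvPolynomial.rename φ) :=
        MvPolynomial.algHom_ext fun i => by
          rw [AlgHom.comp_apply, AlgHom.comp_apply, MvPolynomial.rename_X]
          exact evalAt_coord (F := F) (G := G) (fun i => coord H (φ i))
            (fun _ _ h => isUnit_coord_sub H _ _ (φ.map_adj h)) i
      exact DFunLike.congr_fun this a
    rw [h3] at h2
    have h4 : MvPolynomial.rename φ a = 0 := by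
      apply IsLocalization.injective (Conf F H) (hd H)
      rw [h2, map_zero]
    have h5 : a = 0 := by
      apply MvPolynomial.rename_injective φ hφ
      rw [h4, map_zero]
    rw [h5, IsLocalization.mk'_zero]
  intro p q h
  exact Subtype.ext (key (congrArg Subtype.val h))

theorem coe_derivT (G : SimpleGraph ι) (k : ι) (p : TInv F G) :
    (derivT G k p : Conf F G) = derivZ G k (p : Conf F G) := rfl

theorem derivT_mul (G : SimpleGraph ι) (k : ι) (p q : TInv F G) :
    derivT G k (p * q) = p * derivT G k q + q * derivT G k p :=
  Subtype.ext (by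
    rw [coe_derivT, Subalgebra.coe_mul, Derivation.leibniz]; rfl)

theorem derivT_algebraMap (G : SimpleGraph ι) (k : ι) (r : F) :
    derivT G k (algebraMap F (TInv F G) r) = 0 :=
  Subtype.ext (by rw [coe_derivT]; exact Derivation.map_algebraMap _ r)

open Classical in
theorem derivT_zsub (G : SimpleGraph ι) (k i j : ι) :
    derivT (F := F) G k (zsub G i j) =
      algebraMap F _ ((if i = k then 1 else 0) - (if j = k then 1 else 0)) := by
  refine Subtype.ext ?_
  rw [coe_derivT]
  by_cases h : i = k <;> by_cases h' : j = k <;> simp [derivZ, shiftZ, h, h', zsub]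

/-- Two derivations along an algebra homomorphism agree if they agree on the differences
`z_i - z_j`. -/
theorem derivation_ext {G : SimpleGraph ι} {B : Type*} [CommRing B] [Algebra F B]
    (R : TInv F G →ₐ[F] B) (D D' : TInv F G →ₗ[F] B)
    (h : ∀ p q, D (p * q) = R p * D q + R q * D p)
    (h' : ∀ p q, D' (p * q) = R p * D' q + R q * D' p)
    (hz : ∀ i j, D (zsub G i j) = D' (zsub G i j)) (p : TInv F G) : D p = D' p := by
  have one : ∀ D : TInv F G →ₗ[F] B, (∀ p q, D (p * q) = R p * D q + R q * D p) → D 1 = 0 :=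
    fun D h => by
      have := h 1 1
      rw [mul_one, map_one R, one_mul] at this
      exact left_eq_add.1 this
  induction p using tinv_induction with
  | sub i j => exact hz i j
  | inv i j x _ hx =>
    have h1 := h x (zsub G i j)
    have h2 := h' x (zsub G i j)
    rw [hx, one _ h] at h1
    rw [hx, one _ h', ← hz] at h2
    have h3 : R x * R (zsub G i j) = 1 := by rw [← map_mul, hx, map_one]
    linear_combination R x * h2 - R x * h1 - (D x - D' x) * h3
  | const r => rw [Algebra.algebraMap_eq_smul_one, map_smul, map_smul, one _ h, one _ h']
  | add x y hx hy => rw [map_add, map_add, hx, hy]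
  | mul x y hx hy => rw [h, h', hx, hy]

theorem derivT_comm (G : SimpleGraph ι) (k l : ι) (p : TInv F G) :
    derivT G k (derivT G l p) = derivT G l (derivT G k p) := by
  let D : TInv F G →ₗ[F] TInv F G :=
    { toFun := fun p => derivT G k (derivT G l p) - derivT G l (derivT G k p)
      map_add' := fun p q => by simp only [map_add]; ring
      map_smul' := fun c p => by
        simp only [map_smul, RingHom.id_apply]
        exact (smul_sub c _ _).symm }
  have := derivation_ext (B := TInv F G) (AlgHom.id F (TInv F G)) D 0
    (fun p q => by
      change derivT G k (derivT G l (p * q)) - derivT G l (derivT G k (p * q)) =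
        p * (derivT G k (derivT G l q) - derivT G l (derivT G k q)) +
          q * (derivT G k (derivT G l p) - derivT G l (derivT G k p))
      simp only [derivT_mul, map_add]
      ring) (fun p q => by simp only [LinearMap.zero_apply, mul_zero, add_zero])
    (fun i j => by
      change derivT G k (derivT G l (zsub G i j)) - derivT G l (derivT G k (zsub G i j)) = 0
      rw [derivT_zsub, derivT_zsub, derivT_algebraMap, derivT_algebraMap]
      exact sub_zero 0) p
  exact sub_eq_zero.1 this

open Classical in
/-- The chain rule for the substitution `z_i ↦ z_{φ i}`. -/
theorem derivT_substT [Fintype ι] {G : SimpleGraph ι} {H : SimpleGraph κ} (φ : G →g H) (k : κ)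
    (p : TInv F G) :
    derivT H k (substT φ p) = ∑ i, if φ i = k then substT φ (derivT G i p) else 0 := by
  have := derivation_ext (B := TInv F H) (substT (F := F) φ) (derivT H k ∘ₗ (substT φ).toLinearMap)
    (∑ i, if φ i = k then (substT φ).toLinearMap ∘ₗ derivT G i else 0)
    (fun p q => by simp [derivT_mul])
    (fun p q => by
      simp only [LinearMap.coe_sum, Finset.sum_apply, Finset.mul_sum, ← Finset.sum_add_distrib]
      refine Finset.sum_congr rfl fun i _ => ?_
      split_ifs <;> simp [derivT_mul])
    (fun i j => by
      have h : ∀ x : ι, ((if φ x = k then (substT (F := F) φ).toLinearMap ∘ₗ derivT G x else 0) :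
          TInv F G →ₗ[F] TInv F H) (zsub G i j) =
          (if φ x = k then algebraMap F _ ((if i = x then 1 else 0) - (if j = x then 1 else 0))
            else 0) := fun x => by
        split_ifs <;> simp [derivT_zsub, -map_sub, *]
      simp only [LinearMap.coe_sum, Finset.sum_apply, h, LinearMap.comp_apply,
        AlgHom.toLinearMap_apply, substT_zsub, derivT_zsub]
      have h2 : ∀ x : ι, (if φ x = k then algebraMap F (TInv F H)
            ((if i = x then 1 else 0) - (if j = x then 1 else 0)) else 0) =
          algebraMap F (TInv F H) ((if i = x then if φ i = k then 1 else 0 else 0) -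
            (if j = x then if φ j = k then 1 else 0 else 0)) := fun x => by
        by_cases h1 : i = x <;> by_cases h2 : j = x <;> subst_vars <;> simp <;> split_ifs <;> simp_all
      simp only [h2, ← map_sum, Finset.sum_sub_distrib, Finset.sum_ite_eq, Finset.mem_univ,
        if_true]) p
  have h3 : ∀ x : ι, ((if φ x = k then (substT (F := F) φ).toLinearMap ∘ₗ derivT G x else 0) :
          TInv F G →ₗ[F] TInv F H) p = if φ x = k then substT φ (derivT G x p) else 0 := fun x => by
    split_ifs <;> rfl
  simpa only [LinearMap.coe_sum, Finset.sum_apply, h3, LinearMap.comp_apply,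
        AlgHom.toLinearMap_apply] using this

theorem derivT_substT_of_fiber [Finite ι] {G : SimpleGraph ι} {H : SimpleGraph κ} (φ : G →g H)
    {k : κ} {i : ι} (hi : φ i = k) (h : ∀ j, φ j = k → j = i) (p : TInv F G) :
    derivT H k (substT φ p) = substT φ (derivT G i p) := by
  classical
  cases nonempty_fintype ι
  rw [derivT_substT, Finset.sum_eq_single i]
  · simp [hi]
  · intro j _ hj
    rw [if_neg (fun h' => hj (h j h'))]
  · simp

theorem derivT_substT_of_injective [Finite ι] {G : SimpleGraph ι} {H : SimpleGraph κ} (φ : G →g H)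
    (hφ : Function.Injective φ) (i : ι) (p : TInv F G) :
    derivT H (φ i) (substT φ p) = substT φ (derivT G i p) :=
  derivT_substT_of_fiber φ rfl (fun _ h => hφ h) p

theorem derivT_substT_of_notMem [Finite ι] {G : SimpleGraph ι} {H : SimpleGraph κ} (φ : G →g H)
    (k : κ) (hk : ∀ i, φ i ≠ k) (p : TInv F G) : derivT H k (substT φ p) = 0 := by
  classical
  cases nonempty_fintype ι
  rw [derivT_substT]
  exact Finset.sum_eq_zero fun i _ => if_neg (hk i)

/-- An isomorphism of index sets as a homomorphism of complete graphs. -/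
def equivHom (e : ι ≃ κ) : (⊤ : SimpleGraph ι) →g (⊤ : SimpleGraph κ) where
  toFun := e
  map_rel' h := by simpa using h

@[simp] theorem equivHom_apply (e : ι ≃ κ) (i : ι) : equivHom e i = e i := rfl

theorem derivT_equiv [Finite ι] (e : ι ≃ κ) (i : ι) (p : TInv F (⊤ : SimpleGraph ι)) :
    derivT ⊤ (e i) (substT (equivHom e) p) = substT (equivHom e) (derivT ⊤ i p) :=
  derivT_substT_of_injective (equivHom e) e.injective i p

end Functions

/-! ### Functions with prescribed poles on a block -/

section Block

variable {F : Type u} [Field F]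

@[simp] theorem collapse_castAdd (m n : ℕ) (i : Fin m) : collapse m n (Fin.castAdd n i) = 0 := by
  simp [collapse]

@[simp] theorem collapse_natAdd (m n : ℕ) (j : Fin n) :
    collapse m n (Fin.natAdd m j) = j.succ := by
  simp [collapse]

/-- The contraction of the block as a homomorphism of graphs. -/
def collapseHom (m n : ℕ) : regGraph m n →g (⊤ : SimpleGraph (Fin (n + 1))) :=
  ⟨collapse m n, fun h => h⟩

/-- The inclusion of the block as a homomorphism of complete graphs. -/
def castAddHom (m n : ℕ) : (⊤ : SimpleGraph (Fin m)) →g (⊤ : SimpleGraph (Fin (m + n))) :=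
  ⟨Fin.castAdd n, fun h => by simpa using h⟩

/-- The inclusion of `regGraph m n` in the complete graph. -/
def regHom (m n : ℕ) : regGraph m n →g (⊤ : SimpleGraph (Fin (m + n))) :=
  ⟨id, fun {a b} h => by
    rintro rfl
    exact (regGraph m n).loopless.irrefl _ h⟩

@[simp] theorem collapseHom_apply (m n : ℕ) (i) : collapseHom m n i = collapse m n i := rfl

@[simp] theorem castAddHom_apply (m n : ℕ) (i) : castAddHom m n i = Fin.castAdd n i := rfl

@[simp] theorem regHom_apply (m n : ℕ) (i) : regHom m n i = i := rfl

theorem specialize_eq (m n : ℕ) : specialize (F := F) m n = substT (collapseHom m n) := rfl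

theorem blockIncl_eq (m n : ℕ) : blockIncl (F := F) m n = substT (castAddHom m n) := rfl

theorem regIncl_eq (m n : ℕ) : regIncl (F := F) m n = substT (regHom m n) := rfl

@[simp] theorem specialize_zsub (m n : ℕ) (i j : Fin (m + n)) :
    specialize (F := F) m n (zsub _ i j) = zsub ⊤ (collapse m n i) (collapse m n j) := by
  rw [specialize_eq, substT_zsub, collapseHom_apply, collapseHom_apply]

@[simp] theorem regIncl_zsub (m n : ℕ) (i j : Fin (m + n)) :
    regIncl (F := F) m n (zsub _ i j) = zsub ⊤ i j := by
  rw [regIncl_eq, substT_zsub, regHom_apply, regHom_apply]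

@[simp] theorem blockIncl_zsub (m n : ℕ) (i j : Fin m) :
    blockIncl (F := F) m n (zsub _ i j) = zsub ⊤ (Fin.castAdd n i) (Fin.castAdd n j) := by
  rw [blockIncl_eq, substT_zsub, castAddHom_apply, castAddHom_apply]

theorem regIncl_injective (m n : ℕ) : Function.Injective (regIncl (F := F) m n) :=
  substT_injective (regHom m n) fun _ _ h => h

theorem derivT_regIncl (m n : ℕ) (i : Fin (m + n)) (h : ORegular F m n) :
    derivT ⊤ i (regIncl m n h) = regIncl m n (derivT _ i h) :=
  derivT_substT_of_injective (regHom m n) (fun _ _ h => h) i h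

theorem derivT_castAdd_blockIncl (m n : ℕ) (i : Fin m) (q : O F m) :
    derivT ⊤ (Fin.castAdd n i) (blockIncl m n q) = blockIncl m n (derivT _ i q) :=
  derivT_substT_of_injective (castAddHom m n) (Fin.castAdd_injective m n) i q

theorem derivT_natAdd_blockIncl (m n : ℕ) (j : Fin n) (q : O F m) :
    derivT ⊤ (Fin.natAdd m j) (blockIncl m n q) = 0 :=
  derivT_substT_of_notMem (castAddHom m n) _ (fun i h => by
    have := congrArg Fin.val h
    have h2 := i.2
    simp at this
    omega) q

theorem derivT_zero_specialize (m n : ℕ) (h : ORegular F m n) :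
    derivT ⊤ 0 (specialize m n h) =
      ∑ i : Fin m, specialize m n (derivT _ (Fin.castAdd n i) h) := by
  classical
  rw [specialize_eq, derivT_substT, Fin.sum_univ_add]
  simp

theorem derivT_succ_specialize (m n : ℕ) (j : Fin n) (h : ORegular F m n) :
    derivT ⊤ j.succ (specialize m n h) = specialize m n (derivT _ (Fin.natAdd m j) h) := by
  classical
  rw [specialize_eq, derivT_substT, Fin.sum_univ_add]
  simp [(Fin.succ_ne_zero j).symm]

/-- If the edges of `G'` that are not edges of `G` lie in a block of `m` variables, then every
function with poles along `G'` has poles along `G` only after multiplication by some function `d` of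
the variables in the block, which is a product of differences `z_i - z_j` and in particular
invertible. -/
theorem exists_denominator_of_hom {κ : Type*} {m : ℕ} {G G' : SimpleGraph κ}
    (φ : (⊤ : SimpleGraph (Fin m)) →g G') (ψ : G →g G') (hψ : ∀ i, ψ i = i)
    (hG : ∀ i j, G'.Adj i j → G.Adj i j ∨ ∃ i' j', i' ≠ j' ∧ i = φ i' ∧ j = φ j')
    (x : TInv F G') :
    ∃ d ∈ Submonoid.closure {y : O F m | ∃ i j, i ≠ j ∧ y = zsub ⊤ i j}, ∃ h : TInv F G,
      substT φ d * x = substT ψ h := by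
  have hreg : ∀ d ∈ Submonoid.closure {y : O F m | ∃ i j, i ≠ j ∧ y = zsub ⊤ i j},
      ∃ h : TInv F G, substT φ d = substT ψ h := fun d hd => by
    induction hd using Submonoid.closure_induction with
    | mem x hx =>
      obtain ⟨i, j, _, rfl⟩ := hx
      exact ⟨zsub _ (φ i) (φ j), by simp [hψ]⟩
    | one => exact ⟨1, by simp⟩
    | mul x y _ _ hx hy =>
      obtain ⟨h, hx⟩ := hx
      obtain ⟨h', hy⟩ := hy
      exact ⟨h * h', by rw [map_mul, map_mul, hx, hy]⟩
  induction x using tinv_induction with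
  | sub i j => exact ⟨1, one_mem _, zsub _ i j, by simp [hψ]⟩
  | inv i j x hij hx =>
    obtain hadj | ⟨i', j', hij', rfl, rfl⟩ := hG i j hij
    · obtain ⟨y, hy⟩ := exists_inv_zsub (F := F) hadj
      refine ⟨1, one_mem _, y, ?_⟩
      have := congrArg (substT ψ) hy
      rw [map_mul, map_one, substT_zsub, hψ, hψ] at this
      rw [map_one, one_mul]
      linear_combination substT ψ y * hx - x * this
    · refine ⟨zsub ⊤ i' j', Submonoid.subset_closure ⟨i', j', hij', rfl⟩, 1, ?_⟩
      rw [substT_zsub, map_one, mul_comm, hx]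
  | const r => exact ⟨1, one_mem _, algebraMap F _ r, by simp⟩
  | add x y hx hy =>
    obtain ⟨d, hd, h, hx⟩ := hx
    obtain ⟨d', hd', h', hy⟩ := hy
    obtain ⟨e, he⟩ := hreg d hd
    obtain ⟨e', he'⟩ := hreg d' hd'
    refine ⟨d * d', mul_mem hd hd', e' * h + e * h', ?_⟩
    rw [map_mul, map_add, map_mul, map_mul, ← hx, ← hy, ← he, ← he']
    ring
  | mul x y hx hy =>
    obtain ⟨d, hd, h, hx⟩ := hx
    obtain ⟨d', hd', h', hy⟩ := hy
    refine ⟨d * d', mul_mem hd hd', h * h', ?_⟩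
    rw [map_mul, map_mul, ← hx, ← hy]
    ring

theorem exists_denominator (m n : ℕ) (x : O F (m + n)) :
    ∃ d ∈ Submonoid.closure {y : O F m | ∃ i j, i ≠ j ∧ y = zsub ⊤ i j}, ∃ h : ORegular F m n,
      blockIncl m n d * x = regIncl m n h := by
  refine exists_denominator_of_hom (castAddHom m n) (regHom m n) (fun _ => rfl) (fun i j hij => ?_) x
  rw [or_iff_not_imp_right]
  intro hb
  change collapse m n i ≠ collapse m n j
  intro h
  apply hij.ne
  revert hb h
  refine Fin.addCases (fun i' => ?_) (fun i' => ?_) i <;>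
    refine Fin.addCases (fun j' => ?_) (fun j' => ?_) j <;> intro hb h
  · by_contra hne
    exact hb ⟨i', j', fun h => hne (by rw [h]), rfl, rfl⟩
  · simp [(Fin.succ_ne_zero j').symm] at h
  · simp at h
  · simp at h; rw [h]

theorem exists_inv_of_mem_closure {m : ℕ} {d : O F m}
    (hd : d ∈ Submonoid.closure {y : O F m | ∃ i j, i ≠ j ∧ y = zsub ⊤ i j}) :
    ∃ e, e * d = 1 := by
  induction hd using Submonoid.closure_induction with
  | mem x hx =>
    obtain ⟨i, j, hij, rfl⟩ := hx
    exact exists_inv_zsub (by simpa using hij)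
  | one => exact ⟨1, one_mul _⟩
  | mul x y _ _ hx hy =>
    obtain ⟨e, he⟩ := hx
    obtain ⟨e', he'⟩ := hy
    exact ⟨e * e', by linear_combination e' * y * he + he'⟩

/-- Every function is the product of a function of the first `m` variables and of a function that is
regular on the block of these variables. -/
theorem exists_blockIncl_mul_regIncl (m n : ℕ) (x : O F (m + n)) :
    ∃ (q : O F m) (h : ORegular F m n), x = blockIncl m n q * regIncl m n h := by
  obtain ⟨d, hd, h, hx⟩ := exists_denominator m n x
  obtain ⟨e, he⟩ := exists_inv_of_mem_closure hd
  refine ⟨e, h, ?_⟩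
  rw [← hx, ← mul_assoc, ← map_mul, he, map_one, one_mul]

/-- A bilinear map on pairs of a function of the first `m` variables and a function regular on the
block, balanced over the differences in the block, is induced by a linear map on all functions. -/
theorem exists_glue (m n : ℕ) {Y : Type*} [AddCommGroup Y] [Module F Y]
    (B : O F m →ₗ[F] ORegular F m n →ₗ[F] Y)
    (hB : ∀ i j q h, B (zsub ⊤ i j * q) h =
      B q (zsub _ (Fin.castAdd n i) (Fin.castAdd n j) * h)) :
    ∃ L : O F (m + n) →ₗ[F] Y, ∀ q h, L (blockIncl m n q * regIncl m n h) = B q h := by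
  set M := Submonoid.closure {y : O F m | ∃ i j, i ≠ j ∧ y = zsub ⊤ i j} with hM
  have bal : ∀ d ∈ M, ∃ d' : ORegular F m n, regIncl m n d' = blockIncl m n d ∧
      ∀ q h, B (d * q) h = B q (d' * h) := fun d hd => by
    induction hd using Submonoid.closure_induction with
    | mem x hx =>
      obtain ⟨i, j, _, rfl⟩ := hx
      exact ⟨zsub _ (Fin.castAdd n i) (Fin.castAdd n j), by simp, fun q h => hB i j q h⟩
    | one => exact ⟨1, by simp, by simp⟩
    | mul x y _ _ hx hy =>
      obtain ⟨x', hx, hx'⟩ := hx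
      obtain ⟨y', hy, hy'⟩ := hy
      exact ⟨x' * y', by rw [map_mul, map_mul, hx, hy], fun q h => by
        rw [mul_assoc, hx', hy', ← mul_assoc, mul_comm y']⟩
  -- the value at `q * h` depends on this product only
  have wd : ∀ q h q' h', blockIncl m n q * regIncl m n h = blockIncl m n q' * regIncl m n h' →
      B q h = B q' h' := by
    intro q h q' h' heq
    -- `q` and `q'` have a common denominator
    have hden : ∀ q : O F m, ∃ d ∈ M, ∃ r : ORegular F m n, regIncl m n r = blockIncl m n (d * q) ∧
        ∃ e : O F m, e * d = 1 ∧ ∀ h, B q h = B e (r * h) := by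
      intro q
      have hq : ∃ d ∈ M, ∃ r : ORegular F m n, regIncl m n r = blockIncl m n (d * q) ∧
          ∀ a h, B (d * q * a) h = B a (r * h) := by
        induction q using tinv_induction with
        | sub i j =>
          exact ⟨1, one_mem _, zsub _ (Fin.castAdd n i) (Fin.castAdd n j), by simp,
            fun a h => by rw [one_mul, hB]⟩
        | inv i j x hij hx =>
          refine ⟨zsub ⊤ i j, Submonoid.subset_closure ⟨i, j, by simpa using hij, rfl⟩, 1, ?_, ?_⟩
          · rw [mul_comm, hx, map_one, map_one]
          · intro a h
            rw [mul_comm (zsub ⊤ i j), hx, one_mul, one_mul]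
        | const r =>
          refine ⟨1, one_mem _, algebraMap F _ r, by simp, fun a h => ?_⟩
          rw [one_mul, ← Algebra.smul_def, ← Algebra.smul_def, map_smul, map_smul,
            LinearMap.smul_apply]
        | add x y hx hy =>
          obtain ⟨d, hd, r, hr, hx⟩ := hx
          obtain ⟨d', hd', r', hr', hy⟩ := hy
          obtain ⟨s, hs, hs'⟩ := bal d hd
          obtain ⟨s', hs1, hs1'⟩ := bal d' hd'
          refine ⟨d * d', mul_mem hd hd', s' * r + s * r', ?_, ?_⟩
          · rw [map_add, map_mul, map_mul, hr, hr', hs, hs1, ← map_mul, ← map_mul, ← map_add]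
            congr 1; ring
          · intro a h
            have : d * d' * (x + y) * a = d' * (d * x * a) + d * (d' * y * a) := by ring
            rw [this, map_add, LinearMap.add_apply, hs', hs1', hx, hy, ← map_add]
            congr 1; ring
        | mul x y hx hy =>
          obtain ⟨d, hd, r, hr, hx⟩ := hx
          obtain ⟨d', hd', r', hr', hy⟩ := hy
          refine ⟨d * d', mul_mem hd hd', r * r', ?_, ?_⟩
          · rw [map_mul, hr, hr', ← map_mul]
            congr 1; ring
          · intro a h
            have : d * d' * (x * y) * a = d * x * (d' * y * a) := by ring
            rw [this, hx, hy]
            congr 1; ring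
      obtain ⟨d, hd, r, hr, hr'⟩ := hq
      obtain ⟨e, he⟩ := exists_inv_of_mem_closure hd
      refine ⟨d, hd, r, hr, e, he, fun h => ?_⟩
      rw [← hr']
      congr 2
      linear_combination (-q) * he
    obtain ⟨d, hd, r, hr, e, he, hqe⟩ := hden q
    obtain ⟨d', hd', r', hr', e', he', hqe'⟩ := hden q'
    obtain ⟨s, hs, hs'⟩ := bal d hd
    obtain ⟨s', hs1, hs1'⟩ := bal d' hd'
    rw [hqe, hqe']
    have h1 : e = d' * (e * e') := by linear_combination (-e) * he'
    have h2 : e' = d * (e * e') := by linear_combination (-e') * he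
    conv_lhs => rw [h1]
    conv_rhs => rw [h2]
    rw [hs', hs1']
    congr 1
    apply regIncl_injective
    simp only [map_mul, hs, hs1, hr, hr']
    linear_combination blockIncl m n d * blockIncl m n d' * heq
  choose Q H hQH using exists_blockIncl_mul_regIncl (F := F) m n
  -- the pairs of a fixed denominator are closed under addition
  have hval : ∀ q h, B (Q (blockIncl m n q * regIncl m n h)) (H (blockIncl m n q * regIncl m n h)) =
      B q h := fun q h => wd _ _ _ _ (hQH _).symm
  refine ⟨{ toFun := fun x => B (Q x) (H x), map_add' := ?_, map_smul' := ?_ }, hval⟩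
  · intro x y
    obtain ⟨d, hd, h, hx⟩ := exists_denominator m n x
    obtain ⟨d', hd', h', hy⟩ := exists_denominator m n y
    obtain ⟨e, he⟩ := exists_inv_of_mem_closure (mul_mem hd hd')
    obtain ⟨s, hs, hs'⟩ := bal d hd
    obtain ⟨s', hs1, hs1'⟩ := bal d' hd'
    have he2 : blockIncl m n e * (blockIncl m n d * blockIncl m n d') = 1 := by
      rw [← map_mul, ← map_mul, he, map_one]
    have ex : x = blockIncl m n e * regIncl m n (s' * h) := by
      rw [map_mul, hs1, ← hx]; linear_combination (-x) * he2
    have ey : y = blockIncl m n e * regIncl m n (s * h') := by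
      rw [map_mul, hs, ← hy]; linear_combination (-y) * he2
    have exy : x + y = blockIncl m n e * regIncl m n (s' * h + s * h') := by
      rw [map_add, mul_add, ← ex, ← ey]
    rw [wd _ _ _ _ ((hQH (x + y)).symm.trans exy), wd _ _ _ _ ((hQH x).symm.trans ex),
      wd _ _ _ _ ((hQH y).symm.trans ey), map_add]
  · intro c x
    have : c • x = blockIncl m n (Q x) * regIncl m n (c • H x) := by
      rw [map_smul, mul_smul_comm, ← hQH x]
    rw [wd _ _ _ _ ((hQH (c • x)).symm.trans this), map_smul, RingHom.id_apply]

theorem blockIncl_ext (m n : ℕ) {Y : Type*} [AddCommGroup Y] [Module F Y]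
    {L L' : O F (m + n) →ₗ[F] Y}
    (h : ∀ q h, L (blockIncl m n q * regIncl m n h) = L' (blockIncl m n q * regIncl m n h)) :
    L = L' := by
  ext x
  obtain ⟨q, r, rfl⟩ := exists_blockIncl_mul_regIncl m n x
  exact h q r

end Block

/-! ### Values: polynomials, their quotients and the maps between them -/

section Values

variable {F : Type u} {V : Type v} [Field F] [AddCommGroup V] [Module F V] [Module F[X] V]
  [IsScalarTower F F[X] V] {ι κ : Type*}

theorem pol_C_mul (a : F[X]) (p : A F ι) (v : V) :
    (pol (MvPolynomial.C a * p) v : PolV F V ι) = pol p (a • v) := by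
  rw [← MvPolynomial.smul_eq_C_mul]
  exact TensorProduct.smul_tmul a p v

theorem pol_add_left (p q : A F ι) (v : V) :
    (pol (p + q) v : PolV F V ι) = pol p v + pol q v := TensorProduct.add_tmul p q v

theorem pol_add_right (p : A F ι) (v w : V) :
    (pol p (v + w) : PolV F V ι) = pol p v + pol p w := TensorProduct.tmul_add p v w

theorem pol_zero_right (p : A F ι) : (pol p 0 : PolV F V ι) = 0 := TensorProduct.tmul_zero V p

theorem pol_smul_right (p : A F ι) (c : F) (v : V) :
    (pol p (c • v) : PolV F V ι) = c • pol p v := TensorProduct.tmul_smul c p v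

theorem polynomial_smul_pol (a : F[X]) (p : A F ι) (v : V) :
    a • (pol p v : PolV F V ι) = pol p (a • v) := (TensorProduct.tmul_smul a p v).symm

theorem C_smul_polV (a : F[X]) (x : PolV F V ι) :
    (MvPolynomial.C a : A F ι) • x = a • x := by
  induction x using pol_induction with
  | zero => simp
  | pol p v => rw [smul_pol, pol_C_mul, polynomial_smul_pol]
  | add x y hx hy => rw [smul_add, smul_add, hx, hy]

/-- Induction on values: they are generated by constants under multiplication by the variables. -/
theorem polV_induction {motive : PolV F V ι → Prop} (const : ∀ v, motive (pol 1 v))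
    (mulX : ∀ i x, motive x → motive ((MvPolynomial.X i : A F ι) • x))
    (add : ∀ x y, motive x → motive y → motive (x + y)) (x : PolV F V ι) : motive x := by
  induction x using pol_induction with
  | zero => rw [← pol_zero_right 1]; exact const 0
  | add x y hx hy => exact add x y hx hy
  | pol p v =>
    induction p using MvPolynomial.induction_on generalizing v with
    | C a => rw [← mul_one (MvPolynomial.C a), pol_C_mul]; exact const _
    | add p q hp hq => rw [pol_add_left]; exact add _ _ (hp v) (hq v)
    | mul_X p i hp => rw [mul_comm, ← smul_pol]; exact mulX i _ (hp v)

@[simp] theorem substL_pol (φ : A F ι →ₐ[F[X]] A F κ) (p : A F ι) (v : V) :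
    substL V φ (pol p v) = pol (φ p) v := rfl

theorem substL_substL {τ : Type*} (φ : A F ι →ₐ[F[X]] A F κ) (ψ : A F κ →ₐ[F[X]] A F τ)
    (x : PolV F V ι) : substL V ψ (substL V φ x) = substL V (ψ.comp φ) x := by
  induction x using pol_induction with
  | zero => simp
  | pol p v => rfl
  | add x y hx hy => simp only [map_add, hx, hy]

theorem diffL_pol_one (n : ℕ) (i j : Fin n) (v : V) : diffL F V n i j (pol 1 v) = 0 := by
  have h : ∀ k : Fin n, MvPolynomial.pderiv k (1 : A F (Fin n)) = 0 := fun k =>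
    Derivation.map_one_eq_zero _
  rw [diffL, polMap_pol, LinearMap.sub_apply, Derivation.coeFn_coe, Derivation.coeFn_coe, h, h,
    sub_zero]
  exact TensorProduct.zero_tmul _ v

theorem diffL_smul (n : ℕ) (i j : Fin n) (a : A F (Fin n)) (x : PolV F V (Fin n)) :
    diffL F V n i j (a • x) =
      (MvPolynomial.pderiv j a - MvPolynomial.pderiv i a) • x + a • diffL F V n i j x := by
  induction x using pol_induction with
  | zero => simp
  | add x y hx hy => simp only [smul_add, map_add, hx, hy]; abel
  | pol p v =>
    simp only [diffL, smul_pol, polMap_pol, LinearMap.sub_apply, Derivation.coeFn_coe,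
      smul_eq_mul, Derivation.leibniz, ← pol_add_left]
    congr 1
    ring

/-- The chain rule for the operators `∂/∂λ_j - ∂/∂λ_i`. -/
theorem diffL_substL {n n' : ℕ} (φ : A F (Fin n) →ₐ[F[X]] A F (Fin n')) (i j : Fin n')
    (i' j' : Fin n)
    (h : ∀ k, MvPolynomial.pderiv j (φ (MvPolynomial.X k)) -
        MvPolynomial.pderiv i (φ (MvPolynomial.X k)) =
      φ (MvPolynomial.pderiv j' (MvPolynomial.X k) - MvPolynomial.pderiv i' (MvPolynomial.X k)))
    (x : PolV F V (Fin n)) :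
    diffL F V n' i j (substL V φ x) = substL V φ (diffL F V n i' j' x) := by
  induction x using polV_induction with
  | const v => rw [substL_pol, map_one, diffL_pol_one, diffL_pol_one, map_zero]
  | mulX k x hx => rw [substL_smul, diffL_smul, diffL_smul, map_add, substL_smul, substL_smul, hx, h]
  | add x y hx hy => simp only [map_add, hx, hy]

theorem coeffs_X_smul (i : ι) (x : PolV F V ι) :
    coeffs ((MvPolynomial.X i : A F ι) • x) =
      Finsupp.mapDomain (· + Finsupp.single i 1) (coeffs x) := by
  classical
  have hinj : Function.Injective (fun α : ι →₀ ℕ => α + Finsupp.single i 1) :=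
    add_left_injective _
  induction x using pol_induction with
  | zero => simp
  | add x y hx hy => simp only [smul_add, map_add, hx, hy, Finsupp.mapDomain_add]
  | pol p v =>
    ext α
    rw [smul_pol, coeffs_pol, mul_comm, MvPolynomial.coeff_mul_X']
    split_ifs with h
    · have h1 : α = (α - Finsupp.single i 1) + Finsupp.single i 1 := by
        rw [tsub_add_cancel_of_le]
        rw [Finsupp.single_le_iff]
        exact Nat.one_le_iff_ne_zero.2 (Finsupp.mem_support_iff.1 h)
      conv_rhs => rw [h1]
      rw [Finsupp.mapDomain_apply hinj, coeffs_pol]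
    · rw [zero_smul, Finsupp.mapDomain_of_notMem_range]
      rintro ⟨β, rfl⟩
      simp at h

theorem coeffs_pol_one (v : V) : coeffs (pol 1 v : PolV F V ι) = Finsupp.single 0 v := by
  classical
  ext α
  rw [coeffs_pol, MvPolynomial.coeff_one, Finsupp.single_apply]
  split_ifs <;> simp

variable (F V) in
/-- The values of maps in `P^ch(n)` (for `b = true`) and in `P̃^ch(n)` (for `b = false`). -/
def Val : Bool → ℕ → Type (max u v)
  | true, n => QuotV F V n
  | false, n => PolV F V (Fin n)

instance Val.instAddCommGroup : ∀ b n, AddCommGroup (Val F V b n)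
  | true, n => inferInstanceAs (AddCommGroup (QuotV F V n))
  | false, n => inferInstanceAs (AddCommGroup (PolV F V (Fin n)))

instance Val.instModuleA : ∀ b n, Module (A F (Fin n)) (Val F V b n)
  | true, n => inferInstanceAs (Module (A F (Fin n)) (QuotV F V n))
  | false, n => inferInstanceAs (Module (A F (Fin n)) (PolV F V (Fin n)))

instance Val.instModule : ∀ b n, Module F (Val F V b n)
  | true, n => inferInstanceAs (Module F (QuotV F V n))
  | false, n => inferInstanceAs (Module F (PolV F V (Fin n)))

instance Val.instSMulCommClass : ∀ b n, SMulCommClass (A F (Fin n)) F (Val F V b n)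
  | true, n => inferInstanceAs (SMulCommClass (A F (Fin n)) F (QuotV F V n))
  | false, n => inferInstanceAs (SMulCommClass (A F (Fin n)) F (PolV F V (Fin n)))

variable (F V) in
/-- The value represented by a polynomial. -/
def proj : ∀ b n, PolV F V (Fin n) →ₗ[F] Val F V b n
  | true, n => toQuot F V n
  | false, _ => LinearMap.id

theorem proj_smul (b : Bool) (n : ℕ) (a : A F (Fin n)) (x : PolV F V (Fin n)) :
    proj F V b n (a • x) = a • proj F V b n x := by
  cases b <;> rfl

theorem proj_surjective (b : Bool) (n : ℕ) : Function.Surjective (proj F V b n) := by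
  cases b
  · exact fun x => ⟨x, rfl⟩
  · intro x
    obtain ⟨y, hy⟩ := Submodule.mkQ_surjective (totalRange F V n) x
    exact ⟨y, hy⟩

theorem proj_total (n : ℕ) (x : PolV F V (Fin n)) :
    proj F V true n (total F (Fin n) • x) = 0 := toQuot_total F V n x

/-- A linear map on representatives of values, as a linear map on values. -/
def valLift {Y : Type*} [AddCommGroup Y] [Module F Y] {n : ℕ} : ∀ (b : Bool)
    (T : PolV F V (Fin n) →ₗ[F] Y) (_ : b = true → ∀ x, T (total F (Fin n) • x) = 0),
    Val F V b n →ₗ[F] Y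
  | true, T, hT => quotLift T (hT rfl)
  | false, T, _ => T

@[simp] theorem valLift_proj {Y : Type*} [AddCommGroup Y] [Module F Y] {n : ℕ} (b : Bool)
    (T : PolV F V (Fin n) →ₗ[F] Y) (hT : b = true → ∀ x, T (total F (Fin n) • x) = 0)
    (x : PolV F V (Fin n)) : valLift b T hT (proj F V b n x) = T x := by
  cases b <;> rfl

/-- The map of values induced by a substitution of the variables. -/
def valMap (b b' : Bool) {n n' : ℕ} (φ : A F (Fin n) →ₐ[F[X]] A F (Fin n'))
    (h : b = true → ∀ y : PolV F V (Fin n'), proj F V b' n' (φ (total F (Fin n)) • y) = 0) :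
    Val F V b n →ₗ[F] Val F V b' n' :=
  valLift b (proj F V b' n' ∘ₗ substL V φ) fun hb x => by
    rw [LinearMap.comp_apply, substL_smul, h hb]

@[simp] theorem valMap_proj (b b' : Bool) {n n' : ℕ} (φ : A F (Fin n) →ₐ[F[X]] A F (Fin n'))
    (h : b = true → ∀ y : PolV F V (Fin n'), proj F V b' n' (φ (total F (Fin n)) • y) = 0)
    (x : PolV F V (Fin n)) :
    valMap b b' φ h (proj F V b n x) = proj F V b' n' (substL V φ x) := valLift_proj _ _ _ _

theorem valMap_smul (b b' : Bool) {n n' : ℕ} (φ : A F (Fin n) →ₐ[F[X]] A F (Fin n'))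
    (h : b = true → ∀ y : PolV F V (Fin n'), proj F V b' n' (φ (total F (Fin n)) • y) = 0)
    (a : A F (Fin n)) (x : Val F V b n) :
    valMap b b' φ h (a • x) = φ a • valMap b b' φ h x := by
  obtain ⟨x, rfl⟩ := proj_surjective b n x
  rw [← proj_smul, valMap_proj, valMap_proj, substL_smul, proj_smul]

variable (F V) in
/-- The operator `∂/∂λ_j - ∂/∂λ_i` on values. -/
def diffV : ∀ (b : Bool) (n : ℕ) (_ _ : Fin n), Val F V b n →ₗ[F] Val F V b n
  | true, n, i, j => diffQ F V n i j
  | false, n, i, j => diffL F V n i j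

theorem diffV_proj (b : Bool) (n : ℕ) (i j : Fin n) (x : PolV F V (Fin n)) :
    diffV F V b n i j (proj F V b n x) = proj F V b n (diffL F V n i j x) := by
  cases b <;> rfl

theorem diffV_X_smul (b : Bool) (n : ℕ) (i j k : Fin n) (x : Val F V b n) :
    diffV F V b n i j ((MvPolynomial.X k : A F (Fin n)) • x) =
      ((if k = j then 1 else 0) - (if k = i then 1 else 0) : F) • x +
        (MvPolynomial.X k : A F (Fin n)) • diffV F V b n i j x := by
  obtain ⟨x, rfl⟩ := proj_surjective b n x
  have h : (MvPolynomial.pderiv j (MvPolynomial.X k) - MvPolynomial.pderiv i (MvPolynomial.X k) :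
      A F (Fin n)) = algebraMap F _ ((if k = j then 1 else 0) - (if k = i then 1 else 0)) := by
    rw [MvPolynomial.pderiv_X, MvPolynomial.pderiv_X, map_sub, Pi.single_apply, Pi.single_apply]
    by_cases h : k = j <;> by_cases h' : k = i <;> simp [h, h', eq_comm]
  rw [← proj_smul, diffV_proj, diffV_proj, diffL_smul, map_add, proj_smul (a := MvPolynomial.X k),
    h, algebraMap_smul, map_smul]

theorem diffV_valMap (b b' : Bool) {n n' : ℕ} (φ : A F (Fin n) →ₐ[F[X]] A F (Fin n'))
    (hφ : b = true → ∀ y : PolV F V (Fin n'), proj F V b' n' (φ (total F (Fin n)) • y) = 0)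
    (i j : Fin n') (i' j' : Fin n)
    (h : ∀ k, MvPolynomial.pderiv j (φ (MvPolynomial.X k)) -
        MvPolynomial.pderiv i (φ (MvPolynomial.X k)) =
      φ (MvPolynomial.pderiv j' (MvPolynomial.X k) - MvPolynomial.pderiv i' (MvPolynomial.X k)))
    (x : Val F V b n) :
    diffV F V b' n' i j (valMap b b' φ hφ x) = valMap b b' φ hφ (diffV F V b n i' j' x) := by
  obtain ⟨x, rfl⟩ := proj_surjective b n x
  rw [valMap_proj, diffV_proj, diffV_proj, valMap_proj, diffL_substL φ i j i' j' h]

theorem rename_total {n n' : ℕ} (e : Fin n ≃ Fin n') :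
    MvPolynomial.rename e (total F (Fin n)) = total F (Fin n') := by
  simp only [total, map_add, map_sum, MvPolynomial.rename_X, MvPolynomial.rename_C]
  rw [Equiv.sum_comp e (fun i => (MvPolynomial.X i : A F (Fin n')))]

variable (F V) in
/-- The renaming `λ_i ↦ λ_{e⁻¹ i}` of the variables of values. -/
def renV (b : Bool) {n n' : ℕ} (e : Fin n' ≃ Fin n) : Val F V b n →ₗ[F] Val F V b n' :=
  valMap b b (MvPolynomial.rename e.symm) fun hb y => by
    subst hb; rw [rename_total, proj_total]

theorem renV_proj (b : Bool) {n n' : ℕ} (e : Fin n' ≃ Fin n) (x : PolV F V (Fin n)) :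
    renV F V b e (proj F V b n x) = proj F V b n' (substL V (MvPolynomial.rename e.symm) x) :=
  valMap_proj _ _ _ _ _

theorem renV_X_smul (b : Bool) {n n' : ℕ} (e : Fin n' ≃ Fin n) (i : Fin n') (x : Val F V b n) :
    renV F V b e ((MvPolynomial.X (e i) : A F (Fin n)) • x) =
      (MvPolynomial.X i : A F (Fin n')) • renV F V b e x := by
  rw [renV, valMap_smul, MvPolynomial.rename_X, Equiv.symm_apply_apply]

theorem renV_renV (b : Bool) {n n' n'' : ℕ} (e : Fin n' ≃ Fin n) (e' : Fin n'' ≃ Fin n')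
    (x : Val F V b n) : renV F V b e' (renV F V b e x) = renV F V b (e'.trans e) x := by
  obtain ⟨x, rfl⟩ := proj_surjective b n x
  rw [renV_proj, renV_proj, renV_proj, substL_substL]
  congr 3
  exact MvPolynomial.algHom_ext fun i => by simp

theorem renV_refl (b : Bool) {n : ℕ} (x : Val F V b n) :
    renV F V b (Equiv.refl (Fin n)) x = x := by
  obtain ⟨x, rfl⟩ := proj_surjective b n x
  rw [renV_proj]
  congr 1
  induction x using pol_induction with
  | zero => simp
  | pol p v => simp
  | add x y hx hy => rw [map_add, hx, hy]

theorem diffV_renV (b : Bool) {n n' : ℕ} (e : Fin n' ≃ Fin n) (i j : Fin n') (x : Val F V b n) :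
    diffV F V b n' i j (renV F V b e x) = renV F V b e (diffV F V b n (e i) (e j) x) := by
  refine diffV_valMap b b _ _ i j (e i) (e j) (fun k => ?_) x
  rw [MvPolynomial.rename_X, map_sub]
  have h : ∀ l : Fin n', (MvPolynomial.pderiv l (MvPolynomial.X (e.symm k)) : A F (Fin n')) =
      MvPolynomial.rename e.symm (MvPolynomial.pderiv (e l) (MvPolynomial.X k)) := fun l => by
    rw [MvPolynomial.pderiv_X, MvPolynomial.pderiv_X, Pi.single_apply, Pi.single_apply]
    by_cases hl : e l = k
    · subst hl; simp
    · rw [if_neg, if_neg, map_zero]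
      · rintro rfl; exact hl rfl
      · rintro rfl; simp at hl
  rw [h, h]

end Values

/-! ### Evaluation of polynomials at commuting operators -/

section Plug

variable {F : Type u} {V : Type v} [Field F] [AddCommGroup V] [Module F V] [Module F[X] V]
  [IsScalarTower F F[X] V] {H : Type*} [AddCommGroup H] [Module F H] {m : ℕ}

/-- The monomial `T ^ α` in the operators `T i`. -/
def opPow (T : Fin m → Module.End F H) (α : Fin m →₀ ℕ) : Module.End F H :=
  (List.ofFn fun i => T i ^ α i).prod

theorem opPow_zero (T : Fin m → Module.End F H) : opPow T 0 = 1 := by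
  simp [opPow]

theorem opPow_add_single (T : Fin m → Module.End F H) (hT : ∀ i j, Commute (T i) (T j))
    (α : Fin m →₀ ℕ) (i : Fin m) : opPow T (α + Finsupp.single i 1) = T i * opPow T α := by
  have key : ∀ {m : ℕ} (T : Fin m → Module.End F H) (_ : ∀ i j, Commute (T i) (T j))
      (α : Fin m → ℕ) (i : Fin m),
      (List.ofFn fun j => T j ^ (α j + if i = j then 1 else 0)).prod =
        T i * (List.ofFn fun j => T j ^ α j).prod := by
    intro m
    induction m with
    | zero => intro _ _ _ i; exact i.elim0
    | succ m ih =>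
      intro T hT α i
      rw [List.ofFn_succ, List.ofFn_succ, List.prod_cons, List.prod_cons]
      refine Fin.cases ?_ (fun i => ?_) i
      · have : ∀ j : Fin m, (0 : Fin (m + 1)) ≠ j.succ := fun j => (Fin.succ_ne_zero j).symm
        simp only [this, if_false, add_zero, if_true, pow_succ', mul_assoc]
      · have h2 : (i.succ : Fin (m + 1)) ≠ 0 := Fin.succ_ne_zero i
        simp only [h2, if_false, add_zero]
        have := ih (fun j => T j.succ) (fun a b => hT _ _) (fun j => α j.succ) i
        simp only [← Fin.succ_inj (n := m)] at this
        rw [this, ← mul_assoc, ← mul_assoc, ((hT 0 i.succ).pow_left _).eq]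
  rw [opPow, opPow, ← key T hT]
  simp only [Finsupp.add_apply, Finsupp.single_apply]

/-- The value `∑ α, T ^ α (φ (w_α))` of a polynomial `∑ α, x ^ α w_α` at commuting operators. -/
def opEval (T : Fin m → Module.End F H) (φ : V →ₗ[F] H) : PolV F V (Fin m) →ₗ[F] H :=
  Finsupp.lsum F (fun α => opPow T α ∘ₗ φ) ∘ₗ (coeffs.restrictScalars F).toLinearMap

theorem opEval_apply (T : Fin m → Module.End F H) (φ : V →ₗ[F] H) (G : PolV F V (Fin m)) :
    opEval T φ G = (coeffs G).sum fun α x => opPow T α (φ x) := rfl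

@[simp] theorem opEval_pol_one (T : Fin m → Module.End F H) (φ : V →ₗ[F] H) (v : V) :
    opEval T φ (pol 1 v) = φ v := by
  rw [opEval_apply, coeffs_pol_one, Finsupp.sum_single_index (by simp), opPow_zero]
  rfl

theorem opEval_X_smul (T : Fin m → Module.End F H) (hT : ∀ i j, Commute (T i) (T j))
    (φ : V →ₗ[F] H) (i : Fin m) (G : PolV F V (Fin m)) :
    opEval T φ ((MvPolynomial.X i : A F (Fin m)) • G) = T i (opEval T φ G) := by
  rw [opEval_apply, opEval_apply, coeffs_X_smul, Finsupp.sum_mapDomain_index_inj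
    (add_left_injective _), map_finsuppSum]
  simp only [opPow_add_single T hT, Module.End.mul_apply]

theorem opEval_add_right (T : Fin m → Module.End F H) (φ ψ : V →ₗ[F] H) (G : PolV F V (Fin m)) :
    opEval T (φ + ψ) G = opEval T φ G + opEval T ψ G := by
  simp [opEval_apply, Finsupp.sum_add]

theorem opEval_smul_right (T : Fin m → Module.End F H) (c : F) (φ : V →ₗ[F] H)
    (G : PolV F V (Fin m)) : opEval T (c • φ) G = c • opEval T φ G := by
  simp [opEval_apply, Finsupp.smul_sum]

theorem finsupp_nat_induction {ι : Type*} {motive : (ι →₀ ℕ) → Prop} (zero : motive 0)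
    (add_single : ∀ α i, motive α → motive (α + Finsupp.single i 1)) (α : ι →₀ ℕ) :
    motive α := by
  classical
  induction α using Finsupp.induction with
  | zero => exact zero
  | single_add a b f _ _ hf =>
    clear * - hf add_single
    induction b with
    | zero => simpa using hf
    | succ b ih =>
      have : Finsupp.single a (b + 1) + f = Finsupp.single a b + f + Finsupp.single a 1 := by
        rw [Finsupp.single_add]; abel
      rw [this]
      exact add_single _ _ ih

/-- The coefficient of `x ^ (α - β) y ^ β` in `(x - y) ^ α`. -/
def signedChoose (α β : Fin m →₀ ℕ) : ℤ := (-1) ^ β.degree * ∏ i, ((α i).choose (β i) : ℤ)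

theorem signedChoose_add_single (α β : Fin m →₀ ℕ) (i : Fin m) :
    signedChoose (α + Finsupp.single i 1) β = signedChoose α β -
      if β i = 0 then 0 else signedChoose α (β - Finsupp.single i 1) := by
  classical
  have h1 : ∀ γ : Fin m →₀ ℕ, (∀ j, j ≠ i → γ j = β j) → ∀ a : ℕ,
      (∏ j ∈ Finset.univ.erase i, (((α + Finsupp.single i a) j).choose (γ j) : ℤ)) =
        ∏ j ∈ Finset.univ.erase i, ((α j).choose (β j) : ℤ) := fun γ hγ a => by
    refine Finset.prod_congr rfl fun j hj => ?_
    have hj := (Finset.mem_erase.1 hj).1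
    rw [hγ j hj, Finsupp.add_apply, Finsupp.single_eq_of_ne hj, add_zero]
  have h2 : ∀ (f : Fin m → ℤ), ∏ j, f j = f i * ∏ j ∈ Finset.univ.erase i, f j := fun f =>
    (Finset.mul_prod_erase _ f (Finset.mem_univ i)).symm
  unfold signedChoose
  rw [h2, h2 fun j => ((α j).choose (β j) : ℤ), h1 β (fun _ _ => rfl)]
  split_ifs with hβ
  · simp [hβ]
  · obtain ⟨k, hk⟩ := Nat.exists_eq_succ_of_ne_zero hβ
    have h3 := h1 (β - Finsupp.single i 1) (fun j hj => by
      rw [Finsupp.tsub_apply, Finsupp.single_eq_of_ne hj, Nat.sub_zero]) 0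
    rw [Finsupp.single_zero, add_zero] at h3
    rw [h2 fun j => ((α j).choose ((β - Finsupp.single i 1 : Fin m →₀ ℕ) j) : ℤ), h3]
    have hd : β.degree = (β - Finsupp.single i 1).degree + 1 := by
      have : β = (β - Finsupp.single i 1) + Finsupp.single i 1 := by
        rw [tsub_add_cancel_of_le]
        rw [Finsupp.single_le_iff]
        exact Nat.one_le_iff_ne_zero.2 hβ
      conv_lhs => rw [this, map_add, Finsupp.degree_single]
    rw [hd, Finsupp.add_apply, Finsupp.single_eq_same, hk, Finsupp.tsub_apply,
      Finsupp.single_eq_same, hk, Nat.succ_sub_one, Nat.choose_succ_succ]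
    push_cast
    ring

/-- Pascal's rule for the expansion of `(x - y) ^ (α + e_i) = (x - y) ^ α x_i - (x - y) ^ α y_i`. -/
theorem sum_signedChoose_add_single {Y : Type*} [AddCommGroup Y] (α : Fin m →₀ ℕ) (i : Fin m)
    (t : (Fin m →₀ ℕ) → (Fin m →₀ ℕ) → Y) :
    ∑ p ∈ Finset.HasAntidiagonal.antidiagonal (α + Finsupp.single i 1),
      signedChoose (α + Finsupp.single i 1) p.1 • t p.1 p.2 =
    ∑ p ∈ Finset.HasAntidiagonal.antidiagonal α,
        signedChoose α p.1 • t p.1 (p.2 + Finsupp.single i 1) -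
      ∑ p ∈ Finset.HasAntidiagonal.antidiagonal α,
        signedChoose α p.1 • t (p.1 + Finsupp.single i 1) p.2 := by
  classical
  simp only [signedChoose_add_single, sub_smul, Finset.sum_sub_distrib]
  have le : ∀ γ : Fin m →₀ ℕ, γ i ≠ 0 → γ - Finsupp.single i 1 + Finsupp.single i 1 = γ :=
    fun γ hγ => by
      rw [tsub_add_cancel_of_le]
      rw [Finsupp.single_le_iff]
      exact Nat.one_le_iff_ne_zero.2 hγ
  congr 1
  · symm
    refine Finset.sum_of_injOn (fun p => (p.1, p.2 + Finsupp.single i 1)) ?_ ?_ ?_ ?_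
    · intro p _ q _ h
      simp only [Prod.mk.injEq, add_left_inj] at h
      exact Prod.ext h.1 h.2
    · intro p hp
      simp only [Finset.mem_coe, Finset.HasAntidiagonal.mem_antidiagonal] at hp ⊢
      rw [← add_assoc, hp]
    · intro p hp hp'
      rw [Finset.HasAntidiagonal.mem_antidiagonal] at hp
      have h0 : p.2 i = 0 := by
        by_contra h0
        refine hp' ⟨(p.1, p.2 - Finsupp.single i 1), ?_, ?_⟩
        · simp only [Finset.mem_coe, Finset.HasAntidiagonal.mem_antidiagonal]
          apply add_right_cancel (b := Finsupp.single i 1)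
          rw [add_assoc, le _ h0, hp]
        · simp only [le _ h0]
      have h1 := DFunLike.congr_fun hp i
      rw [Finsupp.add_apply, Finsupp.add_apply, h0, Finsupp.single_eq_same, add_zero] at h1
      have : signedChoose α p.1 = 0 := by
        rw [signedChoose, Finset.prod_eq_zero (Finset.mem_univ i), mul_zero]
        rw [h1, Nat.choose_succ_self, Nat.cast_zero]
      rw [this, zero_smul]
    · intro p _
      rfl
  · symm
    refine Finset.sum_of_injOn (fun p => (p.1 + Finsupp.single i 1, p.2)) ?_ ?_ ?_ ?_
    · intro p _ q _ h
      simp only [Prod.mk.injEq, add_left_inj] at h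
      exact Prod.ext h.1 h.2
    · intro p hp
      simp only [Finset.mem_coe, Finset.HasAntidiagonal.mem_antidiagonal] at hp ⊢
      rw [← hp]; abel
    · intro p hp hp'
      rw [Finset.HasAntidiagonal.mem_antidiagonal] at hp
      have h0 : p.1 i = 0 := by
        by_contra h0
        refine hp' ⟨(p.1 - Finsupp.single i 1, p.2), ?_, ?_⟩
        · simp only [Finset.mem_coe, Finset.HasAntidiagonal.mem_antidiagonal]
          apply add_right_cancel (b := Finsupp.single i 1)
          rw [add_right_comm, le _ h0, hp]
        · simp only [le _ h0]
      rw [if_pos h0, zero_smul]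
    · intro p _
      rw [if_neg (by simp), add_tsub_cancel_right]

variable {R Y : Type*} [AddCommGroup R] [Module F R] [AddCommGroup Y] [Module F Y]

/-- The operator `φ ↦ x φ - φ d`. -/
def shiftOp (x : Module.End F Y) (d : Module.End F R) : Module.End F (R →ₗ[F] Y) where
  toFun φ := x ∘ₗ φ - φ ∘ₗ d
  map_add' φ ψ := by rw [LinearMap.comp_add, LinearMap.add_comp]; abel
  map_smul' c φ := by rw [LinearMap.comp_smul, LinearMap.smul_comp, RingHom.id_apply, smul_sub]

@[simp] theorem shiftOp_apply (x : Module.End F Y) (d : Module.End F R) (φ : R →ₗ[F] Y) (r : R) :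
    shiftOp x d φ r = x (φ r) - φ (d r) := rfl

theorem shiftOp_commute {x x' : Module.End F Y} {d d' : Module.End F R} (hx : Commute x x')
    (hd : Commute d d') : Commute (shiftOp x d) (shiftOp x' d') := by
  refine LinearMap.ext fun φ => LinearMap.ext fun r => ?_
  have h1 : ∀ y, x (x' y) = x' (x y) := fun y => LinearMap.congr_fun hx.eq y
  have h2 : ∀ y, d (d' y) = d' (d y) := fun y => LinearMap.congr_fun hd.eq y
  simp only [Module.End.mul_apply, shiftOp_apply, map_sub, h1, h2]
  abel

/-- The expansion of `(x - d) ^ α`. -/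
theorem opPow_shiftOp (x : Fin m → Module.End F Y) (d : Fin m → Module.End F R)
    (hx : ∀ i j, Commute (x i) (x j)) (hd : ∀ i j, Commute (d i) (d j)) (α : Fin m →₀ ℕ)
    (φ : R →ₗ[F] Y) (r : R) :
    opPow (fun i => shiftOp (x i) (d i)) α φ r =
      ∑ p ∈ Finset.HasAntidiagonal.antidiagonal α,
        signedChoose α p.1 • opPow x p.2 (φ (opPow d p.1 r)) := by
  induction α using finsupp_nat_induction generalizing r with
  | zero => simp [opPow_zero, signedChoose]
  | add_single α i ih =>
    rw [opPow_add_single _ (fun i j => shiftOp_commute (hx i j) (hd i j)), Module.End.mul_apply,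
      shiftOp_apply, ih, ih,
      sum_signedChoose_add_single α i fun β γ => opPow x γ (φ (opPow d β r)), map_sum]
    have hc : ∀ β, opPow d β (d i r) = opPow d (β + Finsupp.single i 1) r := fun β => by
      rw [opPow_add_single _ hd]
      have : Commute (opPow d β) (d i) := by
        induction β using finsupp_nat_induction with
        | zero => rw [opPow_zero]; exact Commute.one_left _
        | add_single β j ih => rw [opPow_add_single _ hd]; exact (hd j i).mul_left ih
      exact LinearMap.congr_fun this.eq r
    congr 1
    · refine Finset.sum_congr rfl fun p _ => ?_
      rw [map_zsmul, opPow_add_single _ hx, Module.End.mul_apply]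
    · refine Finset.sum_congr rfl fun p _ => ?_
      rw [hc]

end Plug

/-! ### Insertion of polynomials into functions regular on a block -/

section Insertion

variable {F : Type u} {V : Type v} [Field F] [AddCommGroup V] [Module F V] [Module F[X] V]
  [IsScalarTower F F[X] V]

/-- The operator `φ ↦ λ_i φ - φ ∂/∂z_i` on maps from functions to values. -/
def mulDer {N : ℕ} (G : SimpleGraph (Fin N)) (Y : Type w) [AddCommGroup Y] [Module F Y]
    [Module (A F (Fin N)) Y] [SMulCommClass (A F (Fin N)) F Y] (i : Fin N) :
    Module.End F (TInv F G →ₗ[F] Y) :=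
  shiftOp (DistribSMul.toLinearMap F Y (MvPolynomial.X i : A F (Fin N))) (derivT G i)

section

variable {N : ℕ} {G : SimpleGraph (Fin N)} {Y : Type w} [AddCommGroup Y] [Module F Y]
    [Module (A F (Fin N)) Y] [SMulCommClass (A F (Fin N)) F Y]

@[simp] theorem mulDer_apply (i : Fin N) (φ : TInv F G →ₗ[F] Y) (p : TInv F G) :
    mulDer G Y i φ p = (MvPolynomial.X i : A F (Fin N)) • φ p - φ (derivT G i p) := rfl

theorem commute_mulX (i j : Fin N) :
    Commute (DistribSMul.toLinearMap F Y (MvPolynomial.X i : A F (Fin N)))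
      (DistribSMul.toLinearMap F Y (MvPolynomial.X j : A F (Fin N))) :=
  LinearMap.ext fun y => by
    simp only [Module.End.mul_apply, DistribSMul.toLinearMap_apply, smul_smul, mul_comm]

theorem commute_derivT (i j : Fin N) :
    Commute (derivT G i : Module.End F (TInv F G)) (derivT G j) :=
  LinearMap.ext fun p => derivT_comm G i j p

theorem commute_mulDer (i j : Fin N) :
    Commute (mulDer (F := F) G Y i) (mulDer G Y j) :=
  shiftOp_commute (commute_mulX i j) (commute_derivT i j)

end

section

variable {m n : ℕ} {Y : Type w} [AddCommGroup Y] [Module F Y] [Module (A F (Fin (m + n))) Y]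
  [SMulCommClass (A F (Fin (m + n))) F Y]

/-- The linear form of `plug`: the insertion of a polynomial `G` into a function `h` that is regular
on the block, as the value of `G` at the commuting operators `φ ↦ λ_i φ - φ ∂/∂z_i`. -/
def plugL (Φ : V →ₗ[F] O F (n + 1) →ₗ[F] Y) :
    PolV F V (Fin m) →ₗ[F] ORegular F m n →ₗ[F] Y :=
  opEval (fun i : Fin m => mulDer (regGraph m n) Y (Fin.castAdd n i))
    (LinearMap.lcomp F Y (specialize m n).toLinearMap ∘ₗ Φ)

@[simp] theorem plugL_pol_one (Φ : V →ₗ[F] O F (n + 1) →ₗ[F] Y) (x : V) (h : ORegular F m n) :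
    plugL Φ (pol 1 x) h = Φ x (specialize m n h) := by
  rw [plugL, opEval_pol_one]; rfl

theorem plugL_X_smul (Φ : V →ₗ[F] O F (n + 1) →ₗ[F] Y) (i : Fin m) (G : PolV F V (Fin m))
    (h : ORegular F m n) :
    plugL Φ ((MvPolynomial.X i : A F (Fin m)) • G) h =
      (MvPolynomial.X (Fin.castAdd n i) : A F (Fin (m + n))) • plugL Φ G h -
        plugL Φ G (derivT _ (Fin.castAdd n i) h) := by
  rw [plugL, opEval_X_smul _ fun _ _ => commute_mulDer _ _]; rfl

theorem plugL_add_left (Φ Ψ : V →ₗ[F] O F (n + 1) →ₗ[F] Y) (G : PolV F V (Fin m)) :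
    plugL (Φ + Ψ) G = plugL Φ G + plugL Ψ G := by
  rw [plugL, LinearMap.comp_add, opEval_add_right]; rfl

theorem plugL_smul_left (c : F) (Φ : V →ₗ[F] O F (n + 1) →ₗ[F] Y) (G : PolV F V (Fin m)) :
    plugL (c • Φ) G = c • plugL Φ G := by
  rw [plugL, LinearMap.comp_smul, opEval_smul_right]; rfl

theorem opPow_mulX_smul (γ : Fin m →₀ ℕ) (y : Y) :
    opPow (fun i : Fin m => DistribSMul.toLinearMap F Y
      (MvPolynomial.X (Fin.castAdd n i) : A F (Fin (m + n)))) γ y =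
      (MvPolynomial.monomial (γ.mapDomain (Fin.castAdd n)) 1 : A F (Fin (m + n))) • y := by
  induction γ using finsupp_nat_induction with
  | zero =>
    rw [opPow_zero, Finsupp.mapDomain_zero]
    exact (one_smul (A F (Fin (m + n))) y).symm
  | add_single γ i ih =>
    rw [opPow_add_single _ (fun _ _ => commute_mulX _ _), Module.End.mul_apply, ih,
      DistribSMul.toLinearMap_apply, smul_smul, Finsupp.mapDomain_add, Finsupp.mapDomain_single,
      MvPolynomial.X, MvPolynomial.monomial_mul, one_mul,
      add_comm (Finsupp.single _ 1)]

theorem iterDeriv_eq_opPow (G : SimpleGraph (Fin (m + n))) (β : Fin m →₀ ℕ) :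
    iterDeriv (F := F) G (Fin.castAdd n) β =
      opPow (H := TInv F G)
        (fun i => (derivT G (Fin.castAdd n i) : Module.End F (TInv F G))) β := rfl

/-- The binomial expansion of `(λ - ∂_z) ^ α` in `plug` is the value of `λ ^ α` at the commuting
operators `mulDer`. -/
theorem plug_eq_plugL (Φ : V →ₗ[F] O F (n + 1) →ₗ[F] Y) (G : PolV F V (Fin m))
    (h : ORegular F m n) : plug m n (fun x r => Φ x r) G h = plugL Φ G h := by
  have key : ∀ (α : Fin m →₀ ℕ) (φ : ORegular F m n →ₗ[F] Y),
      opPow (fun i : Fin m => mulDer (regGraph m n) Y (Fin.castAdd n i)) α φ h =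
      ∑ p ∈ Finset.HasAntidiagonal.antidiagonal α, signedChoose α p.1 •
        (MvPolynomial.monomial (p.2.mapDomain (Fin.castAdd n)) 1 : A F (Fin (m + n))) •
          φ (iterDeriv (regGraph m n) (Fin.castAdd n) p.1 h) := fun α φ => by
    refine (opPow_shiftOp (R := ORegular F m n) _ _ (fun _ _ => commute_mulX _ _)
      (fun _ _ => commute_derivT _ _) α φ h).trans ?_
    refine Finset.sum_congr rfl fun p _ => ?_
    rw [opPow_mulX_smul, iterDeriv_eq_opPow]
  rw [plugL, opEval_apply, Finsupp.sum, LinearMap.sum_apply]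
  refine Finset.sum_congr rfl fun α _ => ?_
  rw [key]
  rfl

/-- Two insertions are equal if they agree on the coefficients. -/
theorem plugL_congr {Φ Ψ : V →ₗ[F] O F (n + 1) →ₗ[F] Y} {G : PolV F V (Fin m)}
    (h : ∀ α, Φ (coeffs G α) = Ψ (coeffs G α)) : plugL Φ G = plugL Ψ G := by
  rw [plugL, plugL, opEval_apply, opEval_apply]
  refine Finset.sum_congr rfl fun α _ => ?_
  simp only [LinearMap.comp_apply, h]

theorem smul_zsub_eq {N : ℕ} (G : SimpleGraph (Fin N)) (k i j : Fin N) (p : TInv F G) :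
    p * derivT G k (zsub G i j) = ((if i = k then 1 else 0) - (if j = k then 1 else 0) : F) • p := by
  classical
  rw [derivT_zsub, mul_comm, ← Algebra.smul_def]
  congr

theorem diffL_X_smul (i j k : Fin m) (G : PolV F V (Fin m)) :
    diffL F V m i j ((MvPolynomial.X k : A F (Fin m)) • G) =
      ((if k = j then 1 else 0) - (if k = i then 1 else 0) : F) • G +
        (MvPolynomial.X k : A F (Fin m)) • diffL F V m i j G := diffV_X_smul false m i j k G

/-- A multiplication by `z_i - z_j` in the block may be moved from the function to the
polynomial. -/
theorem plugL_diffL (Φ : V →ₗ[F] O F (n + 1) →ₗ[F] Y) (i j : Fin m) (G : PolV F V (Fin m))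
    (h : ORegular F m n) :
    plugL Φ (diffL F V m i j G) h =
      plugL Φ G (zsub _ (Fin.castAdd n i) (Fin.castAdd n j) * h) := by
  induction G using polV_induction generalizing h with
  | const x =>
    rw [diffL_pol_one, map_zero, plugL_pol_one, map_mul, specialize_zsub, collapse_castAdd,
      collapse_castAdd, zsub_self, zero_mul, map_zero, LinearMap.zero_apply]
  | add x y hx hy => simp only [map_add, LinearMap.add_apply, hx, hy]
  | mulX k G ih =>
    rw [diffL_X_smul, map_add, LinearMap.add_apply, map_smul, plugL_X_smul, LinearMap.smul_apply,
      plugL_X_smul, derivT_mul, map_add, smul_zsub_eq, map_smul, ih, ih]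
    simp only [(Fin.castAdd_injective m n).eq_iff]
    have : ((if k = j then 1 else 0) - (if k = i then 1 else 0) : F) =
        -((if i = k then 1 else 0) - (if j = k then 1 else 0)) := by
      simp only [eq_comm (a := k)]; ring
    rw [this, neg_smul]
    abel

end

variable {b b₁ b₂ : Bool} {m n : ℕ}

theorem plugL_zsub_mul (Φ : V →ₗ[F] O F (n + 1) →ₗ[F] Val F V b (m + n)) (i j : Fin (m + n))
    (hΦ : ∀ x r, Φ x (zsub ⊤ (collapse m n i) (collapse m n j) * r) =
      diffV F V b (m + n) i j (Φ x r)) (G : PolV F V (Fin m)) (h : ORegular F m n) :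
    plugL Φ G (zsub _ i j * h) = diffV F V b (m + n) i j (plugL Φ G h) := by
  induction G using polV_induction generalizing h with
  | const x => rw [plugL_pol_one, plugL_pol_one, map_mul, specialize_zsub, hΦ]
  | add x y hx hy => simp only [map_add, LinearMap.add_apply, hx, hy]
  | mulX k G ih =>
    rw [plugL_X_smul, plugL_X_smul, map_sub, diffV_X_smul, ih, derivT_mul, map_add, ih,
      smul_zsub_eq, map_smul]
    have : ((if Fin.castAdd n k = j then 1 else 0) - (if Fin.castAdd n k = i then 1 else 0) : F) =
        -((if i = Fin.castAdd n k then 1 else 0) - (if j = Fin.castAdd n k then 1 else 0)) := by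
      simp only [eq_comm (a := Fin.castAdd n k)]; ring
    rw [this, neg_smul]
    abel

variable (F) in
/-- The shift of the first variable of `f` in the product `f ∘ g`: it is zero for `g` in `P^ch`; for
`g` in `P̃^ch` it is `-(∂ + λ_1 + ⋯ + λ_N)`. -/
def shiftT : ∀ (_ : Bool) (N : ℕ), A F (Fin N)
  | true, _ => 0
  | false, N => -total F (Fin N)

theorem pderiv_total {N : ℕ} (k : Fin N) : MvPolynomial.pderiv k (total F (Fin N)) = 1 := by
  simp [total, MvPolynomial.pderiv_X, Pi.single_apply]

theorem pderiv_shiftT (b : Bool) {N : ℕ} (i j : Fin N) :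
    MvPolynomial.pderiv i (shiftT F b N) = MvPolynomial.pderiv j (shiftT F b N) := by
  cases b <;> simp [shiftT, pderiv_total]

variable (V) in
/-- The substitution `λ_0 ↦ s + μ_1 + ⋯ + μ_m`, `λ_j ↦ μ_{m+j}` on values, where `s` is given by
`shiftT`. -/
def insV (h : b = (b₁ && b₂)) (m n : ℕ) : Val F V b₁ (n + 1) →ₗ[F] Val F V b (m + n) :=
  valMap b₁ b (insA F m n (shiftT F b₂ (m + n))) fun hb y => by
    subst hb
    rw [insA_total]
    cases b₂
    · rw [shiftT, neg_add_cancel, zero_smul, map_zero]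
    · subst h
      rw [shiftT, zero_add]
      exact proj_total _ _

theorem insV_proj (h : b = (b₁ && b₂)) (m n : ℕ) (x : PolV F V (Fin (n + 1))) :
    insV V h m n (proj F V b₁ (n + 1) x) =
      proj F V b (m + n) (substL V (insA F m n (shiftT F b₂ (m + n))) x) := valMap_proj _ _ _ _ _

theorem insV_X_succ_smul (h : b = (b₁ && b₂)) (m n : ℕ) (j : Fin n) (x : Val F V b₁ (n + 1)) :
    insV V h m n ((MvPolynomial.X j.succ : A F (Fin (n + 1))) • x) =
      (MvPolynomial.X (Fin.natAdd m j) : A F (Fin (m + n))) • insV V h m n x := by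
  rw [insV, valMap_smul]
  simp [insA]

theorem insV_X_zero_smul (h : b = (b₁ && b₂)) (m n : ℕ) (x : Val F V b₁ (n + 1)) :
    insV V h m n ((MvPolynomial.X 0 : A F (Fin (n + 1))) • x) =
      (shiftT F b₂ (m + n) + ∑ i : Fin m, MvPolynomial.X (Fin.castAdd n i) : A F (Fin (m + n))) •
        insV V h m n x := by
  rw [insV, valMap_smul]
  simp [insA]

/-- The shift of the first variable is symmetric in the variables `λ_i`, hence it is not seen by the
operators `∂/∂λ_j - ∂/∂λ_i`. -/
theorem diffV_insV (h : b = (b₁ && b₂)) (m n : ℕ) (i j : Fin (m + n)) (x : Val F V b₁ (n + 1)) :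
    diffV F V b (m + n) i j (insV V h m n x) =
      insV V h m n (diffV F V b₁ (n + 1) (collapse m n i) (collapse m n j) x) := by
  refine diffV_valMap b₁ b _ _ i j _ _ (fun k => ?_) x
  have key : ∀ l : Fin (m + n), MvPolynomial.pderiv l
      (insA F m n (shiftT F b₂ (m + n)) (MvPolynomial.X k)) =
      insA F m n (shiftT F b₂ (m + n)) (MvPolynomial.pderiv (collapse m n l) (MvPolynomial.X k)) +
        if k = 0 then MvPolynomial.pderiv i (shiftT F b₂ (m + n)) else 0 := fun l => by
    refine Fin.cases ?_ (fun k => ?_) k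
    · simp only [insA, MvPolynomial.aeval_X, Fin.cons_zero, map_add, map_sum, if_true]
      rw [pderiv_shiftT b₂ l i]
      refine (add_comm _ _).trans ?_
      congr 1
      refine Fin.addCases (fun l => ?_) (fun l => ?_) l
      · simp [MvPolynomial.pderiv_X, Pi.single_apply, (Fin.castAdd_injective m n).eq_iff]
      · have h1 : ∀ x : Fin m, Fin.castAdd n x ≠ Fin.natAdd m l := fun x hx => by
          have := congrArg Fin.val hx
          have h2 := x.2
          simp at this
          omega
        simp [MvPolynomial.pderiv_X, h1, (Fin.succ_ne_zero l).symm]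
    · simp only [insA, MvPolynomial.aeval_X, Fin.cons_succ, Fin.succ_ne_zero, if_false, add_zero]
      refine Fin.addCases (fun l => ?_) (fun l => ?_) l
      · have h1 : Fin.natAdd m k ≠ Fin.castAdd n l := fun hx => by
          have := congrArg Fin.val hx
          have h2 := l.2
          simp at this
          omega
        simp [MvPolynomial.pderiv_X, h1]
      · simp [MvPolynomial.pderiv_X, Pi.single_apply]
  rw [key, key, map_sub]
  abel

end Insertion

/-! ### The product in the first position -/

section Comp

variable {F : Type u} {V : Type v} [Field F] [AddCommGroup V] [Module F V] [Module F[X] V]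
  [IsScalarTower F F[X] V]

variable (F V) in
/-- The maps with values in `Val F V b n`. -/
abbrev CMaps (b : Bool) (n : ℕ) : Type _ := Maps F V n (Val F V b n)

variable (F V) in
/-- The sesquilinear maps: `P^ch(n)` for `b = true` and `P̃^ch(n)` for `b = false`. -/
def PV (b : Bool) (n : ℕ) : Submodule F (CMaps F V b n) := sesqui (diffV F V b n)

section

variable {n : ℕ} {Y : Type w} [AddCommGroup Y] [Module F Y]

theorem Maps.map_update_add (f : Maps F V n Y) (v : Fin n → V) (i : Fin n) (x y : V) :
    f (Function.update v i (x + y)) = f (Function.update v i x) + f (Function.update v i y) :=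
  MultilinearMap.map_update_add f v i x y

theorem Maps.map_update_smul (f : Maps F V n Y) (v : Fin n → V) (i : Fin n) (c : F) (x : V) :
    f (Function.update v i (c • x)) = c • f (Function.update v i x) :=
  MultilinearMap.map_update_smul f v i c x

theorem Maps.cons_add (f : Maps F V (n + 1) Y) (w : Fin n → V) (x y : V) :
    f (Fin.cons (x + y) w : Fin (n + 1) → V) =
      f (Fin.cons x w : Fin (n + 1) → V) + f (Fin.cons y w : Fin (n + 1) → V) := by
  have := Maps.map_update_add f (Fin.cons x w : Fin (n + 1) → V) 0 x y
  simpa only [Fin.update_cons_zero] using this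

theorem Maps.cons_smul (f : Maps F V (n + 1) Y) (w : Fin n → V) (c : F) (x : V) :
    f (Fin.cons (c • x) w : Fin (n + 1) → V) = c • f (Fin.cons x w : Fin (n + 1) → V) := by
  have := Maps.map_update_smul f (Fin.cons x w : Fin (n + 1) → V) 0 c x
  simpa only [Fin.update_cons_zero] using this

end

variable {b b₁ b₂ : Bool} {m n : ℕ}

/-- The value of `f` with the first argument free and the others fixed, expressed through the
variables of `f ∘ g`. -/
def insMap (h : b = (b₁ && b₂)) (m : ℕ) {n : ℕ} (f : CMaps F V b₁ (n + 1)) (w : Fin n → V) :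
    V →ₗ[F] O F (n + 1) →ₗ[F] Val F V b (m + n) where
  toFun x := insV V h m n ∘ₗ f (Fin.cons x w : Fin (n + 1) → V)
  map_add' x y := by rw [Maps.cons_add, LinearMap.comp_add]
  map_smul' c x := by rw [Maps.cons_smul, LinearMap.comp_smul, RingHom.id_apply]

@[simp] theorem insMap_apply (h : b = (b₁ && b₂)) (f : CMaps F V b₁ (n + 1)) (w : Fin n → V)
    (x : V) (r : O F (n + 1)) :
    insMap h m f w x r = insV V h m n (f (Fin.cons x w : Fin (n + 1) → V) r) := rfl

/-- `k` is the product `f ∘ g` in the first position. -/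
def IsComp (h : b = (b₁ && b₂)) (f : CMaps F V b₁ (n + 1)) (g : CMaps F V b₂ m)
    (k : CMaps F V b (m + n)) : Prop :=
  ∀ (v : Fin (m + n) → V) (q : O F m) (r : ORegular F m n) (G : PolV F V (Fin m)),
    proj F V b₂ m G = g (fun i => v (Fin.castAdd n i)) q →
      k v (blockIncl m n q * regIncl m n r) =
        plugL (insMap h m f fun j => v (Fin.natAdd m j)) G r

theorem IsComp.unique {h : b = (b₁ && b₂)} {f : CMaps F V b₁ (n + 1)} {g : CMaps F V b₂ m}
    {k k' : CMaps F V b (m + n)} (hk : IsComp h f g k) (hk' : IsComp h f g k') : k = k' := by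
  refine Maps.ext F V fun v p => ?_
  obtain ⟨q, r, rfl⟩ := exists_blockIncl_mul_regIncl m n p
  obtain ⟨G, hG⟩ := proj_surjective b₂ m (g (fun i => v (Fin.castAdd n i)) q)
  rw [hk v q r G hG, hk' v q r G hG]

theorem insMap_X_smul (h : b = (b₁ && b₂)) {f : CMaps F V b₁ (n + 1)} (hf : f ∈ PV F V b₁ (n + 1))
    (w : Fin n → V) (x : V) (r : O F (n + 1)) :
    insMap h m f w ((Polynomial.X : F[X]) • x) r = insMap h m f w x (derivT ⊤ 0 r) -
      (shiftT F b₂ (m + n) + ∑ i : Fin m, MvPolynomial.X (Fin.castAdd n i) : A F (Fin (m + n))) •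
        insMap h m f w x r := by
  have := hf.1 (Fin.cons x w : Fin (n + 1) → V) 0 r
  rw [Fin.cons_zero, Fin.update_cons_zero] at this
  rw [insMap_apply, insMap_apply, ← this, map_add, insV_X_zero_smul, insMap_apply,
    add_sub_cancel_right]

theorem insMap_zsub_mul (h : b = (b₁ && b₂)) {f : CMaps F V b₁ (n + 1)}
    (hf : f ∈ PV F V b₁ (n + 1)) (w : Fin n → V) (i j : Fin (m + n)) (x : V) (r : O F (n + 1)) :
    insMap h m f w x (zsub ⊤ (collapse m n i) (collapse m n j) * r) =
      diffV F V b (m + n) i j (insMap h m f w x r) := by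
  rw [insMap_apply, hf.2, insMap_apply, diffV_insV]

/-- The insertion of `(∂ + λ_1 + ⋯ + λ_m) G`. -/
theorem plugL_total (h : b = (b₁ && b₂)) {f : CMaps F V b₁ (n + 1)} (hf : f ∈ PV F V b₁ (n + 1))
    (w : Fin n → V) (G : PolV F V (Fin m)) (r : ORegular F m n) :
    plugL (insMap h m f w) (total F (Fin m) • G) r =
      -(shiftT F b₂ (m + n) • plugL (insMap h m f w) G r) := by
  induction G using polV_induction generalizing r with
  | const x =>
    rw [total, add_smul, smul_pol, pol_C_mul, Finset.sum_smul, map_add, map_sum,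
      LinearMap.add_apply, LinearMap.sum_apply, plugL_pol_one, insMap_X_smul h hf]
    simp only [plugL_X_smul, plugL_pol_one, Finset.sum_sub_distrib, derivT_zero_specialize, map_sum,
      add_smul, Finset.sum_smul]
    abel
  | add x y hx hy => simp only [smul_add, map_add, LinearMap.add_apply, hx, hy]; abel
  | mulX k G ih =>
    rw [smul_comm, plugL_X_smul, plugL_X_smul, ih, ih, smul_sub, smul_neg, smul_comm]
    abel

/-- The insertion of a value of `g`. -/
def plugV (h : b = (b₁ && b₂)) {f : CMaps F V b₁ (n + 1)} (hf : f ∈ PV F V b₁ (n + 1))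
    (w : Fin n → V) : Val F V b₂ m →ₗ[F] ORegular F m n →ₗ[F] Val F V b (m + n) :=
  valLift b₂ (plugL (insMap h m f w)) fun hb x => LinearMap.ext fun r => by
    rw [plugL_total h hf]
    subst hb
    rw [shiftT, zero_smul, neg_zero, LinearMap.zero_apply]

@[simp] theorem plugV_proj (h : b = (b₁ && b₂)) {f : CMaps F V b₁ (n + 1)}
    (hf : f ∈ PV F V b₁ (n + 1)) (w : Fin n → V) (G : PolV F V (Fin m)) :
    plugV h hf w (proj F V b₂ m G) = plugL (insMap h m f w) G := valLift_proj _ _ _ _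

theorem insMap_update_add (h : b = (b₁ && b₂)) (f : CMaps F V b₁ (n + 1)) (w : Fin n → V)
    (j : Fin n) (x y : V) : insMap h m f (Function.update w j (x + y)) =
      insMap h m f (Function.update w j x) + insMap h m f (Function.update w j y) := by
  refine LinearMap.ext fun z => LinearMap.ext fun r => ?_
  simp only [insMap_apply, LinearMap.add_apply, Fin.cons_update, Maps.map_update_add, map_add]

theorem insMap_update_smul (h : b = (b₁ && b₂)) (f : CMaps F V b₁ (n + 1)) (w : Fin n → V)
    (j : Fin n) (c : F) (x : V) : insMap h m f (Function.update w j (c • x)) =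
      c • insMap h m f (Function.update w j x) := by
  refine LinearMap.ext fun z => LinearMap.ext fun r => ?_
  simp only [insMap_apply, LinearMap.smul_apply, Fin.cons_update, Maps.map_update_smul, map_smul]

theorem update_castAdd_castAdd (v : Fin (m + n) → V) (i : Fin m) (x : V) :
    (fun a => Function.update v (Fin.castAdd n i) x (Fin.castAdd n a)) =
      Function.update (fun a => v (Fin.castAdd n a)) i x :=
  Function.update_comp_eq_of_injective v (Fin.castAdd_injective m n) i x

theorem update_castAdd_natAdd (v : Fin (m + n) → V) (i : Fin m) (x : V) :
    (fun a => Function.update v (Fin.castAdd n i) x (Fin.natAdd m a)) =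
      fun a => v (Fin.natAdd m a) :=
  funext fun a => Function.update_of_ne (fun h => by
    have := congrArg Fin.val h
    have h2 := i.2
    simp at this
    omega) _ _

theorem update_natAdd_natAdd (v : Fin (m + n) → V) (j : Fin n) (x : V) :
    (fun a => Function.update v (Fin.natAdd m j) x (Fin.natAdd m a)) =
      Function.update (fun a => v (Fin.natAdd m a)) j x :=
  Function.update_comp_eq_of_injective v (Fin.natAdd_injective n m) j x

theorem update_natAdd_castAdd (v : Fin (m + n) → V) (j : Fin n) (x : V) :
    (fun a => Function.update v (Fin.natAdd m j) x (Fin.castAdd n a)) =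
      fun a => v (Fin.castAdd n a) :=
  funext fun a => Function.update_of_ne (fun h => by
    have := congrArg Fin.val h
    have h2 := a.2
    simp at this
    omega) _ _

/-- The product `f ∘ g` exists: both sesquilinearity conditions on the multiplication by `z_i - z_j`
make the defining expression balanced over the functions of the block, so it glues. -/
theorem exists_isComp (h : b = (b₁ && b₂)) {f : CMaps F V b₁ (n + 1)} {g : CMaps F V b₂ m}
    (hf : f ∈ PV F V b₁ (n + 1)) (hg : g ∈ PV F V b₂ m) :
    ∃ k : CMaps F V b (m + n), IsComp h f g k := by
  have key : ∀ v : Fin (m + n) → V, ∃ L : O F (m + n) →ₗ[F] Val F V b (m + n), ∀ q r,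
      L (blockIncl m n q * regIncl m n r) = plugV h hf (fun j => v (Fin.natAdd m j))
        (g (fun i => v (Fin.castAdd n i)) q) r := fun v => by
    refine exists_glue m n (plugV h hf (fun j => v (Fin.natAdd m j)) ∘ₗ
      g (fun i => v (Fin.castAdd n i))) fun i j q r => ?_
    rw [LinearMap.comp_apply, LinearMap.comp_apply, hg.2]
    obtain ⟨G, hG⟩ := proj_surjective b₂ m (g (fun i => v (Fin.castAdd n i)) q)
    rw [← hG, diffV_proj, plugV_proj, plugV_proj, plugL_diffL]
  choose L hL using key
  have hv : ∀ v (q : O F m) (G : PolV F V (Fin m)),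
      proj F V b₂ m G = g (fun i => v (Fin.castAdd n i)) q → ∀ r,
      L v (blockIncl m n q * regIncl m n r) =
        plugL (insMap h m f fun j => v (Fin.natAdd m j)) G r := fun v q G hG r => by
    rw [hL, ← hG, plugV_proj]
  refine ⟨show MultilinearMap F (fun _ : Fin (m + n) => V) (O F (m + n) →ₗ[F] Val F V b (m + n)) from
    { toFun := L, map_update_add' := ?_, map_update_smul' := ?_ }, fun v q r G hG => hv v q G hG r⟩
  · intro inst v i x y
    rw [Subsingleton.elim inst (instDecidableEqFin _)]
    refine blockIncl_ext m n fun q r => ?_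
    rw [LinearMap.add_apply, hL, hL, hL]
    refine Fin.addCases (fun i => ?_) (fun i => ?_) i
    · simp only [update_castAdd_castAdd, update_castAdd_natAdd, Maps.map_update_add,
        LinearMap.add_apply, map_add]
    · simp only [update_natAdd_castAdd, update_natAdd_natAdd]
      obtain ⟨G, hG⟩ := proj_surjective b₂ m (g (fun i => v (Fin.castAdd n i)) q)
      rw [← hG, plugV_proj, plugV_proj, plugV_proj, insMap_update_add, plugL_add_left,
        LinearMap.add_apply]
  · intro inst v i c x
    rw [Subsingleton.elim inst (instDecidableEqFin _)]
    refine blockIncl_ext m n fun q r => ?_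
    rw [LinearMap.smul_apply, hL, hL]
    refine Fin.addCases (fun i => ?_) (fun i => ?_) i
    · simp only [update_castAdd_castAdd, update_castAdd_natAdd, Maps.map_update_smul,
        LinearMap.smul_apply, map_smul]
    · simp only [update_natAdd_castAdd, update_natAdd_natAdd]
      obtain ⟨G, hG⟩ := proj_surjective b₂ m (g (fun i => v (Fin.castAdd n i)) q)
      rw [← hG, plugV_proj, plugV_proj, insMap_update_smul, plugL_smul_left,
        LinearMap.smul_apply]

/-- The sesquilinearity of `f` in an argument outside of the block, after an insertion. -/
theorem plugL_add_smul_derivT (h : b = (b₁ && b₂)) {f : CMaps F V b₁ (n + 1)}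
    (hf : f ∈ PV F V b₁ (n + 1)) (w : Fin n → V) (j : Fin n) (G : PolV F V (Fin m))
    (r : ORegular F m n) :
    plugL (insMap h m f (Function.update w j ((Polynomial.X : F[X]) • w j))) G r +
      (MvPolynomial.X (Fin.natAdd m j) : A F (Fin (m + n))) • plugL (insMap h m f w) G r =
      plugL (insMap h m f w) G (derivT _ (Fin.natAdd m j) r) := by
  induction G using polV_induction generalizing r with
  | const x =>
    have := hf.1 (Fin.cons x w : Fin (n + 1) → V) j.succ (specialize m n r)
    rw [Fin.cons_succ, ← Fin.cons_update] at this
    rw [plugL_pol_one, plugL_pol_one, plugL_pol_one, insMap_apply, insMap_apply, insMap_apply,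
      ← insV_X_succ_smul, ← map_add, this, derivT_succ_specialize]
  | add x y hx hy => simp only [map_add, LinearMap.add_apply, smul_add, ← hx, ← hy]; abel
  | mulX k G ih =>
    rw [plugL_X_smul, plugL_X_smul, plugL_X_smul, ← ih, derivT_comm, ← ih, smul_sub, smul_add,
      smul_comm (MvPolynomial.X (Fin.natAdd m j) : A F (Fin (m + n)))]
    abel

/-- The product of sesquilinear maps is sesquilinear. -/
theorem IsComp.mem_PV {h : b = (b₁ && b₂)} {f : CMaps F V b₁ (n + 1)} {g : CMaps F V b₂ m}
    {k : CMaps F V b (m + n)} (hk : IsComp h f g k) (hf : f ∈ PV F V b₁ (n + 1))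
    (hg : g ∈ PV F V b₂ m) : k ∈ PV F V b (m + n) := by
  refine ⟨fun v i p => ?_, fun v i j p => ?_⟩
  · obtain ⟨q, r, rfl⟩ := exists_blockIncl_mul_regIncl m n p
    obtain ⟨G, hG⟩ := proj_surjective b₂ m (g (fun i => v (Fin.castAdd n i)) q)
    refine Fin.addCases (fun i => ?_) (fun i => ?_) i
    · obtain ⟨G', hG'⟩ := proj_surjective b₂ m (g (fun i => v (Fin.castAdd n i)) (derivT ⊤ i q))
      have h1 := hg.1 (fun i => v (Fin.castAdd n i)) i q
      rw [derivT_mul, derivT_castAdd_blockIncl, derivT_regIncl, map_add, hk v q _ G hG,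
        mul_comm (regIncl m n r), hk v _ r G' hG',
        hk _ q r (G' - (MvPolynomial.X i : A F (Fin m)) • G), hk v q _ G hG,
        update_castAdd_natAdd, map_sub, LinearMap.sub_apply, plugL_X_smul]
      · abel
      · rw [update_castAdd_castAdd, map_sub, hG', ← h1, proj_smul, hG, add_sub_cancel_right]
    · rw [derivT_mul, derivT_natAdd_blockIncl, derivT_regIncl, mul_zero, add_zero, hk v q _ G hG,
        hk v q _ G hG, hk _ q r G, update_natAdd_natAdd, ← plugL_add_smul_derivT h hf]
      rw [update_natAdd_castAdd, hG]
  · obtain ⟨q, r, rfl⟩ := exists_blockIncl_mul_regIncl m n p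
    obtain ⟨G, hG⟩ := proj_surjective b₂ m (g (fun i => v (Fin.castAdd n i)) q)
    have : zsub ⊤ i j * (blockIncl m n q * regIncl m n r) =
        blockIncl m n q * regIncl m n (zsub _ i j * r) := by
      rw [map_mul, regIncl_zsub]; ring
    rw [this, hk v q _ G hG, hk v q _ G hG]
    exact plugL_zsub_mul _ i j (insMap_zsub_mul h hf _ i j) G r

open Classical in
/-- The product `f ∘ g` in the first position (zero if it does not exist; it exists for
sesquilinear `f` and `g`). -/
def comp (h : b = (b₁ && b₂)) (f : CMaps F V b₁ (n + 1)) (g : CMaps F V b₂ m) :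
    CMaps F V b (m + n) := if H : ∃ k, IsComp h f g k then H.choose else 0

theorem isComp_comp (h : b = (b₁ && b₂)) {f : CMaps F V b₁ (n + 1)} {g : CMaps F V b₂ m}
    (hf : f ∈ PV F V b₁ (n + 1)) (hg : g ∈ PV F V b₂ m) : IsComp h f g (comp h f g) := by
  have H := exists_isComp h hf hg
  rw [comp, dif_pos H]
  exact H.choose_spec

theorem comp_mem_PV (h : b = (b₁ && b₂)) {f : CMaps F V b₁ (n + 1)} {g : CMaps F V b₂ m}
    (hf : f ∈ PV F V b₁ (n + 1)) (hg : g ∈ PV F V b₂ m) : comp h f g ∈ PV F V b (m + n) :=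
  (isComp_comp h hf hg).mem_PV hf hg

end Comp

/-! ### Relabeling of the arguments -/

section Relabel

variable {F : Type u} {V : Type v} [Field F] [AddCommGroup V] [Module F V] [Module F[X] V]
  [IsScalarTower F F[X] V] {b b₁ b₂ b₃ b₁₂ b₂₃ : Bool} {m n m' n' : ℕ}

variable (F V) in
/-- The map on functionals induced by the relabeling `e`. -/
def reindexHom (b : Bool) (e : Fin n' ≃ Fin n) :
    (O F n →ₗ[F] Val F V b n) →ₗ[F] (O F n' →ₗ[F] Val F V b n') where
  toFun φ := renV F V b e ∘ₗ φ ∘ₗ (substT (equivHom e)).toLinearMap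
  map_add' φ ψ := by rw [LinearMap.add_comp, LinearMap.comp_add]
  map_smul' c φ := by rw [LinearMap.smul_comp, LinearMap.comp_smul, RingHom.id_apply]

/-- The map `f` with its arguments, its variables `z_i` and its variables `λ_i` relabeled, without
any sign. -/
def reindex (b : Bool) (e : Fin n' ≃ Fin n) : CMaps F V b n →ₗ[F] CMaps F V b n' where
  toFun f := (reindexHom F V b e).compMultilinearMap
    (MultilinearMap.domDomCongr e.symm
      (f : MultilinearMap F (fun _ : Fin n => V) (O F n →ₗ[F] Val F V b n)))
  map_add' _ _ := Maps.ext F V fun _ _ => map_add (renV F V b e) _ _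
  map_smul' c _ := Maps.ext F V fun _ _ => map_smul (renV F V b e) c _

theorem reindex_apply (e : Fin n' ≃ Fin n) (f : CMaps F V b n) (v : Fin n' → V) (p : O F n') :
    reindex b e f v p = renV F V b e (f (fun i => v (e.symm i)) (substT (equivHom e) p)) := rfl

theorem reindex_reindex {n'' : ℕ} (e : Fin n' ≃ Fin n) (e' : Fin n'' ≃ Fin n') (f : CMaps F V b n) :
    reindex b e' (reindex b e f) = reindex b (e'.trans e) f := by
  refine Maps.ext F V fun v p => ?_
  rw [reindex_apply, reindex_apply, reindex_apply, renV_renV, substT_substT]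
  rfl

theorem reindex_refl (f : CMaps F V b n) : reindex b (Equiv.refl _) f = f := by
  refine Maps.ext F V fun v p => ?_
  rw [reindex_apply, renV_refl, substT_eq_self _ fun _ => rfl]
  rfl

theorem reindex_mem_PV (e : Fin n' ≃ Fin n) {f : CMaps F V b n} (hf : f ∈ PV F V b n) :
    reindex b e f ∈ PV F V b n' := by
  refine ⟨fun v i p => ?_, fun v i j p => ?_⟩
  · have h := hf.1 (fun i => v (e.symm i)) (e i) (substT (equivHom e) p)
    rw [derivT_equiv, e.symm_apply_apply] at h
    rw [reindex_apply, reindex_apply, reindex_apply, ← h, map_add, renV_X_smul]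
    congr 4
    funext k
    by_cases hk : k = e i
    · subst hk; simp
    · rw [Function.update_of_ne hk, Function.update_of_ne]
      rintro rfl; simp at hk
  · rw [reindex_apply, reindex_apply, map_mul, substT_zsub, hf.2, diffV_renV]
    rfl

/-- The bijection of `{1, …, m' + n'}` with `{1, …, m + n}` given by bijections of the two blocks. -/
def sumEquiv (σ : Fin m' ≃ Fin m) (π : Fin n' ≃ Fin n) : Fin (m' + n') ≃ Fin (m + n) :=
  (finSumFinEquiv.symm.trans (Equiv.sumCongr σ π)).trans finSumFinEquiv

@[simp] theorem sumEquiv_castAdd (σ : Fin m' ≃ Fin m) (π : Fin n' ≃ Fin n) (i : Fin m') :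
    sumEquiv σ π (Fin.castAdd n' i) = Fin.castAdd n (σ i) := by
  simp [sumEquiv]

@[simp] theorem sumEquiv_natAdd (σ : Fin m' ≃ Fin m) (π : Fin n' ≃ Fin n) (j : Fin n') :
    sumEquiv σ π (Fin.natAdd m' j) = Fin.natAdd m (π j) := by
  simp [sumEquiv]

theorem sumEquiv_symm (σ : Fin m' ≃ Fin m) (π : Fin n' ≃ Fin n) :
    (sumEquiv σ π).symm = sumEquiv σ.symm π.symm := rfl

/-- The bijection of `{0, …, n'}` with `{0, …, n}` that fixes `0`. -/
def consEquiv (π : Fin n' ≃ Fin n) : Fin (n' + 1) ≃ Fin (n + 1) :=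
  ((finSuccEquiv n').trans (Equiv.optionCongr π)).trans (finSuccEquiv n).symm

@[simp] theorem consEquiv_zero (π : Fin n' ≃ Fin n) : consEquiv π 0 = 0 := by
  simp [consEquiv]

@[simp] theorem consEquiv_succ (π : Fin n' ≃ Fin n) (j : Fin n') :
    consEquiv π j.succ = (π j).succ := by
  simp [consEquiv]

theorem consEquiv_symm (π : Fin n' ≃ Fin n) : (consEquiv π).symm = consEquiv π.symm := by
  simp [consEquiv, Equiv.ext_iff]

theorem cons_comp_consEquiv (π : Fin n' ≃ Fin n) (x : V) (w : Fin n' → V) :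
    (fun i => (Fin.cons x w : Fin (n' + 1) → V) ((consEquiv π).symm i)) =
      (Fin.cons x fun j => w (π.symm j) : Fin (n + 1) → V) := by
  funext i
  rw [consEquiv_symm]
  refine Fin.cases ?_ (fun j => ?_) i <;> simp

theorem collapse_sumEquiv (σ : Fin m' ≃ Fin m) (π : Fin n' ≃ Fin n) (i : Fin (m' + n')) :
    collapse m n (sumEquiv σ π i) = consEquiv π (collapse m' n' i) := by
  refine Fin.addCases (fun i => ?_) (fun j => ?_) i <;> simp

/-- `sumEquiv` as a homomorphism of the graphs of the allowed poles. -/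
def sumEquivHom (σ : Fin m' ≃ Fin m) (π : Fin n' ≃ Fin n) : regGraph m' n' →g regGraph m n :=
  ⟨sumEquiv σ π, fun {i j} h => by
    change collapse m n _ ≠ collapse m n _
    rw [collapse_sumEquiv, collapse_sumEquiv]
    exact (consEquiv π).injective.ne h⟩

@[simp] theorem sumEquivHom_apply (σ : Fin m' ≃ Fin m) (π : Fin n' ≃ Fin n) (i) :
    sumEquivHom σ π i = sumEquiv σ π i := rfl

theorem rename_shiftT {N N' : ℕ} (e : Fin N ≃ Fin N') (b : Bool) :
    MvPolynomial.rename e (shiftT F b N) = shiftT F b N' := by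
  cases b
  · rw [shiftT, map_neg, rename_total]; rfl
  · rw [shiftT, map_zero]; rfl

theorem renV_insV (h : b = (b₁ && b₂)) (σ : Fin m' ≃ Fin m) (π : Fin n' ≃ Fin n)
    (y : Val F V b₁ (n + 1)) : renV F V b (sumEquiv σ π) (insV V h m n y) =
      insV V h m' n' (renV F V b₁ (consEquiv π) y) := by
  obtain ⟨y, rfl⟩ := proj_surjective _ _ y
  rw [insV_proj, renV_proj, renV_proj, insV_proj, substL_substL, substL_substL]
  congr 3
  refine MvPolynomial.algHom_ext fun k => ?_
  rw [AlgHom.comp_apply, AlgHom.comp_apply, sumEquiv_symm, consEquiv_symm]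
  refine Fin.cases ?_ (fun j => ?_) k
  · simp only [insA, MvPolynomial.aeval_X, Fin.cons_zero, MvPolynomial.rename_X, map_add, map_sum,
      sumEquiv_castAdd, consEquiv_zero, rename_shiftT]
    rw [Equiv.sum_comp σ.symm fun i => (MvPolynomial.X (Fin.castAdd n' i) : A F (Fin (m' + n')))]
  · simp [insA]

/-- The insertion of polynomials commutes with relabelings. -/
theorem renV_plugL (h : b = (b₁ && b₂)) (σ : Fin m' ≃ Fin m) (π : Fin n' ≃ Fin n)
    (f : CMaps F V b₁ (n + 1)) (w : Fin n' → V) (G : PolV F V (Fin m)) (r : ORegular F m' n') :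
    renV F V b (sumEquiv σ π)
      (plugL (insMap h m f fun j => w (π.symm j)) G (substT (sumEquivHom σ π) r)) =
      plugL (insMap h m' (reindex b₁ (consEquiv π) f) w)
        (substL V (MvPolynomial.rename σ.symm) G) r := by
  induction G using polV_induction generalizing r with
  | const x =>
    rw [substL_pol, map_one, plugL_pol_one, plugL_pol_one, insMap_apply, insMap_apply, renV_insV,
      reindex_apply, cons_comp_consEquiv, specialize_eq, specialize_eq, substT_substT, substT_substT]
    rw [substT_congr (φ := (collapseHom m n).comp (sumEquivHom σ π))
      (ψ := (equivHom (consEquiv π)).comp (collapseHom m' n')) fun i => collapse_sumEquiv σ π i]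
  | add x y hx hy => simp only [map_add, LinearMap.add_apply, hx, hy]
  | mulX i G ih =>
    have h1 : Fin.castAdd n i = sumEquiv σ π (Fin.castAdd n' (σ.symm i)) := by simp
    rw [substL_smul, MvPolynomial.rename_X, plugL_X_smul, plugL_X_smul, map_sub, h1, renV_X_smul,
      ih]
    have h2 := derivT_substT_of_injective (sumEquivHom (m := m) (n := n) σ π)
      (sumEquiv σ π).injective (Fin.castAdd n' (σ.symm i)) r
    rw [sumEquivHom_apply] at h2
    rw [h2, ih]

/-- The product in the first position commutes with relabelings. -/
theorem IsComp.reindex {h : b = (b₁ && b₂)} {f : CMaps F V b₁ (n + 1)} {g : CMaps F V b₂ m}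
    {k : CMaps F V b (m + n)} (hk : IsComp h f g k) (σ : Fin m' ≃ Fin m) (π : Fin n' ≃ Fin n) :
    IsComp h (Chiral.reindex b₁ (consEquiv π) f) (Chiral.reindex b₂ σ g)
      (Chiral.reindex b (sumEquiv σ π) k) := by
  intro v q r G hG
  have h1 : substT (equivHom (sumEquiv σ π)) (blockIncl m' n' q * regIncl m' n' r) =
      blockIncl m n (substT (equivHom σ) q) * regIncl m n (substT (sumEquivHom σ π) r) := by
    rw [map_mul]
    congr 1
    · rw [blockIncl_eq, blockIncl_eq, substT_substT, substT_substT]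
      exact substT_congr (fun i => by simp) q
    · rw [regIncl_eq, regIncl_eq, substT_substT, substT_substT]
      exact substT_congr (fun i => by simp) r
  have h2 : substL V (MvPolynomial.rename σ.symm) (substL V (MvPolynomial.rename σ) G) = G := by
    have := renV_renV false σ.symm σ G
    rw [Equiv.self_trans_symm] at this
    exact this.trans (renV_refl false G)
  rw [reindex_apply, h1, hk _ _ _ (substL V (MvPolynomial.rename σ) G)]
  · conv_rhs => rw [← h2, ← renV_plugL h σ π]
    rw [sumEquiv_symm]
    simp only [sumEquiv_natAdd]
  · have h3 := renV_proj b₂ σ.symm G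
    rw [Equiv.symm_symm] at h3
    rw [← h3, hG, reindex_apply, renV_renV, Equiv.symm_trans_self, renV_refl]
    rw [sumEquiv_symm]
    simp only [sumEquiv_castAdd]

theorem reindex_comp (h : b = (b₁ && b₂)) {f : CMaps F V b₁ (n + 1)} {g : CMaps F V b₂ m}
    (hf : f ∈ PV F V b₁ (n + 1)) (hg : g ∈ PV F V b₂ m) (σ : Fin m' ≃ Fin m)
    (π : Fin n' ≃ Fin n) : reindex b (sumEquiv σ π) (comp h f g) =
      comp h (reindex b₁ (consEquiv π) f) (reindex b₂ σ g) :=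
  ((isComp_comp h hf hg).reindex σ π).unique
    (isComp_comp h (reindex_mem_PV _ hf) (reindex_mem_PV _ hg))

end Relabel

/-! ### Sequential associativity of the products in the first position -/

section Sequential

variable {F : Type u} {V : Type v} [Field F] [AddCommGroup V] [Module F V] [Module F[X] V]
  [IsScalarTower F F[X] V] {b b₁ b₂ b₃ b₁₂ b₂₃ : Bool}

theorem plugV_X_smul {m n : ℕ} (h : b = (b₁ && b₂)) {f : CMaps F V b₁ (n + 1)}
    (hf : f ∈ PV F V b₁ (n + 1)) (w : Fin n → V) (i : Fin m) (y : Val F V b₂ m)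
    (r : ORegular F m n) :
    plugV h hf w ((MvPolynomial.X i : A F (Fin m)) • y) r =
      (MvPolynomial.X (Fin.castAdd n i) : A F (Fin (m + n))) • plugV h hf w y r -
        plugV h hf w y (derivT _ (Fin.castAdd n i) r) := by
  obtain ⟨y, rfl⟩ := proj_surjective _ _ y
  rw [← proj_smul, plugV_proj, plugL_X_smul, plugV_proj]

/-- The identification of `{0, …, t + n}` with a block of `t + 1` and a block of `n` elements. -/
def assocOuter (t n : ℕ) : Fin (t + n + 1) ≃ Fin (t + 1 + n) := finCongr (by omega)

/-- The identification of the index sets of three consecutive blocks. -/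
def assocIndex (s t n : ℕ) : Fin (s + (t + n)) ≃ Fin (s + t + n) := finCongr (by omega)

variable (s t n : ℕ)

@[simp] theorem assocOuter_zero : assocOuter t n 0 = Fin.castAdd n 0 := Fin.ext (by simp [assocOuter])

@[simp] theorem assocOuter_succ_castAdd (j : Fin t) :
    assocOuter t n (Fin.castAdd n j).succ = Fin.castAdd n j.succ := Fin.ext (by simp [assocOuter])

@[simp] theorem assocOuter_succ_natAdd (j : Fin n) :
    assocOuter t n (Fin.natAdd t j).succ = Fin.natAdd (t + 1) j :=
  Fin.ext (by simp [assocOuter]; omega)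

@[simp] theorem assocOuter_symm_castAdd_zero : (assocOuter t n).symm (Fin.castAdd n 0) = 0 := by
  rw [Equiv.symm_apply_eq]; simp

@[simp] theorem assocOuter_symm_castAdd_succ (j : Fin t) :
    (assocOuter t n).symm (Fin.castAdd n j.succ) = (Fin.castAdd n j).succ := by
  rw [Equiv.symm_apply_eq]; simp

@[simp] theorem assocOuter_symm_natAdd (j : Fin n) :
    (assocOuter t n).symm (Fin.natAdd (t + 1) j) = (Fin.natAdd t j).succ := by
  rw [Equiv.symm_apply_eq]; simp

@[simp] theorem assocIndex_castAdd (i : Fin s) :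
    assocIndex s t n (Fin.castAdd (t + n) i) = Fin.castAdd n (Fin.castAdd t i) :=
  Fin.ext (by simp [assocIndex])

@[simp] theorem assocIndex_natAdd_castAdd (j : Fin t) :
    assocIndex s t n (Fin.natAdd s (Fin.castAdd n j)) = Fin.castAdd n (Fin.natAdd s j) :=
  Fin.ext (by simp [assocIndex])

@[simp] theorem assocIndex_natAdd_natAdd (j : Fin n) :
    assocIndex s t n (Fin.natAdd s (Fin.natAdd t j)) = Fin.natAdd (s + t) j :=
  Fin.ext (by simp [assocIndex]; omega)

@[simp] theorem assocIndex_symm_castAdd_castAdd (i : Fin s) :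
    (assocIndex s t n).symm (Fin.castAdd n (Fin.castAdd t i)) = Fin.castAdd (t + n) i := by
  rw [Equiv.symm_apply_eq]; simp

@[simp] theorem assocIndex_symm_castAdd_natAdd (j : Fin t) :
    (assocIndex s t n).symm (Fin.castAdd n (Fin.natAdd s j)) =
      Fin.natAdd s (Fin.castAdd n j) := by
  rw [Equiv.symm_apply_eq]; simp

@[simp] theorem assocIndex_symm_natAdd (j : Fin n) :
    (assocIndex s t n).symm (Fin.natAdd (s + t) j) = Fin.natAdd s (Fin.natAdd t j) := by
  rw [Equiv.symm_apply_eq]; simp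

/-- The contraction of the first `s` of three blocks. -/
def contract (i : Fin (s + t + n)) : Fin (t + 1 + n) :=
  assocOuter t n (collapse s (t + n) ((assocIndex s t n).symm i))

@[simp] theorem contract_castAdd (i : Fin (s + t)) :
    contract s t n (Fin.castAdd n i) = Fin.castAdd n (collapse s t i) := by
  refine Fin.addCases (fun i => ?_) (fun j => ?_) i <;> simp [contract]

@[simp] theorem contract_natAdd (i : Fin n) :
    contract s t n (Fin.natAdd (s + t) i) = Fin.natAdd (t + 1) i := by
  simp [contract]

theorem collapse_contract (i : Fin (s + t + n)) :
    collapse (t + 1) n (contract s t n i) = collapse (s + t) n i := by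
  refine Fin.addCases (fun i => ?_) (fun j => ?_) i <;> simp

/-- `contract` as a homomorphism of the graphs of the allowed poles. -/
def contractHom : regGraph (s + t) n →g regGraph (t + 1) n :=
  ⟨contract s t n, fun {i j} h => by
    change collapse _ _ _ ≠ collapse _ _ _
    rw [collapse_contract, collapse_contract]
    exact h⟩

/-- The inclusion of the functions regular on the first two blocks in those regular on the first
block. -/
def outerHom : regGraph (s + t) n →g regGraph s (t + n) :=
  ⟨(assocIndex s t n).symm, fun {i j} h => by
    change collapse _ _ _ ≠ collapse _ _ _
    intro h'
    apply h
    rw [← collapse_contract s t n i, ← collapse_contract s t n j, contract, h', contract]⟩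

/-- The inclusion of the functions of the first two blocks that are regular on the first block. -/
def innerHom : regGraph s t →g regGraph s (t + n) :=
  ⟨fun i => (assocIndex s t n).symm (Fin.castAdd n i), fun {i j} h => by
    change collapse _ _ _ ≠ collapse _ _ _
    intro h'
    apply h
    apply Fin.castAdd_injective _ n
    rw [← contract_castAdd, ← contract_castAdd, contract, h', contract]⟩

@[simp] theorem contractHom_apply (i) : contractHom s t n i = contract s t n i := rfl

@[simp] theorem outerHom_apply (i) : outerHom s t n i = (assocIndex s t n).symm i := rfl

@[simp] theorem innerHom_apply (i) :
    innerHom s t n i = (assocIndex s t n).symm (Fin.castAdd n i) := rfl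

variable {s t n}

/-- The two iterated substitutions of the variables `λ_i` agree, including the shifts of the first
variables. -/
theorem rename_insA_insA (h₂ : b₂₃ = (b₂ && b₃)) :
    ((insA F s (t + n) (shiftT F b₃ (s + (t + n)))).comp
        (MvPolynomial.rename (assocOuter t n).symm)).comp
      (insA F (t + 1) n (shiftT F b₂ (t + 1 + n))) =
    ((MvPolynomial.rename (assocIndex s t n).symm).comp
      (insA F (s + t) n (shiftT F b₂₃ (s + t + n))) :
        A F (Fin (n + 1)) →ₐ[F[X]] A F (Fin (s + (t + n)))) := by
  refine MvPolynomial.algHom_ext fun k => ?_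
  rw [AlgHom.comp_apply, AlgHom.comp_apply, AlgHom.comp_apply]
  refine Fin.cases ?_ (fun j => ?_) k
  · simp only [insA, MvPolynomial.aeval_X, Fin.cons_zero, map_add, map_sum, rename_shiftT,
      MvPolynomial.rename_X, Fin.sum_univ_succ, Fin.sum_univ_add, assocOuter_symm_castAdd_zero,
      assocOuter_symm_castAdd_succ, assocIndex_symm_castAdd_castAdd, assocIndex_symm_castAdd_natAdd,
      Fin.cons_succ]
    have key : insA F s (t + n) (shiftT F b₃ (s + (t + n))) (shiftT F b₂ (t + n + 1)) +
        shiftT F b₃ (s + (t + n)) = shiftT F b₂₃ (s + (t + n)) := by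
      subst h₂
      cases b₂
      · rw [shiftT, map_neg, insA_total, Bool.false_and, shiftT]; ring
      · rw [shiftT, map_zero, Bool.true_and, zero_add]
    rw [← key, insA]
    ring
  · simp [insA]

theorem plugL_shiftT_smul {m n : ℕ} (h : b = (b₁ && b₂₃)) (h₂ : b₂₃ = (b₂ && b₃))
    {f : CMaps F V b₁ (n + 1)} (hf : f ∈ PV F V b₁ (n + 1)) (w : Fin n → V) (G : PolV F V (Fin m))
    (r : ORegular F m n) :
    plugL (insMap h m f w) (shiftT F b₃ m • G) r =
      shiftT F b₃ (m + n) • plugL (insMap h m f w) G r := by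
  cases b₃
  · rw [Bool.and_false] at h₂
    subst h₂
    rw [shiftT, neg_smul, map_neg, LinearMap.neg_apply, plugL_total h hf, neg_neg]
  · rw [shiftT, shiftT, zero_smul, zero_smul, map_zero, LinearMap.zero_apply]

/-- The first block may be contracted before or after the insertion into `f`. -/
theorem insV_renV_plugL (h : b = (b₁₂ && b₃)) (h₁ : b₁₂ = (b₁ && b₂)) (h' : b = (b₁ && b₂₃))
    (h₂ : b₂₃ = (b₂ && b₃)) {f : CMaps F V b₁ (n + 1)} (hf : f ∈ PV F V b₁ (n + 1)) (w : Fin n → V)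
    (G : PolV F V (Fin (t + 1))) (r : ORegular F (s + t) n) :
    insV V h s (t + n) (renV F V b₁₂ (assocOuter t n)
        (plugL (insMap h₁ (t + 1) f w) G (substT (contractHom s t n) r))) =
      renV F V b (assocIndex s t n) (plugL (insMap h' (s + t) f w)
        (substL V (insA F s t (shiftT F b₃ (s + t))) G) r) := by
  induction G using polV_induction generalizing r with
  | const y =>
    rw [substL_pol, map_one, plugL_pol_one, plugL_pol_one, insMap_apply, insMap_apply,
      specialize_eq, specialize_eq, substT_substT,
      substT_congr (φ := (collapseHom (t + 1) n).comp (contractHom s t n))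
        (ψ := collapseHom (s + t) n) fun i => collapse_contract s t n i]
    generalize f (Fin.cons y w : Fin (n + 1) → V) (substT (collapseHom (s + t) n) r) = z
    obtain ⟨z, rfl⟩ := proj_surjective _ _ z
    rw [insV_proj, renV_proj, insV_proj, insV_proj, renV_proj, substL_substL, substL_substL,
      substL_substL, ← rename_insA_insA h₂]
  | add x y hx hy => simp only [map_add, LinearMap.add_apply, hx, hy]
  | mulX k G ih =>
    rw [substL_smul, plugL_X_smul, map_sub, map_sub]
    refine Fin.cases ?_ (fun j => ?_) k
    · have h1 : (Fin.castAdd n 0 : Fin (t + 1 + n)) = assocOuter t n 0 := by simp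
      have h3 : derivT (regGraph (t + 1) n) (assocOuter t n 0) (substT (contractHom s t n) r) =
          ∑ i : Fin s, substT (contractHom s t n)
            (derivT _ (Fin.castAdd n (Fin.castAdd t i)) r) := by
        classical
        rw [derivT_substT, Fin.sum_univ_add, Fin.sum_univ_add]
        have h4 : ∀ x : Fin n, Fin.natAdd (t + 1) x ≠ Fin.castAdd n (0 : Fin (t + 1)) :=
          fun x hx => by
            have := congrArg Fin.val hx
            simp at this
        simp [h4, (Fin.castAdd_injective (t + 1) n).eq_iff]
      rw [h1, renV_X_smul, insV_X_zero_smul, ih, h3]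
      simp only [map_sum, ih]
      rw [insA, MvPolynomial.aeval_X, Fin.cons_zero, add_smul, add_smul, map_add,
        LinearMap.add_apply, ← insA, plugL_shiftT_smul h' h₂ hf, map_add, Finset.sum_smul,
        Finset.sum_smul, map_sum, LinearMap.sum_apply, map_sum]
      have h5 : ∀ y : Val F V b (s + t + n), renV F V b (assocIndex s t n)
          (shiftT F b₃ (s + t + n) • y) =
          shiftT F b₃ (s + (t + n)) • renV F V b (assocIndex s t n) y := fun y => by
        rw [renV, valMap_smul, rename_shiftT]
      have h6 : ∀ i : Fin s, (Fin.castAdd n (Fin.castAdd t i)) =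
          assocIndex s t n (Fin.castAdd (t + n) i) := fun i => by simp
      rw [h5, add_sub_assoc, ← Finset.sum_sub_distrib]
      congr 1
      refine Finset.sum_congr rfl fun i _ => ?_
      rw [plugL_X_smul, map_sub, h6, renV_X_smul]
    · have h1 : (Fin.castAdd n j.succ : Fin (t + 1 + n)) =
          assocOuter t n (Fin.castAdd n j).succ := by simp
      have h3 : derivT (regGraph (t + 1) n) (assocOuter t n (Fin.castAdd n j).succ)
          (substT (contractHom s t n) r) =
          substT (contractHom s t n) (derivT _ (Fin.castAdd n (Fin.natAdd s j)) r) := by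
        refine derivT_substT_of_fiber _ (by simp) (fun i => ?_) r
        refine Fin.addCases (fun i => ?_) (fun i => ?_) i
        · refine Fin.addCases (fun i => ?_) (fun i => ?_) i
          · intro h
            simp [(Fin.castAdd_injective (t + 1) n).eq_iff, (Fin.succ_ne_zero j).symm] at h
          · intro h
            simp [(Fin.castAdd_injective (t + 1) n).eq_iff] at h
            rw [h]
        · intro hx
          have := congrArg Fin.val hx
          have h2 := j.2
          simp at this
          omega
      have h6 : (Fin.castAdd n (Fin.natAdd s j)) =
          assocIndex s t n (Fin.natAdd s (Fin.castAdd n j)) := by simp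
      rw [h1, renV_X_smul, insV_X_succ_smul, ih, h3, ih, insA, MvPolynomial.aeval_X, Fin.cons_succ,
        ← insA, plugL_X_smul, map_sub, h6, renV_X_smul]

/-- The values of the two bracketings of `f`, `g` and `h` at a product of functions. -/
theorem plugL_reindex_comp (h : b = (b₁₂ && b₃)) (h₁ : b₁₂ = (b₁ && b₂)) (h' : b = (b₁ && b₂₃))
    (h₂ : b₂₃ = (b₂ && b₃)) {f : CMaps F V b₁ (n + 1)} (hf : f ∈ PV F V b₁ (n + 1))
    {g : CMaps F V b₂ (t + 1)} {k : CMaps F V b₁₂ (t + 1 + n)} (hk : IsComp h₁ f g k)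
    (w : Fin (t + n) → V) (H : PolV F V (Fin s)) (r₁ : ORegular F s t)
    (r₂ : ORegular F (s + t) n) :
    plugL (insMap h s (reindex b₁₂ (assocOuter t n) k) w) H
        (substT (innerHom s t n) r₁ * substT (outerHom s t n) r₂) =
      renV F V b (assocIndex s t n) (plugV h' hf (fun j => w (Fin.natAdd t j))
        (plugL (insMap h₂ s g fun j => w (Fin.castAdd n j)) H r₁) r₂) := by
  induction H using polV_induction generalizing r₁ r₂ with
  | const x =>
    rw [plugL_pol_one, plugL_pol_one, insMap_apply, insMap_apply, reindex_apply]
    have h1 : substT (equivHom (assocOuter t n)) (specialize s (t + n)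
        (substT (innerHom s t n) r₁ * substT (outerHom s t n) r₂)) =
        blockIncl (t + 1) n (specialize s t r₁) *
          regIncl (t + 1) n (substT (contractHom s t n) r₂) := by
      rw [map_mul, map_mul]
      simp only [specialize_eq, blockIncl_eq, regIncl_eq, substT_substT]
      congr 1
      · exact substT_congr (fun i => contract_castAdd s t n i) r₁
    obtain ⟨G, hG⟩ := proj_surjective b₂ (t + 1)
      (g (Fin.cons x fun j => w (Fin.castAdd n j) : Fin (t + 1) → V) (specialize s t r₁))
    rw [h1, hk _ _ _ G]
    · rw [← hG, insV_proj, plugV_proj, ← insV_renV_plugL h h₁ h' h₂ hf]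
      simp
    · rw [hG]
      congr 2
      funext i
      refine Fin.cases ?_ (fun i => ?_) i
      · rw [Fin.cons_zero, assocOuter_symm_castAdd_zero, Fin.cons_zero]
      · rw [Fin.cons_succ, assocOuter_symm_castAdd_succ, Fin.cons_succ]
  | add x y hx hy => simp only [map_add, LinearMap.add_apply, hx, hy]
  | mulX i H ih =>
    have h6 : Fin.castAdd n (Fin.castAdd t i) =
          assocIndex s t n (Fin.castAdd (t + n) i) := by simp
    have h7 : derivT _ (Fin.castAdd (t + n) i) (substT (outerHom s t n) r₂) =
        substT (outerHom s t n) (derivT _ (Fin.castAdd n (Fin.castAdd t i)) r₂) := by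
      have := derivT_substT_of_injective (outerHom s t n) (assocIndex s t n).symm.injective
        (Fin.castAdd n (Fin.castAdd t i)) r₂
      rwa [outerHom_apply, assocIndex_symm_castAdd_castAdd] at this
    have h8 : derivT _ (Fin.castAdd (t + n) i) (substT (innerHom s t n) r₁) =
        substT (innerHom s t n) (derivT _ (Fin.castAdd t i) r₁) := by
      have := derivT_substT_of_injective (innerHom s t n)
        ((assocIndex s t n).symm.injective.comp (Fin.castAdd_injective _ n)) (Fin.castAdd t i) r₁
      rwa [innerHom_apply, assocIndex_symm_castAdd_castAdd] at this
    rw [plugL_X_smul, plugL_X_smul, derivT_mul, h7, h8, map_add, ih, ih,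
      mul_comm (substT (outerHom s t n) r₂), ih, map_sub, LinearMap.sub_apply, map_sub,
      plugV_X_smul, map_sub, h6, renV_X_smul]
    abel

/-- Sequential associativity of the product in the first position. -/
theorem comp_comp_first (h : b = (b₁₂ && b₃)) (h₁ : b₁₂ = (b₁ && b₂)) (h' : b = (b₁ && b₂₃))
    (h₂ : b₂₃ = (b₂ && b₃)) {f : CMaps F V b₁ (n + 1)} (hf : f ∈ PV F V b₁ (n + 1))
    {g : CMaps F V b₂ (t + 1)} (hg : g ∈ PV F V b₂ (t + 1)) {k : CMaps F V b₃ s}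
    (hk : k ∈ PV F V b₃ s) :
    comp h (reindex b₁₂ (assocOuter t n) (comp h₁ f g)) k =
      reindex b (assocIndex s t n) (comp h' f (comp h₂ g k)) := by
  have hL := isComp_comp h (reindex_mem_PV (assocOuter t n) (comp_mem_PV h₁ hf hg)) hk
  have hR := isComp_comp h' hf (comp_mem_PV h₂ hg hk)
  refine Maps.ext F V fun v p => ?_
  obtain ⟨p', r₂, hp⟩ := exists_blockIncl_mul_regIncl (s + t) n
    (substT (equivHom (assocIndex s t n)) p)
  obtain ⟨q, r₁, rfl⟩ := exists_blockIncl_mul_regIncl s t p'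
  have hp' : p = blockIncl s (t + n) q *
      regIncl s (t + n) (substT (innerHom s t n) r₁ * substT (outerHom s t n) r₂) := by
    apply substT_injective (equivHom (assocIndex s t n)) (assocIndex s t n).injective
    rw [hp, map_mul, map_mul, map_mul, map_mul, mul_assoc]
    simp only [blockIncl_eq, regIncl_eq, substT_substT]
    congr 1
  obtain ⟨H, hH⟩ := proj_surjective b₃ s (k (fun i => v (Fin.castAdd (t + n) i)) q)
  obtain ⟨G, hG⟩ := proj_surjective b₂₃ (s + t)
    (plugL (insMap h₂ s g fun j => v (Fin.natAdd s (Fin.castAdd n j))) H r₁)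
  rw [reindex_apply, hp, hR _ _ _ G]
  · rw [hp', hL v q _ H hH, plugL_reindex_comp h h₁ h' h₂ hf (isComp_comp h₁ hf hg), ← hG, plugV_proj]
    simp
  · rw [hG, isComp_comp h₂ hg hk _ _ _ H]
    · simp
    · rw [hH]; simp

end Sequential

/-! ### Parallel associativity of the products in the first position -/

section Parallel

variable {F : Type u} {V : Type v} [Field F] [AddCommGroup V] [Module F V] [Module F[X] V]
  [IsScalarTower F F[X] V] {b b₁ b₂ b₃ b₁₂ b₁₃ : Bool}

/-- The bijection of `{0, …, m + n}` with a block of `m` and a block of `n + 1` elements that maps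
`0` to the first element of the second block. -/
def frontEquiv (m n : ℕ) : Fin (m + n + 1) ≃ Fin (m + (n + 1)) where
  toFun := Fin.cons (Fin.natAdd m 0)
    (Fin.append (Fin.castAdd (n + 1)) fun j => Fin.natAdd m j.succ)
  invFun := Fin.append (fun i => (Fin.castAdd n i).succ)
    (Fin.cons 0 fun j => (Fin.natAdd m j).succ)
  left_inv i := by
    refine Fin.cases ?_ (fun i => ?_) i
    · simp
    · refine Fin.addCases (fun i => ?_) (fun i => ?_) i <;> simp
  right_inv i := by
    refine Fin.addCases (fun i => ?_) (fun i => ?_) i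
    · simp
    · refine Fin.cases ?_ (fun i => ?_) i <;> simp

/-- The exchange of the first two of three blocks. -/
def blockSwapFun (l m n : ℕ) : Fin (l + (m + n)) → Fin (m + (l + n)) :=
  Fin.append (fun i => Fin.natAdd m (Fin.castAdd n i))
    (Fin.append (Fin.castAdd (l + n)) fun j => Fin.natAdd m (Fin.natAdd l j))

@[simp] theorem blockSwapFun_blockSwapFun (l m n : ℕ) (i : Fin (l + (m + n))) :
    blockSwapFun m l n (blockSwapFun l m n i) = i := by
  refine Fin.addCases (fun i => ?_) (fun i => ?_) i
  · simp [blockSwapFun]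
  · refine Fin.addCases (fun i => ?_) (fun i => ?_) i <;> simp [blockSwapFun]

/-- The exchange of the first two of three blocks. -/
def blockSwap (l m n : ℕ) : Fin (l + (m + n)) ≃ Fin (m + (l + n)) :=
  ⟨blockSwapFun l m n, blockSwapFun m l n, blockSwapFun_blockSwapFun l m n,
    blockSwapFun_blockSwapFun m l n⟩

variable (l m n : ℕ)

theorem blockSwap_symm : (blockSwap l m n).symm = blockSwap m l n := rfl

@[simp] theorem blockSwap_castAdd (i : Fin l) :
    blockSwap l m n (Fin.castAdd (m + n) i) = Fin.natAdd m (Fin.castAdd n i) := by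
  simp [blockSwap, blockSwapFun]

@[simp] theorem blockSwap_natAdd_castAdd (i : Fin m) :
    blockSwap l m n (Fin.natAdd l (Fin.castAdd n i)) = Fin.castAdd (l + n) i := by
  simp [blockSwap, blockSwapFun]

@[simp] theorem blockSwap_natAdd_natAdd (i : Fin n) :
    blockSwap l m n (Fin.natAdd l (Fin.natAdd m i)) = Fin.natAdd m (Fin.natAdd l i) := by
  simp [blockSwap, blockSwapFun]

@[simp] theorem frontEquiv_zero : frontEquiv m n 0 = Fin.natAdd m 0 := by
  simp [frontEquiv]

@[simp] theorem frontEquiv_castAdd (i : Fin m) :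
    frontEquiv m n (Fin.castAdd n i).succ = Fin.castAdd (n + 1) i := by
  simp [frontEquiv]

@[simp] theorem frontEquiv_natAdd (i : Fin n) :
    frontEquiv m n (Fin.natAdd m i).succ = Fin.natAdd m i.succ := by
  simp [frontEquiv]

@[simp] theorem frontEquiv_symm_castAdd (i : Fin m) :
    (frontEquiv m n).symm (Fin.castAdd (n + 1) i) = (Fin.castAdd n i).succ := by
  rw [Equiv.symm_apply_eq]; simp

@[simp] theorem frontEquiv_symm_natAdd_zero :
    (frontEquiv m n).symm (Fin.natAdd m 0) = 0 := by
  rw [Equiv.symm_apply_eq]; simp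

@[simp] theorem frontEquiv_symm_natAdd_succ (i : Fin n) :
    (frontEquiv m n).symm (Fin.natAdd m i.succ) = (Fin.natAdd m i).succ := by
  rw [Equiv.symm_apply_eq]; simp

/-- The contraction of the first of three blocks to one element, which is placed after the second
block. -/
def contractFirst (i : Fin (l + (m + n))) : Fin (m + (n + 1)) :=
  frontEquiv m n (collapse l (m + n) i)

@[simp] theorem contractFirst_castAdd (i : Fin l) :
    contractFirst l m n (Fin.castAdd (m + n) i) = Fin.natAdd m 0 := by
  simp [contractFirst]

@[simp] theorem contractFirst_natAdd_castAdd (i : Fin m) :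
    contractFirst l m n (Fin.natAdd l (Fin.castAdd n i)) = Fin.castAdd (n + 1) i := by
  simp [contractFirst]

@[simp] theorem contractFirst_natAdd_natAdd (i : Fin n) :
    contractFirst l m n (Fin.natAdd l (Fin.natAdd m i)) = Fin.natAdd m i.succ := by
  simp [contractFirst]

/-- The pairs of indices that do not both lie in the first or both in the second of three blocks. -/
def parGraph : SimpleGraph (Fin (l + (m + n))) :=
  (regGraph m (n + 1)).comap (contractFirst l m n)

/-- `contractFirst` as a homomorphism of the graphs of the allowed poles. -/
def contractFirstHom : parGraph l m n →g regGraph m (n + 1) := ⟨contractFirst l m n, fun h => h⟩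

theorem collapse_contractFirst_blockSwap (i : Fin (l + (m + n))) :
    collapse l (n + 1) (contractFirst m l n (blockSwap l m n i)) =
      Equiv.swap 0 1 (collapse m (n + 1) (contractFirst l m n i)) := by
  have h1 : ∀ k : Fin n, Equiv.swap (0 : Fin (n + 1 + 1)) 1 k.succ.succ = k.succ.succ := fun k =>
    Equiv.swap_apply_of_ne_of_ne (Fin.succ_ne_zero _)
      (fun h => Fin.succ_ne_zero k (Fin.succ_injective _ h))
  refine Fin.addCases (fun i => ?_) (fun i => ?_) i
  · simp
  · refine Fin.addCases (fun i => ?_) (fun i => ?_) i <;> simp [h1]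

/-- `blockSwap` as a homomorphism of the graphs of the allowed poles. -/
def blockSwapHom : parGraph l m n →g parGraph m l n :=
  ⟨blockSwap l m n, fun {i j} h => by
    change collapse _ _ _ ≠ collapse _ _ _
    rw [collapse_contractFirst_blockSwap, collapse_contractFirst_blockSwap]
    exact (Equiv.swap _ _).injective.ne h⟩

/-- The inclusion of the functions regular on the first two blocks in those regular on the first
block. -/
def parRegHom : parGraph l m n →g regGraph l (m + n) :=
  ⟨id, fun {i j} h => by
    change collapse _ _ _ ≠ collapse _ _ _
    intro h'
    apply (regGraph m (n + 1)).ne_of_adj h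
    change collapse l (m + n) i = collapse l (m + n) j at h'
    rw [contractFirst, h', contractFirst]⟩

/-- The inclusion of the functions of the second block. -/
def secondBlockHom : (⊤ : SimpleGraph (Fin m)) →g regGraph l (m + n) :=
  ⟨fun i => Fin.natAdd l (Fin.castAdd n i), fun {i j} h => by
    change collapse _ _ _ ≠ collapse _ _ _
    rw [collapse_natAdd, collapse_natAdd]
    intro h'
    exact h.ne (Fin.castAdd_injective _ n (Fin.succ_injective _ h'))⟩

@[simp] theorem contractFirstHom_apply (i) : contractFirstHom l m n i = contractFirst l m n i := rfl

@[simp] theorem blockSwapHom_apply (i) : blockSwapHom l m n i = blockSwap l m n i := rfl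

@[simp] theorem parRegHom_apply (i) : parRegHom l m n i = i := rfl

@[simp] theorem secondBlockHom_apply (i) :
    secondBlockHom l m n i = Fin.natAdd l (Fin.castAdd n i) := rfl

variable {l m n}

theorem insMap_cons_add (h : b = (b₁ && b₂)) (f : CMaps F V b₁ (n + 1 + 1)) (w : Fin n → V)
    (x y : V) : insMap h m f (Fin.cons (x + y) w : Fin (n + 1) → V) =
      insMap h m f (Fin.cons x w : Fin (n + 1) → V) +
        insMap h m f (Fin.cons y w : Fin (n + 1) → V) := by
  have := insMap_update_add (m := m) h f (Fin.cons x w : Fin (n + 1) → V) 0 x y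
  simpa only [Fin.update_cons_zero] using this

theorem insMap_cons_smul (h : b = (b₁ && b₂)) (f : CMaps F V b₁ (n + 1 + 1)) (w : Fin n → V)
    (c : F) (x : V) : insMap h m f (Fin.cons (c • x) w : Fin (n + 1) → V) =
      c • insMap h m f (Fin.cons x w : Fin (n + 1) → V) := by
  have := insMap_update_smul (m := m) h f (Fin.cons x w : Fin (n + 1) → V) 0 c x
  simpa only [Fin.update_cons_zero] using this

/-- The insertion of a polynomial into the first and of a constant into the second argument. -/
def plugConst (h : b = (b₁₂ && b₃)) (h₁ : b₁₂ = (b₁ && b₂)) (l : ℕ) (f : CMaps F V b₁ (n + 1 + 1))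
    (w : Fin n → V) (G : PolV F V (Fin m)) :
    V →ₗ[F] TInv F (parGraph l m n) →ₗ[F] Val F V b (l + (m + n)) where
  toFun x := insV V h l (m + n) ∘ₗ renV F V b₁₂ (frontEquiv m n) ∘ₗ
    plugL (insMap h₁ m f (Fin.cons x w : Fin (n + 1) → V)) G ∘ₗ
      (substT (contractFirstHom l m n)).toLinearMap
  map_add' x y := by
    rw [insMap_cons_add, plugL_add_left, LinearMap.add_comp, LinearMap.comp_add,
      LinearMap.comp_add]
  map_smul' c x := by
    rw [insMap_cons_smul, plugL_smul_left, LinearMap.smul_comp, LinearMap.comp_smul,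
      LinearMap.comp_smul, RingHom.id_apply]

theorem plugConst_apply (h : b = (b₁₂ && b₃)) (h₁ : b₁₂ = (b₁ && b₂))
    (f : CMaps F V b₁ (n + 1 + 1)) (w : Fin n → V) (G : PolV F V (Fin m)) (x : V)
    (r : TInv F (parGraph l m n)) : plugConst h h₁ l f w G x r =
      insV V h l (m + n) (renV F V b₁₂ (frontEquiv m n)
        (plugL (insMap h₁ m f (Fin.cons x w : Fin (n + 1) → V)) G
          (substT (contractFirstHom l m n) r))) := rfl

/-- The insertion of a polynomial `G` into the first and of a polynomial into the second argument.
-/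
def plugTwo (h : b = (b₁₂ && b₃)) (h₁ : b₁₂ = (b₁ && b₂)) (f : CMaps F V b₁ (n + 1 + 1))
    (w : Fin n → V) (G : PolV F V (Fin m)) :
    PolV F V (Fin l) →ₗ[F] TInv F (parGraph l m n) →ₗ[F] Val F V b (l + (m + n)) :=
  opEval (fun i : Fin l => mulDer (parGraph l m n) (Val F V b (l + (m + n)))
    (Fin.castAdd (m + n) i)) (plugConst h h₁ l f w G)

theorem plugTwo_pol_one (h : b = (b₁₂ && b₃)) (h₁ : b₁₂ = (b₁ && b₂))
    (f : CMaps F V b₁ (n + 1 + 1)) (w : Fin n → V) (G : PolV F V (Fin m)) (x : V)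
    (r : TInv F (parGraph l m n)) : plugTwo h h₁ f w G (pol 1 x) r =
      insV V h l (m + n) (renV F V b₁₂ (frontEquiv m n)
        (plugL (insMap h₁ m f (Fin.cons x w : Fin (n + 1) → V)) G
          (substT (contractFirstHom l m n) r))) := by
  rw [plugTwo, opEval_pol_one, plugConst_apply]

theorem plugTwo_X_smul (h : b = (b₁₂ && b₃)) (h₁ : b₁₂ = (b₁ && b₂))
    (f : CMaps F V b₁ (n + 1 + 1)) (w : Fin n → V) (G : PolV F V (Fin m)) (i : Fin l)
    (H : PolV F V (Fin l)) (r : TInv F (parGraph l m n)) :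
    plugTwo h h₁ f w G ((MvPolynomial.X i : A F (Fin l)) • H) r =
      (MvPolynomial.X (Fin.castAdd (m + n) i) : A F (Fin (l + (m + n)))) • plugTwo h h₁ f w G H r -
        plugTwo h h₁ f w G H (derivT _ (Fin.castAdd (m + n) i) r) := by
  rw [plugTwo, opEval_X_smul _ fun _ _ => commute_mulDer _ _]; rfl

theorem plugTwo_add (h : b = (b₁₂ && b₃)) (h₁ : b₁₂ = (b₁ && b₂))
    (f : CMaps F V b₁ (n + 1 + 1)) (w : Fin n → V) (G G' : PolV F V (Fin m))
    (H : PolV F V (Fin l)) :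
    plugTwo h h₁ f w (G + G') H = plugTwo h h₁ f w G H + plugTwo h h₁ f w G' H := by
  have key : plugConst h h₁ l f w (G + G') =
      plugConst h h₁ l f w G + plugConst h h₁ l f w G' :=
    LinearMap.ext fun x => LinearMap.ext fun r => by
      rw [plugConst_apply, map_add, LinearMap.add_apply, map_add, map_add]
      rfl
  rw [plugTwo, plugTwo, plugTwo, ← opEval_add_right, key]

/-- The counterpart of `plugTwo_X_smul` for the variables of the second polynomial. -/
theorem plugTwo_X_smul_right (h : b = (b₁₂ && b₃)) (h₁ : b₁₂ = (b₁ && b₂))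
    (f : CMaps F V b₁ (n + 1 + 1)) (w : Fin n → V) (G : PolV F V (Fin m)) (j : Fin m)
    (H : PolV F V (Fin l)) (r : TInv F (parGraph l m n)) :
    plugTwo h h₁ f w ((MvPolynomial.X j : A F (Fin m)) • G) H r =
      (MvPolynomial.X (Fin.natAdd l (Fin.castAdd n j)) : A F (Fin (l + (m + n)))) •
        plugTwo h h₁ f w G H r -
        plugTwo h h₁ f w G H (derivT _ (Fin.natAdd l (Fin.castAdd n j)) r) := by
  induction H using polV_induction generalizing r with
  | const x =>
    have h1 : Fin.castAdd (n + 1) j = frontEquiv m n (Fin.castAdd n j).succ := by simp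
    have h2 : derivT _ (Fin.castAdd (n + 1) j) (substT (contractFirstHom l m n) r) =
        substT (contractFirstHom l m n) (derivT _ (Fin.natAdd l (Fin.castAdd n j)) r) := by
      refine derivT_substT_of_fiber _ (by simp) (fun i => ?_) r
      refine Fin.addCases (fun i => ?_) (fun i => ?_) i
      · intro hx
        have := congrArg Fin.val hx
        have h2 := j.2
        simp at this
        omega
      · refine Fin.addCases (fun i => ?_) (fun i => ?_) i
        · intro h
          rw [contractFirstHom_apply, contractFirst_natAdd_castAdd,
            (Fin.castAdd_injective m (n + 1)).eq_iff] at h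
          rw [h]
        · intro hx
          have := congrArg Fin.val hx
          have h2 := j.2
          simp at this
          omega
    rw [plugTwo_pol_one, plugTwo_pol_one, plugTwo_pol_one, plugL_X_smul, h2, map_sub, map_sub, h1,
      renV_X_smul, insV_X_succ_smul]
  | add x y hx hy => simp only [map_add, LinearMap.add_apply, hx, hy, smul_add]; abel
  | mulX i H ih =>
    rw [plugTwo_X_smul, plugTwo_X_smul, plugTwo_X_smul, ih, ih, derivT_comm, smul_sub, smul_sub,
      smul_comm]
    abel

/-- The iterated substitutions of the variables `λ_i` agree. For two maps in `P̃^ch` they differ: both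
shifts would involve `∂`; this is why one of the maps has to lie in `P^ch`. -/
theorem rename_insA_insA_parallel (hb : (b₂ || b₃) = true) :
    (((insA F l (m + n) (shiftT F b₃ (l + (m + n)))).comp
        (MvPolynomial.rename (frontEquiv m n).symm)).comp
      (insA F m (n + 1) (shiftT F b₂ (m + (n + 1))))) =
    (((MvPolynomial.rename (blockSwap l m n).symm).comp
      (insA F m (l + n) (shiftT F b₂ (m + (l + n))))).comp
        (MvPolynomial.rename (frontEquiv l n).symm)).comp
      ((insA F l (n + 1) (shiftT F b₃ (l + (n + 1)))).comp
        (MvPolynomial.rename (Equiv.swap (0 : Fin (n + 1 + 1)) 1))) := by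
  have h1 : ∀ k : Fin n, Equiv.swap (0 : Fin (n + 1 + 1)) 1 k.succ.succ = k.succ.succ := fun k =>
    Equiv.swap_apply_of_ne_of_ne (Fin.succ_ne_zero _)
      (fun h => Fin.succ_ne_zero k (Fin.succ_injective _ h))
  have h2 : ∀ (l m : ℕ) (b₂ b₃ : Bool), (b₂ || b₃) = true →
      insA F l (m + n) (shiftT F b₃ (l + (m + n))) (shiftT F b₂ (m + n + 1)) =
        shiftT F b₂ (l + (m + n)) := by
    intro l m b₂ b₃ hb
    cases b₂
    · rw [Bool.false_or] at hb
      subst hb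
      rw [shiftT, shiftT, shiftT, map_neg, insA_total, zero_add]
    · rw [shiftT, shiftT, map_zero]
  have hb' : (b₃ || b₂) = true := by rw [Bool.or_comm]; exact hb
  have h3 : ∀ (s : A F (Fin (m + (n + 1)))),
      insA F m (n + 1) s (MvPolynomial.X 1) = MvPolynomial.X (Fin.natAdd m 0) := fun s => by
    rw [insA, MvPolynomial.aeval_X, ← Fin.succ_zero_eq_one, Fin.cons_succ]
  have h3' : ∀ (s : A F (Fin (l + (n + 1)))),
      insA F l (n + 1) s (MvPolynomial.X 1) = MvPolynomial.X (Fin.natAdd l 0) := fun s => by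
    rw [insA, MvPolynomial.aeval_X, ← Fin.succ_zero_eq_one, Fin.cons_succ]
  have h4 : ∀ (m n : ℕ) (s : A F (Fin (m + n))),
      insA F m n s (MvPolynomial.X 0) = s + ∑ i : Fin m, MvPolynomial.X (Fin.castAdd n i) :=
    fun m n s => by rw [insA, MvPolynomial.aeval_X, Fin.cons_zero]
  have h5 : ∀ (m n : ℕ) (s : A F (Fin (m + n))) (j : Fin n),
      insA F m n s (MvPolynomial.X j.succ) = MvPolynomial.X (Fin.natAdd m j) :=
    fun m n s j => by rw [insA, MvPolynomial.aeval_X, Fin.cons_succ]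
  refine MvPolynomial.algHom_ext fun k => ?_
  simp only [AlgHom.comp_apply, MvPolynomial.rename_X]
  refine Fin.cases ?_ (fun j => Fin.cases ?_ (fun j => ?_) j) k
  · rw [Equiv.swap_apply_left, h3', MvPolynomial.rename_X, frontEquiv_symm_natAdd_zero, h4, h4,
      map_add, map_add, map_sum, map_sum, map_add, map_sum, rename_shiftT, rename_shiftT,
      h2 _ _ _ _ hb]
    simp only [MvPolynomial.rename_X, frontEquiv_symm_castAdd, h5, blockSwap_symm,
      blockSwap_castAdd]
  · rw [Fin.succ_zero_eq_one, Equiv.swap_apply_right, h3, MvPolynomial.rename_X,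
      frontEquiv_symm_natAdd_zero, h4, h4, map_add, map_add, map_sum, map_sum, map_add, map_sum,
      rename_shiftT, h2 _ _ _ _ hb', rename_shiftT]
    simp only [MvPolynomial.rename_X, frontEquiv_symm_castAdd, h5, blockSwap_symm,
      blockSwap_natAdd_castAdd]
  · rw [h1]
    simp only [MvPolynomial.rename_X, h5, frontEquiv_symm_natAdd_succ, blockSwap_symm,
      blockSwap_natAdd_natAdd]

theorem cons_cons_swap (x y : V) (w : Fin n → V) (i : Fin (n + 1 + 1)) :
    (Fin.cons x (Fin.cons y w : Fin (n + 1) → V) : Fin (n + 1 + 1) → V) (Equiv.swap 0 1 i) =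
      (Fin.cons y (Fin.cons x w : Fin (n + 1) → V) : Fin (n + 1 + 1) → V) i := by
  refine Fin.cases ?_ (fun j => Fin.cases ?_ (fun k => ?_) j) i
  · rw [Equiv.swap_apply_left, ← Fin.succ_zero_eq_one]; simp
  · rw [Fin.succ_zero_eq_one, Equiv.swap_apply_right, Fin.cons_zero, ← Fin.succ_zero_eq_one]; simp
  · have h1 : Equiv.swap (0 : Fin (n + 1 + 1)) 1 k.succ.succ = k.succ.succ :=
      Equiv.swap_apply_of_ne_of_ne (Fin.succ_ne_zero _)
        (fun h => Fin.succ_ne_zero k (Fin.succ_injective _ h))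
    rw [h1]
    simp

/-- The insertion into the first two arguments is symmetric. -/
theorem plugTwo_swap (h : b = (b₁₂ && b₃)) (h₁ : b₁₂ = (b₁ && b₂)) (h' : b = (b₁₃ && b₂))
    (h₁' : b₁₃ = (b₁ && b₃)) (hb : (b₂ || b₃) = true) (f : CMaps F V b₁ (n + 1 + 1))
    (w : Fin n → V) (G : PolV F V (Fin m)) (H : PolV F V (Fin l)) (r : TInv F (parGraph l m n)) :
    plugTwo h h₁ f w G H r = renV F V b (blockSwap l m n)
      (plugTwo h' h₁' (reindex b₁ (Equiv.swap 0 1) f) w H G (substT (blockSwapHom l m n) r)) := by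
  have hd : ∀ (i : Fin (l + (m + n))) (r : TInv F (parGraph l m n)),
      derivT _ (blockSwap l m n i) (substT (blockSwapHom l m n) r) =
      substT (blockSwapHom l m n) (derivT _ i r) := fun i r =>
    derivT_substT_of_injective (blockSwapHom l m n) (blockSwap l m n).injective i r
  have hG : ∀ i : Fin m, Fin.castAdd (l + n) i =
    blockSwap l m n (Fin.natAdd l (Fin.castAdd n i)) := fun i => by simp
  have hH : ∀ i : Fin l, Fin.natAdd m (Fin.castAdd n i) =
    blockSwap l m n (Fin.castAdd (m + n) i) := fun i => by simp
  induction H using polV_induction generalizing r with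
  | const x =>
    induction G using polV_induction generalizing r with
    | const y =>
      rw [plugTwo_pol_one, plugTwo_pol_one, plugL_pol_one, plugL_pol_one, insMap_apply,
        insMap_apply, reindex_apply]
      simp only [specialize_eq, substT_substT, Equiv.symm_swap, cons_cons_swap]
      rw [substT_congr (φ := (equivHom (Equiv.swap 0 1)).comp ((collapseHom l (n + 1)).comp
          ((contractFirstHom m l n).comp (blockSwapHom l m n))))
        (ψ := (collapseHom m (n + 1)).comp (contractFirstHom l m n)) fun i => ?_]
      · generalize f _ _ = z
        obtain ⟨z, rfl⟩ := proj_surjective _ _ z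
        rw [insV_proj, renV_proj, insV_proj, renV_proj, insV_proj, renV_proj, insV_proj, renV_proj,
          substL_substL, substL_substL, substL_substL, substL_substL, substL_substL, substL_substL]
        have := rename_insA_insA_parallel (F := F) (l := l) (m := m) (n := n) hb
        rw [Equiv.symm_swap]
        rw [this]
        rfl
      · change Equiv.swap 0 1 (collapse l (n + 1) (contractFirst m l n (blockSwap l m n i))) =
          collapse m (n + 1) (contractFirst l m n i)
        rw [collapse_contractFirst_blockSwap, Equiv.swap_apply_self]
    | add x y hx hy =>
      simp only [plugTwo_add, map_add, LinearMap.add_apply, hx, hy]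
    | mulX i G ih =>
      rw [plugTwo_X_smul_right, plugTwo_X_smul, map_sub, hG, renV_X_smul, hd, ih, ih]
  | add x y hx hy => simp only [plugTwo_add, map_add, LinearMap.add_apply, hx, hy]
  | mulX i H ih =>
    rw [plugTwo_X_smul_right, plugTwo_X_smul, map_sub, hH, renV_X_smul, hd, ih, ih]

/-- The value of a product of `f ∘ g` with a third map, inserted into the second argument of `f`. -/
theorem plugL_reindex_comp_second (h : b = (b₁₂ && b₃)) (h₁ : b₁₂ = (b₁ && b₂))
    {f : CMaps F V b₁ (n + 1 + 1)} {g : CMaps F V b₂ m} {k : CMaps F V b₁₂ (m + (n + 1))}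
    (hk : IsComp h₁ f g k) (w : Fin (m + n) → V) (H : PolV F V (Fin l)) (q : O F m)
    (G : PolV F V (Fin m)) (hG : proj F V b₂ m G = g (fun i => w (Fin.castAdd n i)) q)
    (r : TInv F (parGraph l m n)) :
    plugL (insMap h l (reindex b₁₂ (frontEquiv m n) k) w) H
        (substT (secondBlockHom l m n) q * substT (parRegHom l m n) r) =
      plugTwo h h₁ f (fun j => w (Fin.natAdd m j)) G H r := by
  induction H using polV_induction generalizing r with
  | const x =>
    rw [plugTwo_pol_one, plugL_pol_one, insMap_apply, reindex_apply]
    have h1 : substT (equivHom (frontEquiv m n)) (specialize l (m + n)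
        (substT (secondBlockHom l m n) q * substT (parRegHom l m n) r)) =
        blockIncl m (n + 1) q * regIncl m (n + 1) (substT (contractFirstHom l m n) r) := by
      rw [map_mul, map_mul]
      simp only [specialize_eq, blockIncl_eq, regIncl_eq, substT_substT]
      congr 1
      exact substT_congr (fun i => by simp) q
    rw [h1, hk _ _ _ G]
    · congr 6
      funext i
      refine Fin.cases ?_ (fun i => ?_) i <;> simp
    · rw [hG]
      simp
  | add x y hx hy => simp only [map_add, LinearMap.add_apply, hx, hy]
  | mulX i H ih =>
    have h7 : derivT _ (Fin.castAdd (m + n) i) (substT (parRegHom l m n) r) =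
        substT (parRegHom l m n) (derivT _ (Fin.castAdd (m + n) i) r) :=
      derivT_substT_of_injective (parRegHom l m n) (fun _ _ h => h) _ r
    have h8 : derivT _ (Fin.castAdd (m + n) i) (substT (secondBlockHom l m n) q) = 0 :=
      derivT_substT_of_notMem (secondBlockHom l m n) _ (fun j h => by
        have := congrArg Fin.val h
        have h2 := i.2
        simp at this
        omega) q
    rw [plugL_X_smul, plugTwo_X_smul, derivT_mul, h7, h8, mul_zero, add_zero, ih, ih]

/-- Every function is a product of a function of the first block, one of the second block and one
that is regular on both. -/
theorem exists_three_factors (p : O F (l + (m + n))) :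
    ∃ (q₁ : O F l) (q₂ : O F m) (r : TInv F (parGraph l m n)),
      p = blockIncl l (m + n) q₁ *
        regIncl l (m + n) (substT (secondBlockHom l m n) q₂ * substT (parRegHom l m n) r) := by
  obtain ⟨q₁, x, rfl⟩ := exists_blockIncl_mul_regIncl l (m + n) p
  obtain ⟨d, hd, r, hr⟩ := exists_denominator_of_hom (secondBlockHom l m n) (parRegHom l m n)
    (fun _ => rfl) (fun i j hij => by
      rw [or_iff_not_imp_left]
      intro hadj
      have h1 : collapse m (n + 1) (contractFirst l m n i) =
        collapse m (n + 1) (contractFirst l m n j) := not_not.1 hadj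
      have h2 : collapse l (m + n) i ≠ collapse l (m + n) j := hij
      clear hij hadj
      revert h1 h2
      refine Fin.addCases (fun i => ?_) (fun i => Fin.addCases (fun i => ?_) (fun i => ?_) i) i <;>
      refine Fin.addCases (fun j => ?_) (fun j => Fin.addCases (fun j => ?_) (fun j => ?_) j) j <;>
      intro h1 h2
      all_goals first
        | exact absurd rfl (by simpa using h2)
        | exact ⟨i, j, fun h => h2 (by rw [h]), rfl, rfl⟩
        | (exfalso
           simp [Fin.ext_iff] at h1 h2
           try omega)) x
  obtain ⟨e, he⟩ := exists_inv_of_mem_closure hd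
  refine ⟨q₁, e, r, ?_⟩
  rw [← hr, ← mul_assoc, ← map_mul, he, map_one, one_mul]

/-- Parallel associativity: the products with `g` in the first and with `k` in the second argument
of `f` commute. -/
theorem comp_comp_second (h : b = (b₁₂ && b₃)) (h₁ : b₁₂ = (b₁ && b₂)) (h' : b = (b₁₃ && b₂))
    (h₁' : b₁₃ = (b₁ && b₃)) (hb : (b₂ || b₃) = true) {f : CMaps F V b₁ (n + 1 + 1)}
    (hf : f ∈ PV F V b₁ (n + 1 + 1)) {g : CMaps F V b₂ m} (hg : g ∈ PV F V b₂ m)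
    {k : CMaps F V b₃ l} (hk : k ∈ PV F V b₃ l) :
    comp h (reindex b₁₂ (frontEquiv m n) (comp h₁ f g)) k =
      reindex b (blockSwap l m n) (comp h' (reindex b₁₃ (frontEquiv l n)
        (comp h₁' (reindex b₁ (Equiv.swap 0 1) f) k)) g) := by
  have hL := isComp_comp h (reindex_mem_PV (frontEquiv m n) (comp_mem_PV h₁ hf hg)) hk
  have hR := isComp_comp h' (reindex_mem_PV (frontEquiv l n)
    (comp_mem_PV h₁' (reindex_mem_PV (Equiv.swap 0 1) hf) hk)) hg
  refine Maps.ext F V fun v p => ?_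
  obtain ⟨q₁, q₂, r, rfl⟩ := exists_three_factors p
  obtain ⟨H, hH⟩ := proj_surjective b₃ l (k (fun i => v (Fin.castAdd (m + n) i)) q₁)
  obtain ⟨G, hG⟩ := proj_surjective b₂ m
    (g (fun i => v (Fin.natAdd l (Fin.castAdd n i))) q₂)
  have h1 : substT (equivHom (blockSwap l m n)) (blockIncl l (m + n) q₁ *
        regIncl l (m + n) (substT (secondBlockHom l m n) q₂ * substT (parRegHom l m n) r)) =
      blockIncl m (l + n) q₂ *
        regIncl m (l + n) (substT (secondBlockHom m l n) q₁ * substT (parRegHom m l n)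
          (substT (blockSwapHom l m n) r)) := by
    rw [map_mul, map_mul, map_mul, map_mul, mul_left_comm]
    simp only [blockIncl_eq, regIncl_eq, substT_substT]
    congr 1
    · exact substT_congr (fun i => by simp) q₂
    · congr 1
      exact substT_congr (fun i => by simp) q₁
  rw [hL v q₁ _ H hH, plugL_reindex_comp_second h h₁ (isComp_comp h₁ hf hg) _ H q₂ G hG, reindex_apply,
    h1, hR _ _ _ G, plugL_reindex_comp_second h' h₁' (isComp_comp h₁' (reindex_mem_PV _ hf) hk) _ G q₁ H,
    plugTwo_swap h h₁ h' h₁' hb]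
  · simp [blockSwap_symm]
  · rw [hH]; simp [blockSwap_symm]
  · rw [hG]; simp [blockSwap_symm]

end Parallel

/-! ### Koszul signs -/

section Signs

theorem ksign_comm (a b : ZMod 2) : ksign a b = ksign b a := by
  unfold ksign; simp only [and_comm]

theorem ksign_mul_self (a b : ZMod 2) : ksign a b * ksign a b = 1 := by
  revert a b; decide

theorem ksign_add_right (a b c : ZMod 2) : ksign a (b + c) = ksign a b * ksign a c := by
  revert a b c; decide

theorem ksign_zero_right (a : ZMod 2) : ksign a 0 = 1 := by
  revert a; decide

theorem ksign_sum_right {ι : Type*} (s : Finset ι) (a : ZMod 2) (ε : ι → ZMod 2) :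
    ksign a (∑ i ∈ s, ε i) = ∏ i ∈ s, ksign a (ε i) := by
  classical
  induction s using Finset.induction_on with
  | empty => simp [ksign_zero_right]
  | insert i s hi ih => rw [Finset.sum_insert hi, Finset.prod_insert hi, ksign_add_right, ih]

theorem ksign_sum_left {ι : Type*} (s : Finset ι) (a : ZMod 2) (ε : ι → ZMod 2) :
    ksign (∑ i ∈ s, ε i) a = ∏ i ∈ s, ksign (ε i) a := by
  rw [ksign_comm, ksign_sum_right]
  exact Finset.prod_congr rfl fun i _ => ksign_comm _ _

theorem castAdd_lt_castAdd {k : ℕ} (l : ℕ) (i j : Fin k) :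
    Fin.castAdd l i < Fin.castAdd l j ↔ i < j := Iff.rfl

/-- The sign of the rearrangement `e` of homogeneous vectors of parities `ε`. -/
def eSign {n n' : ℕ} (e : Fin n' ≃ Fin n) (ε : Fin n' → ZMod 2) : ℤ :=
  ∏ i, ∏ j, if i < j ∧ e j < e i then ksign (ε i) (ε j) else 1

variable {m n m' n' n'' : ℕ}

theorem permSign_eq_eSign (σ : Equiv.Perm (Fin n)) (ε : Fin n → ZMod 2) :
    permSign σ ε = eSign σ ε := rfl

/-- The cocycle identity for the Koszul sign: a pair that is reversed by both maps contributes
twice. -/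
theorem eSign_trans (e : Fin n' ≃ Fin n) (e' : Fin n'' ≃ Fin n') (ε : Fin n'' → ZMod 2) :
    eSign (e'.trans e) ε = eSign e' ε * eSign e (fun i => ε (e'.symm i)) := by
  have h1 : eSign e (fun i => ε (e'.symm i)) =
      (∏ i, ∏ j, if i < j ∧ e' i < e' j ∧ e (e' j) < e (e' i) then ksign (ε i) (ε j) else 1) *
      ∏ i, ∏ j, if i < j ∧ e' j < e' i ∧ e (e' i) < e (e' j) then ksign (ε i) (ε j) else 1 := by
    rw [eSign, ← Equiv.prod_comp e']
    have h2 : ∀ i, (∏ j, if e' i < j ∧ e j < e (e' i) then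
        ksign (ε (e'.symm (e' i))) (ε (e'.symm j)) else 1) =
        ∏ j, ((if i < j ∧ e' i < e' j ∧ e (e' j) < e (e' i) then ksign (ε i) (ε j) else 1) *
          if j < i ∧ e' i < e' j ∧ e (e' j) < e (e' i) then ksign (ε j) (ε i) else 1) := fun i => by
      rw [← Equiv.prod_comp e']
      refine Finset.prod_congr rfl fun j _ => ?_
      simp only [Equiv.symm_apply_apply]
      rw [ksign_comm (ε j)]
      rcases lt_trichotomy i j with h | h | h
      · simp [h, h.not_gt]
      · subst h; simp
      · simp [h, h.not_gt]
    rw [Finset.prod_congr rfl fun i _ => h2 i]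
    simp only [Finset.prod_mul_distrib]
    congr 1
    exact Finset.prod_comm
  rw [h1, eSign, eSign, ← Finset.prod_mul_distrib, ← Finset.prod_mul_distrib]
  refine Finset.prod_congr rfl fun i _ => ?_
  rw [← Finset.prod_mul_distrib, ← Finset.prod_mul_distrib]
  refine Finset.prod_congr rfl fun j _ => ?_
  by_cases h : i < j
  · simp only [h, true_and, Equiv.trans_apply]
    rcases lt_trichotomy (e' i) (e' j) with h' | h' | h'
    · simp [h', h'.not_gt]
    · exact absurd (e'.injective h') h.ne
    · rcases lt_trichotomy (e (e' i)) (e (e' j)) with h'' | h'' | h''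
      · simp [h', h'.not_gt, h'', h''.not_gt, ksign_mul_self]
      · exact absurd (e'.injective (e.injective h'')) h.ne
      · simp [h', h'.not_gt, h'', h''.not_gt]
  · simp [h]

theorem eSign_of_strictMono (e : Fin n' ≃ Fin n) (he : StrictMono e) (ε : Fin n' → ZMod 2) :
    eSign e ε = 1 :=
  Finset.prod_eq_one fun _ _ => Finset.prod_eq_one fun _ _ =>
    if_neg fun h => lt_asymm h.2 (he h.1)

theorem eSign_refl (ε : Fin n → ZMod 2) : eSign (Equiv.refl (Fin n)) ε = 1 :=
  eSign_of_strictMono _ (fun _ _ h => h) ε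

theorem eSign_sumEquiv (σ : Fin m' ≃ Fin m) (π : Fin n' ≃ Fin n) (ε : Fin (m' + n') → ZMod 2) :
    eSign (sumEquiv σ π) ε =
      eSign σ (fun i => ε (Fin.castAdd n' i)) * eSign π (fun j => ε (Fin.natAdd m' j)) := by
  have h1 : ∀ (k l : ℕ) (i : Fin k) (j : Fin l), ¬ Fin.natAdd k j < Fin.castAdd l i :=
    fun k l i j h => by
      have := Fin.lt_def.1 h
      have h2 := i.2
      simp at this
      omega
  simp only [eSign, Fin.prod_univ_add, sumEquiv_castAdd, sumEquiv_natAdd, h1, and_false, false_and,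
    if_false, Finset.prod_const_one, mul_one, one_mul, Fin.natAdd_lt_natAdd_iff,
    castAdd_lt_castAdd]

theorem eSign_consEquiv (π : Fin n' ≃ Fin n) (ε : Fin (n' + 1) → ZMod 2) :
    eSign (consEquiv π) ε = eSign π (fun j => ε j.succ) := by
  simp [eSign, Fin.prod_univ_succ]

theorem eSign_assocOuter (t n : ℕ) (ε : Fin (t + n + 1) → ZMod 2) : eSign (assocOuter t n) ε = 1 :=
  eSign_of_strictMono _ (fun _ _ h => h) ε

theorem eSign_assocIndex (s t n : ℕ) (ε : Fin (s + (t + n)) → ZMod 2) :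
    eSign (assocIndex s t n) ε = 1 :=
  eSign_of_strictMono _ (fun _ _ h => h) ε

theorem eSign_frontEquiv (m n : ℕ) (ε : Fin (m + n + 1) → ZMod 2) :
    eSign (frontEquiv m n) ε = ksign (ε 0) (∑ i : Fin m, ε (Fin.castAdd n i).succ) := by
  have h1 : ∀ (k l : ℕ) (i : Fin k) (j : Fin l), ¬ Fin.natAdd k j < Fin.castAdd l i :=
    fun k l i j h => by
      have := Fin.lt_def.1 h
      have h2 := i.2
      simp at this
      omega
  have h2 : ∀ (k l : ℕ) (i : Fin k) (j : Fin l), Fin.castAdd l i < Fin.natAdd k j :=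
    fun k l i j => Fin.lt_def.2 (by
      have h2 := i.2
      simp
      omega)
  have h3 : ∀ (k : ℕ) (i j : Fin k), ¬ (i < j ∧ j < i) := fun k i j h => lt_asymm h.1 h.2
  rw [ksign_sum_right]
  simp [eSign, Fin.prod_univ_succ, Fin.prod_univ_add, castAdd_lt_castAdd, h1, h2, h3]

theorem eSign_blockSwap (l m n : ℕ) (ε : Fin (l + (m + n)) → ZMod 2) :
    eSign (blockSwap l m n) ε = ksign (∑ i : Fin l, ε (Fin.castAdd (m + n) i))
      (∑ i : Fin m, ε (Fin.natAdd l (Fin.castAdd n i))) := by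
  have h1 : ∀ (k l : ℕ) (i : Fin k) (j : Fin l), ¬ Fin.natAdd k j < Fin.castAdd l i :=
    fun k l i j h => by
      have := Fin.lt_def.1 h
      have h2 := i.2
      simp at this
      omega
  have h2 : ∀ (k l : ℕ) (i : Fin k) (j : Fin l), Fin.castAdd l i < Fin.natAdd k j :=
    fun k l i j => Fin.lt_def.2 (by
      have h2 := i.2
      simp
      omega)
  have h3 : ∀ (k : ℕ) (i j : Fin k), ¬ (i < j ∧ j < i) := fun k i j h => lt_asymm h.1 h.2
  rw [ksign_sum_left]
  simp only [ksign_sum_right]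
  simp [eSign, Fin.prod_univ_add, castAdd_lt_castAdd, h1, h2, h3]

theorem eSign_swap (n : ℕ) (ε : Fin (n + 1 + 1) → ZMod 2) :
    eSign (Equiv.swap (0 : Fin (n + 1 + 1)) 1) ε = ksign (ε 0) (ε 1) := by
  have h1 : ∀ k : Fin n, Equiv.swap (0 : Fin (n + 1 + 1)) 1 k.succ.succ = k.succ.succ := fun k =>
    Equiv.swap_apply_of_ne_of_ne (Fin.succ_ne_zero _)
      (fun h => Fin.succ_ne_zero k (Fin.succ_injective _ h))
  have h2 : Equiv.swap (0 : Fin (n + 1 + 1)) 1 (Fin.succ 0) = 0 := Equiv.swap_apply_right 0 1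
  have h3 : ∀ (k : ℕ) (i j : Fin k), ¬ (i < j ∧ j < i) := fun k i j h => lt_asymm h.1 h.2
  have h4 : ∀ k : Fin n, ¬ k.succ.succ < (1 : Fin (n + 1 + 1)) := fun k h => by
    have := Fin.lt_def.1 h
    simp at this
  rw [eSign, Fin.prod_univ_succ, Fin.prod_univ_succ]
  simp only [Fin.prod_univ_succ (n := n + 1), Fin.prod_univ_succ (n := n), h1, h2,
    Equiv.swap_apply_left]
  simp [h3, h4]

end Signs

/-! ### The signed action of relabelings -/

section Decomposition

variable {R M : Type*} [Ring R] [AddCommGroup M] [Module R M] {P : ZMod 2 → Submodule R M}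

/-- The identification of a graded module with the sum of its summands. -/
def gradedEquiv (hP : DirectSum.IsInternal P) : (⨁ i, P i) ≃ₗ[R] M :=
  LinearEquiv.ofBijective (DirectSum.coeLinearMap P) hP

theorem gradedEquiv_apply (hP : DirectSum.IsInternal P) (y : ⨁ i, P i) :
    gradedEquiv hP y = DirectSum.coeLinearMap P y := rfl

/-- The projection onto a summand of a `ℤ/2`-grading. -/
def prjI (hP : DirectSum.IsInternal P) (i : ZMod 2) : M →ₗ[R] M :=
  (P i).subtype ∘ₗ DirectSum.component R (ZMod 2) (fun i => P i) i ∘ₗ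
    (gradedEquiv hP).symm.toLinearMap

theorem prjI_mem (hP : DirectSum.IsInternal P) (i : ZMod 2) (x : M) : prjI hP i x ∈ P i :=
  Submodule.coe_mem _

theorem gradedEquiv_symm_of_mem (hP : DirectSum.IsInternal P) {i : ZMod 2} {x : M}
    (hx : x ∈ P i) : (gradedEquiv hP).symm x =
      DirectSum.lof R (ZMod 2) (fun i => P i) i ⟨x, hx⟩ := by
  rw [LinearEquiv.symm_apply_eq]
  exact (DirectSum.coeLinearMap_lof P i ⟨x, hx⟩).symm

theorem prjI_of_mem (hP : DirectSum.IsInternal P) {i : ZMod 2} {x : M} (hx : x ∈ P i) :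
    prjI hP i x = x := by
  rw [prjI, LinearMap.comp_apply, LinearMap.comp_apply, LinearEquiv.coe_coe,
    gradedEquiv_symm_of_mem hP hx, DirectSum.component.lof_self]
  rfl

theorem prjI_of_mem_ne (hP : DirectSum.IsInternal P) {i j : ZMod 2} (hij : j ≠ i) {x : M}
    (hx : x ∈ P i) : prjI hP j x = 0 := by
  rw [prjI, LinearMap.comp_apply, LinearMap.comp_apply, LinearEquiv.coe_coe,
    gradedEquiv_symm_of_mem hP hx, DirectSum.component.of, dif_neg hij.symm]
  rfl

theorem sum_prjI (hP : DirectSum.IsInternal P) (x : M) : ∑ i, prjI hP i x = x := by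
  obtain ⟨y, rfl⟩ := (gradedEquiv hP).surjective x
  induction y using DirectSum.induction_on with
  | zero => simp
  | of i y =>
    have hm : gradedEquiv hP (DirectSum.of (fun i => P i) i y) ∈ P i := by
      rw [gradedEquiv_apply, DirectSum.coeLinearMap_of]
      exact y.2
    rw [Finset.sum_eq_single i, prjI_of_mem hP hm]
    · exact fun j _ hj => prjI_of_mem_ne hP hj hm
    · simp
  | add y z hy hz => simp only [map_add, Finset.sum_add_distrib, hy, hz]

end Decomposition

section Action

variable {F : Type u} {V : Type v} [Field F] [AddCommGroup V] [Module F V] [Module F[X] V]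
  [IsScalarTower F F[X] V] {E : ZMod 2 → Submodule F[X] V} {b b₁ b₂ b₃ b₁₂ b₁₃ b₂₃ : Bool}
  {l m n m' n' n'' : ℕ}

/-- The map `f` with its arguments projected to their parts of parities `ε`. -/
def compPrj (hE : DirectSum.IsInternal E) {Y : Type w} [AddCommGroup Y] [Module F Y]
    (ε : Fin n → ZMod 2) : Maps F V n Y →ₗ[F] Maps F V n Y where
  toFun f := (f : MultilinearMap F (fun _ : Fin n => V) (O F n →ₗ[F] Y)).compLinearMap
    fun i => (prjI hE (ε i)).restrictScalars F
  map_add' _ _ := rfl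
  map_smul' _ _ := rfl

theorem compPrj_apply (hE : DirectSum.IsInternal E) {Y : Type w} [AddCommGroup Y] [Module F Y]
    (ε : Fin n → ZMod 2) (f : Maps F V n Y) (v : Fin n → V) :
    compPrj hE ε f v = f fun i => prjI hE (ε i) (v i) := rfl

theorem sum_compPrj (hE : DirectSum.IsInternal E) {Y : Type w} [AddCommGroup Y] [Module F Y]
    (f : Maps F V n Y) (v : Fin n → V) : ∑ ε, compPrj hE ε f v = f v := by
  have h := MultilinearMap.map_sum
    (show MultilinearMap F (fun _ : Fin n => V) (O F n →ₗ[F] Y) from f)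
    (fun i (j : ZMod 2) => prjI hE j (v i))
  simp only [sum_prjI] at h
  exact h.symm

/-- Maps are determined by their values at homogeneous vectors. -/
theorem maps_ext_homogeneous (hE : DirectSum.IsInternal E) {Y : Type w} [AddCommGroup Y]
    [Module F Y] {f g : Maps F V n Y}
    (h : ∀ (ε : Fin n → ZMod 2) v p, (∀ i, v i ∈ E (ε i)) → f v p = g v p) : f = g := by
  refine Maps.ext F V fun v p => ?_
  rw [← sum_compPrj hE f, ← sum_compPrj hE g]
  congr 1
  refine Finset.sum_congr rfl fun ε _ => LinearMap.ext fun p => ?_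
  exact h ε _ p fun i => prjI_mem hE _ _

theorem compPrj_of_mem (hE : DirectSum.IsInternal E) {Y : Type w} [AddCommGroup Y] [Module F Y]
    (ε ε' : Fin n → ZMod 2) (f : Maps F V n Y) (v : Fin n → V) (hv : ∀ i, v i ∈ E (ε i)) :
    compPrj hE ε' f v = if ε' = ε then f v else 0 := by
  rw [compPrj_apply]
  split_ifs with h
  · subst h
    congr 1
    funext i
    exact prjI_of_mem hE (hv i)
  · obtain ⟨i, hi⟩ := Function.ne_iff.1 h
    exact MultilinearMap.map_coord_zero
      (show MultilinearMap F (fun _ : Fin n => V) (O F n →ₗ[F] Y) from f) i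
      (prjI_of_mem_ne hE hi (hv i))

theorem compPrj_mem_PV (hE : DirectSum.IsInternal E) (ε : Fin n → ZMod 2) {f : CMaps F V b n}
    (hf : f ∈ PV F V b n) : compPrj hE ε f ∈ PV F V b n := by
  refine ⟨fun v i p => ?_, fun v i j p => hf.2 _ i j p⟩
  have h := hf.1 (fun i => prjI hE (ε i) (v i)) i p
  rw [compPrj_apply, compPrj_apply, ← h]
  congr 4
  funext k
  by_cases hk : k = i
  · subst hk; simp
  · simp [Function.update_of_ne hk]

/-- The right action of relabelings of the arguments, with the Koszul sign. -/
def act (hE : DirectSum.IsInternal E) (b : Bool) (e : Fin n' ≃ Fin n) :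
    CMaps F V b n →ₗ[F] CMaps F V b n' :=
  ∑ ε, eSign e ε • (compPrj hE ε ∘ₗ reindex b e)

theorem act_eq_sum (hE : DirectSum.IsInternal E) (e : Fin n' ≃ Fin n) (f : CMaps F V b n) :
    act hE b e f = ∑ ε, eSign e ε • compPrj hE ε (reindex b e f) := by
  rw [act, LinearMap.sum_apply]
  rfl

/-- Evaluation of maps as a linear map. -/
def evalMaps (n : ℕ) (Y : Type w) [AddCommGroup Y] [Module F Y] (v : Fin n → V) (p : O F n) :
    Maps F V n Y →ₗ[F] Y where
  toFun f := f v p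
  map_add' _ _ := rfl
  map_smul' _ _ := rfl

theorem evalMaps_apply {Y : Type w} [AddCommGroup Y] [Module F Y] (v : Fin n → V) (p : O F n)
    (f : Maps F V n Y) : evalMaps n Y v p f = f v p := rfl

theorem zsmul_maps_apply {Y : Type w} [AddCommGroup Y] [Module F Y] (c : ℤ) (f : Maps F V n Y)
    (v : Fin n → V) (p : O F n) : (c • f) v p = c • f v p := map_zsmul (evalMaps n Y v p) c f

theorem act_apply (hE : DirectSum.IsInternal E) (e : Fin n' ≃ Fin n) (f : CMaps F V b n)
    {ε : Fin n' → ZMod 2} {v : Fin n' → V} (hv : ∀ i, v i ∈ E (ε i)) (p : O F n') :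
    act hE b e f v p = eSign e ε • reindex b e f v p := by
  rw [act_eq_sum, ← evalMaps_apply, map_sum, Finset.sum_eq_single ε]
  · rw [map_zsmul, evalMaps_apply, compPrj_of_mem hE ε ε _ v hv, if_pos rfl]
  · intro ε' _ h
    rw [map_zsmul, evalMaps_apply, compPrj_of_mem hE ε ε' _ v hv, if_neg h, LinearMap.zero_apply,
      smul_zero]
  · simp

theorem act_eq_reindex (hE : DirectSum.IsInternal E) (e : Fin n' ≃ Fin n) (he : ∀ ε, eSign e ε = 1)
    (f : CMaps F V b n) : act hE b e f = reindex b e f :=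
  maps_ext_homogeneous hE fun ε v p hv => by rw [act_apply hE e f hv, he, one_smul]

theorem act_act (hE : DirectSum.IsInternal E) (e : Fin n' ≃ Fin n) (e' : Fin n'' ≃ Fin n')
    (f : CMaps F V b n) : act hE b e' (act hE b e f) = act hE b (e'.trans e) f :=
  maps_ext_homogeneous hE fun ε v p hv => by
    rw [act_apply hE _ _ hv, act_apply hE _ _ hv, ← reindex_reindex, reindex_apply,
      act_apply hE _ _ (fun i => hv (e'.symm i)), reindex_apply _ (reindex b e f), map_zsmul, smul_smul,
      eSign_trans]

theorem act_refl (hE : DirectSum.IsInternal E) (f : CMaps F V b n) :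
    act hE b (Equiv.refl _) f = f := by
  rw [act_eq_reindex hE _ eSign_refl, reindex_refl]

theorem act_mem_PV (hE : DirectSum.IsInternal E) (e : Fin n' ≃ Fin n) {f : CMaps F V b n}
    (hf : f ∈ PV F V b n) : act hE b e f ∈ PV F V b n' := by
  rw [act_eq_sum]
  exact sum_mem fun ε _ => zsmul_mem (compPrj_mem_PV hE ε (reindex_mem_PV e hf)) _

theorem comp_apply_congr_left (h : b = (b₁ && b₂)) {f f' : CMaps F V b₁ (n + 1)}
    {g : CMaps F V b₂ m} (hf : f ∈ PV F V b₁ (n + 1)) (hf' : f' ∈ PV F V b₁ (n + 1))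
    (hg : g ∈ PV F V b₂ m) (S : Submodule F[X] V) (v : Fin (m + n) → V) (c : ℤ)
    (hS : ∀ q, ∃ G, proj F V b₂ m G = g (fun i => v (Fin.castAdd n i)) q ∧ ∀ α, coeffs G α ∈ S)
    (hfS : ∀ x ∈ S, f' (Fin.cons x fun j => v (Fin.natAdd m j) : Fin (n + 1) → V) =
      c • f (Fin.cons x fun j => v (Fin.natAdd m j) : Fin (n + 1) → V)) (p : O F (m + n)) :
    comp h f' g v p = c • comp h f g v p := by
  obtain ⟨q, r, rfl⟩ := exists_blockIncl_mul_regIncl m n p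
  obtain ⟨G, hG, hGS⟩ := hS q
  rw [isComp_comp h hf hg v q r G hG, isComp_comp h hf' hg v q r G hG,
    ← Int.cast_smul_eq_zsmul F, ← LinearMap.smul_apply, ← plugL_smul_left]
  refine LinearMap.congr_fun (plugL_congr fun α => LinearMap.ext fun r => ?_) r
  rw [insMap_apply, hfS _ (hGS α), LinearMap.smul_apply, LinearMap.smul_apply]
  exact (map_zsmul (insV V h m n) c _).trans (Int.cast_smul_eq_zsmul F c _).symm

theorem comp_apply_congr_right (h : b = (b₁ && b₂)) {f : CMaps F V b₁ (n + 1)}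
    {g g' : CMaps F V b₂ m} (hf : f ∈ PV F V b₁ (n + 1)) (hg : g ∈ PV F V b₂ m)
    (hg' : g' ∈ PV F V b₂ m) (v : Fin (m + n) → V) (c : ℤ)
    (hgg : ∀ q, g' (fun i => v (Fin.castAdd n i)) q = c • g (fun i => v (Fin.castAdd n i)) q)
    (p : O F (m + n)) : comp h f g' v p = c • comp h f g v p := by
  obtain ⟨q, r, rfl⟩ := exists_blockIncl_mul_regIncl m n p
  obtain ⟨G, hG⟩ := proj_surjective b₂ m (g (fun i => v (Fin.castAdd n i)) q)
  rw [isComp_comp h hf hg v q r G hG, isComp_comp h hf hg' v q r (c • G), map_zsmul]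
  · rfl
  · rw [map_zsmul, hG, hgg]

/-- The product in the first position is equivariant. -/
theorem comp_act (hE : DirectSum.IsInternal E) (h : b = (b₁ && b₂)) {f : CMaps F V b₁ (n + 1)}
    {g : CMaps F V b₂ m} (hf : f ∈ PV F V b₁ (n + 1)) (hg : g ∈ PV F V b₂ m) (σ : Fin m' ≃ Fin m)
    (π : Fin n' ≃ Fin n) : comp h (act hE b₁ (consEquiv π) f) (act hE b₂ σ g) =
      act hE b (sumEquiv σ π) (comp h f g) := by
  refine maps_ext_homogeneous hE fun ε v p hv => ?_
  rw [act_apply hE _ _ hv, eSign_sumEquiv, reindex_comp h hf hg,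
    comp_apply_congr_left (f := reindex b₁ (consEquiv π) f) h (reindex_mem_PV _ hf)
      (act_mem_PV hE _ hf) (act_mem_PV hE _ hg) ⊤ v (eSign π fun j => ε (Fin.natAdd m' j)),
    comp_apply_congr_right (g := reindex b₂ σ g) h (reindex_mem_PV _ hf) (reindex_mem_PV _ hg)
      (act_mem_PV hE _ hg) v (eSign σ fun j => ε (Fin.castAdd n' j)), smul_smul, mul_comm]
  · intro q
    exact act_apply hE σ g (fun i => hv (Fin.castAdd n' i)) q
  · intro q
    obtain ⟨G, hG⟩ := proj_surjective b₂ m' (act hE b₂ σ g (fun i => v (Fin.castAdd n' i)) q)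
    exact ⟨G, hG, fun _ => trivial⟩
  · intro x _
    rw [← sum_prjI hE x]
    have hadd : ∀ (k : CMaps F V b₁ (n' + 1)) (w : Fin n' → V),
        k (Fin.cons (∑ i, prjI hE i x) w : Fin (n' + 1) → V) =
          ∑ i, k (Fin.cons (prjI hE i x) w : Fin (n' + 1) → V) := fun k w => by
      let L : V →ₗ[F] (O F (n' + 1) →ₗ[F] Val F V b₁ (n' + 1)) :=
        { toFun := fun x => k (Fin.cons x w : Fin (n' + 1) → V)
          map_add' := Maps.cons_add k w
          map_smul' := Maps.cons_smul k w }
      exact map_sum L (fun i => prjI hE i x) Finset.univ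
    rw [hadd, hadd, Finset.smul_sum]
    refine Finset.sum_congr rfl fun i _ => LinearMap.ext fun p => ?_
    rw [act_apply hE (ε := Fin.cons i fun j => ε (Fin.natAdd m' j)), eSign_consEquiv]
    · rfl
    · intro j
      refine Fin.cases ?_ (fun j => ?_) j
      · exact prjI_mem hE i x
      · exact hv _

variable (E) in
/-- The values of parity `i`. -/
def valPar : ∀ (b : Bool) (n : ℕ) (_ : ZMod 2), Submodule F (Val F V b n)
  | true, n, i => quotPar E n i
  | false, n, i => polPar E n i

theorem exists_proj_of_mem_valPar {i : ZMod 2} {y : Val F V b n} (hy : y ∈ valPar E b n i) :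
    ∃ G, proj F V b n G = y ∧ G ∈ polPar E n i := by
  cases b
  · exact ⟨y, rfl, hy⟩
  · obtain ⟨G, hG, hy⟩ := hy
    exact ⟨G, hy, hG⟩

theorem proj_mem_valPar {i : ZMod 2} {G : PolV F V (Fin n)} (hG : G ∈ polPar E n i) :
    proj F V b n G ∈ valPar E b n i := by
  cases b
  · exact hG
  · exact ⟨G, hG, rfl⟩

/-- Sequential associativity, with signs. -/
theorem comp_act_assocOuter (hE : DirectSum.IsInternal E) (h : b = (b₁₂ && b₃))
    (h₁ : b₁₂ = (b₁ && b₂)) (h' : b = (b₁ && b₂₃)) (h₂ : b₂₃ = (b₂ && b₃))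
    {f : CMaps F V b₁ (n + 1)} (hf : f ∈ PV F V b₁ (n + 1)) {g : CMaps F V b₂ (m + 1)}
    (hg : g ∈ PV F V b₂ (m + 1)) {k : CMaps F V b₃ l} (hk : k ∈ PV F V b₃ l) :
    comp h (act hE b₁₂ (assocOuter m n) (comp h₁ f g)) k =
      act hE b (assocIndex l m n) (comp h' f (comp h₂ g k)) := by
  rw [act_eq_reindex hE _ (eSign_assocOuter m n), act_eq_reindex hE _ (eSign_assocIndex l m n),
    comp_comp_first h h₁ h' h₂ hf hg hk]

/-- Parallel associativity, with signs. -/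
theorem comp_act_frontEquiv (hE : DirectSum.IsInternal E) (h : b = (b₁₂ && b₃))
    (h₁ : b₁₂ = (b₁ && b₂)) (h' : b = (b₁₃ && b₂)) (h₁' : b₁₃ = (b₁ && b₃))
    (hb : (b₂ || b₃) = true) {f : CMaps F V b₁ (n + 1 + 1)} (hf : f ∈ PV F V b₁ (n + 1 + 1))
    {g : CMaps F V b₂ m} (hg : g ∈ PV F V b₂ m) {k : CMaps F V b₃ l} (hk : k ∈ PV F V b₃ l)
    {i j : ZMod 2} (hgi : g ∈ mapsPar E (valPar E b₂ m) i)
    (hkj : k ∈ mapsPar E (valPar E b₃ l) j) :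
    comp h (act hE b₁₂ (frontEquiv m n) (comp h₁ f g)) k =
      ksign i j • act hE b (blockSwap l m n) (comp h' (act hE b₁₃ (frontEquiv l n)
        (comp h₁' (act hE b₁ (Equiv.swap 0 1) f) k)) g) := by
  refine maps_ext_homogeneous hE fun ε v p hv => ?_
  have hk' : ∀ q, ∃ G, proj F V b₃ l G = k (fun i => v (Fin.castAdd (m + n) i)) q ∧
      ∀ α, coeffs G α ∈ E (j + ∑ i : Fin l, ε (Fin.castAdd (m + n) i)) := fun q =>
    exists_proj_of_mem_valPar (hkj _ _ q fun i => hv (Fin.castAdd (m + n) i))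
  have hg' : ∀ q, ∃ G, proj F V b₂ m G = g (fun i => v (Fin.natAdd l (Fin.castAdd n i))) q ∧
      ∀ α, coeffs G α ∈ E (i + ∑ i : Fin m, ε (Fin.natAdd l (Fin.castAdd n i))) := fun q =>
    exists_proj_of_mem_valPar (hgi _ _ q fun i => hv (Fin.natAdd l (Fin.castAdd n i)))
  have key : comp h (act hE b₁₂ (frontEquiv m n) (comp h₁ f g)) k v p =
      ksign (j + ∑ i : Fin l, ε (Fin.castAdd (m + n) i))
        (∑ i : Fin m, ε (Fin.natAdd l (Fin.castAdd n i))) •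
      comp h (reindex b₁₂ (frontEquiv m n) (comp h₁ f g)) k v p := by
    refine comp_apply_congr_left h (reindex_mem_PV _ (comp_mem_PV h₁ hf hg))
      (act_mem_PV hE _ (comp_mem_PV h₁ hf hg)) hk _ v _ hk' (fun x hx => LinearMap.ext fun q => ?_) p
    rw [act_apply hE (ε := Fin.cons (j + ∑ i : Fin l, ε (Fin.castAdd (m + n) i))
      fun j => ε (Fin.natAdd l j)), eSign_frontEquiv]
    · simp only [Fin.cons_zero, Fin.cons_succ]
      rfl
    · exact fun i => Fin.cases hx (fun i => hv _) i
  have hsw : act hE b₁ (Equiv.swap 0 1) f ∈ PV F V b₁ (n + 1 + 1) := act_mem_PV hE _ hf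
  have hsw' : reindex b₁ (Equiv.swap 0 1) f ∈ PV F V b₁ (n + 1 + 1) := reindex_mem_PV _ hf
  set v' : Fin (m + (l + n)) → V := fun i => v ((blockSwap l m n).symm i) with hv'
  have hl : (fun i => v' (Fin.natAdd m (Fin.castAdd n i))) = fun i => v (Fin.castAdd (m + n) i) := by
    funext i; simp [hv', blockSwap_symm]
  have hm : (fun i => v' (Fin.castAdd (l + n) i)) =
      fun i => v (Fin.natAdd l (Fin.castAdd n i)) := by
    funext i; simp [hv', blockSwap_symm]
  have hn : (fun i => v' (Fin.natAdd m (Fin.natAdd l i))) =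
      fun i => v (Fin.natAdd l (Fin.natAdd m i)) := by
    funext i; simp [hv', blockSwap_symm]
  have key₂ : ∀ p, comp h' (act hE b₁₃ (frontEquiv l n)
        (comp h₁' (act hE b₁ (Equiv.swap 0 1) f) k)) g v' p =
      ksign (i + ∑ i : Fin m, ε (Fin.natAdd l (Fin.castAdd n i)))
        (∑ i : Fin l, ε (Fin.castAdd (m + n) i)) •
      comp h' (reindex b₁₃ (frontEquiv l n)
        (comp h₁' (act hE b₁ (Equiv.swap 0 1) f) k)) g v' p := fun p => by
    refine comp_apply_congr_left h' (reindex_mem_PV _ (comp_mem_PV h₁' hsw hk))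
      (act_mem_PV hE _ (comp_mem_PV h₁' hsw hk)) hg _ v' _ (by rw [hm]; exact hg')
      (fun x hx => LinearMap.ext fun q => ?_) p
    rw [act_apply hE (ε := Fin.cons (i + ∑ i : Fin m, ε (Fin.natAdd l (Fin.castAdd n i)))
      fun j => ε ((blockSwap l m n).symm (Fin.natAdd m j))), eSign_frontEquiv]
    · simp only [Fin.cons_zero, Fin.cons_succ, blockSwap_symm, blockSwap_natAdd_castAdd]
      rfl
    · exact fun i => Fin.cases hx (fun i => hv _) i
  have key₃ : ∀ p, comp h' (reindex b₁₃ (frontEquiv l n)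
        (comp h₁' (act hE b₁ (Equiv.swap 0 1) f) k)) g v' p =
      ksign (j + ∑ i : Fin l, ε (Fin.castAdd (m + n) i))
        (i + ∑ i : Fin m, ε (Fin.natAdd l (Fin.castAdd n i))) •
      comp h' (reindex b₁₃ (frontEquiv l n)
        (comp h₁' (reindex b₁ (Equiv.swap 0 1) f) k)) g v' p := fun p => by
    refine comp_apply_congr_left h' (reindex_mem_PV _ (comp_mem_PV h₁' hsw' hk))
      (reindex_mem_PV _ (comp_mem_PV h₁' hsw hk)) hg _ v' _ (by rw [hm]; exact hg')
      (fun x hx => LinearMap.ext fun q => ?_) p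
    rw [reindex_apply, LinearMap.smul_apply, reindex_apply, ← map_zsmul]
    congr 1
    have hl' : (fun i : Fin l => (Fin.cons x fun j => v' (Fin.natAdd m j) : Fin (l + n + 1) → V)
        ((frontEquiv l n).symm (Fin.castAdd (n + 1) i))) =
          fun i => v (Fin.castAdd (m + n) i) := by
      rw [← hl]; funext i; simp
    refine comp_apply_congr_left h₁' hsw' hsw hk
      (E (j + ∑ i : Fin l, ε (Fin.castAdd (m + n) i))) _ _ (by rw [hl']; exact hk')
      (fun y hy => LinearMap.ext fun q => ?_) _
    have hw : (fun i : Fin (n + 1) =>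
        (Fin.cons x fun j => v' (Fin.natAdd m j) : Fin (l + n + 1) → V)
        ((frontEquiv l n).symm (Fin.natAdd l i))) =
        Fin.cons x fun i => v (Fin.natAdd l (Fin.natAdd m i)) := by
      funext i
      refine Fin.cases ?_ (fun i => ?_) i
      · simp
      · rw [frontEquiv_symm_natAdd_succ, Fin.cons_succ, Fin.cons_succ]
        exact congrFun hn i
    rw [hw, act_apply hE (ε := Fin.cons (j + ∑ i : Fin l, ε (Fin.castAdd (m + n) i))
      (Fin.cons (i + ∑ i : Fin m, ε (Fin.natAdd l (Fin.castAdd n i)))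
        fun i => ε (Fin.natAdd l (Fin.natAdd m i)))), eSign_swap]
    · rw [Fin.cons_zero, ← Fin.succ_zero_eq_one, Fin.cons_succ, Fin.cons_zero,
        LinearMap.smul_apply]
    · exact fun i => Fin.cases hy (fun i => Fin.cases hx (fun i => hv _) i) i
  have hsign : ∀ i j a b : ZMod 2, ksign (j + a) b =
      ksign i j * (ksign a b * (ksign (i + b) a * ksign (j + a) (i + b))) := by decide
  rw [key, comp_comp_second h h₁ h' h₁' hb hf hg hk, zsmul_maps_apply, act_apply hE _ _ hv, reindex_apply,
    reindex_apply, key₂, key₃, map_zsmul, map_zsmul, eSign_blockSwap, smul_smul, smul_smul, smul_smul]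
  congr 1
  rw [hsign i]
  ring

end Action

/-! ### The products of invariants -/

section Box

variable {F : Type u} {V : Type v} [Field F] [AddCommGroup V] [Module F V] [Module F[X] V]
  [IsScalarTower F F[X] V] {E : ZMod 2 → Submodule F[X] V} {b b₁ b₂ b₃ b₁₂ b₁₃ b₂₃ : Bool}
  {l m n m' n' n'' : ℕ}

theorem insMap_add (h : b = (b₁ && b₂)) (f f' : CMaps F V b₁ (n + 1)) (w : Fin n → V) :
    insMap h m (f + f') w = insMap h m f w + insMap h m f' w :=
  LinearMap.ext fun _ => LinearMap.ext fun _ => map_add (insV V h m n) _ _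

theorem insMap_smul (h : b = (b₁ && b₂)) (c : F) (f : CMaps F V b₁ (n + 1)) (w : Fin n → V) :
    insMap h m (c • f) w = c • insMap h m f w :=
  LinearMap.ext fun _ => LinearMap.ext fun _ => map_smul (insV V h m n) _ _

theorem comp_add_left (h : b = (b₁ && b₂)) {f f' : CMaps F V b₁ (n + 1)} {g : CMaps F V b₂ m}
    (hf : f ∈ PV F V b₁ (n + 1)) (hf' : f' ∈ PV F V b₁ (n + 1)) (hg : g ∈ PV F V b₂ m) :
    comp h (f + f') g = comp h f g + comp h f' g := by
  refine (isComp_comp h (add_mem hf hf') hg).unique fun v q r G hG => ?_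
  rw [Maps.add_apply, LinearMap.add_apply, isComp_comp h hf hg v q r G hG,
    isComp_comp h hf' hg v q r G hG, ← LinearMap.add_apply, ← plugL_add_left,
    insMap_add]

theorem comp_smul_left (h : b = (b₁ && b₂)) (c : F) {f : CMaps F V b₁ (n + 1)} {g : CMaps F V b₂ m}
    (hf : f ∈ PV F V b₁ (n + 1)) (hg : g ∈ PV F V b₂ m) :
    comp h (c • f) g = c • comp h f g := by
  refine (isComp_comp h (Submodule.smul_mem _ c hf) hg).unique fun v q r G hG => ?_
  rw [Maps.smul_apply, LinearMap.smul_apply, isComp_comp h hf hg v q r G hG,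
    ← LinearMap.smul_apply, ← plugL_smul_left, insMap_smul]

theorem comp_add_right (h : b = (b₁ && b₂)) {f : CMaps F V b₁ (n + 1)} {g g' : CMaps F V b₂ m}
    (hf : f ∈ PV F V b₁ (n + 1)) (hg : g ∈ PV F V b₂ m) (hg' : g' ∈ PV F V b₂ m) :
    comp h f (g + g') = comp h f g + comp h f g' := by
  refine (isComp_comp h hf (add_mem hg hg')).unique fun v q r G hG => ?_
  obtain ⟨G', hG'⟩ := proj_surjective b₂ m (g (fun i => v (Fin.castAdd n i)) q)
  rw [Maps.add_apply, LinearMap.add_apply, isComp_comp h hf hg v q r G' hG',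
    isComp_comp h hf hg' v q r (G - G'), map_sub, LinearMap.sub_apply]
  · abel
  · rw [map_sub, hG, hG', Maps.add_apply, LinearMap.add_apply]
    abel

theorem comp_smul_right (h : b = (b₁ && b₂)) (c : F) {f : CMaps F V b₁ (n + 1)}
    {g : CMaps F V b₂ m} (hf : f ∈ PV F V b₁ (n + 1)) (hg : g ∈ PV F V b₂ m) :
    comp h f (c • g) = c • comp h f g := by
  refine (isComp_comp h hf (Submodule.smul_mem _ c hg)).unique fun v q r G hG => ?_
  obtain ⟨G', hG'⟩ := proj_surjective b₂ m (g (fun i => v (Fin.castAdd n i)) q)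
  have h1 : plugL (insMap h m f fun j => v (Fin.natAdd m j)) G r =
      plugL (insMap h m f fun j => v (Fin.natAdd m j)) (c • G') r := by
    have h2 : proj F V b₂ m (c • G') = proj F V b₂ m G := by
      rw [map_smul, hG', hG, Maps.smul_apply, LinearMap.smul_apply]
    rw [← plugV_proj h hf, ← plugV_proj h hf, h2]
  rw [Maps.smul_apply, LinearMap.smul_apply, isComp_comp h hf hg v q r G' hG', h1, map_smul,
    LinearMap.smul_apply]

variable (E) in
/-- The invariants: `WV E true n` is the component of degree `n - 1` of `W`, and `WV E false n` is
the one of `W̃`. -/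
def WV (b : Bool) (n : ℕ) : Submodule F (CMaps F V b n) := PV F V b n ⊓ symm E (renV F V b)

theorem mem_WV_iff (hE : DirectSum.IsInternal E) {f : CMaps F V b n} :
    f ∈ WV E b n ↔ f ∈ PV F V b n ∧ ∀ σ : Equiv.Perm (Fin n), act hE b σ f = f := by
  refine and_congr_right fun _ => ⟨fun h σ => ?_, fun h σ ε v p hv => ?_⟩
  · refine maps_ext_homogeneous hE fun ε v p hv => ?_
    rw [act_apply hE _ _ hv]
    exact h σ ε v p hv
  · conv_rhs => rw [← h σ]
    rw [act_apply hE _ _ hv]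
    rfl

/-- The sum over all permutations. -/
def symSum (hE : DirectSum.IsInternal E) (b : Bool) (n : ℕ) :
    CMaps F V b n →ₗ[F] CMaps F V b n :=
  ∑ σ : Equiv.Perm (Fin n), act hE b σ

theorem symSum_apply (hE : DirectSum.IsInternal E) (f : CMaps F V b n) :
    symSum hE b n f = ∑ σ : Equiv.Perm (Fin n), act hE b σ f := by
  rw [symSum, LinearMap.sum_apply]

theorem symSum_mem_WV (hE : DirectSum.IsInternal E) {f : CMaps F V b n} (hf : f ∈ PV F V b n) :
    symSum hE b n f ∈ WV E b n := by
  rw [mem_WV_iff hE, symSum_apply]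
  refine ⟨sum_mem fun σ _ => act_mem_PV hE _ hf, fun σ => ?_⟩
  rw [map_sum]
  simp only [act_act]
  exact Equiv.sum_comp (Equiv.mulRight σ) fun τ : Equiv.Perm (Fin n) => act hE b τ f

/-- The product `f □ g`, for `f` of arity `n + 1` and `g` of arity `m`: this is the sum over all
permutations divided by the order of the group `S_m × S_n`, under which `f ∘ g` is invariant. -/
def boxSucc (hE : DirectSum.IsInternal E) (h : b = (b₁ && b₂)) (n m : ℕ) :
    WV E b₁ (n + 1) →ₗ[F] WV E b₂ m →ₗ[F] WV E b (m + n) :=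
  LinearMap.mk₂ F
      (fun f g => ((m.factorial * n.factorial : ℕ) : F)⁻¹ •
        ⟨symSum hE b (m + n) (comp h f.1 g.1), symSum_mem_WV hE (comp_mem_PV h f.2.1 g.2.1)⟩)
      (fun f f' g => by
        rw [← smul_add]
        congr 1
        refine Subtype.ext ?_
        change symSum hE b (m + n) (comp h (f.1 + f'.1) g.1) = _
        rw [comp_add_left h f.2.1 f'.2.1 g.2.1, map_add]
        rfl)
      (fun c f g => by
        rw [smul_comm]
        congr 1
        refine Subtype.ext ?_
        change symSum hE b (m + n) (comp h (c • f.1) g.1) = _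
        rw [comp_smul_left h c f.2.1 g.2.1, map_smul]
        rfl)
      (fun f g g' => by
        rw [← smul_add]
        congr 1
        refine Subtype.ext ?_
        change symSum hE b (m + n) (comp h f.1 (g.1 + g'.1)) = _
        rw [comp_add_right h f.2.1 g.2.1 g'.2.1, map_add]
        rfl)
      (fun c f g => by
        rw [smul_comm]
        congr 1
        refine Subtype.ext ?_
        change symSum hE b (m + n) (comp h f.1 (c • g.1)) = _
        rw [comp_smul_right h c f.2.1 g.2.1, map_smul]
        rfl)

theorem coe_boxSucc (hE : DirectSum.IsInternal E) (h : b = (b₁ && b₂)) (n m : ℕ)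
    (f : WV E b₁ (n + 1)) (g : WV E b₂ m) : (boxSucc hE h n m f g : CMaps F V b (m + n)) =
      ((m.factorial * n.factorial : ℕ) : F)⁻¹ • symSum hE b (m + n) (comp h f.1 g.1) := rfl

/-- The product `f □ g`, for `f` of arity `a` and `g` of arity `m`; it is zero for `a = 0`. -/
def boxW (hE : DirectSum.IsInternal E) (h : b = (b₁ && b₂)) : ∀ a m : ℕ,
    WV E b₁ a →ₗ[F] WV E b₂ m →ₗ[F] WV E b (m + (a - 1))
  | 0, _ => 0
  | n + 1, m => boxSucc hE h n m

/-- The product `□` on the direct sums. -/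
def box (hE : DirectSum.IsInternal E) (h : b = (b₁ && b₂)) :
    (⨁ a, WV E b₁ a) →ₗ[F] (⨁ a, WV E b₂ a) →ₗ[F] ⨁ a, WV E b a :=
  DirectSum.toModule F ℕ _ fun a => LinearMap.flip (DirectSum.toModule F ℕ _ fun m =>
    LinearMap.flip ((boxW hE h a m).compr₂ (DirectSum.lof F ℕ (fun a => WV E b a) (m + (a - 1)))))

theorem box_lof (hE : DirectSum.IsInternal E) (h : b = (b₁ && b₂)) (a m : ℕ) (f : WV E b₁ a)
    (g : WV E b₂ m) : box hE h (DirectSum.lof F ℕ (fun a => WV E b₁ a) a f)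
      (DirectSum.lof F ℕ (fun a => WV E b₂ a) m g) =
        DirectSum.lof F ℕ (fun a => WV E b a) (m + (a - 1)) (boxW hE h a m f g) := by
  rw [box, DirectSum.toModule_lof, LinearMap.flip_apply, DirectSum.toModule_lof]
  rfl

theorem box_lof_succ (hE : DirectSum.IsInternal E) (h : b = (b₁ && b₂)) (n m : ℕ)
    (f : WV E b₁ (n + 1)) (g : WV E b₂ m) :
    box hE h (DirectSum.lof F ℕ (fun a => WV E b₁ a) (n + 1) f)
      (DirectSum.lof F ℕ (fun a => WV E b₂ a) m g) =
        DirectSum.lof F ℕ (fun a => WV E b a) (m + n) (boxSucc hE h n m f g) :=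
  box_lof hE h (n + 1) m f g

/-- The inclusion of the invariants in the direct sum of all maps. -/
def inclWV (b : Bool) : (⨁ a, WV E b a) →ₗ[F] ⨁ a, CMaps F V b a :=
  DirectSum.lmap fun a => (WV E b a).subtype

theorem inclWV_lof (b : Bool) (a : ℕ) (f : WV E b a) :
    inclWV b (DirectSum.lof F ℕ (fun a => WV E b a) a f) =
      DirectSum.lof F ℕ (fun a => CMaps F V b a) a f.1 := by
  rw [inclWV, DirectSum.lmap_lof]; rfl

theorem inclWV_injective (b : Bool) : Function.Injective (inclWV (E := E) b) := by
  intro x y hxy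
  refine DFinsupp.ext fun a => Subtype.ext ?_
  exact DFunLike.congr_fun hxy a

/-- The sum over all permutations, in the direct sum of all maps. -/
def symTotal (hE : DirectSum.IsInternal E) (b : Bool) (n : ℕ) :
    CMaps F V b n →ₗ[F] ⨁ a, CMaps F V b a :=
  DirectSum.lof F ℕ (fun a => CMaps F V b a) n ∘ₗ symSum hE b n

theorem symTotal_act (hE : DirectSum.IsInternal E) (e : Fin n' ≃ Fin n) (f : CMaps F V b n) :
    symTotal hE b n' (act hE b e f) = symTotal hE b n f := by
  obtain rfl : n' = n := by simpa using Fintype.card_congr e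
  rw [symTotal, LinearMap.comp_apply, LinearMap.comp_apply, symSum_apply, symSum_apply]
  simp only [act_act]
  congr 1
  exact Equiv.sum_comp (Equiv.mulLeft e) fun τ : Equiv.Perm (Fin n') => act hE b τ f

theorem inclWV_box_succ (hE : DirectSum.IsInternal E) (h : b = (b₁ && b₂)) (n m : ℕ)
    (f : WV E b₁ (n + 1)) (g : WV E b₂ m) :
    inclWV b (box hE h (DirectSum.lof F ℕ (fun a => WV E b₁ a) (n + 1) f)
      (DirectSum.lof F ℕ (fun a => WV E b₂ a) m g)) =
        ((m.factorial * n.factorial : ℕ) : F)⁻¹ • symTotal hE b (m + n) (comp h f.1 g.1) := by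
  rw [box_lof_succ, inclWV_lof, coe_boxSucc, symTotal, LinearMap.comp_apply, map_smul]

theorem box_lof_zero (hE : DirectSum.IsInternal E) (h : b = (b₁ && b₂)) (f : WV E b₁ 0)
    (x : ⨁ a, WV E b₂ a) : box hE h (DirectSum.lof F ℕ (fun a => WV E b₁ a) 0 f) x = 0 := by
  induction x using DirectSum.induction_on with
  | zero => rw [map_zero]
  | of m g =>
    change box hE h _ (DirectSum.lof F ℕ (fun a => WV E b₂ a) m g) = 0
    rw [box_lof, boxW, LinearMap.zero_apply, LinearMap.zero_apply, map_zero]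
  | add x y hx hy => rw [map_add, hx, hy, add_zero]

theorem exists_consEquiv (e : Fin (n' + 1) ≃ Fin (n + 1)) (he : e 0 = 0) :
    ∃ π : Fin n' ≃ Fin n, e = consEquiv π := by
  have h1 : ∀ {n n' : ℕ} (e : Fin (n' + 1) ≃ Fin (n + 1)) (_ : e 0 = 0) (j : Fin n'),
      ∃ k, e j.succ = Fin.succ k := fun e he j => by
    refine ⟨(e j.succ).pred fun h => ?_, (Fin.succ_pred _ _).symm⟩
    rw [← he] at h
    exact Fin.succ_ne_zero j (e.injective h)
  have he' : e.symm 0 = 0 := by rw [Equiv.symm_apply_eq, he]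
  choose p hp using h1 e he
  choose q hq using h1 e.symm he'
  refine ⟨⟨p, q, fun j => ?_, fun j => ?_⟩, Equiv.ext fun i => ?_⟩
  · apply Fin.succ_injective
    rw [← hq, ← hp, Equiv.symm_apply_apply]
  · apply Fin.succ_injective
    rw [← hp, ← hq, Equiv.apply_symm_apply]
  · refine Fin.cases ?_ (fun j => ?_) i
    · rw [he, consEquiv_zero]
    · rw [consEquiv_succ, hp]; rfl

theorem consEquiv_refl (n : ℕ) : consEquiv (Equiv.refl (Fin n)) = Equiv.refl _ :=
  Equiv.ext fun i => Fin.cases (by simp) (fun j => by simp) i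

theorem comp_act_left (hE : DirectSum.IsInternal E) (h : b = (b₁ && b₂)) {f : CMaps F V b₁ (n + 1)}
    {g : CMaps F V b₂ m} (hf : f ∈ PV F V b₁ (n + 1)) (hg : g ∈ PV F V b₂ m)
    (π : Fin n' ≃ Fin n) : comp h (act hE b₁ (consEquiv π) f) g =
      act hE b (sumEquiv (Equiv.refl _) π) (comp h f g) := by
  rw [← comp_act hE h hf hg, act_refl]

theorem comp_act_right (hE : DirectSum.IsInternal E) (h : b = (b₁ && b₂)) {f : CMaps F V b₁ (n + 1)}
    {g : CMaps F V b₂ m} (hf : f ∈ PV F V b₁ (n + 1)) (hg : g ∈ PV F V b₂ m)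
    (σ : Fin m' ≃ Fin m) : comp h f (act hE b₂ σ g) =
      act hE b (sumEquiv σ (Equiv.refl _)) (comp h f g) := by
  rw [← comp_act hE h hf hg, consEquiv_refl, act_refl]

/-- The product of two invariants is invariant under permutations of the two blocks. -/
theorem act_sumEquiv_comp (hE : DirectSum.IsInternal E) (h : b = (b₁ && b₂))
    {f : CMaps F V b₁ (n + 1)} {g : CMaps F V b₂ m} (hf : f ∈ WV E b₁ (n + 1))
    (hg : g ∈ WV E b₂ m) (σ : Equiv.Perm (Fin m)) (π : Equiv.Perm (Fin n)) :
    act hE b (sumEquiv σ π) (comp h f g) = comp h f g := by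
  rw [← comp_act hE h hf.1 hg.1, ((mem_WV_iff hE).1 hf).2, ((mem_WV_iff hE).1 hg).2]

/-- After symmetrization, the product depends only on the argument of `f` into which `g` is
inserted. -/
theorem symTotal_comp_act (hE : DirectSum.IsInternal E) (h : b = (b₁ && b₂)) {M N : ℕ}
    {f : CMaps F V b₁ M} (hf : f ∈ PV F V b₁ M) {g : CMaps F V b₂ m} (hg : g ∈ PV F V b₂ m)
    (e e₀ : Fin (N + 1) ≃ Fin M) (s : Equiv.Perm (Fin M)) (hs : act hE b₁ s f = f)
    (hse : s (e₀ 0) = e 0) :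
    symTotal hE b (m + N) (comp h (act hE b₁ e f) g) =
      symTotal hE b (m + N) (comp h (act hE b₁ e₀ f) g) := by
  obtain ⟨π, hπ⟩ := exists_consEquiv ((e.trans s.symm).trans e₀.symm) (by
    rw [Equiv.trans_apply, Equiv.trans_apply, ← hse, Equiv.symm_apply_apply,
      Equiv.symm_apply_apply])
  have he : e = (consEquiv π).trans (e₀.trans s) := by
    rw [← hπ]; ext; simp
  rw [he, ← act_act, ← act_act hE s e₀, hs, comp_act_left hE h (act_mem_PV hE _ hf) hg,
    symTotal_act]

/-- A sum over bijections, according to the image of `0`. -/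
theorem sum_equiv_eq {D : Type*} [AddCommGroup D] {N : ℕ} (hN : N + 1 = m + n)
    (Φ : (Fin (N + 1) ≃ Fin (m + n)) → D) (A B : D)
    (hA : ∀ e (i : Fin m), e 0 = Fin.castAdd n i → Φ e = A)
    (hB : ∀ e (j : Fin n), e 0 = Fin.natAdd m j → Φ e = B) :
    ∑ e, Φ e = N.factorial • (m • A + n • B) := by
  have h1 : ∀ e, Φ e = Fin.addCases (motive := fun _ => D) (fun _ : Fin m => A)
      (fun _ : Fin n => B) (e 0) := fun e => by
    generalize hx : e 0 = x
    revert hx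
    refine Fin.addCases (fun i hx => ?_) (fun j hx => ?_) x
    · rw [Fin.addCases_left, hA e i hx]
    · rw [Fin.addCases_right, hB e j hx]
  simp only [h1]
  rw [← Equiv.sum_comp (Equiv.equivCongr (Equiv.refl (Fin (N + 1))) (finCongr hN)),
    ← Equiv.sum_comp Equiv.Perm.decomposeFin.symm, Fintype.sum_prod_type]
  simp only [Equiv.equivCongr_apply_apply, Equiv.refl_symm, Equiv.refl_apply,
    Equiv.Perm.decomposeFin_symm_apply_zero, Finset.sum_const, Finset.card_univ,
    Fintype.card_perm, Fintype.card_fin]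
  rw [← Finset.smul_sum, Equiv.sum_comp (finCongr hN) (fun x => Fin.addCases
    (motive := fun _ => D) (fun _ : Fin m => A) (fun _ : Fin n => B) x), Fin.sum_univ_add]
  simp

theorem lof_act_finCongr (hE : DirectSum.IsInternal E) {a a' : ℕ} (h : a' = a) (f : WV E b a)
    (hf : act hE b (finCongr h) f.1 ∈ WV E b a') :
    DirectSum.lof F ℕ (fun a => WV E b a) a' ⟨act hE b (finCongr h) f.1, hf⟩ =
      DirectSum.lof F ℕ (fun a => WV E b a) a f := by
  subst h
  congr 1
  refine Subtype.ext ?_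
  exact act_refl hE f.1

theorem act_mem_WV (hE : DirectSum.IsInternal E) (e : Fin n' ≃ Fin n) {f : CMaps F V b n}
    (hf : f ∈ WV E b n) : act hE b e f ∈ WV E b n' := by
  obtain rfl : n' = n := by simpa using Fintype.card_congr e
  rw [((mem_WV_iff hE).1 hf).2]
  exact hf

theorem act_finCongr_symSum (hE : DirectSum.IsInternal E) (h : n' = n) (f : CMaps F V b n) :
    act hE b (finCongr h) (symSum hE b n f) = ∑ e : Fin n' ≃ Fin n, act hE b e f := by
  rw [symSum_apply, map_sum]
  simp only [act_act]
  refine Fintype.sum_equiv (Equiv.equivCongr (finCongr h.symm) (Equiv.refl _)) _ _ fun σ => ?_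
  congr 1

variable [CharZero F]

/-- The product `(f □ g) □ k`, as a sum over bijections. -/
theorem inclWV_box_box (hE : DirectSum.IsInternal E) (h : b = (b₁₂ && b₃)) (h₁ : b₁₂ = (b₁ && b₂))
    {N : ℕ} (hN : N + 1 = m + n) (f : WV E b₁ (n + 1)) (g : WV E b₂ m) (k : WV E b₃ l) :
    inclWV b (box hE h (box hE h₁ (DirectSum.lof F ℕ (fun a => WV E b₁ a) (n + 1) f)
      (DirectSum.lof F ℕ (fun a => WV E b₂ a) m g)) (DirectSum.lof F ℕ (fun a => WV E b₃ a) l k)) =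
      (((l.factorial * N.factorial : ℕ) : F)⁻¹ * ((m.factorial * n.factorial : ℕ) : F)⁻¹) •
        ∑ e : Fin (N + 1) ≃ Fin (m + n),
          symTotal hE b (l + N) (comp h (act hE b₁₂ e (comp h₁ f.1 g.1)) k.1) := by
  have hc := comp_mem_PV h₁ f.2.1 g.2.1
  rw [box_lof_succ, ← lof_act_finCongr hE hN _ (act_mem_WV hE _ (Subtype.prop _)), inclWV_box_succ,
    mul_smul]
  congr 1
  have h2 : act hE b₁₂ (finCongr hN) (boxSucc hE h₁ n m f g).1 =
      ((m.factorial * n.factorial : ℕ) : F)⁻¹ •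
        ∑ e : Fin (N + 1) ≃ Fin (m + n), act hE b₁₂ e (comp h₁ f.1 g.1) := by
    refine (congrArg (act hE b₁₂ (finCongr hN)) (coe_boxSucc hE h₁ n m f g)).trans ?_
    rw [map_smul, act_finCongr_symSum]
  have h3 : ∀ s : Finset (Fin (N + 1) ≃ Fin (m + n)),
      comp h (∑ e ∈ s, act hE b₁₂ e (comp h₁ f.1 g.1)) k.1 =
        ∑ e ∈ s, comp h (act hE b₁₂ e (comp h₁ f.1 g.1)) k.1 := fun s => by
    classical
    induction s using Finset.induction_on with
    | empty =>
      have := comp_smul_left h (0 : F) (zero_mem (PV F V b₁₂ (N + 1))) k.2.1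
      rwa [zero_smul, zero_smul] at this
    | insert e s he ih =>
      rw [Finset.sum_insert he, Finset.sum_insert he, ← ih, comp_add_left h (act_mem_PV hE _ hc)
        (sum_mem fun e _ => act_mem_PV hE _ hc) k.2.1]
  change symTotal hE b (l + N) (comp h (act hE b₁₂ (finCongr hN)
    (boxSucc hE h₁ n m f g).1) k.1) = _
  rw [h2, comp_smul_left h _ (sum_mem fun e _ => act_mem_PV hE _ hc) k.2.1, h3, map_smul, map_sum]

/-- The product `f □ (g □ k)`. -/
theorem inclWV_box_box_right (hE : DirectSum.IsInternal E) (h' : b = (b₁ && b₂₃))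
    (h₂ : b₂₃ = (b₂ && b₃)) (f : WV E b₁ (n + 1)) (g : WV E b₂ (m + 1)) (k : WV E b₃ l) :
    inclWV b (box hE h' (DirectSum.lof F ℕ (fun a => WV E b₁ a) (n + 1) f)
      (box hE h₂ (DirectSum.lof F ℕ (fun a => WV E b₂ a) (m + 1) g)
        (DirectSum.lof F ℕ (fun a => WV E b₃ a) l k))) =
      ((l.factorial * m.factorial * n.factorial : ℕ) : F)⁻¹ •
        symTotal hE b (l + m + n) (comp h' f.1 (comp h₂ g.1 k.1)) := by
  have hc := comp_mem_PV h₂ g.2.1 k.2.1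
  have h3 : ∀ s : Finset (Equiv.Perm (Fin (l + m))),
      comp h' f.1 (∑ e ∈ s, act hE b₂₃ e (comp h₂ g.1 k.1)) =
        ∑ e ∈ s, comp h' f.1 (act hE b₂₃ e (comp h₂ g.1 k.1)) := fun s => by
    classical
    induction s using Finset.induction_on with
    | empty =>
      have := comp_smul_right h' (0 : F) f.2.1 (zero_mem (PV F V b₂₃ (l + m)))
      rwa [zero_smul, zero_smul] at this
    | insert e s he ih =>
      rw [Finset.sum_insert he, Finset.sum_insert he, ← ih, comp_add_right h' f.2.1
        (act_mem_PV hE _ hc) (sum_mem fun e _ => act_mem_PV hE _ hc)]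
  rw [box_lof_succ, inclWV_box_succ, coe_boxSucc, comp_smul_right h' _ f.2.1 (symSum_mem_WV hE hc).1, symSum_apply, h3, map_smul, map_sum]
  have h4 : ∀ e : Equiv.Perm (Fin (l + m)),
      symTotal hE b (l + m + n) (comp h' f.1 (act hE b₂₃ e (comp h₂ g.1 k.1))) =
        symTotal hE b (l + m + n) (comp h' f.1 (comp h₂ g.1 k.1)) := fun e => by
    rw [comp_act_right hE h' f.2.1 hc, symTotal_act]
  simp only [h4, Finset.sum_const, Finset.card_univ, Fintype.card_perm, Fintype.card_fin]
  rw [← Nat.cast_smul_eq_nsmul F, smul_smul, smul_smul]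
  congr 1
  have := Nat.factorial_ne_zero (l + m)
  have := Nat.factorial_ne_zero l
  have := Nat.factorial_ne_zero m
  have := Nat.factorial_ne_zero n
  push_cast
  field_simp

/-- The associator of the product `□`: only the products with `g` and `k` in different arguments of
`f` remain. -/
theorem inclWV_associator_succ (hE : DirectSum.IsInternal E) (h : b = (b₁₂ && b₃))
    (h₁ : b₁₂ = (b₁ && b₂)) (h' : b = (b₁ && b₂₃)) (h₂ : b₂₃ = (b₂ && b₃))
    (f : WV E b₁ (n + 1)) (g : WV E b₂ m) (k : WV E b₃ l) (B : ⨁ a, CMaps F V b a)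
    (hB : ∀ {n'} (hn : n = n' + 1) (e : Fin (m + n' + 1) ≃ Fin (m + n)),
      (∃ j, e 0 = Fin.natAdd m j) →
        symTotal hE b (l + (m + n')) (comp h (act hE b₁₂ e (comp h₁ f.1 g.1)) k.1) = B) :
    inclWV b (box hE h (box hE h₁ (DirectSum.lof F ℕ (fun a => WV E b₁ a) (n + 1) f)
      (DirectSum.lof F ℕ (fun a => WV E b₂ a) m g)) (DirectSum.lof F ℕ (fun a => WV E b₃ a) l k)) -
    inclWV b (box hE h' (DirectSum.lof F ℕ (fun a => WV E b₁ a) (n + 1) f)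
      (box hE h₂ (DirectSum.lof F ℕ (fun a => WV E b₂ a) m g)
        (DirectSum.lof F ℕ (fun a => WV E b₃ a) l k))) =
      ((n : F) / (l.factorial * m.factorial * n.factorial : ℕ)) • B := by
  have hfac : ∀ n : ℕ, (n.factorial : F) ≠ 0 := fun n => by
    exact_mod_cast Nat.factorial_ne_zero n
  have hB' : ∀ {N} (hN : N + 1 = m + n) (e : Fin (N + 1) ≃ Fin (m + n)) (j : Fin n),
      e 0 = Fin.natAdd m j →
        symTotal hE b (l + N) (comp h (act hE b₁₂ e (comp h₁ f.1 g.1)) k.1) = B := by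
    intro N hN e j hj
    obtain ⟨n', rfl⟩ : ∃ n', n = n' + 1 := ⟨n - 1, by have := j.2; omega⟩
    obtain rfl : N = m + n' := by omega
    exact hB rfl e ⟨j, hj⟩
  cases m with
  | zero =>
    rw [box_lof_zero, map_zero, map_zero, sub_zero]
    cases n with
    | zero =>
      rw [box_lof_succ]
      change inclWV b (box hE h (DirectSum.lof F ℕ (fun a => WV E b₁₂ a) 0 _) _) = _
      rw [box_lof_zero, map_zero, Nat.cast_zero, zero_div, zero_smul]
    | succ n =>
      rw [inclWV_box_box hE h h₁ (N := n) (by omega), sum_equiv_eq (by omega) _ 0 B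
        (fun e i => i.elim0) (hB' (by omega)), zero_smul, zero_add, ← Nat.cast_smul_eq_nsmul F,
        ← Nat.cast_smul_eq_nsmul F, smul_smul, smul_smul]
      congr 1
      have := hfac l
      have := hfac n
      have := hfac (n + 1)
      have := hfac 0
      push_cast
      field_simp
  | succ t =>
    have hinv := act_sumEquiv_comp hE h₁ f.2 g.2
    rw [inclWV_box_box hE h h₁ (N := t + n) (by omega), sum_equiv_eq (by omega) _
      (symTotal hE b (l + (t + n))
        (comp h (act hE b₁₂ (assocOuter t n) (comp h₁ f.1 g.1)) k.1)) B ?_ (hB' (by omega)),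
      comp_act_assocOuter hE h h₁ h' h₂ f.2.1 g.2.1 k.2.1, symTotal_act,
      inclWV_box_box_right hE h' h₂]
    · rw [← Nat.cast_smul_eq_nsmul F, ← Nat.cast_smul_eq_nsmul F, ← Nat.cast_smul_eq_nsmul F,
        smul_smul, smul_add, smul_smul, smul_smul, add_sub_right_comm, ← sub_smul]
      have := hfac l
      have := hfac t
      have := hfac n
      have := hfac (t + n)
      have ht : ((t : F) + 1) ≠ 0 := by exact_mod_cast Nat.succ_ne_zero t
      have e1 : ((((l.factorial * (t + n).factorial : ℕ) : F)⁻¹ *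
          (((t + 1).factorial * n.factorial : ℕ) : F)⁻¹) * (t + n).factorial * ((t + 1 : ℕ) : F) -
          ((l.factorial * t.factorial * n.factorial : ℕ) : F)⁻¹) = 0 := by
        rw [Nat.factorial_succ t]
        push_cast
        field_simp
        ring
      rw [e1, zero_smul, zero_add]
      congr 1
      rw [Nat.factorial_succ t]
      push_cast
      field_simp
    · intro e i he
      refine symTotal_comp_act hE h (comp_mem_PV h₁ f.2.1 g.2.1) k.2.1 e (assocOuter t n)
        (sumEquiv (Equiv.swap 0 i) (Equiv.refl _)) (hinv _ _) ?_
      rw [assocOuter_zero, sumEquiv_castAdd, Equiv.swap_apply_left, he]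

/-- The symmetry of the associator of the product `□`. -/
theorem inclWV_associator_symm (hE : DirectSum.IsInternal E) (h : b = (b₁₂ && b₃))
    (h₁ : b₁₂ = (b₁ && b₂)) (h' : b = (b₁ && b₂₃)) (h₂ : b₂₃ = (b₂ && b₃)) (h₃ : b = (b₁₃ && b₂))
    (h₁₃ : b₁₃ = (b₁ && b₃)) (h₃₂ : b₂₃ = (b₃ && b₂)) (hb : (b₂ || b₃) = true) {a : ℕ}
    (f : WV E b₁ a) (g : WV E b₂ m) (k : WV E b₃ l) {i j : ZMod 2}
    (hg : g.1 ∈ mapsPar E (valPar E b₂ m) i) (hk : k.1 ∈ mapsPar E (valPar E b₃ l) j) :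
    inclWV b (box hE h (box hE h₁ (DirectSum.lof F ℕ (fun a => WV E b₁ a) a f)
      (DirectSum.lof F ℕ (fun a => WV E b₂ a) m g)) (DirectSum.lof F ℕ (fun a => WV E b₃ a) l k)) -
    inclWV b (box hE h' (DirectSum.lof F ℕ (fun a => WV E b₁ a) a f)
      (box hE h₂ (DirectSum.lof F ℕ (fun a => WV E b₂ a) m g)
        (DirectSum.lof F ℕ (fun a => WV E b₃ a) l k))) =
    ksign i j • (inclWV b (box hE h₃ (box hE h₁₃ (DirectSum.lof F ℕ (fun a => WV E b₁ a) a f)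
      (DirectSum.lof F ℕ (fun a => WV E b₃ a) l k)) (DirectSum.lof F ℕ (fun a => WV E b₂ a) m g)) -
    inclWV b (box hE h' (DirectSum.lof F ℕ (fun a => WV E b₁ a) a f)
      (box hE h₃₂ (DirectSum.lof F ℕ (fun a => WV E b₃ a) l k)
        (DirectSum.lof F ℕ (fun a => WV E b₂ a) m g)))) := by
  cases a with
  | zero =>
    simp only [box_lof_zero, map_zero, LinearMap.zero_apply, sub_zero, smul_zero]
  | succ n =>
    cases n with
    | zero =>
      rw [inclWV_associator_succ hE h h₁ h' h₂ f g k 0 (fun hn => absurd hn (by omega)),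
        inclWV_associator_succ hE h₃ h₁₃ h' h₃₂ f k g 0 (fun hn => absurd hn (by omega)), smul_zero,
        smul_zero, smul_zero]
    | succ n =>
      have key : ∀ {b b₂ b₃ b₁₂ : Bool} {m l : ℕ} (h : b = (b₁₂ && b₃)) (h₁ : b₁₂ = (b₁ && b₂))
          (g : WV E b₂ m) (k : WV E b₃ l) {n'} (hn : n + 1 = n' + 1)
          (e : Fin (m + n' + 1) ≃ Fin (m + (n + 1))), (∃ j, e 0 = Fin.natAdd m j) →
          symTotal hE b (l + (m + n')) (comp h (act hE b₁₂ e (comp h₁ f.1 g.1)) k.1) =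
          symTotal hE b (l + (m + n))
            (comp h (act hE b₁₂ (frontEquiv m n) (comp h₁ f.1 g.1)) k.1) := by
        intro b b₂ b₃ b₁₂ m l h h₁ g k n' hn e he
        obtain ⟨j, he⟩ := he
        obtain rfl : n' = n := by omega
        refine symTotal_comp_act hE h (comp_mem_PV h₁ f.2.1 g.2.1) k.2.1 e (frontEquiv m n')
          (sumEquiv (Equiv.refl _) (Equiv.swap 0 j)) (act_sumEquiv_comp hE h₁ f.2 g.2 _ _) ?_
        rw [frontEquiv_zero, sumEquiv_natAdd, Equiv.swap_apply_left, he]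
      rw [inclWV_associator_succ hE h h₁ h' h₂ f g k _ (key h h₁ g k),
        inclWV_associator_succ hE h₃ h₁₃ h' h₃₂ f k g _ (key h₃ h₁₃ k g),
        comp_act_frontEquiv hE h h₁ h₃ h₁₃ hb f.2.1 g.2.1 k.2.1 hg hk, map_zsmul, symTotal_act,
        ((mem_WV_iff hE).1 f.2).2, smul_comm, mul_comm m.factorial l.factorial]

end Box

/-! ### Shuffles -/

section Shuffles

variable {m n : ℕ}

theorem perm_eq_refl_of_strictMono (u : Equiv.Perm (Fin n)) (hu : StrictMono u) :
    u = Equiv.refl _ := by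
  have h : hu.orderIsoOfSurjective u u.surjective = OrderIso.refl (Fin n) := Subsingleton.elim _ _
  exact Equiv.ext fun i => DFunLike.congr_fun h i

/-- Every permutation is in a unique way the product of a shuffle and of a permutation of the two
blocks. -/
theorem shuffle_bijective (m n : ℕ) : Function.Bijective
    (fun x : {σ : Equiv.Perm (Fin (m + n)) // IsShuffle m n σ} ×
      (Equiv.Perm (Fin m) × Equiv.Perm (Fin n)) => (sumEquiv x.2.1 x.2.2).trans x.1.1) := by
  constructor
  · rintro ⟨⟨σ, hσ⟩, s, t⟩ ⟨⟨σ', hσ'⟩, s', t'⟩ h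
    have hc : ∀ i, σ (sumEquiv s t i) = σ' (sumEquiv s' t' i) := fun i => DFunLike.congr_fun h i
    have hs : s = s' := by
      have h1 : ∀ i, σ' (Fin.castAdd n (s' (s.symm i))) = σ (Fin.castAdd n i) := fun i => by
        have := hc (Fin.castAdd n (s.symm i))
        rw [sumEquiv_castAdd, sumEquiv_castAdd, Equiv.apply_symm_apply] at this
        exact this.symm
      have h2 : StrictMono (fun i => σ' (Fin.castAdd n i)) := fun i j hij => hσ'.1 i j hij
      have h3 : StrictMono (s.symm.trans s') := fun i j hij => by
        rw [← h2.lt_iff_lt]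
        simp only [Equiv.trans_apply, h1]
        exact hσ.1 i j hij
      have h4 := perm_eq_refl_of_strictMono _ h3
      ext i
      have := DFunLike.congr_fun h4 (s i)
      simp only [Equiv.trans_apply, Equiv.symm_apply_apply, Equiv.refl_apply] at this
      rw [this]
    have ht : t = t' := by
      have h1 : ∀ i, σ' (Fin.natAdd m (t' (t.symm i))) = σ (Fin.natAdd m i) := fun i => by
        have := hc (Fin.natAdd m (t.symm i))
        rw [sumEquiv_natAdd, sumEquiv_natAdd, Equiv.apply_symm_apply] at this
        exact this.symm
      have h2 : StrictMono (fun i => σ' (Fin.natAdd m i)) := fun i j hij => hσ'.2 i j hij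
      have h3 : StrictMono (t.symm.trans t') := fun i j hij => by
        rw [← h2.lt_iff_lt]
        simp only [Equiv.trans_apply, h1]
        exact hσ.2 i j hij
      have h4 := perm_eq_refl_of_strictMono _ h3
      ext i
      have := DFunLike.congr_fun h4 (t i)
      simp only [Equiv.trans_apply, Equiv.symm_apply_apply, Equiv.refl_apply] at this
      rw [this]
    subst hs ht
    have : σ = σ' := Equiv.ext fun i => by
      have := hc ((sumEquiv s t).symm i)
      rwa [Equiv.apply_symm_apply] at this
    subst this
    rfl
  · intro ρ
    have hmono : ∀ {k : ℕ} (f : Fin k → Fin (m + n)), Function.Injective f →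
        StrictMono (f ∘ Tuple.sort f) := fun f hf =>
      (Tuple.monotone_sort f).strictMono_of_injective (hf.comp (Tuple.sort f).injective)
    set s := Tuple.sort fun i => ρ (Fin.castAdd n i) with hs
    set t := Tuple.sort fun i => ρ (Fin.natAdd m i) with ht
    refine ⟨⟨⟨(sumEquiv s t).trans ρ, fun i j hij => ?_, fun i j hij => ?_⟩, s.symm, t.symm⟩, ?_⟩
    · simp only [Equiv.trans_apply, sumEquiv_castAdd]
      exact hmono (fun i => ρ (Fin.castAdd n i))
        (ρ.injective.comp (Fin.castAdd_injective m n)) hij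
    · simp only [Equiv.trans_apply, sumEquiv_natAdd]
      exact hmono (fun i => ρ (Fin.natAdd m i)) (ρ.injective.comp (Fin.natAdd_injective n m)) hij
    · ext i
      simp only [Equiv.trans_apply]
      rw [← sumEquiv_symm, Equiv.apply_symm_apply]

variable {F : Type u} {V : Type v} [Field F] [AddCommGroup V] [Module F V] [Module F[X] V]
  [IsScalarTower F F[X] V] {E : ZMod 2 → Submodule F[X] V} {b b₁ b₂ : Bool}

open Classical in
/-- For a map that is invariant under `S_m × S_n`, the sum over all permutations is `m! n!` times the
sum over the shuffles. -/
theorem symSum_eq_shuffles (hE : DirectSum.IsInternal E) {k : CMaps F V b (m + n)}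
    (hk : ∀ s t, act hE b (sumEquiv s t) k = k) : symSum hE b (m + n) k =
      (m.factorial * n.factorial) •
        ∑ σ : Equiv.Perm (Fin (m + n)) with IsShuffle m n σ, act hE b σ.symm k := by
  rw [symSum_apply, ← Equiv.sum_comp (Equiv.inv (Equiv.Perm (Fin (m + n)))),
    ← (shuffle_bijective m n).sum_comp, Fintype.sum_prod_type]
  have h1 : ∀ (σ : {σ : Equiv.Perm (Fin (m + n)) // IsShuffle m n σ})
      (x : Equiv.Perm (Fin m) × Equiv.Perm (Fin n)),
      act hE b (Equiv.inv (Equiv.Perm (Fin (m + n))) ((sumEquiv x.1 x.2).trans σ.1)) k =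
        act hE b σ.1.symm k := fun σ x => by
    have : Equiv.inv (Equiv.Perm (Fin (m + n))) ((sumEquiv x.1 x.2).trans σ.1) =
      σ.1.symm.trans (sumEquiv x.1.symm x.2.symm) := rfl
    rw [this, ← act_act, hk]
  simp only [h1, Finset.sum_const, Finset.card_univ, Fintype.card_prod, Fintype.card_perm,
    Fintype.card_fin]
  rw [← Finset.smul_sum]
  congr 1
  exact (Finset.sum_subtype (p := fun σ => IsShuffle m n σ)
    (Finset.univ.filter fun σ => IsShuffle m n σ) (by simp) fun σ => act hE b σ.symm k).symm

variable [CharZero F]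

theorem isShuffleSum_boxSucc (hE : DirectSum.IsInternal E) (h : b = (b₁ && b₂))
    (f : WV E b₁ (n + 1)) (g : WV E b₂ m) :
    IsShuffleSum E m n (renV F V b) (comp h f.1 g.1) (boxSucc hE h n m f g).1 := by
  intro ε v p hv
  rw [coe_boxSucc, symSum_eq_shuffles hE (act_sumEquiv_comp hE h f.2 g.2),
    ← Nat.cast_smul_eq_nsmul F, smul_smul, inv_mul_cancel₀, one_smul, ← evalMaps_apply, map_sum]
  · refine Finset.sum_congr rfl fun σ _ => ?_
    rw [evalMaps_apply, act_apply hE _ _ hv]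
    rfl
  · exact_mod_cast mul_ne_zero (Nat.factorial_ne_zero m) (Nat.factorial_ne_zero n)

theorem IsShuffleSum.unique (hE : DirectSum.IsInternal E)
    {ren : Equiv.Perm (Fin (m + n)) → Val F V b (m + n) →ₗ[F] Val F V b (m + n)}
    {k y y' : CMaps F V b (m + n)} (hy : IsShuffleSum E m n ren k y)
    (hy' : IsShuffleSum E m n ren k y') : y = y' :=
  maps_ext_homogeneous hE fun ε v p hv => (hy ε v p hv).trans (hy' ε v p hv).symm

end Shuffles

/-! ### Parities -/

section Parity

variable {F : Type u} {V : Type v} [Field F] [AddCommGroup V] [Module F V] [Module F[X] V]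
  [IsScalarTower F F[X] V] {E : ZMod 2 → Submodule F[X] V} {b b₁ b₂ : Bool} {m n n' : ℕ}

theorem X_smul_mem_polPar {i : ZMod 2} (k : Fin n) {G : PolV F V (Fin n)} (hG : G ∈ polPar E n i) :
    (MvPolynomial.X k : A F (Fin n)) • G ∈ polPar E n i := by
  intro α
  rw [coeffs_X_smul]
  by_cases h : α ∈ Set.range (fun β : Fin n →₀ ℕ => β + Finsupp.single k 1)
  · obtain ⟨β, rfl⟩ := h
    rw [Finsupp.mapDomain_apply (add_left_injective _)]
    exact hG β
  · rw [Finsupp.mapDomain_of_notMem_range _ _ h]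
    exact zero_mem _

theorem smul_mem_polPar {i : ZMod 2} (a : A F (Fin n)) {G : PolV F V (Fin n)}
    (hG : G ∈ polPar E n i) : a • G ∈ polPar E n i := by
  induction a using MvPolynomial.induction_on with
  | C a =>
    rw [C_smul_polV]
    intro α
    rw [map_smul, Finsupp.smul_apply]
    exact (E i).smul_mem a (hG α)
  | add p q hp hq => rw [add_smul]; exact add_mem hp hq
  | mul_X p k hp => rw [mul_comm, mul_smul]; exact X_smul_mem_polPar k hp

theorem pol_mem_polPar {i : ZMod 2} (p : A F (Fin n)) {x : V} (hx : x ∈ E i) :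
    (pol p x : PolV F V (Fin n)) ∈ polPar E n i := by
  intro α
  rw [coeffs_pol]
  exact (E i).smul_mem _ hx

theorem polPar_induction {i : ZMod 2} {motive : PolV F V (Fin n) → Prop}
    (const : ∀ x ∈ E i, motive (pol 1 x))
    (mulX : ∀ k G, motive G → motive ((MvPolynomial.X k : A F (Fin n)) • G))
    (add : ∀ G G', motive G → motive G' → motive (G + G')) {G : PolV F V (Fin n)}
    (hG : G ∈ polPar E n i) : motive G := by
  classical
  have mono : ∀ (α : Fin n →₀ ℕ) (x : V), x ∈ E i →
      motive (pol (MvPolynomial.monomial α 1) x) := fun α x hx => by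
    induction α using finsupp_nat_induction with
    | zero => exact const x hx
    | add_single α k ih =>
      have : (MvPolynomial.monomial (α + Finsupp.single k 1) 1 : A F (Fin n)) =
          MvPolynomial.X k * MvPolynomial.monomial α 1 := by
        rw [MvPolynomial.X, MvPolynomial.monomial_mul, one_mul, add_comm]
      rw [this, ← smul_pol]
      exact mulX k _ ih
  have zero : motive 0 := by
    rw [← pol_zero_right 1]
    exact const 0 (zero_mem _)
  have h1 : G = (coeffs G).sum fun α x => pol (MvPolynomial.monomial α 1) x := by
    apply coeffs.injective
    rw [map_finsuppSum]
    refine Finsupp.ext fun β => ?_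
    rw [Finsupp.sum_apply]
    simp only [coeffs_pol, MvPolynomial.coeff_monomial, ite_smul, one_smul, zero_smul]
    rw [Finsupp.sum_ite_eq']
    split_ifs with h
    · rfl
    · exact Finsupp.notMem_support_iff.1 h
  rw [h1, Finsupp.sum]
  refine Finset.sum_induction _ motive (fun _ _ => add _ _) zero fun α _ => mono α _ (hG α)

theorem X_smul_mem_valPar {i : ZMod 2} (k : Fin n) {y : Val F V b n} (hy : y ∈ valPar E b n i) :
    (MvPolynomial.X k : A F (Fin n)) • y ∈ valPar E b n i := by
  obtain ⟨G, rfl, hG⟩ := exists_proj_of_mem_valPar hy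
  rw [← proj_smul]
  exact proj_mem_valPar (X_smul_mem_polPar k hG)

theorem substL_mem_polPar {i : ZMod 2} (φ : A F (Fin n) →ₐ[F[X]] A F (Fin n'))
    {G : PolV F V (Fin n)} (hG : G ∈ polPar E n i) : substL V φ G ∈ polPar E n' i := by
  refine polPar_induction (motive := fun G => substL V φ G ∈ polPar E n' i) ?_ ?_ ?_ hG
  · intro x hx
    rw [substL_pol]
    exact pol_mem_polPar _ hx
  · intro k G hG
    rw [substL_smul]
    exact smul_mem_polPar _ hG
  · intro G G' hG hG'
    rw [map_add]
    exact add_mem hG hG'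

theorem valMap_mem_valPar {i : ZMod 2} {b b' : Bool} (φ : A F (Fin n) →ₐ[F[X]] A F (Fin n'))
    (h : b = true → ∀ y : PolV F V (Fin n'), proj F V b' n' (φ (total F (Fin n)) • y) = 0)
    {y : Val F V b n} (hy : y ∈ valPar E b n i) : valMap b b' φ h y ∈ valPar E b' n' i := by
  obtain ⟨G, rfl, hG⟩ := exists_proj_of_mem_valPar hy
  rw [valMap_proj]
  exact proj_mem_valPar (substL_mem_polPar φ hG)

/-- The product in the first position is compatible with parities. -/
theorem comp_mem_mapsPar (h : b = (b₁ && b₂)) {f : CMaps F V b₁ (n + 1)} {g : CMaps F V b₂ m}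
    (hf : f ∈ PV F V b₁ (n + 1)) (hg : g ∈ PV F V b₂ m) {i j : ZMod 2}
    (hfi : f ∈ mapsPar E (valPar E b₁ (n + 1)) i) (hgj : g ∈ mapsPar E (valPar E b₂ m) j) :
    comp h f g ∈ mapsPar E (valPar E b (m + n)) (i + j) := by
  intro ε v p hv
  obtain ⟨q, r, rfl⟩ := exists_blockIncl_mul_regIncl m n p
  obtain ⟨G, hG, hGj⟩ := exists_proj_of_mem_valPar (hgj _ _ q fun i => hv (Fin.castAdd n i))
  rw [isComp_comp h hf hg v q r G hG]
  refine polPar_induction (motive := fun G => ∀ r, plugL (insMap h m f fun j => v (Fin.natAdd m j))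
    G r ∈ valPar E b (m + n) (i + j + ∑ k, ε k)) ?_ ?_ ?_ hGj r
  · intro x hx r
    rw [plugL_pol_one, insMap_apply]
    refine valMap_mem_valPar _ _ ?_
    have := hfi (Fin.cons (j + ∑ k : Fin m, ε (Fin.castAdd n k)) fun k => ε (Fin.natAdd m k))
      (Fin.cons x fun k => v (Fin.natAdd m k)) (specialize m n r)
      (fun k => Fin.cases hx (fun k => hv _) k)
    rw [Fin.sum_univ_succ] at this
    simp only [Fin.cons_zero, Fin.cons_succ] at this
    rw [Fin.sum_univ_add]
    have e : i + j + (∑ k, ε (Fin.castAdd n k) + ∑ k, ε (Fin.natAdd m k)) =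
        i + (j + ∑ k, ε (Fin.castAdd n k) + ∑ k, ε (Fin.natAdd m k)) := by abel
    rw [e]
    exact this
  · intro k G hG r
    rw [plugL_X_smul]
    exact sub_mem (X_smul_mem_valPar _ (hG r)) (hG _)
  · intro G G' hG hG' r
    rw [map_add, LinearMap.add_apply]
    exact add_mem (hG r) (hG' r)

theorem act_mem_mapsPar (hE : DirectSum.IsInternal E) (e : Fin n' ≃ Fin n) {f : CMaps F V b n}
    {i : ZMod 2} (hf : f ∈ mapsPar E (valPar E b n) i) :
    act hE b e f ∈ mapsPar E (valPar E b n') i := by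
  intro ε v p hv
  rw [act_apply hE _ _ hv, reindex_apply]
  refine zsmul_mem (valMap_mem_valPar _ _ ?_) _
  have := hf (fun k => ε (e.symm k)) (fun k => v (e.symm k)) (substT (equivHom e) p)
    (fun k => hv _)
  rwa [Equiv.sum_comp e.symm ε] at this

variable (E) in
/-- The invariants of parity `i`. -/
def parWV (b : Bool) (i : ZMod 2) (a : ℕ) : Submodule F (WV E b a) :=
  (mapsPar E (valPar E b a) i).comap (WV E b a).subtype

theorem boxSucc_mem_parWV (hE : DirectSum.IsInternal E) (h : b = (b₁ && b₂)) {i j : ZMod 2}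
    {f : WV E b₁ (n + 1)} {g : WV E b₂ m} (hf : f ∈ parWV E b₁ i (n + 1))
    (hg : g ∈ parWV E b₂ j m) : boxSucc hE h n m f g ∈ parWV E b (i + j) (m + n) := by
  change (boxSucc hE h n m f g).1 ∈ mapsPar E (valPar E b (m + n)) (i + j)
  rw [coe_boxSucc, symSum_apply]
  exact Submodule.smul_mem _ _ (sum_mem fun σ _ =>
    act_mem_mapsPar hE _ (comp_mem_mapsPar h f.2.1 g.2.1 hf hg))

theorem sumPar_induction {M : ℕ → Type*} [∀ a, AddCommGroup (M a)] [∀ a, Module F (M a)]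
    {G : ∀ a, Submodule F (M a)} {motive : (⨁ a, M a) → Prop} (zero : motive 0)
    (lof : ∀ a, ∀ f ∈ G a, motive (DirectSum.lof F ℕ M a f))
    (add : ∀ x y, motive x → motive y → motive (x + y)) {x : ⨁ a, M a} (hx : x ∈ sumPar G) :
    motive x := by
  classical
  rw [← DirectSum.sum_support_of x]
  exact Finset.sum_induction _ motive add zero fun a _ =>
    lof a _ ((Submodule.mem_iInf _).1 hx a)

theorem mem_sumPar {M : ℕ → Type*} [∀ a, AddCommGroup (M a)] [∀ a, Module F (M a)]
    {G : ∀ a, Submodule F (M a)} {x : ⨁ a, M a} : x ∈ sumPar G ↔ ∀ a, x a ∈ G a :=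
  Submodule.mem_iInf _

theorem lof_mem_sumPar {M : ℕ → Type*} [∀ a, AddCommGroup (M a)] [∀ a, Module F (M a)]
    {G : ∀ a, Submodule F (M a)} {a : ℕ} {f : M a} (hf : f ∈ G a) :
    DirectSum.lof F ℕ M a f ∈ sumPar G := by
  refine mem_sumPar.2 fun c => ?_
  by_cases h : c = a
  · subst h
    rw [DirectSum.lof_apply]
    exact hf
  · rw [DirectSum.lof_eq_of, DirectSum.of_eq_of_ne _ _ _ h]
    exact zero_mem _

/-- The product `□` is compatible with parities. -/
theorem box_mem_sumPar (hE : DirectSum.IsInternal E) (h : b = (b₁ && b₂)) {i j : ZMod 2}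
    {x : ⨁ a, WV E b₁ a} {y : ⨁ a, WV E b₂ a} (hx : x ∈ sumPar (parWV E b₁ i))
    (hy : y ∈ sumPar (parWV E b₂ j)) : box hE h x y ∈ sumPar (parWV E b (i + j)) := by
  refine sumPar_induction (motive := fun x => box hE h x y ∈ sumPar (parWV E b (i + j)))
    ?_ ?_ ?_ hx
  · rw [map_zero, LinearMap.zero_apply]; exact zero_mem _
  · intro a f hf
    refine sumPar_induction (motive := fun y => box hE h _ y ∈ sumPar (parWV E b (i + j)))
      ?_ ?_ ?_ hy
    · rw [map_zero]; exact zero_mem _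
    · intro m g hg
      cases a with
      | zero => rw [box_lof_zero]; exact zero_mem _
      | succ n =>
        rw [box_lof_succ]
        exact lof_mem_sumPar (boxSucc_mem_parWV hE h hf hg)
    · intro y y' hy hy'
      rw [map_add]; exact add_mem hy hy'
  · intro x x' hx hx'
    rw [map_add, LinearMap.add_apply]; exact add_mem hx hx'

/-! ### The decomposition of the invariants by parity -/

/-- The parity involution of a superspace. -/
def parInv (hE : DirectSum.IsInternal E) : V →ₗ[F[X]] V := prjI hE 0 - prjI hE 1

/-- The sign `(-1)^i`. -/
def parSign (i : ZMod 2) : F := if i = 0 then 1 else -1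

theorem parSign_add (i j : ZMod 2) :
    (parSign (i + j) : F) = parSign i * parSign j := by
  have h : ∀ i : ZMod 2, i = 0 ∨ i = 1 := by decide
  have h1 : (1 : ZMod 2) + 1 = 0 := by decide
  rcases h i with rfl | rfl <;> rcases h j with rfl | rfl <;> simp [parSign, h1]

theorem parSign_sum {ι : Type*} (s : Finset ι) (ε : ι → ZMod 2) :
    (parSign (∑ i ∈ s, ε i) : F) = ∏ i ∈ s, parSign (ε i) := by
  classical
  induction s using Finset.induction_on with
  | empty => simp [parSign]
  | insert i s hi ih => rw [Finset.sum_insert hi, Finset.prod_insert hi, parSign_add, ih]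

theorem parInv_of_mem (hE : DirectSum.IsInternal E) {i : ZMod 2} {x : V} (hx : x ∈ E i) :
    parInv hE x = (parSign i : F) • x := by
  have h : ∀ i : ZMod 2, i = 0 ∨ i = 1 := by decide
  rcases h i with rfl | rfl
  · rw [parInv, LinearMap.sub_apply, prjI_of_mem hE hx, prjI_of_mem_ne hE (by decide) hx]
    simp [parSign]
  · rw [parInv, LinearMap.sub_apply, prjI_of_mem hE hx, prjI_of_mem_ne hE (by decide) hx]
    simp [parSign]

theorem add_parInv_mem (hE : DirectSum.IsInternal E) (i : ZMod 2) (x : V) :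
    x + (parSign i : F) • parInv hE x ∈ E i := by
  have h : ∀ i : ZMod 2, i = 0 ∨ i = 1 := by decide
  have hx := sum_prjI hE x
  have h2 : ∑ i : ZMod 2, prjI hE i x = prjI hE 0 x + prjI hE 1 x := Fin.sum_univ_two _
  rw [h2] at hx
  rw [parInv, LinearMap.sub_apply]
  rcases h i with rfl | rfl
  · have : x + (parSign (0 : ZMod 2) : F) • (prjI hE 0 x - prjI hE 1 x) =
        prjI hE 0 x + prjI hE 0 x := by
      conv_lhs => rw [← hx]
      simp [parSign, prjI_of_mem hE (prjI_mem hE _ x),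
        prjI_of_mem_ne hE (show (1 : ZMod 2) ≠ 0 by decide) (prjI_mem hE 0 x),
        prjI_of_mem_ne hE (show (0 : ZMod 2) ≠ 1 by decide) (prjI_mem hE 1 x)]
    rw [this]
    exact add_mem (prjI_mem hE _ _) (prjI_mem hE _ _)
  · have : x + (parSign (1 : ZMod 2) : F) • (prjI hE 0 x - prjI hE 1 x) =
        prjI hE 1 x + prjI hE 1 x := by
      conv_lhs => rw [← hx]
      simp [parSign, prjI_of_mem hE (prjI_mem hE _ x),
        prjI_of_mem_ne hE (show (1 : ZMod 2) ≠ 0 by decide) (prjI_mem hE 0 x),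
        prjI_of_mem_ne hE (show (0 : ZMod 2) ≠ 1 by decide) (prjI_mem hE 1 x)]
      abel
    rw [this]
    exact add_mem (prjI_mem hE _ _) (prjI_mem hE _ _)

/-- The parity involution on polynomials. -/
def polInv (hE : DirectSum.IsInternal E) (n : ℕ) : PolV F V (Fin n) →ₗ[F] PolV F V (Fin n) :=
  (show (A F (Fin n) ⊗[F[X]] V) →ₗ[F[X]] (A F (Fin n) ⊗[F[X]] V) from
    LinearMap.lTensor _ (parInv hE)).restrictScalars F

theorem polInv_pol (hE : DirectSum.IsInternal E) (p : A F (Fin n)) (x : V) :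
    polInv hE n (pol p x) = pol p (parInv hE x) := rfl

theorem polInv_smul (hE : DirectSum.IsInternal E) (a : A F (Fin n)) (G : PolV F V (Fin n)) :
    polInv hE n (a • G) = a • polInv hE n G := by
  induction G using pol_induction with
  | zero => simp
  | pol p x => rw [smul_pol, polInv_pol, polInv_pol, smul_pol]
  | add x y hx hy => simp only [smul_add, map_add, hx, hy]

variable (n b) in
/-- The parity involution on values. -/
def valInv (hE : DirectSum.IsInternal E) : Val F V b n →ₗ[F] Val F V b n :=
  valLift b (proj F V b n ∘ₗ polInv hE n) fun hb x => by
    subst hb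
    rw [LinearMap.comp_apply, polInv_smul, proj_total]

theorem valInv_proj (hE : DirectSum.IsInternal E) (G : PolV F V (Fin n)) :
    valInv b n hE (proj F V b n G) = proj F V b n (polInv hE n G) := valLift_proj _ _ _ _

theorem valInv_smul (hE : DirectSum.IsInternal E) (a : A F (Fin n)) (y : Val F V b n) :
    valInv b n hE (a • y) = a • valInv b n hE y := by
  obtain ⟨G, rfl⟩ := proj_surjective b n y
  rw [← proj_smul, valInv_proj, polInv_smul, valInv_proj, proj_smul]

theorem valInv_valMap (hE : DirectSum.IsInternal E) {b' : Bool}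
    (φ : A F (Fin n) →ₐ[F[X]] A F (Fin n'))
    (h : b = true → ∀ y : PolV F V (Fin n'), proj F V b' n' (φ (total F (Fin n)) • y) = 0)
    (y : Val F V b n) : valInv b' n' hE (valMap b b' φ h y) = valMap b b' φ h (valInv b n hE y) := by
  obtain ⟨G, rfl⟩ := proj_surjective b n y
  rw [valMap_proj, valInv_proj, valInv_proj, valMap_proj]
  congr 1
  induction G using pol_induction with
  | zero => simp
  | pol p x => rfl
  | add x y hx hy => simp only [map_add, hx, hy]

theorem valInv_diffV (hE : DirectSum.IsInternal E) (i j : Fin n) (y : Val F V b n) :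
    valInv b n hE (diffV F V b n i j y) = diffV F V b n i j (valInv b n hE y) := by
  obtain ⟨G, rfl⟩ := proj_surjective b n y
  rw [diffV_proj, valInv_proj, valInv_proj, diffV_proj]
  congr 1
  induction G using pol_induction with
  | zero => simp
  | pol p x => rfl
  | add x y hx hy => simp only [map_add, hx, hy]

theorem valInv_of_mem (hE : DirectSum.IsInternal E) {i : ZMod 2} {y : Val F V b n}
    (hy : y ∈ valPar E b n i) : valInv b n hE y = (parSign i : F) • y := by
  obtain ⟨G, rfl, hG⟩ := exists_proj_of_mem_valPar hy
  rw [valInv_proj, ← map_smul]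
  congr 1
  refine polPar_induction (motive := fun G => polInv hE n G = (parSign i : F) • G) ?_ ?_ ?_ hG
  · intro x hx
    rw [polInv_pol, parInv_of_mem hE hx, pol_smul_right]
  · intro k G hG
    rw [polInv_smul, hG, smul_comm]
  · intro G G' hG hG'
    rw [map_add, hG, hG', smul_add]

theorem add_valInv_mem (hE : DirectSum.IsInternal E) (i : ZMod 2) (y : Val F V b n) :
    y + (parSign i : F) • valInv b n hE y ∈ valPar E b n i := by
  obtain ⟨G, rfl⟩ := proj_surjective b n y
  rw [valInv_proj, ← map_smul, ← map_add]
  refine proj_mem_valPar ?_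
  induction G using pol_induction with
  | zero => rw [map_zero, smul_zero, add_zero]; exact zero_mem _
  | pol p x =>
    rw [polInv_pol, ← pol_smul_right, ← pol_add_right]
    exact pol_mem_polPar p (add_parInv_mem hE i x)
  | add x y hx hy =>
    rw [map_add, smul_add, add_add_add_comm]
    exact add_mem hx hy

/-- The parity involution on maps. -/
def mapsInv (hE : DirectSum.IsInternal E) (b : Bool) (n : ℕ) : Module.End F (CMaps F V b n) where
  toFun f := postComp (valInv b n hE)
    ((f : MultilinearMap F (fun _ : Fin n => V) (O F n →ₗ[F] Val F V b n)).compLinearMap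
      fun _ => (parInv hE).restrictScalars F)
  map_add' _ _ := Maps.ext F V fun _ _ => map_add (valInv b n hE) _ _
  map_smul' c _ := Maps.ext F V fun _ _ => map_smul (valInv b n hE) c _

theorem mapsInv_apply (hE : DirectSum.IsInternal E) (f : CMaps F V b n) (v : Fin n → V)
    (p : O F n) : mapsInv hE b n f v p = valInv b n hE (f (fun i => parInv hE (v i)) p) := rfl

theorem mapsInv_mem_WV (hE : DirectSum.IsInternal E) {f : CMaps F V b n} (hf : f ∈ WV E b n) :
    mapsInv hE b n f ∈ WV E b n := by
  refine ⟨⟨fun v i p => ?_, fun v i j p => ?_⟩, fun σ ε v p hv => ?_⟩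
  · have h := hf.1.1 (fun i => parInv hE (v i)) i p
    rw [mapsInv_apply, mapsInv_apply, mapsInv_apply, ← h, map_add, valInv_smul]
    congr 4
    funext k
    by_cases hk : k = i
    · subst hk; simp
    · simp [Function.update_of_ne hk]
  · rw [mapsInv_apply, mapsInv_apply, hf.1.2, valInv_diffV]
  · have h := hf.2 σ ε (fun i => parInv hE (v i)) p fun i => by
      rw [parInv_of_mem hE (hv i), ← algebraMap_smul F[X] (parSign (ε i) : F) (v i)]
      exact (E _).smul_mem _ (hv i)
    rw [mapsInv_apply, ← h, permEval, permEval, map_zsmul]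
    congr 1
    exact (valInv_valMap hE _ _ _).symm

theorem mapsInv_apply_of_mem (hE : DirectSum.IsInternal E) (f : CMaps F V b n) {ε : Fin n → ZMod 2}
    {v : Fin n → V} (hv : ∀ i, v i ∈ E (ε i)) (p : O F n) :
    mapsInv hE b n f v p = (parSign (∑ i, ε i) : F) • valInv b n hE (f v p) := by
  have h1 : (fun i => parInv hE (v i)) = fun i => (parSign (ε i) : F) • v i :=
    funext fun i => parInv_of_mem hE (hv i)
  have h2 : f (fun i => (parSign (ε i) : F) • v i) = (∏ i, (parSign (ε i) : F)) • f v :=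
    MultilinearMap.map_smul_univ
      (show MultilinearMap F (fun _ : Fin n => V) (O F n →ₗ[F] Val F V b n) from f) _ _
  rw [mapsInv_apply, h1, h2, LinearMap.smul_apply, map_smul, parSign_sum]

theorem add_mapsInv_mem (hE : DirectSum.IsInternal E) (i : ZMod 2) (f : CMaps F V b n) :
    f + (parSign i : F) • mapsInv hE b n f ∈ mapsPar E (valPar E b n) i := by
  intro ε v p hv
  rw [Maps.add_apply, LinearMap.add_apply, Maps.smul_apply, LinearMap.smul_apply,
    mapsInv_apply_of_mem hE f hv, smul_smul, ← parSign_add]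
  exact add_valInv_mem hE _ _

variable [CharZero F]

/-- A map of both parities vanishes. -/
theorem mapsPar_inf (hE : DirectSum.IsInternal E) {f : CMaps F V b n}
    (h0 : f ∈ mapsPar E (valPar E b n) 0) (h1 : f ∈ mapsPar E (valPar E b n) 1) : f = 0 := by
  refine maps_ext_homogeneous hE fun ε v p hv => ?_
  have e0 := valInv_of_mem hE (h0 ε v p hv)
  have e1 := valInv_of_mem hE (h1 ε v p hv)
  rw [zero_add] at e0
  rw [parSign_add, mul_smul, ← e0] at e1
  have e2 : (parSign (1 : ZMod 2) : F) = -1 := by simp [parSign]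
  rw [e2, neg_smul, one_smul, eq_neg_iff_add_eq_zero, ← two_smul F, smul_eq_zero,
    or_iff_right two_ne_zero] at e1
  rw [e1] at e0
  have e3 : (parSign (∑ i, ε i) : F) ≠ 0 := by
    unfold parSign; split_ifs <;> simp
  exact (smul_eq_zero.1 e0.symm).resolve_left e3

/-- The parity involution shows that the invariants are the sum of their even and odd parts. -/
theorem isInternal_sumPar (hE : DirectSum.IsInternal E) (b : Bool) :
    DirectSum.IsInternal fun i => sumPar (parWV E b i) := by
  have hu : (Set.univ : Set (ZMod 2)) = {0, 1} := by
    ext i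
    have : ∀ i : ZMod 2, i = 0 ∨ i = 1 := by decide
    simpa using this i
  rw [DirectSum.isInternal_submodule_iff_isCompl _ (show (0 : ZMod 2) ≠ 1 by decide) hu]
  constructor
  · rw [disjoint_iff, eq_bot_iff]
    rintro x ⟨h0, h1⟩
    rw [Submodule.mem_bot]
    refine DFinsupp.ext fun a => Subtype.ext ?_
    exact mapsPar_inf hE (mem_sumPar.1 h0 a) (mem_sumPar.1 h1 a)
  · rw [codisjoint_iff, eq_top_iff]
    intro x _
    induction x using DirectSum.induction_on with
    | zero => exact zero_mem _
    | add x y hx hy => exact add_mem (hx trivial) (hy trivial)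
    | of a f =>
      have hm : ∀ i, (f.1 + (parSign i : F) • mapsInv hE b a f.1) ∈ WV E b a := fun i =>
        add_mem f.2 (Submodule.smul_mem _ _ (mapsInv_mem_WV hE f.2))
      have hf : f = (2⁻¹ : F) • (⟨_, hm 0⟩ + ⟨_, hm 1⟩ : WV E b a) := by
        refine Subtype.ext ?_
        change f.1 = (2⁻¹ : F) • ((f.1 + (parSign 0 : F) • mapsInv hE b a f.1) +
          (f.1 + (parSign 1 : F) • mapsInv hE b a f.1))
        have e2 : (parSign (1 : ZMod 2) : F) = -1 := by simp [parSign]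
        have e3 : (parSign (0 : ZMod 2) : F) = 1 := by simp [parSign]
        rw [e2, e3]
        module
      have hl : DirectSum.of (fun a => WV E b a) a f = (2⁻¹ : F) •
          (DirectSum.lof F ℕ (fun a => WV E b a) a ⟨_, hm 0⟩ +
            DirectSum.lof F ℕ (fun a => WV E b a) a ⟨_, hm 1⟩) := by
        rw [← map_add, ← map_smul, ← hf]
        rfl
      rw [hl]
      exact Submodule.smul_mem _ _ (Submodule.add_mem_sup
        (lof_mem_sumPar (add_mapsInv_mem hE 0 f.1)) (lof_mem_sumPar (add_mapsInv_mem hE 1 f.1)))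

end Parity

/-! ### The brackets -/

section Brackets

variable {F : Type u} {V : Type v} [Field F] [AddCommGroup V] [Module F V] [Module F[X] V]
  [IsScalarTower F F[X] V] [CharZero F] {E : ZMod 2 → Submodule F[X] V}
  {b b₁ b₂ b₃ b₁₂ b₁₃ b₂₃ : Bool}

/-- The associator of `□` is supersymmetric in its last two arguments. -/
theorem box_associator_symm (hE : DirectSum.IsInternal E) (h : b = (b₁₂ && b₃))
    (h₁ : b₁₂ = (b₁ && b₂)) (h' : b = (b₁ && b₂₃)) (h₂ : b₂₃ = (b₂ && b₃)) (h₃ : b = (b₁₃ && b₂))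
    (h₁₃ : b₁₃ = (b₁ && b₃)) (h₃₂ : b₂₃ = (b₃ && b₂)) (hb : (b₂ || b₃) = true) {i j : ZMod 2}
    (x : ⨁ a, WV E b₁ a) {y : ⨁ a, WV E b₂ a} {z : ⨁ a, WV E b₃ a}
    (hy : y ∈ sumPar (parWV E b₂ i)) (hz : z ∈ sumPar (parWV E b₃ j)) :
    box hE h (box hE h₁ x y) z - box hE h' x (box hE h₂ y z) =
      ksign i j • (box hE h₃ (box hE h₁₃ x z) y - box hE h' x (box hE h₃₂ z y)) := by
  induction x using DirectSum.induction_on with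
  | zero => simp only [map_zero, LinearMap.zero_apply, sub_zero, smul_zero]
  | add x x' hx hx' =>
    simp only [map_add, LinearMap.add_apply]
    rw [add_sub_add_comm, hx, hx', ← smul_add, add_sub_add_comm]
  | of a f =>
    refine sumPar_induction (motive := fun y => box hE h (box hE h₁ _ y) z -
      box hE h' _ (box hE h₂ y z) = ksign i j • (box hE h₃ (box hE h₁₃ _ z) y -
        box hE h' _ (box hE h₃₂ z y))) ?_ ?_ ?_ hy
    · simp only [map_zero, LinearMap.zero_apply, sub_zero, smul_zero]
    · intro m g hg
      refine sumPar_induction (motive := fun z => box hE h (box hE h₁ _ _) z -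
        box hE h' _ (box hE h₂ _ z) = ksign i j • (box hE h₃ (box hE h₁₃ _ z) _ -
          box hE h' _ (box hE h₃₂ z _))) ?_ ?_ ?_ hz
      · simp only [map_zero, LinearMap.zero_apply, sub_zero, smul_zero]
      · intro l k hk
        apply inclWV_injective
        rw [map_sub, map_zsmul, map_sub]
        exact inclWV_associator_symm hE h h₁ h' h₂ h₃ h₁₃ h₃₂ hb f g k hg hk
      · intro z z' hz hz'
        simp only [map_add, LinearMap.add_apply]
        rw [add_sub_add_comm, hz, hz', ← smul_add, add_sub_add_comm]
    · intro y y' hy hy'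
      simp only [map_add, LinearMap.add_apply]
      rw [add_sub_add_comm, hy, hy', ← smul_add, add_sub_add_comm]

/-- The bilinear map that is `x □ y - (-1)^{p(x) p(y)} y □ x` on homogeneous elements. -/
def bracket (hE : DirectSum.IsInternal E) (h : b = (b₁ && b₂)) (h' : b = (b₂ && b₁)) :
    (⨁ a, WV E b₁ a) →ₗ[F] (⨁ a, WV E b₂ a) →ₗ[F] ⨁ a, WV E b a :=
  box hE h + ∑ i, ∑ j, ((-ksign i j : ℤ) : F) • (box hE h').flip.compl₁₂
    (prjI (isInternal_sumPar hE b₁) i) (prjI (isInternal_sumPar hE b₂) j)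

theorem bracket_apply (hE : DirectSum.IsInternal E) (h : b = (b₁ && b₂)) (h' : b = (b₂ && b₁))
    {i j : ZMod 2} {x : ⨁ a, WV E b₁ a} {y : ⨁ a, WV E b₂ a} (hx : x ∈ sumPar (parWV E b₁ i))
    (hy : y ∈ sumPar (parWV E b₂ j)) :
    bracket hE h h' x y = box hE h x y - ksign i j • box hE h' y x := by
  rw [bracket]
  simp only [LinearMap.add_apply, LinearMap.sum_apply]
  rw [Finset.sum_eq_single i, Finset.sum_eq_single j]
  · rw [LinearMap.smul_apply, LinearMap.smul_apply, LinearMap.compl₁₂_apply,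
      LinearMap.flip_apply, prjI_of_mem (isInternal_sumPar hE b₁) hx,
      prjI_of_mem (isInternal_sumPar hE b₂) hy, Int.cast_smul_eq_zsmul, neg_smul, sub_eq_add_neg]
  · intro j' _ hj
    rw [LinearMap.smul_apply, LinearMap.smul_apply, LinearMap.compl₁₂_apply,
      prjI_of_mem_ne (isInternal_sumPar hE b₂) hj hy, map_zero, smul_zero]
  · intro hj; exact absurd (Finset.mem_univ _) hj
  · intro i' _ hi
    refine Finset.sum_eq_zero fun j' _ => ?_
    rw [LinearMap.smul_apply, LinearMap.smul_apply, LinearMap.compl₁₂_apply,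
      prjI_of_mem_ne (isInternal_sumPar hE b₁) hi hx, map_zero, LinearMap.zero_apply, smul_zero]
  · intro hi; exact absurd (Finset.mem_univ _) hi

theorem bracket_mem (hE : DirectSum.IsInternal E) (h : b = (b₁ && b₂)) (h' : b = (b₂ && b₁))
    {i j : ZMod 2} {x : ⨁ a, WV E b₁ a} {y : ⨁ a, WV E b₂ a} (hx : x ∈ sumPar (parWV E b₁ i))
    (hy : y ∈ sumPar (parWV E b₂ j)) : bracket hE h h' x y ∈ sumPar (parWV E b (i + j)) := by
  rw [bracket_apply hE h h' hx hy]
  refine sub_mem (box_mem_sumPar hE h hx hy) (zsmul_mem ?_ _)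
  rw [add_comm]
  exact box_mem_sumPar hE h' hy hx

theorem bracket_skew (hE : DirectSum.IsInternal E) (h : b = (b₁ && b₂)) (h' : b = (b₂ && b₁))
    {i j : ZMod 2} {x : ⨁ a, WV E b₁ a} {y : ⨁ a, WV E b₂ a} (hx : x ∈ sumPar (parWV E b₁ i))
    (hy : y ∈ sumPar (parWV E b₂ j)) :
    bracket hE h h' x y = -(ksign i j • bracket hE h' h y x) := by
  rw [bracket_apply hE h h' hx hy, bracket_apply hE h' h hy hx, smul_sub, smul_smul,
    ksign_comm j i, ksign_mul_self, one_smul, neg_sub]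

theorem ksign_eq (i j : ZMod 2) : ksign i j = 1 ∨ ksign i j = -1 := by
  revert i j; decide

/-- The Jacobi identity follows from the supersymmetry of the associators: here `xyz` stands for
`(x y) z` and `xyz'` for `x (y z)`. -/
theorem jacobi_of_associators {M : Type*} [AddCommGroup M] {r s t : ℤ} (hr : r = 1 ∨ r = -1)
    (hs : s = 1 ∨ s = -1) (ht : t = 1 ∨ t = -1)
    {xyz xyz' xzy xzy' yxz yxz' yzx yzx' zxy zxy' zyx zyx' : M}
    (h1 : xyz - xyz' = t • (xzy - xzy')) (h2 : yxz - yxz' = s • (yzx - yzx'))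
    (h3 : zxy - zxy' = r • (zyx - zyx')) :
    xyz' - t • xzy' - (r * s) • (yzx - t • zyx) =
      xyz - r • yxz - (s * t) • (zxy' - r • zyx') +
        r • (yxz' - s • yzx' - (r * t) • (xzy - s • zxy)) := by
  rcases hr with rfl | rfl <;> rcases hs with rfl | rfl <;> rcases ht with rfl | rfl
  · linear_combination (norm := module) (-1 : ℤ) • h1 + (1 : ℤ) • h2 - (1 : ℤ) • h3
  · linear_combination (norm := module) (-1 : ℤ) • h1 + (1 : ℤ) • h2 + (1 : ℤ) • h3
  · linear_combination (norm := module) (-1 : ℤ) • h1 + (1 : ℤ) • h2 + (1 : ℤ) • h3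
  · linear_combination (norm := module) (-1 : ℤ) • h1 + (1 : ℤ) • h2 - (1 : ℤ) • h3
  · linear_combination (norm := module) (-1 : ℤ) • h1 - (1 : ℤ) • h2 - (1 : ℤ) • h3
  · linear_combination (norm := module) (-1 : ℤ) • h1 - (1 : ℤ) • h2 + (1 : ℤ) • h3
  · linear_combination (norm := module) (-1 : ℤ) • h1 - (1 : ℤ) • h2 + (1 : ℤ) • h3
  · linear_combination (norm := module) (-1 : ℤ) • h1 - (1 : ℤ) • h2 - (1 : ℤ) • h3

/-- The Jacobi identity for two elements of `W` and one element of `W` or of `W̃`. -/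
theorem bracket_jacobi (hE : DirectSum.IsInternal E) (h : b = (true && b)) (h' : b = (b && true))
    {i j : ZMod 2} {x y : ⨁ a, WV E true a} (hx : x ∈ sumPar (parWV E true i))
    (hy : y ∈ sumPar (parWV E true j)) (z : ⨁ a, WV E b a) :
    bracket hE h h' x (bracket hE h h' y z) =
      bracket hE h h' (bracket hE (b := true) rfl rfl x y) z +
        ksign i j • bracket hE h h' y (bracket hE h h' x z) := by
  have hom : ∀ k, ∀ z ∈ sumPar (parWV E b k), bracket hE h h' x (bracket hE h h' y z) =
      bracket hE h h' (bracket hE (b := true) rfl rfl x y) z +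
        ksign i j • bracket hE h h' y (bracket hE h h' x z) := fun k z hz => by
    rw [bracket_apply hE h h' hx (bracket_mem hE h h' hy hz),
      bracket_apply hE h h' (bracket_mem hE rfl rfl hx hy) hz,
      bracket_apply hE h h' hy (bracket_mem hE h h' hx hz),
      bracket_apply hE h h' hy hz, bracket_apply hE h h' hx hz, bracket_apply hE rfl rfl hx hy]
    simp only [map_sub, LinearMap.sub_apply, map_zsmul, LinearMap.smul_apply, ksign_add_right,
      ksign_comm (i + j) k]
    have H1 := box_associator_symm hE h rfl h h h' h h' rfl x hy hz
    have H2 := box_associator_symm hE h rfl h h h' h h' rfl y hx hz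
    have H3 := box_associator_symm hE h' h' h' rfl h' h' rfl rfl z hx hy
    rw [ksign_comm k i, ksign_comm k j, ksign_comm j i]
    exact jacobi_of_associators (ksign_eq i j) (ksign_eq i k) (ksign_eq j k) H1 H2 H3
  rw [← sum_prjI (isInternal_sumPar hE b) z]
  simp only [map_sum, Finset.smul_sum]
  rw [← Finset.sum_add_distrib]
  exact Finset.sum_congr rfl fun k _ => hom k _ (prjI_mem (isInternal_sumPar hE b) k z)

end Brackets

/-! ### The quotient map on values -/

section Quotient

variable {F : Type u} {V : Type v} [Field F] [AddCommGroup V] [Module F V] [Module F[X] V]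
  [IsScalarTower F F[X] V] {n : ℕ}

variable (F V) in
/-- The map from values to values in the quotient. -/
def toQ (b : Bool) (n : ℕ) : Val F V b n →ₗ[F] Val F V true n :=
  valLift b (proj F V true n) fun _ x => proj_total n x

theorem toQ_proj (b : Bool) (G : PolV F V (Fin n)) :
    toQ F V b n (proj F V b n G) = proj F V true n G := valLift_proj _ _ _ _

theorem toQ_smul (b : Bool) (a : A F (Fin n)) (y : Val F V b n) :
    toQ F V b n (a • y) = a • toQ F V b n y := by
  obtain ⟨G, rfl⟩ := proj_surjective b n y
  rw [← proj_smul, toQ_proj, toQ_proj, proj_smul]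

theorem toQ_diffV (b : Bool) (i j : Fin n) (y : Val F V b n) :
    toQ F V b n (diffV F V b n i j y) = diffV F V true n i j (toQ F V b n y) := by
  obtain ⟨G, rfl⟩ := proj_surjective b n y
  rw [diffV_proj, toQ_proj, toQ_proj, diffV_proj]

theorem toQ_renV (b : Bool) {n' : ℕ} (e : Fin n' ≃ Fin n) (y : Val F V b n) :
    toQ F V b n' (renV F V b e y) = renV F V true e (toQ F V b n y) := by
  obtain ⟨G, rfl⟩ := proj_surjective b n y
  rw [renV_proj, toQ_proj, toQ_proj, renV_proj]

variable (F V) in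
/-- Composition with the map to the quotient; for `b = false` this is `quotMaps`. -/
def quotV (b : Bool) (n : ℕ) : CMaps F V b n →ₗ[F] CMaps F V true n := postComp (toQ F V b n)

theorem quotV_apply (b : Bool) (f : CMaps F V b n) (v : Fin n → V) (p : O F n) :
    quotV F V b n f v p = toQ F V b n (f v p) := rfl

theorem quotV_mem_PV {b : Bool} {f : CMaps F V b n} (hf : f ∈ PV F V b n) :
    quotV F V b n f ∈ PV F V true n :=
  ⟨fun v i p => by rw [quotV_apply, quotV_apply, quotV_apply, ← hf.1, map_add, toQ_smul],
    fun v i j p => by rw [quotV_apply, quotV_apply, hf.2, toQ_diffV]⟩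

theorem quotV_act {E : ZMod 2 → Submodule F[X] V} (hE : DirectSum.IsInternal E) (b : Bool) {n' : ℕ}
    (e : Fin n' ≃ Fin n) (f : CMaps F V b n) :
    quotV F V b n' (act hE b e f) = act hE true e (quotV F V b n f) := by
  refine maps_ext_homogeneous hE fun ε v p hv => ?_
  rw [act_apply hE _ _ hv, quotV_apply, act_apply hE _ _ hv, map_zsmul]
  congr 1
  exact toQ_renV b e _

theorem quotV_symSum {E : ZMod 2 → Submodule F[X] V} (hE : DirectSum.IsInternal E) (b : Bool)
    (f : CMaps F V b n) :
    quotV F V b n (symSum hE b n f) = symSum hE true n (quotV F V b n f) := by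
  rw [symSum_apply, symSum_apply, map_sum]
  exact Finset.sum_congr rfl fun σ _ => quotV_act hE b σ f

end Quotient

/-! ### Division by `∂ + λ_1 + ⋯ + λ_n` -/

section Division

variable {F : Type u} {V : Type v} [Field F] [AddCommGroup V] [Module F V] [Module F[X] V]
  [IsScalarTower F F[X] V] {n : ℕ}

/-- In the presence of a variable, `∂ + λ_0 + ⋯ + λ_n` is itself a coordinate. -/
theorem total_smul_injective {x y : PolV F V (Fin (n + 1))}
    (h : total F (Fin (n + 1)) • x = total F (Fin (n + 1)) • y) : x = y := by
  let φ : A F (Fin (n + 1)) →ₐ[F[X]] A F (Fin (n + 1)) :=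
    MvPolynomial.aeval (Fin.cons (MvPolynomial.X 0 - (MvPolynomial.C Polynomial.X +
      ∑ i : Fin n, MvPolynomial.X i.succ)) fun i => MvPolynomial.X i.succ)
  let ψ : A F (Fin (n + 1)) →ₐ[F[X]] A F (Fin (n + 1)) :=
    MvPolynomial.aeval (Fin.cons (total F (Fin (n + 1))) fun i => MvPolynomial.X i.succ)
  have hC : ∀ (χ : A F (Fin (n + 1)) →ₐ[F[X]] A F (Fin (n + 1))),
      χ (MvPolynomial.C Polynomial.X) = MvPolynomial.C Polynomial.X := fun χ => χ.commutes _
  have hφ : φ (total F (Fin (n + 1))) = MvPolynomial.X 0 := by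
    rw [total, map_add, hC, map_sum, Fin.sum_univ_succ]
    simp only [φ, MvPolynomial.aeval_X, Fin.cons_zero, Fin.cons_succ]
    ring
  have hψ : ψ.comp φ = AlgHom.id F[X] _ := by
    refine MvPolynomial.algHom_ext fun i => ?_
    refine Fin.cases ?_ (fun i => ?_) i
    · simp only [AlgHom.comp_apply, φ, MvPolynomial.aeval_X, Fin.cons_zero, map_sub, map_add, hC,
        map_sum]
      simp only [ψ, MvPolynomial.aeval_X, Fin.cons_zero, Fin.cons_succ, AlgHom.id_apply]
      rw [total, Fin.sum_univ_succ]
      ring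
    · simp only [AlgHom.comp_apply, φ, ψ, MvPolynomial.aeval_X, Fin.cons_succ, AlgHom.id_apply]
  have hid : ∀ x : PolV F V (Fin (n + 1)), substL V ψ (substL V φ x) = x := fun x => by
    rw [substL_substL, hψ]
    induction x using pol_induction with
    | zero => simp
    | pol p v => rfl
    | add x y hx hy => rw [map_add, hx, hy]
  have h1 := congrArg (fun x => coeffs (substL V φ x)) h
  simp only [substL_smul, hφ, coeffs_X_smul] at h1
  rw [← hid x, coeffs.injective (Finsupp.mapDomain_injective (add_left_injective _) h1), hid]

theorem exists_partialMaps_eq {f : TMaps F V n} (hf : quotMaps F V n f = 0) :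
    ∃ g, partialMaps F V n g = f := by
  let T : PolV F V (Fin n) →ₗ[F] PolV F V (Fin n) :=
    DistribSMul.toLinearMap F (PolV F V (Fin n)) (total F (Fin n))
  obtain ⟨S, hS⟩ := T.rangeRestrict.exists_rightInverse_of_surjective T.range_rangeRestrict
  obtain ⟨S', hS'⟩ := LinearMap.exists_extend S
  refine ⟨postComp S' f, Maps.ext F V fun v p => ?_⟩
  have h1 : toQuot F V n (f v p) = 0 := congrArg (fun k : QMaps F V n => k v p) hf
  obtain ⟨x, hx⟩ := (Submodule.Quotient.mk_eq_zero _).1 h1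
  have h2 : f v p ∈ LinearMap.range T := ⟨x, hx⟩
  have h3 : S' (f v p) = S ⟨f v p, h2⟩ := LinearMap.congr_fun hS' ⟨f v p, h2⟩
  have h4 : T.rangeRestrict (S ⟨f v p, h2⟩) = ⟨f v p, h2⟩ := LinearMap.congr_fun hS _
  change T (S' (f v p)) = f v p
  rw [h3]
  exact congrArg Subtype.val h4

variable (F V n) in
theorem quotMaps_surjective : Function.Surjective (quotMaps F V n) := fun f => by
  obtain ⟨S, hS⟩ := (toQuot F V n).exists_rightInverse_of_surjective
    (LinearMap.range_eq_top.2 (proj_surjective true n))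
  exact ⟨postComp S f, Maps.ext F V fun v p => LinearMap.congr_fun hS (f v p)⟩

/-- A multiple of `∂ + λ_1 + ⋯ + λ_n` satisfies the sesquilinearity conditions only if the quotient
does, since the operators `∂/∂λ_j - ∂/∂λ_i` kill this sum. This gives the injectivity of the
canonical map. -/
theorem mem_PT_of_partialMaps_mem : ∀ {n : ℕ} {g : TMaps F V n},
    partialMaps F V n g ∈ PT F V n → g ∈ PT F V n
  | 0, g, _ => ⟨fun _ i => i.elim0, fun _ i => i.elim0⟩
  | n + 1, g, hg => by
    refine ⟨fun v i p => total_smul_injective ?_, fun v i j p => total_smul_injective ?_⟩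
    · have h := hg.1 v i p
      simp only [partialMaps, postComp_apply, DistribSMul.toLinearMap_apply] at h
      rw [← h, smul_add, smul_comm]
    · have h := hg.2 v i j p
      simp only [partialMaps, postComp_apply, DistribSMul.toLinearMap_apply, diffL_total] at h
      exact h

theorem mem_PT_zero (g : TMaps F V 0) : g ∈ PT F V 0 :=
  ⟨fun _ i => i.elim0, fun _ i => i.elim0⟩

variable {E : ZMod 2 → Submodule F[X] V}

theorem mem_WT_zero (g : TMaps F V 0) : g ∈ WT E 0 := by
  refine ⟨mem_PT_zero g, fun σ ε v p _ => ?_⟩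
  obtain rfl : σ = Equiv.refl _ := Subsingleton.elim _ _
  rw [permEval, permSign_eq_eSign, eSign_refl, one_smul, Subsingleton.elim (fun i => v _) v,
    substT_eq_self _ (fun i => i.elim0)]
  exact renV_refl false _

theorem mem_WT_of_partialMaps_mem : ∀ {n : ℕ} {g : TMaps F V n},
    partialMaps F V n g ∈ WT E n → g ∈ WT E n
  | 0, g, _ => mem_WT_zero g
  | n + 1, g, hg => by
    refine ⟨mem_PT_of_partialMaps_mem hg.1, fun σ ε v p hv => total_smul_injective ?_⟩
    have h := hg.2 σ ε v p hv
    simp only [permEval, partialMaps, postComp_apply, DistribSMul.toLinearMap_apply] at h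
    rw [← h, permEval, permL, substL_smul, permA_total, smul_comm]

theorem mem_range_partialPT (f : PT F V n) (hf : quotMaps F V n f = 0) :
    f ∈ LinearMap.range (partialPT F V n) := by
  obtain ⟨g, hg⟩ := exists_partialMaps_eq hf
  exact ⟨⟨g, mem_PT_of_partialMaps_mem (hg ▸ f.2)⟩, Subtype.ext hg⟩

theorem mem_range_partialWT (f : WT E n) (hf : quotMaps F V n f = 0) :
    f ∈ LinearMap.range (partialWT E n) := by
  obtain ⟨g, hg⟩ := exists_partialMaps_eq hf
  exact ⟨⟨g, mem_WT_of_partialMaps_mem (hg ▸ f.2)⟩, Subtype.ext hg⟩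

variable (F V n) in
theorem canonP_injective : Function.Injective (canonP F V n) := by
  rw [← LinearMap.ker_eq_bot, canonP, LinearMap.ker_eq_bot']
  intro x hx
  obtain ⟨f, rfl⟩ := Submodule.mkQ_surjective _ x
  exact (Submodule.Quotient.mk_eq_zero _).2 (mem_range_partialPT f (congrArg Subtype.val hx))

variable (E n) in
theorem canonW_injective : Function.Injective (canonW E n) := by
  rw [← LinearMap.ker_eq_bot, canonW, LinearMap.ker_eq_bot']
  intro x hx
  obtain ⟨f, rfl⟩ := Submodule.mkQ_surjective _ x
  exact (Submodule.Quotient.mk_eq_zero _).2 (mem_range_partialWT f (congrArg Subtype.val hx))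

theorem canonP_surjective_of (h : ∀ k ∈ PQ F V n, ∃ f ∈ PT F V n, quotMaps F V n f = k) :
    Function.Surjective (canonP F V n) := fun k => by
  obtain ⟨f, hf, hk⟩ := h k.1 k.2
  exact ⟨Submodule.Quotient.mk ⟨f, hf⟩, Subtype.ext hk⟩

theorem canonW_surjective_of (h : ∀ k ∈ WQ E n, ∃ f ∈ WT E n, quotMaps F V n f = k) :
    Function.Surjective (canonW E n) := fun k => by
  obtain ⟨f, hf, hk⟩ := h k.1 k.2
  exact ⟨Submodule.Quotient.mk ⟨f, hf⟩, Subtype.ext hk⟩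

variable (F V) in
theorem canonP_bijective_zero : Function.Bijective (canonP F V 0) :=
  ⟨canonP_injective F V 0, canonP_surjective_of fun k _ =>
    (quotMaps_surjective F V 0 k).imp fun f hf => ⟨mem_PT_zero f, hf⟩⟩

variable (E) in
theorem canonW_bijective_zero : Function.Bijective (canonW E 0) :=
  ⟨canonW_injective 0 E, canonW_surjective_of fun k _ =>
    (quotMaps_surjective F V 0 k).imp fun f hf => ⟨mem_WT_zero f, hf⟩⟩

end Division

/-! ### Lifting of maps on free modules -/

section Free

variable {F : Type u} {V : Type v} [Field F] [AddCommGroup V] [Module F V] [Module F[X] V]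
  [IsScalarTower F F[X] V] {n : ℕ} {H : Type w} [AddCommGroup H] [Module F H] {I : Type*}

theorem exists_multilinearMap_basis {κ : Type*} (B : Module.Basis κ F V)
    (f₀ : (Fin n → κ) → H) : ∃ f : MultilinearMap F (fun _ : Fin n => V) H,
      ∀ k : Fin n → κ, f (fun i => B (k i)) = f₀ k := by
  refine ⟨((Basis.piTensorProduct fun _ : Fin n => B).constr F f₀).compMultilinearMap
    (PiTensorProduct.tprod F), fun k => ?_⟩
  rw [LinearMap.compMultilinearMap_apply, ← Basis.piTensorProduct_apply (fun _ : Fin n => B) k,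
    Module.Basis.constr_basis]

/-- The basis `∂^a e_i` over `F` of the free `F[∂]`-module with the basis `e_i`. -/
def polyBasis (e : Module.Basis I F[X] V) : Module.Basis (ℕ × I) F V :=
  (Polynomial.basisMonomials F).smulTower e

theorem polyBasis_zero (e : Module.Basis I F[X] V) (i : I) : polyBasis e (0, i) = e i := by
  rw [polyBasis, Module.Basis.smulTower_apply, Polynomial.coe_basisMonomials]
  change (Polynomial.monomial 0 1 : F[X]) • e i = e i
  rw [Polynomial.monomial_zero_one, one_smul]

theorem polyBasis_succ (e : Module.Basis I F[X] V) (a : ℕ) (i : I) :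
    polyBasis e (a + 1, i) = (Polynomial.X : F[X]) • polyBasis e (a, i) := by
  simp only [polyBasis, Module.Basis.smulTower_apply, Polynomial.coe_basisMonomials]
  rw [smul_smul, Polynomial.X_mul_monomial]

theorem polyBasis_update (e : Module.Basis I F[X] V) (α : Fin n →₀ ℕ) (k : Fin n → I) (i : Fin n) :
    (fun j => polyBasis e ((α + Finsupp.single i 1 : Fin n →₀ ℕ) j, k j)) =
      Function.update (fun j => polyBasis e (α j, k j)) i
        ((Polynomial.X : F[X]) • polyBasis e (α i, k i)) := by
  funext j
  by_cases h : j = i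
  · subst h
    rw [Function.update_self, Finsupp.add_apply, Finsupp.single_eq_same, polyBasis_succ]
  · rw [Function.update_of_ne h, Finsupp.add_apply, Finsupp.single_eq_of_ne h, add_zero]

/-- If `∂` in the `i`-th argument of a multilinear map corresponds to an operator on its values,
then a subspace that is stable under these operators contains all the values if it contains those
at the basis vectors. -/
theorem multilinear_mem_of_basis (e : Module.Basis I F[X] V)
    (f : MultilinearMap F (fun _ : Fin n => V) H) (T : Fin n → Module.End F H)
    (hf : ∀ v i, f (Function.update v i ((Polynomial.X : F[X]) • v i)) = T i (f v))
    (N : Submodule F H) (hN : ∀ i, ∀ x ∈ N, T i x ∈ N)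
    (h : ∀ k : Fin n → I, f (fun i => e (k i)) ∈ N) (v : Fin n → V) : f v ∈ N := by
  have h1 : ∀ (α : Fin n →₀ ℕ) (k : Fin n → I), f (fun j => polyBasis e (α j, k j)) ∈ N :=
    fun α k => by
      induction α using finsupp_nat_induction with
      | zero => simpa only [Finsupp.coe_zero, Pi.zero_apply, polyBasis_zero] using h k
      | add_single α i ih =>
        rw [polyBasis_update]
        have := hf (fun j => polyBasis e (α j, k j)) i
        rw [this]
        exact hN i _ ih
  have h2 : N.mkQ.compMultilinearMap f = 0 :=
    Module.Basis.ext_multilinear (fun _ => polyBasis e) fun k => by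
      refine (Submodule.Quotient.mk_eq_zero N).2 ?_
      exact h1 (Finsupp.equivFunOnFinite.symm fun i => (k i).1) fun i => (k i).2
  exact (Submodule.Quotient.mk_eq_zero N).1 (DFunLike.congr_fun h2 v)

/-- A function on tuples of basis vectors of a free `F[∂]`-module extends to a multilinear map for
which `∂` in the `i`-th argument corresponds to a given operator on the values. -/
theorem exists_multilinearMap_of_basis (e : Module.Basis I F[X] V) (T : Fin n → Module.End F H)
    (hT : ∀ i j, Commute (T i) (T j)) (f₀ : (Fin n → I) → H) :
    ∃ f : MultilinearMap F (fun _ : Fin n => V) H,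
      (∀ v i, f (Function.update v i ((Polynomial.X : F[X]) • v i)) = T i (f v)) ∧
      ∀ k : Fin n → I, f (fun i => e (k i)) = f₀ k := by
  obtain ⟨f, hf⟩ := exists_multilinearMap_basis (polyBasis e) fun k : Fin n → ℕ × I =>
    opPow T (Finsupp.equivFunOnFinite.symm fun i => (k i).1) (f₀ fun i => (k i).2)
  have h1 : ∀ (α : Fin n →₀ ℕ) (k : Fin n → I), f (fun j => polyBasis e (α j, k j)) =
      opPow T α (f₀ k) := fun α k => by
    rw [hf fun j => (α j, k j)]
    congr 2
    exact Finsupp.ext fun i => rfl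
  refine ⟨f, fun v i => ?_, fun k => ?_⟩
  · classical
    let g : MultilinearMap F (fun _ : Fin n => V) H := f.compLinearMap fun j =>
      if j = i then DistribSMul.toLinearMap F V (Polynomial.X : F[X]) else LinearMap.id
    have hg : ∀ v, g v = f (Function.update v i ((Polynomial.X : F[X]) • v i)) := fun v => by
      rw [MultilinearMap.compLinearMap_apply]
      congr 1
      funext j
      by_cases h : j = i
      · subst h; rw [if_pos rfl, Function.update_self]; rfl
      · rw [if_neg h, Function.update_of_ne h]; rfl
    have h2 : g = (T i).compMultilinearMap f :=
      Module.Basis.ext_multilinear (fun _ => polyBasis e) fun k => by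
        rw [hg, LinearMap.compMultilinearMap_apply]
        have h3 := h1 (Finsupp.equivFunOnFinite.symm fun i => (k i).1) fun i => (k i).2
        have h4 := h1 ((Finsupp.equivFunOnFinite.symm fun i => (k i).1) + Finsupp.single i 1)
          fun i => (k i).2
        rw [polyBasis_update, opPow_add_single _ hT, Module.End.mul_apply, ← h3] at h4
        exact h4
    rw [← hg, h2, LinearMap.compMultilinearMap_apply]
  · have := h1 0 k
    rw [opPow_zero] at this
    simpa only [Finsupp.coe_zero, Pi.zero_apply, polyBasis_zero, Module.End.one_apply] using this

variable [CharZero F]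

variable (F n) in
/-- The substitution `λ_i ↦ λ_i - (∂ + λ_1 + ⋯ + λ_n) / n`. -/
def centerA : A F (Fin n) →ₐ[F[X]] A F (Fin n) :=
  MvPolynomial.aeval fun i => MvPolynomial.X i -
    MvPolynomial.C (Polynomial.C (n : F)⁻¹) * total F (Fin n)

theorem centerA_total (hn : n ≠ 0) : centerA F n (total F (Fin n)) = 0 := by
  have hC : centerA F n (MvPolynomial.C Polynomial.X) = MvPolynomial.C Polynomial.X :=
    (centerA F n).commutes _
  have h : (n : A F (Fin n)) * MvPolynomial.C (Polynomial.C (n : F)⁻¹) = 1 := by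
    have h1 : (n : A F (Fin n)) = MvPolynomial.C (Polynomial.C (n : F)) := by simp
    rw [h1, ← map_mul, ← map_mul, mul_inv_cancel₀ (Nat.cast_ne_zero.2 hn), map_one, map_one]
  rw [total, map_add, hC, map_sum]
  simp only [centerA, MvPolynomial.aeval_X]
  rw [Finset.sum_sub_distrib, Finset.sum_const, Finset.card_univ, Fintype.card_fin, nsmul_eq_mul,
    ← mul_assoc, h, total]
  ring

variable (F V) in
/-- The section of the quotient map given by `λ_i ↦ λ_i - (∂ + λ_1 + ⋯ + λ_n) / n`. -/
def centerV (hn : n ≠ 0) : Val F V true n →ₗ[F] Val F V false n :=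
  valMap true false (centerA F n) fun _ y => by rw [centerA_total hn, zero_smul, map_zero]

theorem toQ_centerV (hn : n ≠ 0) (y : Val F V true n) :
    toQ F V false n (centerV F V hn y) = y := by
  obtain ⟨G, rfl⟩ := proj_surjective true n y
  have h := toQ_proj false (substL V (centerA F n) G)
  rw [centerV, valMap_proj, h]
  induction G using polV_induction with
  | const v => rw [substL_pol, map_one]
  | mulX k x hx =>
    have h1 : centerA F n (MvPolynomial.X k) = MvPolynomial.X k -
        total F (Fin n) * MvPolynomial.C (Polynomial.C (n : F)⁻¹) := by
      rw [centerA, MvPolynomial.aeval_X, mul_comm]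
    rw [substL_smul, h1, sub_smul, mul_smul, map_sub, proj_total, sub_zero, proj_smul, proj_smul,
      hx (toQ_proj false _)]
  | add x y hx hy =>
    rw [map_add, map_add, map_add, hx (toQ_proj false _), hy (toQ_proj false _)]

theorem diffV_centerV (hn : n ≠ 0) (i j : Fin n) (y : Val F V true n) :
    diffV F V false n i j (centerV F V hn y) = centerV F V hn (diffV F V true n i j y) := by
  refine diffV_valMap true false _ _ i j i j (fun k => ?_) y
  have h : ∀ l, MvPolynomial.pderiv l (centerA F n (MvPolynomial.X k)) =
      MvPolynomial.pderiv l (MvPolynomial.X k) - MvPolynomial.C (Polynomial.C (n : F)⁻¹) :=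
    fun l => by
      rw [centerA, MvPolynomial.aeval_X, map_sub, MvPolynomial.pderiv_C_mul, pderiv_total, mul_one]
  rw [h, h, map_sub]
  have h2 : ∀ l, centerA F n (MvPolynomial.pderiv l (MvPolynomial.X k)) =
      MvPolynomial.pderiv l (MvPolynomial.X k) := fun l => by
    rw [MvPolynomial.pderiv_X, Pi.single_apply]
    split_ifs
    · exact map_one _
    · exact map_zero _
  rw [h2, h2]
  ring

/-- On a free `F[∂]`-module all sesquilinear maps with values in the quotient lift. -/
theorem exists_quotV_eq (hV : Module.Free F[X] V) (hn : n ≠ 0) {k : CMaps F V true n}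
    (hk : k ∈ PV F V true n) : ∃ f ∈ PV F V false n, quotV F V false n f = k := by
  let e := Module.Free.chooseBasis F[X] V
  let T : ∀ b, Fin n → Module.End F (O F n →ₗ[F] Val F V b n) := fun b i => -mulDer ⊤ _ i
  have hT : ∀ i j, Commute (T false i) (T false j) := fun i j =>
    LinearMap.ext fun φ => by
      change -(mulDer ⊤ _ i (-(mulDer ⊤ _ j φ))) = -(mulDer ⊤ _ j (-(mulDer ⊤ _ i φ)))
      rw [map_neg, map_neg]
      exact congrArg (fun x => - -x) (LinearMap.congr_fun (commute_mulDer i j).eq φ)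
  obtain ⟨f, hf, hf₀⟩ := exists_multilinearMap_of_basis e (T false) hT fun c =>
    centerV F V hn ∘ₗ k fun i => e (c i)
  let f' : CMaps F V false n := f
  have hTapply : ∀ b i (φ : O F n →ₗ[F] Val F V b n) p, T b i φ p =
      φ (derivT ⊤ i p) - (MvPolynomial.X i : A F (Fin n)) • φ p := fun b i φ p => by
    change -(mulDer ⊤ _ i φ p) = _
    rw [mulDer_apply, neg_sub]
  refine ⟨f', ⟨fun v i p => ?_, fun v i j p => ?_⟩, ?_⟩
  · have h1 := LinearMap.congr_fun (hf v i) p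
    rw [hTapply] at h1
    exact eq_sub_iff_add_eq.1 h1
  · let N : Submodule F (O F n →ₗ[F] Val F V false n) :=
      { carrier := {φ | ∀ i j p, φ (zsub ⊤ i j * p) = diffV F V false n i j (φ p)}
        add_mem' := fun {φ ψ} hφ hψ i j p => by
          rw [LinearMap.add_apply, LinearMap.add_apply, hφ, hψ, map_add]
        zero_mem' := fun i j p => by rw [LinearMap.zero_apply, LinearMap.zero_apply, map_zero]
        smul_mem' := fun c φ hφ i j p => by
          rw [LinearMap.smul_apply, LinearMap.smul_apply, hφ, map_smul] }
    refine multilinear_mem_of_basis e f (T false) hf N (fun l φ hφ i j p => ?_) (fun c i j p => ?_)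
      v i j p
    · rw [hTapply, hTapply, derivT_mul, derivT_zsub, map_add, hφ, hφ,
        map_sub (diffV F V false n i j), diffV_X_smul, mul_comm p, ← Algebra.smul_def, map_smul]
      simp only [eq_comm (a := l), sub_smul]
      split_ifs <;> abel
    · rw [hf₀]
      exact (congrArg (centerV F V hn) (hk.2 _ i j p)).trans (diffV_centerV hn i j _).symm
  · have hk1 : ∀ v i, k (Function.update v i ((Polynomial.X : F[X]) • v i)) = T true i (k v) :=
      fun v i => LinearMap.ext fun p => by
        rw [hTapply, ← hk.1 v i p, add_sub_cancel_right]
    let g : CMaps F V true n := quotV F V false n f' - k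
    have hg : ∀ v, g v = toQ F V false n ∘ₗ f' v - k v := fun v => rfl
    have h1 : ∀ v, g v ∈ (⊥ : Submodule F (O F n →ₗ[F] Val F V true n)) := by
      refine multilinear_mem_of_basis e
        (show MultilinearMap F (fun _ : Fin n => V) (O F n →ₗ[F] Val F V true n) from g) (T true)
        (fun v i => ?_) ⊥ ?_ fun c => ?_
      · refine (hg _).trans ?_
        refine Eq.trans ?_ (congrArg (T true i) (hg v)).symm
        rw [hk1, map_sub]
        congr 1
        refine LinearMap.ext fun p => ?_
        have h2 := LinearMap.congr_fun (hf v i) p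
        rw [hTapply] at h2 ⊢
        rw [LinearMap.comp_apply, LinearMap.comp_apply, LinearMap.comp_apply, ← toQ_smul,
          ← map_sub]
        exact congrArg _ h2
      · intro i x hx
        rw [(Submodule.mem_bot F).1 hx, map_zero]
        exact zero_mem _
      · refine (Submodule.mem_bot F).2 ((hg _).trans (sub_eq_zero.2 ?_))
        refine LinearMap.ext fun p => ?_
        refine (congrArg _ (LinearMap.congr_fun (hf₀ c) p)).trans ?_
        exact toQ_centerV hn _
    refine Maps.ext F V fun v p => ?_
    exact LinearMap.congr_fun (sub_eq_zero.1 ((Submodule.mem_bot F).1 (h1 v))) p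

/-- On a free `F[∂]`-module all invariants with values in the quotient lift. -/
theorem exists_quotV_eq_of_mem_WV {E : ZMod 2 → Submodule F[X] V} (hE : DirectSum.IsInternal E)
    (hV : Module.Free F[X] V) (hn : n ≠ 0) {k : CMaps F V true n} (hk : k ∈ WV E true n) :
    ∃ f ∈ WV E false n, quotV F V false n f = k := by
  obtain ⟨f, hf, hfk⟩ := exists_quotV_eq hV hn hk.1
  refine ⟨(n.factorial : F)⁻¹ • symSum hE false n f,
    Submodule.smul_mem _ _ (symSum_mem_WV hE hf), ?_⟩
  rw [map_smul, quotV_symSum, hfk, symSum_apply,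
    Finset.sum_congr rfl fun σ _ => ((mem_WV_iff hE).1 hk).2 σ, Finset.sum_const,
    Finset.card_univ, Fintype.card_perm, Fintype.card_fin, ← Nat.cast_smul_eq_nsmul F, smul_smul,
    inv_mul_cancel₀, one_smul]
  exact_mod_cast n.factorial_ne_zero

theorem canonP_surjective (hV : Module.Free F[X] V) (hn : n ≠ 0) :
    Function.Surjective (canonP F V n) :=
  canonP_surjective_of fun _ hk => exists_quotV_eq hV hn hk

theorem canonW_surjective {E : ZMod 2 → Submodule F[X] V} (hE : DirectSum.IsInternal E)
    (hV : Module.Free F[X] V) (hn : n ≠ 0) : Function.Surjective (canonW E n) :=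
  canonW_surjective_of fun _ hk => exists_quotV_eq_of_mem_WV hE hV hn hk

end Free

/-! ### The products and the quotient map -/

section QuotientProducts

variable {F : Type u} {V : Type v} [Field F] [AddCommGroup V] [Module F V] [Module F[X] V]
  [IsScalarTower F F[X] V] {E : ZMod 2 → Submodule F[X] V} {b b₁ b₂ : Bool} {m n : ℕ}

theorem toQ_insV (h : b = (b₁ && b₂)) (m n : ℕ) (y : Val F V b₁ (n + 1)) :
    toQ F V b (m + n) (insV V h m n y) =
      insV V (b := true) (b₁ := true) (b₂ := true) rfl m n (toQ F V b₁ (n + 1) y) := by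
  obtain ⟨G, rfl⟩ := proj_surjective b₁ (n + 1) y
  rw [insV_proj, toQ_proj, toQ_proj, insV_proj]
  cases b₂
  · have hs : ∀ k, ∃ t : A F (Fin (m + n)),
        insA F m n (shiftT F false (m + n)) (MvPolynomial.X k) =
          insA F m n (shiftT F true (m + n)) (MvPolynomial.X k) + total F (Fin (m + n)) * t :=
      fun k => by
        refine Fin.cases ⟨-1, ?_⟩ (fun k => ⟨0, ?_⟩) k
        · simp only [insA, MvPolynomial.aeval_X, Fin.cons_zero, shiftT]
          ring
        · simp only [insA, MvPolynomial.aeval_X, Fin.cons_succ, mul_zero, add_zero]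
    induction G using polV_induction with
    | const x => rw [substL_pol, substL_pol, map_one, map_one]
    | mulX k G hG =>
      obtain ⟨t, ht⟩ := hs k
      rw [substL_smul, substL_smul, ht, add_smul, mul_smul, map_add, proj_total, add_zero,
        proj_smul, proj_smul, hG]
    | add G G' hG hG' => simp only [map_add, hG, hG']
  · rfl

theorem toQ_plugL (h : b = (b₁ && b₂)) (f : CMaps F V b₁ (n + 1)) (w : Fin n → V)
    (G : PolV F V (Fin m)) (r : ORegular F m n) :
    toQ F V b (m + n) (plugL (insMap h m f w) G r) =
      plugL (insMap (b := true) (b₁ := true) (b₂ := true) rfl m (quotV F V b₁ (n + 1) f) w) G r := by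
  induction G using polV_induction generalizing r with
  | const x => rw [plugL_pol_one, plugL_pol_one, insMap_apply, insMap_apply, toQ_insV]; rfl
  | mulX k G hG => rw [plugL_X_smul, plugL_X_smul, map_sub, toQ_smul, hG, hG]
  | add G G' hG hG' => simp only [map_add, LinearMap.add_apply, hG, hG']

theorem IsComp.quotV {h : b = (b₁ && b₂)} {f : CMaps F V b₁ (n + 1)} {g : CMaps F V b₂ m}
    {k : CMaps F V b (m + n)} (hk : IsComp h f g k) (hf : f ∈ PV F V b₁ (n + 1)) :
    IsComp (b := true) (b₁ := true) (b₂ := true) rfl (quotV F V b₁ (n + 1) f) (quotV F V b₂ m g)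
      (quotV F V b (m + n) k) := by
  intro v q r G hG
  obtain ⟨G', hG'⟩ := proj_surjective b₂ m (g (fun i => v (Fin.castAdd n i)) q)
  have h1 : proj F V true m G = proj F V true m G' := by
    rw [hG, quotV_apply, ← hG', toQ_proj]
  rw [quotV_apply, hk v q r G' hG', toQ_plugL, ← plugV_proj rfl (quotV_mem_PV hf),
    ← plugV_proj rfl (quotV_mem_PV hf), h1]

theorem quotV_comp (h : b = (b₁ && b₂)) {f : CMaps F V b₁ (n + 1)} {g : CMaps F V b₂ m}
    (hf : f ∈ PV F V b₁ (n + 1)) (hg : g ∈ PV F V b₂ m) :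
    quotV F V b (m + n) (comp h f g) =
      comp (b := true) (b₁ := true) (b₂ := true) rfl (quotV F V b₁ (n + 1) f)
        (quotV F V b₂ m g) :=
  ((isComp_comp h hf hg).quotV hf).unique (isComp_comp _ (quotV_mem_PV hf) (quotV_mem_PV hg))

theorem quotV_true (f : CMaps F V true n) : quotV F V true n f = f :=
  Maps.ext F V fun v p => by
    obtain ⟨G, hG⟩ := proj_surjective true n (f v p)
    rw [quotV_apply, ← hG, toQ_proj]

theorem quotV_mem_WV (hE : DirectSum.IsInternal E) {f : CMaps F V b n} (hf : f ∈ WV E b n) :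
    quotV F V b n f ∈ WV E true n := by
  rw [mem_WV_iff hE] at hf ⊢
  exact ⟨quotV_mem_PV hf.1, fun σ => by rw [← quotV_act, hf.2]⟩

theorem quotV_mem_mapsPar {i : ZMod 2} {f : CMaps F V b n} (hf : f ∈ mapsPar E (valPar E b n) i) :
    quotV F V b n f ∈ mapsPar E (valPar E true n) i := fun ε v p hv => by
  obtain ⟨G, hG, hG'⟩ := exists_proj_of_mem_valPar (hf ε v p hv)
  rw [quotV_apply, ← hG, toQ_proj]
  exact proj_mem_valPar hG'

/-- The map of invariants induced by the map to the quotient. -/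
def quotWV (hE : DirectSum.IsInternal E) (b : Bool) (a : ℕ) : WV E b a →ₗ[F] WV E true a :=
  (quotV F V b a).restrict fun _ hf => quotV_mem_WV hE hf

/-- The map of the direct sums of invariants induced by the map to the quotient. -/
def quotSum (hE : DirectSum.IsInternal E) (b : Bool) :
    (⨁ a, WV E b a) →ₗ[F] ⨁ a, WV E true a := DirectSum.lmap fun a => quotWV hE b a

theorem quotSum_lof (hE : DirectSum.IsInternal E) (b : Bool) (a : ℕ) (f : WV E b a) :
    quotSum hE b (DirectSum.lof F ℕ (fun a => WV E b a) a f) =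
      DirectSum.lof F ℕ (fun a => WV E true a) a (quotWV hE b a f) :=
  DirectSum.lmap_lof _ _ _

theorem quotSum_true (hE : DirectSum.IsInternal E) (x : ⨁ a, WV E true a) :
    quotSum hE true x = x := by
  induction x using DirectSum.induction_on with
  | zero => rw [map_zero]
  | of a f =>
    refine (quotSum_lof hE true a f).trans ?_
    exact congrArg _ (Subtype.ext (quotV_true f.1))
  | add x y hx hy => rw [map_add, hx, hy]

theorem quotSum_mem (hE : DirectSum.IsInternal E) {i : ZMod 2} {x : ⨁ a, WV E b a}
    (hx : x ∈ sumPar (parWV E b i)) : quotSum hE b x ∈ sumPar (parWV E true i) :=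
  mem_sumPar.2 fun a => quotV_mem_mapsPar (mem_sumPar.1 hx a)

/-- The product `□` does not depend on the choice of representatives: the quotient map intertwines
the products on `W`, `W̃` and between them. -/
theorem quotSum_box (hE : DirectSum.IsInternal E) (h : b = (b₁ && b₂)) (x : ⨁ a, WV E b₁ a)
    (y : ⨁ a, WV E b₂ a) : quotSum hE b (box hE h x y) =
      box hE (b := true) rfl (quotSum hE b₁ x) (quotSum hE b₂ y) := by
  induction x using DirectSum.induction_on with
  | zero => simp only [map_zero, LinearMap.zero_apply]
  | add x x' hx hx' => simp only [map_add, LinearMap.add_apply, hx, hx']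
  | of a f =>
    induction y using DirectSum.induction_on with
    | zero => simp only [map_zero]
    | add y y' hy hy' => simp only [map_add, hy, hy']
    | of m g =>
      change quotSum hE b (box hE h (DirectSum.lof F ℕ (fun a => WV E b₁ a) a f)
        (DirectSum.lof F ℕ (fun a => WV E b₂ a) m g)) = box hE rfl
          (quotSum hE b₁ (DirectSum.lof F ℕ (fun a => WV E b₁ a) a f))
          (quotSum hE b₂ (DirectSum.lof F ℕ (fun a => WV E b₂ a) m g))
      rw [quotSum_lof, quotSum_lof]
      cases a with
      | zero => rw [box_lof_zero, box_lof_zero, map_zero]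
      | succ n =>
        rw [box_lof_succ, box_lof_succ, quotSum_lof]
        congr 1
        refine Subtype.ext ?_
        change quotV F V b (m + n) (boxSucc hE h n m f g).1 = (boxSucc hE _ n m _ _).1
        rw [coe_boxSucc, coe_boxSucc, map_smul, quotV_symSum, quotV_comp h f.2.1 g.2.1]
        rfl

variable [CharZero F]

theorem quotSum_bracket (hE : DirectSum.IsInternal E) (h : b = (b₁ && b₂)) (h' : b = (b₂ && b₁))
    (x : ⨁ a, WV E b₁ a) (y : ⨁ a, WV E b₂ a) : quotSum hE b (bracket hE h h' x y) =
      bracket hE (b := true) rfl rfl (quotSum hE b₁ x) (quotSum hE b₂ y) := by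
  rw [← sum_prjI (isInternal_sumPar hE b₁) x, ← sum_prjI (isInternal_sumPar hE b₂) y]
  simp only [map_sum, LinearMap.sum_apply]
  refine Finset.sum_congr rfl fun j _ => Finset.sum_congr rfl fun i _ => ?_
  have hx := prjI_mem (isInternal_sumPar hE b₁) i x
  have hy := prjI_mem (isInternal_sumPar hE b₂) j y
  rw [bracket_apply hE h h' hx hy,
    bracket_apply hE rfl rfl (quotSum_mem hE hx) (quotSum_mem hE hy), map_sub, map_zsmul,
    quotSum_box, quotSum_box]

end QuotientProducts

/-! ### The Lie superalgebras and the representation -/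

section LieStructures

variable {F : Type u} {V : Type v} [Field F] [AddCommGroup V] [Module F V] [Module F[X] V]
  [IsScalarTower F F[X] V] [CharZero F] {E : ZMod 2 → Submodule F[X] V}

/-- The Lie bracket of `W`. -/
def bracketW (hE : DirectSum.IsInternal E) : WQsum E →ₗ[F] WQsum E →ₗ[F] WQsum E :=
  bracket hE (b := true) (b₁ := true) (b₂ := true) rfl rfl

/-- The action of `W` on `W̃`. -/
def actionW (hE : DirectSum.IsInternal E) : WQsum E →ₗ[F] WTsum E →ₗ[F] WTsum E :=
  bracket hE (b := false) (b₁ := true) (b₂ := false) rfl rfl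

theorem isLieSuperalgebra_bracket (hE : DirectSum.IsInternal E) :
    IsLieSuperalgebra (fun i => sumPar (parWV E true i))
      (bracket hE (b := true) (b₁ := true) (b₂ := true) rfl rfl) where
  internal := isInternal_sumPar hE true
  parity _ _ _ _ hx hy := bracket_mem hE (b := true) (b₁ := true) (b₂ := true) rfl rfl hx hy
  skew _ _ _ _ hx hy := bracket_skew hE (b := true) (b₁ := true) (b₂ := true) rfl rfl hx hy
  jacobi _ _ _ _ z hx hy := bracket_jacobi hE (b := true) rfl rfl hx hy z

theorem isLieSuperalgebra_bracketW (hE : DirectSum.IsInternal E) :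
    IsLieSuperalgebra (fun i => sumPar (parWQ E i)) (bracketW hE) :=
  isLieSuperalgebra_bracket hE

theorem isRepresentation_bracket (hE : DirectSum.IsInternal E) :
    IsRepresentation (fun i => sumPar (parWV E true i))
      (bracket hE (b := true) (b₁ := true) (b₂ := true) rfl rfl)
      (fun i => sumPar (parWV E false i))
      (bracket hE (b := false) (b₁ := true) (b₂ := false) rfl rfl) where
  internal := isInternal_sumPar hE false
  parity _ _ _ _ hx hy := bracket_mem hE (b := false) (b₁ := true) (b₂ := false) rfl rfl hx hy
  bracket _ _ _ _ z hx hy := eq_sub_of_add_eq (bracket_jacobi hE (b := false) rfl rfl hx hy z).symm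

theorem isRepresentation_actionW (hE : DirectSum.IsInternal E) :
    IsRepresentation (fun i => sumPar (parWQ E i)) (bracketW hE)
      (fun i => sumPar (parWT E i)) (actionW hE) :=
  isRepresentation_bracket hE

theorem canonWsum_projW (hE : DirectSum.IsInternal E) (w : WTsum E) :
    canonWsum E (projW E w) = quotSum hE false w :=
  DFinsupp.ext fun _ => rfl

theorem canonWsum_injective : Function.Injective (canonWsum E) := fun x y hxy =>
  DFinsupp.ext fun a => canonW_injective a E (DFunLike.congr_fun hxy a)

theorem canonWsum_actionW (hE : DirectSum.IsInternal E) (x : WQsum E) (w : WTsum E) :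
    canonWsum E (projW E (actionW hE x w)) = bracketW hE x (canonWsum E (projW E w)) := by
  rw [canonWsum_projW hE, canonWsum_projW hE]
  refine (quotSum_bracket hE (b := false) (b₁ := true) (b₂ := false) rfl rfl x w).trans ?_
  exact congrArg (fun x => bracket hE (b := true) (b₁ := true) (b₂ := true) rfl rfl x
    (quotSum hE false w)) (quotSum_true hE x)

variable (E) in
theorem projW_surjective : Function.Surjective (projW E) := fun x => by
  induction x using DirectSum.induction_on with
  | zero => exact ⟨0, map_zero _⟩
  | of a f =>
    obtain ⟨g, rfl⟩ := Submodule.mkQ_surjective _ f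
    exact ⟨DirectSum.lof F ℕ (fun a => WT E a) a g, DirectSum.lmap_lof _ _ _⟩
  | add x y hx hy =>
    obtain ⟨x, rfl⟩ := hx
    obtain ⟨y, rfl⟩ := hy
    exact ⟨x + y, map_add _ _ _⟩

theorem projW_mem {i : ZMod 2} {w : WTsum E} (hw : w ∈ sumPar (parWT E i)) :
    projW E w ∈ sumPar (parWR E i) :=
  mem_sumPar.2 fun a => ⟨w a, mem_sumPar.1 hw a, rfl⟩

theorem exists_projW_eq {i : ZMod 2} {x : WRsum E} (hx : x ∈ sumPar (parWR E i)) :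
    ∃ w ∈ sumPar (parWT E i), projW E w = x := by
  refine sumPar_induction (motive := fun x => ∃ w ∈ sumPar (parWT E i), projW E w = x) ?_ ?_
    (fun x y => ?_) hx
  · exact ⟨0, zero_mem _, map_zero _⟩
  · rintro a _ ⟨f, hf, rfl⟩
    exact ⟨DirectSum.lof F ℕ (fun a => WT E a) a f, lof_mem_sumPar hf, DirectSum.lmap_lof _ _ _⟩
  · rintro ⟨x, hx, rfl⟩ ⟨y, hy, rfl⟩
    exact ⟨x + y, add_mem hx hy, map_add _ _ _⟩

theorem canonWsum_mem (hE : DirectSum.IsInternal E) {i : ZMod 2} {x : WRsum E}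
    (hx : x ∈ sumPar (parWR E i)) : canonWsum E x ∈ sumPar (parWQ E i) := by
  obtain ⟨w, hw, rfl⟩ := exists_projW_eq hx
  rw [canonWsum_projW hE]
  exact quotSum_mem hE (b := false) hw

/-- The grading of `W̃ / ∂W̃`: the parts span because they do so in `W̃`, and they are disjoint because
their images in `W` are. -/
theorem isInternal_parWR (hE : DirectSum.IsInternal E) :
    DirectSum.IsInternal fun i => sumPar (parWR E i) := by
  have hu : (Set.univ : Set (ZMod 2)) = {0, 1} := by
    ext i
    have : ∀ i : ZMod 2, i = 0 ∨ i = 1 := by decide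
    simpa using this i
  have h01 : (0 : ZMod 2) ≠ 1 := by decide
  have hQ : IsCompl (sumPar (parWQ E 0)) (sumPar (parWQ E 1)) :=
    (DirectSum.isInternal_submodule_iff_isCompl (fun i => sumPar (parWQ E i)) h01 hu).1
      (isInternal_sumPar hE true)
  have hT : IsCompl (sumPar (parWT E 0)) (sumPar (parWT E 1)) :=
    (DirectSum.isInternal_submodule_iff_isCompl (fun i => sumPar (parWT E i)) h01 hu).1
      (isInternal_sumPar hE false)
  rw [DirectSum.isInternal_submodule_iff_isCompl _ h01 hu]
  constructor
  · rw [disjoint_iff, eq_bot_iff]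
    rintro x ⟨h0, h1⟩
    rw [Submodule.mem_bot]
    refine canonWsum_injective ?_
    rw [map_zero]
    exact Submodule.disjoint_def.1 hQ.disjoint _ (canonWsum_mem hE h0) (canonWsum_mem hE h1)
  · rw [codisjoint_iff, eq_top_iff]
    intro x _
    obtain ⟨w, rfl⟩ := projW_surjective E x
    have hw : w ∈ sumPar (parWT E 0) ⊔ sumPar (parWT E 1) := by
      rw [codisjoint_iff.1 hT.codisjoint]; trivial
    obtain ⟨y, hy, z, hz, rfl⟩ := Submodule.mem_sup.1 hw
    rw [map_add]
    exact Submodule.add_mem_sup (projW_mem hy) (projW_mem hz)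

/-- The bracket of `W̃ / ∂W̃` is induced by the action of `W` on `W̃`. -/
theorem exists_bracketR (hE : DirectSum.IsInternal E) :
    ∃ brR : WRsum E →ₗ[F] WRsum E →ₗ[F] WRsum E, ∀ x w,
      brR x (projW E w) = projW E (actionW hE (canonWsum E x) w) := by
  obtain ⟨S, hS⟩ := (projW E).exists_rightInverse_of_surjective
    (LinearMap.range_eq_top.2 (projW_surjective E))
  refine ⟨((actionW hE).compl₁₂ (canonWsum E) S).compr₂ (projW E), fun x w => ?_⟩
  refine canonWsum_injective ?_
  rw [LinearMap.compr₂_apply, LinearMap.compl₁₂_apply, canonWsum_actionW, canonWsum_actionW]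
  congr 2
  exact LinearMap.congr_fun hS _

variable {brR : WRsum E →ₗ[F] WRsum E →ₗ[F] WRsum E}

theorem canonWsum_bracketR (hE : DirectSum.IsInternal E)
    (h : ∀ x w, brR x (projW E w) = projW E (actionW hE (canonWsum E x) w)) (x y : WRsum E) :
    canonWsum E (brR x y) = bracketW hE (canonWsum E x) (canonWsum E y) := by
  obtain ⟨w, rfl⟩ := projW_surjective E y
  rw [h, canonWsum_actionW]

/-- The identities hold in `W`, and the canonical map is injective. -/
theorem isLieSuperalgebra_bracketR (hE : DirectSum.IsInternal E)
    (h : ∀ x w, brR x (projW E w) = projW E (actionW hE (canonWsum E x) w)) :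
    IsLieSuperalgebra (fun i => sumPar (parWR E i)) brR where
  internal := isInternal_parWR hE
  parity i j x y hx hy := by
    obtain ⟨w, hw, rfl⟩ := exists_projW_eq hy
    rw [h]
    exact projW_mem ((isRepresentation_actionW hE).parity i j _ _ (canonWsum_mem hE hx) hw)
  skew i j x y hx hy := by
    refine canonWsum_injective ?_
    rw [map_neg, map_zsmul, canonWsum_bracketR hE h, canonWsum_bracketR hE h]
    exact (isLieSuperalgebra_bracketW hE).skew i j _ _ (canonWsum_mem hE hx) (canonWsum_mem hE hy)
  jacobi i j x y z hx hy := by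
    refine canonWsum_injective ?_
    simp only [map_add, map_zsmul, canonWsum_bracketR hE h]
    exact (isLieSuperalgebra_bracketW hE).jacobi i j _ _ _ (canonWsum_mem hE hx)
      (canonWsum_mem hE hy)

end LieStructures

/-! ### The products in terms of `IsProduct` -/

section Relations

variable {F : Type u} {V : Type v} [Field F] [AddCommGroup V] [Module F V] [Module F[X] V]
  [IsScalarTower F F[X] V] {E : ZMod 2 → Submodule F[X] V} {b b₁ b₂ : Bool} {m n : ℕ}

/-- `IsComp` is the insertion condition for the substitution `insV`. -/
theorem isComp_iff (h : b = (b₁ && b₂)) (f : CMaps F V b₁ (n + 1)) (g : CMaps F V b₂ m)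
    (k : CMaps F V b (m + n)) : IsComp h f g k ↔
      IsInsertion m n (fun v x r => insV V h m n (f (Fin.cons x v : Fin (n + 1) → V) r))
        (fun v q G => proj F V b₂ m G = g v q) k :=
  forall₅_congr fun v _ r G _ => by
    rw [← plug_eq_plugL (insMap h m f fun j => v (Fin.natAdd m j)) G r]
    rfl

theorem isComp_iff_isCircQQ (f : QMaps F V (n + 1)) (g : QMaps F V m) (k : QMaps F V (m + n)) :
    IsComp (b := true) (b₁ := true) (b₂ := true) rfl f g k ↔ IsCircQQ m n f g k :=
  isComp_iff _ _ _ _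

theorem isComp_iff_isCircQT (f : QMaps F V (n + 1)) (g : TMaps F V m) (k : TMaps F V (m + n)) :
    IsComp (b := false) (b₁ := true) (b₂ := false) rfl f g k ↔ IsCircQT m n f g k :=
  isComp_iff _ _ _ _

theorem isComp_iff_isCircTQ (f : TMaps F V (n + 1)) (g : QMaps F V m) (k : TMaps F V (m + n)) :
    IsComp (b := false) (b₁ := false) (b₂ := true) rfl f g k ↔ IsCircTQ m n f g k :=
  isComp_iff _ _ _ _

/-- The product of `f` in `P̃^ch` and `g` in `P̃^ch` at `λ = -∂` depends only on `f` modulo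
`∂ + λ_0 + ⋯ + λ_n`. -/
theorem IsCircQT.isCircTT {f : TMaps F V (n + 1)} {g : TMaps F V m} {k : TMaps F V (m + n)}
    (hk : IsCircQT m n (quotMaps F V (n + 1) f) g k) :
    IsCircTT m n (-total F (Fin (m + n))) f g k := hk

/-- The product of `f` and `g` in `P̃^ch` at `λ = 0` depends only on `g` modulo
`∂ + λ_1 + ⋯ + λ_m`. -/
theorem IsCircTQ.isCircTT {f : TMaps F V (n + 1)} {g : TMaps F V m} {k : TMaps F V (m + n)}
    (hk : IsCircTQ m n f (quotMaps F V m g) k) : IsCircTT m n 0 f g k := by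
  rintro v q h _ rfl
  exact hk v q h _ rfl

variable [CharZero F]

/-- The product `box` is the product in the sense of `IsProduct`, as soon as `comp` is the product in
the first position in the sense of `C`. -/
theorem isProduct_box (hE : DirectSum.IsInternal E) (h : b = (b₁ && b₂)) {X X' : ℕ → Type*}
    (C : ∀ m n, X (n + 1) → X' m → CMaps F V b (m + n) → Prop) :
    ∀ (a c : ℕ) (f : WV E b₁ a) (g : WV E b₂ c) (f' : X a) (g' : X' c),
    (∀ n (hn : a = n + 1), C c n (hn ▸ f') g'
      (boxSucc hE h n c (hn ▸ f) g).1) →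
    IsProduct (Z := CMaps F V b) C a c f' g'
      (inclWV b (box hE h (DirectSum.lof F ℕ (fun a => WV E b₁ a) a f)
        (DirectSum.lof F ℕ (fun a => WV E b₂ a) c g)))
  | 0, c, f, g, f', g', _ => by
    rw [box_lof_zero, map_zero]
    rfl
  | n + 1, c, f, g, f', g', hC => ⟨_, hC n rfl, by rw [box_lof_succ, inclWV_lof]; rfl⟩

theorem isBoxQQ_box (hE : DirectSum.IsInternal E) {a c : ℕ} (f : WQ E a) (g : WQ E c) :
    IsBoxQQ E a c f g (inclWQ E (box hE (b := true) (b₁ := true) (b₂ := true) rfl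
      (DirectSum.lof F ℕ (fun a => WQ E a) a f) (DirectSum.lof F ℕ (fun a => WQ E a) c g))) := by
  refine isProduct_box hE (b := true) (b₁ := true) (b₂ := true) rfl _ a c f g _ _ ?_
  rintro n rfl
  exact ⟨_, (isComp_iff_isCircQQ _ _ _).1 (isComp_comp _ f.2.1 g.2.1),
    isShuffleSum_boxSucc hE (b := true) (b₁ := true) (b₂ := true) rfl f g⟩

theorem isBoxZeroQT_box (hE : DirectSum.IsInternal E) {a c : ℕ} (f : WQ E a) (g : WT E c) :
    IsBoxZeroQT E a c f g (inclWT E (box hE (b := false) (b₁ := true) (b₂ := false) rfl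
      (DirectSum.lof F ℕ (fun a => WQ E a) a f) (DirectSum.lof F ℕ (fun a => WT E a) c g))) := by
  refine isProduct_box hE (b := false) (b₁ := true) (b₂ := false) rfl _ a c f g _ _ ?_
  rintro n rfl
  exact ⟨_, (isComp_iff_isCircQT _ _ _).1 (isComp_comp _ f.2.1 g.2.1),
    isShuffleSum_boxSucc hE (b := false) (b₁ := true) (b₂ := false) rfl f g⟩

theorem isBoxMinusTQ_box (hE : DirectSum.IsInternal E) {a c : ℕ} (f : WT E a) (g : WQ E c) :
    IsBoxMinusTQ E a c f g (inclWT E (box hE (b := false) (b₁ := false) (b₂ := true) rfl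
      (DirectSum.lof F ℕ (fun a => WT E a) a f) (DirectSum.lof F ℕ (fun a => WQ E a) c g))) := by
  refine isProduct_box hE (b := false) (b₁ := false) (b₂ := true) rfl _ a c f g _ _ ?_
  rintro n rfl
  exact ⟨_, (isComp_iff_isCircTQ _ _ _).1 (isComp_comp _ f.2.1 g.2.1),
    isShuffleSum_boxSucc hE (b := false) (b₁ := false) (b₂ := true) rfl f g⟩

/-- The image in `W` of an element of `W̃`. -/
def quotW (a : ℕ) (f : WT E a) : WQ E a := ⟨quotMaps F V a f, quotMaps_mem_WQ E a f f.2⟩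

theorem canonWsum_projW_lof (a : ℕ) (f : WT E a) :
    canonWsum E (projW E (DirectSum.lof F ℕ (fun a => WT E a) a f)) =
      DirectSum.lof F ℕ (fun a => WQ E a) a (quotW a f) := by
  rw [projW, DirectSum.lmap_lof, canonWsum, DirectSum.lmap_lof]
  rfl

theorem quotW_mem {i : ZMod 2} {a : ℕ} {f : WT E a}
    (hf : f ∈ parWT E i a) : quotW a f ∈ parWQ E i a :=
  quotV_mem_mapsPar (b := false) hf

theorem isBoxZero_box (hE : DirectSum.IsInternal E) {a c : ℕ} (f : WT E a) (g : WT E c) :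
    IsBoxZero E a c f g (inclWT E (box hE (b := false) (b₁ := true) (b₂ := false) rfl
      (DirectSum.lof F ℕ (fun a => WQ E a) a (quotW a f))
      (DirectSum.lof F ℕ (fun a => WT E a) c g))) := by
  refine isProduct_box hE (b := false) (b₁ := true) (b₂ := false) rfl _ a c (quotW a f) g _ _ ?_
  rintro n rfl
  exact ⟨_, ((isComp_iff_isCircQT _ _ _).1 (isComp_comp _ (quotW _ f).2.1 g.2.1)).isCircTT,
    isShuffleSum_boxSucc hE (b := false) (b₁ := true) (b₂ := false) rfl (quotW _ f) g⟩

theorem isBoxMinus_box (hE : DirectSum.IsInternal E) {a c : ℕ} (f : WT E a) (g : WT E c) :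
    IsBoxMinus E a c f g (inclWT E (box hE (b := false) (b₁ := false) (b₂ := true) rfl
      (DirectSum.lof F ℕ (fun a => WT E a) a f)
      (DirectSum.lof F ℕ (fun a => WQ E a) c (quotW c g)))) := by
  refine isProduct_box hE (b := false) (b₁ := false) (b₂ := true) rfl _ a c f (quotW c g) _ _ ?_
  rintro n rfl
  exact ⟨_, ((isComp_iff_isCircTQ _ _ _).1 (isComp_comp _ f.2.1 (quotW _ g).2.1)).isCircTT,
    isShuffleSum_boxSucc hE (b := false) (b₁ := false) (b₂ := true) rfl f (quotW _ g)⟩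

theorem inclWV_bracket (hE : DirectSum.IsInternal E) (h : b = (b₁ && b₂)) (h' : b = (b₂ && b₁))
    {i j : ZMod 2} {x : ⨁ a, WV E b₁ a} {y : ⨁ a, WV E b₂ a} (hx : x ∈ sumPar (parWV E b₁ i))
    (hy : y ∈ sumPar (parWV E b₂ j)) : inclWV b (bracket hE h h' x y) =
      inclWV b (box hE h x y) - ksign i j • inclWV b (box hE h' y x) := by
  rw [bracket_apply hE h h' hx hy, map_sub, map_zsmul]

theorem bracket_self_eq_zero (hE : DirectSum.IsInternal E) (h : b = (b && b)) {i : ZMod 2}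
    {x : ⨁ a, WV E b a} (hx : x ∈ sumPar (parWV E b i)) (h0 : box hE h x x = 0) :
    bracket hE h h x x = 0 := by
  rw [bracket_apply hE h h hx hx, h0, smul_zero, sub_zero]

theorem isBracketW_bracketW (hE : DirectSum.IsInternal E) {i j : ZMod 2} {a c : ℕ} {f : WQ E a}
    {g : WQ E c} (hf : f ∈ parWQ E i a) (hg : g ∈ parWQ E j c) :
    IsBracketW E i j f g (bracketW hE (DirectSum.lof F ℕ (fun a => WQ E a) a f)
      (DirectSum.lof F ℕ (fun a => WQ E a) c g)) := by
  refine ⟨_, _, isBoxQQ_box hE f g, isBoxQQ_box hE g f, ?_⟩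
  exact inclWV_bracket hE (b := true) (b₁ := true) (b₂ := true) rfl rfl (lof_mem_sumPar hf)
    (lof_mem_sumPar hg)

theorem isAction_actionW (hE : DirectSum.IsInternal E) {i j : ZMod 2} {a c : ℕ} {f : WQ E a}
    {g : WT E c} (hf : f ∈ parWQ E i a) (hg : g ∈ parWT E j c) :
    IsAction E i j f g (actionW hE (DirectSum.lof F ℕ (fun a => WQ E a) a f)
      (DirectSum.lof F ℕ (fun a => WT E a) c g)) := by
  refine ⟨_, _, isBoxZeroQT_box hE f g, isBoxMinusTQ_box hE g f, ?_⟩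
  exact inclWV_bracket hE (b := false) (b₁ := true) (b₂ := false) rfl rfl (lof_mem_sumPar hf)
    (lof_mem_sumPar hg)

theorem isBracketWT_actionW (hE : DirectSum.IsInternal E) {i j : ZMod 2} {a c : ℕ} {f : WT E a}
    {g : WT E c} (hf : f ∈ parWT E i a) (hg : g ∈ parWT E j c) :
    IsBracketWT E i j f g
      (actionW hE (canonWsum E (projW E (DirectSum.lof F ℕ (fun a => WT E a) a f)))
        (DirectSum.lof F ℕ (fun a => WT E a) c g)) := by
  refine ⟨_, _, isBoxZero_box hE f g, isBoxMinus_box hE g f, ?_⟩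
  rw [canonWsum_projW_lof]
  exact inclWV_bracket hE (b := false) (b₁ := true) (b₂ := false) rfl rfl
    (lof_mem_sumPar (quotW_mem hf)) (lof_mem_sumPar hg)

theorem box_self_eq_zero (hE : DirectSum.IsInternal E) {X : WQ E 2}
    (hX : IsBoxQQ E 2 2 (X : QMaps F V 2) (X : QMaps F V 2) 0) :
    box hE (b := true) (b₁ := true) (b₂ := true) rfl (DirectSum.lof F ℕ (fun a => WQ E a) 2 X)
      (DirectSum.lof F ℕ (fun a => WQ E a) 2 X) = 0 := by
  obtain ⟨y, ⟨k, hk, hy⟩, h0⟩ := hX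
  have hk' := ((isComp_iff_isCircQQ _ _ _).2 hk).unique
    (isComp_comp (b := true) (b₁ := true) (b₂ := true) (m := 2) (n := 1) rfl X.2.1 X.2.1)
  have hy' := IsShuffleSum.unique (b := true) hE hy (hk' ▸
    isShuffleSum_boxSucc hE (b := true) (b₁ := true) (b₂ := true) (m := 2) (n := 1) rfl X X)
  have hy0 : y = 0 := DirectSum.of_injective (β := QMaps F V) _ (h0.symm.trans (map_zero _).symm)
  refine (box_lof_succ hE (b := true) (b₁ := true) (b₂ := true) rfl 1 2 X X).trans ?_
  have h1 : boxSucc hE (b := true) (b₁ := true) (b₂ := true) rfl 1 2 X X = 0 :=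
    Subtype.ext (hy'.symm.trans hy0)
  rw [h1, map_zero]

theorem actionW_actionW_eq_zero (hE : DirectSum.IsInternal E) {X : WQ E 2} (hX : X ∈ parWQ E 1 2)
    (hXX : IsBoxQQ E 2 2 (X : QMaps F V 2) (X : QMaps F V 2) 0) (w : WTsum E) :
    actionW hE (DirectSum.lof F ℕ (fun a => WQ E a) 2 X)
      (actionW hE (DirectSum.lof F ℕ (fun a => WQ E a) 2 X) w) = 0 := by
  have hX' : DirectSum.lof F ℕ (fun a => WQ E a) 2 X ∈ sumPar (parWQ E 1) := lof_mem_sumPar hX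
  have h1 : bracketW hE (DirectSum.lof F ℕ (fun a => WQ E a) 2 X)
      (DirectSum.lof F ℕ (fun a => WQ E a) 2 X) = 0 :=
    bracket_self_eq_zero hE rfl hX' (box_self_eq_zero hE hXX)
  have h2 := (isRepresentation_actionW hE).bracket 1 1 _ _ w hX' hX'
  have h3 : ksign 1 1 = -1 := by decide
  rw [h1, map_zero, LinearMap.zero_apply, h3, neg_smul, one_smul, sub_neg_eq_add, ← two_smul F] at h2
  exact (smul_eq_zero.1 h2.symm).resolve_left two_ne_zero

theorem isInternal_parityRev {gr : ZMod 2 → Submodule F[X] V} (h : DirectSum.IsInternal gr) :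
    DirectSum.IsInternal (parityRev gr) := by
  have hu : (Set.univ : Set (ZMod 2)) = {0, 1} := by
    ext i
    have : ∀ i : ZMod 2, i = 0 ∨ i = 1 := by decide
    simpa using this i
  have h01 : (0 : ZMod 2) ≠ 1 := by decide
  rw [DirectSum.isInternal_submodule_iff_isCompl _ h01 hu] at h ⊢
  exact h.symm

end Relations

end Chiral

end

theorem proposition5p5 {F V : Type*} [Field F] [CharZero F] [AddCommGroup V]
    [Module F V] [Module F[X] V] [IsScalarTower F F[X] V]
    -- the decomposition of `V` in its even and odd parts, which are `F[∂]`-submodules,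
    -- and the superspace `E = ΠV`
    (gr : ZMod 2 → Submodule F[X] V) (hgr : DirectSum.IsInternal gr)
    (E : ZMod 2 → Submodule F[X] V) (hE : E = Chiral.parityRev gr) :
    -- (a) the canonical map `P̃^ch(n) / ∂P̃^ch(n) → P^ch(n)`
    ((∀ n, Function.Injective (Chiral.canonP F V n)) ∧
      Function.Bijective (Chiral.canonP F V 0) ∧
      (Module.Free F[X] V → ∀ n, 1 ≤ n → Function.Surjective (Chiral.canonP F V n))) ∧
    -- the Lie brackets on `W̃ / ∂W̃` and on `W`, and the representation of `W` on `W̃`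
    ∃ (brR : Chiral.WRsum E →ₗ[F] Chiral.WRsum E →ₗ[F] Chiral.WRsum E)
      (brW : Chiral.WQsum E →ₗ[F] Chiral.WQsum E →ₗ[F] Chiral.WQsum E)
      (ρ : Chiral.WQsum E →ₗ[F] Chiral.WTsum E →ₗ[F] Chiral.WTsum E),
      Chiral.IsLieSuperalgebra (fun i => Chiral.sumPar (Chiral.parWR E i)) brR ∧
      (∀ i j a b (f : Chiral.WT E a) (g : Chiral.WT E b),
        f ∈ Chiral.parWT E i a → g ∈ Chiral.parWT E j b →
        ∃ z, Chiral.IsBracketWT E i j f g z ∧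
          brR (Chiral.projW E (DirectSum.lof F ℕ (fun c => Chiral.WT E c) a f))
            (Chiral.projW E (DirectSum.lof F ℕ (fun c => Chiral.WT E c) b g)) =
              Chiral.projW E z) ∧
      Chiral.IsLieSuperalgebra (fun i => Chiral.sumPar (Chiral.parWQ E i)) brW ∧
      (∀ i j a b (f : Chiral.WQ E a) (g : Chiral.WQ E b),
        f ∈ Chiral.parWQ E i a → g ∈ Chiral.parWQ E j b →
        Chiral.IsBracketW E i j f g
          (brW (DirectSum.lof F ℕ (fun c => Chiral.WQ E c) a f)
            (DirectSum.lof F ℕ (fun c => Chiral.WQ E c) b g))) ∧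
      -- (b) the canonical map `W̃ / ∂W̃ → W`
      (∀ i x, x ∈ Chiral.sumPar (Chiral.parWR E i) →
        Chiral.canonWsum E x ∈ Chiral.sumPar (Chiral.parWQ E i)) ∧
      (∀ x y, Chiral.canonWsum E (brR x y) =
        brW (Chiral.canonWsum E x) (Chiral.canonWsum E y)) ∧
      Function.Injective (Chiral.canonWsum E) ∧
      (∀ a, Function.Injective (Chiral.canonW E a)) ∧
      Function.Bijective (Chiral.canonW E 0) ∧
      (Module.Free F[X] V → ∀ a, 1 ≤ a → Function.Surjective (Chiral.canonW E a)) ∧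
      -- (c) the representation of `W` on `W̃`
      Chiral.IsRepresentation (fun i => Chiral.sumPar (Chiral.parWQ E i)) brW
        (fun i => Chiral.sumPar (Chiral.parWT E i)) ρ ∧
      (∀ i j a b (f : Chiral.WQ E a) (g : Chiral.WT E b),
        f ∈ Chiral.parWQ E i a → g ∈ Chiral.parWT E j b →
        Chiral.IsAction E i j f g
          (ρ (DirectSum.lof F ℕ (fun c => Chiral.WQ E c) a f)
            (DirectSum.lof F ℕ (fun c => Chiral.WT E c) b g))) ∧
      -- it is compatible with the map in (b)
      (∀ i j a b (f : Chiral.WT E a) (g : Chiral.WT E b),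
        f ∈ Chiral.parWT E i a → g ∈ Chiral.parWT E j b →
        Chiral.IsBracketWT E i j f g
          (ρ (Chiral.canonWsum E
              (Chiral.projW E (DirectSum.lof F ℕ (fun c => Chiral.WT E c) a f)))
            (DirectSum.lof F ℕ (fun c => Chiral.WT E c) b g))) ∧
      (∀ x w, Chiral.canonWsum E (Chiral.projW E (ρ x w)) =
        brW x (Chiral.canonWsum E (Chiral.projW E w))) ∧
      -- the differential of the basic complex
      (∀ X : Chiral.WQ E 2, X ∈ Chiral.parWQ E 1 2 →
        Chiral.IsBoxQQ E 2 2 (X : Chiral.QMaps F V 2) (X : Chiral.QMaps F V 2) 0 →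
        ∀ w, ρ (DirectSum.lof F ℕ (fun c => Chiral.WQ E c) 2 X)
          (ρ (DirectSum.lof F ℕ (fun c => Chiral.WQ E c) 2 X) w) = 0) := by
  have hE : DirectSum.IsInternal E := hE ▸ Chiral.isInternal_parityRev hgr
  obtain ⟨brR, h⟩ := Chiral.exists_bracketR hE
  exact ⟨⟨Chiral.canonP_injective F V, Chiral.canonP_bijective_zero F V,
      fun hV n hn => Chiral.canonP_surjective hV (Nat.one_le_iff_ne_zero.1 hn)⟩,
    brR, Chiral.bracketW hE, Chiral.actionW hE,
    Chiral.isLieSuperalgebra_bracketR hE h,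
    fun i j a b f g hf hg => ⟨_, Chiral.isBracketWT_actionW hE hf hg, h _ _⟩,
    Chiral.isLieSuperalgebra_bracketW hE,
    fun i j a b f g hf hg => Chiral.isBracketW_bracketW hE hf hg,
    fun i x hx => Chiral.canonWsum_mem hE hx,
    Chiral.canonWsum_bracketR hE h,
    Chiral.canonWsum_injective,
    fun a => Chiral.canonW_injective a E,
    Chiral.canonW_bijective_zero E,
    fun hV a ha => Chiral.canonW_surjective hE hV (Nat.one_le_iff_ne_zero.1 ha),
    Chiral.isRepresentation_actionW hE,
    fun i j a b f g hf hg => Chiral.isAction_actionW hE hf hg,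
    fun i j a b f g hf hg => Chiral.isBracketWT_actionW hE hf hg,
    Chiral.canonWsum_actionW hE,
    fun X hX hXX w => Chiral.actionW_actionW_eq_zero hE hX hXX w⟩
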